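/- **Conventions.** PPT and QPT algorithms are probabilistic and quantum machines with polynomially bounded running time whose coins have algebraic biases and whose gates are unitaries with algebraic entries. $\mathrm{negl}$ denotes functions $\nu:\mathbb N\to\mathbb R$ with $\lambda^d\nu(\lambda)\to0$ for all $d$. $1^\lambda$ is the security parameter in unary. **Games.** A contextuality game $G=(Q,A,\mathcal C,\mathrm{pred},\mathcal D)$ consists of a finite non-empty set $Q$ of questions, a finite set $A\subset\mathbb R$ of answers, a set $\mathcal C$ of subsets of $Q$ (contexts), a predicate $\mathrm{pred}(\mathbf a,C)\in\{0,1\}$ for $C\in\mathcal C$, $\mathbf a\in A^{C}$, and a distribution $\mathcal D$ on $\mathcal C$. The value of a family $P[\mathbf a|C]$ is $\sum_{C,\mathbf a}\mathrm{pred}(\mathbf a,C)P[\mathbf a|C]\Pr_{\mathcal D}[C]$. $\mathrm{valNC}$ is the supremum of the values of families that are marginals of one distribution on $A^Q$. A quantum strategy $(\mathcal H,|\psi\rangle,\mathbf O)$ consists of a Hilbert space, a unit vector and self-adjoint operators $O_q$ ($q\in Q$) with spectrum in $A$, where $O_q,O_{q'}$ commute if $q,q'$ lie in a common context; its family $P[\cdot|C]$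 is given by measuring the $O_q$, $q\in C$, on $|\psi\rangle$. $\mathrm{valQu}$ is the supremum of the values of quantum strategies. A strategy on $n$ qubits is *described* if the entries of $|\psi\rangle$ and of the spectral projections of the $O_q$ are algebraic numbers. **QFHE.** For each $n$ let $\{U_k\}_{k\in K(n)}$ be a finite group, up to phases, of unitaries on $n$ qubits with algebraic entries, each permuting the standard basis up to phases (for instance the Pauli pads $X^xZ^z$, $k=(x,z)$). A QFHE scheme with ciphertexts of this form consists of: a classical fully homomorphic scheme (PPT key generation, encryption, decryption, and evaluation of each fixed Boolean function; decryption of fresh ciphertexts is exact, of evaluated ones correct up to negl); the encryption $\mathrm{Enc}_{sk}(\psi)=(U_k\psi,\hat k)$ with $k\leftarrow K(n)$ uniform and $\hat k$ a classical homomorphic encryption of $k$, which is PPT on classical messages; and for each fixed circuit $C$ a QPT algorithm $\mathrm{Eval}_C(\xi,\mathrm{Enc}_{sk}(\psi))$, which outputs a classical ciphertext of the output bits and a ciphertext $(\sigma,\hat k'')$ of the output qubits whose decryption is within trace distance $\mathrm{negl}(\lambda)$ of $C(\xi\otimes\psi)$ for all states $\xi,\psi$, keys and ciphertexts. It is *secure*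 if for every PPT distinguisher and polynomial $p$ there is a negligible function bounding the advantage, on input $1^\lambda$ and a ciphertext, between encryptions of any two strings of length $p(\lambda)$. *Evaluated ciphertexts have the form of fresh ones* if the outputs of both evaluation algorithms are within negligible statistical (trace) distance of fresh encryptions of the result under the same secret key. **OPad.** A compatible oblivious pad for $\{U_k\}_{k\in K(n)}$ on $n$ qubits consists of PPT $\mathrm{Gen}(1^\lambda)\to(pk,sk)$, QPT $\mathrm{Enc}(pk,\rho)\to(\sigma,s)$, deterministic polynomial-time $\mathrm{Dec}(sk,s)\in K(n)$ and PPT $\mathrm{Samp}(pk)\to s$ such that: for a negligible $\nu$ and all $\rho$, with probability $\ge1-\nu(\lambda)$ the state $\sigma$ is within $\nu(\lambda)$ of $U_k\rho U_k^\dagger$, $k=\mathrm{Dec}(sk,s)$; and $\mathrm{Samp}(pk)$ is, in expectation over the keys, within negligible statistical distance of the $s$-output of $\mathrm{Enc}(pk,\rho)$. It is *secure* if every PPT prover that gets $pk$, outputs $s$, and then gets $\mathrm{Dec}(sk,s)$ or a uniform element of $K(n)$, each with probability $\tfrac12$, guesses which with probability at most $\tfrac12+\mathrm{negl}(\lambda)$.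 **Compiled game $G'_\lambda$** (contexts of size 2). The verifier samples $sk$, $C\leftarrow\mathcal D$, $q'\leftarrow C$ uniformly, $c_{q'}\leftarrow\mathrm{Enc}_{sk}(q')$ and OPad keys, and sends $(c_{q'},\mathrm{OPad}.pk)$. The prover replies $(c_{a'},\hat k'',s')$. The verifier decrypts $k''$ from $\hat k''$, lets $k'=\mathrm{OPad.Dec}(\mathrm{OPad}.sk,s')$, and sends a uniform $q\leftarrow C$ and the $k$ with $U_k=U_{k'}U_{k''}$ up to a phase. The prover replies $a$. With $a'=\mathrm{Dec}_{sk}(c_{a'})$, the verifier rejects if $a$ or $a'$ is not in $A$; otherwise it accepts iff $a=a'$ (if $q=q'$), respectively iff $\mathrm{pred}((a,a'),C)=1$ (if $q\ne q'$). The honest prover with strategy $(|\psi\rangle,\mathbf O)$ measures $O_{q'}$ on $|\psi\rangle$ under the encryption by $\mathrm{Eval}$, applies $\mathrm{OPad.Enc}$ to the padded post-measurement state, and later measures $U_kO_qU_k^\dagger$ to obtain $a$. **Faithfulness.** A four-message protocol is faithful to $G$ with parameters $s,c$ if it specifies maps that decode questions from certain messages, encode answers (possibly at random) in certain messages and ignore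 the others, and a map $\mathsf{qProver}$ from described $n$-qubit strategies to QPT provers, such that, up to negligible additive terms: (i) *marginal requirement*: for a context $C$, the behaviour of $\mathsf{qProver}(|\psi\rangle,\mathbf O)$ in executions in which all questions asked lie in $C$ depends only on $|\psi\rangle$ and $(O_q)_{q\in C}$; (ii) *well-formedness*: the set $Q'$ of questions asked in an execution lies in a context; (iii) *$G$-soundness*: every (unbounded) classical simulator, which answers decoded questions by a fixed $\tau:Q\to A$, suitably encoded, and produces the remaining messages arbitrarily, is accepted with probability at most $s$; (iv) *decision faithfulness*: with such a simulator the verdict is $\mathrm{pred}(\tau|_C,C)$ if $Q'=C\in\mathcal C$, and "accept" if $Q'\notin\mathcal C$; (v) *quantum completeness*: some described strategy gives a prover accepted with probability $c$, and for each described strategy there is a quantum simulator (answering decoded questions by measuring the strategy's observables on its state, the remaining messages arbitrarily) with the same distribution of the transcript as its prover; (vi) *classical completeness*: for each described strategy with commuting observables some PPT prover has the same transcript distribution as its prover. **Theorem.** Let $G$ be a contextuality game with $\mathrm{valNC}<1$ and $|C|=2$ for all contexts. Take a secure QFHE scheme of the above form, a compatible secure oblivious pad on $n$ qubits, and a described strategy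 on $n$ qubits of value $\mathrm{valQu}$. Then: * (Completeness) The honest prover with this strategy is QPT, and for some negligible $\nu$ it wins $G'_\lambda$ with probability at least $\frac12(1+\mathrm{valQu})-\nu(\lambda)$ for all $\lambda$. * (Soundness) For every PPT prover there is a negligible $\nu'$ such that it wins $G'_\lambda$ with probability at most $\frac12(1+\mathrm{valNC})+\nu'(\lambda)$ for all $\lambda$. * (Faithfulness) If moreover evaluated ciphertexts have the form of fresh ones, then $G'_\lambda$, with the decoding of $c_{q'}$ and encoding of $a'$ by decryption and encryption, with $q,a$ in the clear, and with the honest prover as $\mathsf{qProver}$, is faithful to $G$ with parameters $s=\frac12(1+\mathrm{valNC})$ and $c=\frac12(1+\mathrm{valQu})$. -/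

import Mathlib

namespace Contextuality

noncomputable section

open scoped Classical ENNReal ComplexOrder Matrix

/-! ## Strings, qubits, negligible functions, distances -/

abbrev BitStr := List Bool

/-- Labels of the standard basis of `n` qubits. -/
abbrev Bits (n : ℕ) := Fin n → Bool

/-- Operators on `n` qubits. -/
abbrev QOp (n : ℕ) := Matrix (Bits n) (Bits n) ℂ

/-- The Hilbert space of `n` qubits. -/
abbrev Qubits (n : ℕ) := EuclideanSpace ℂ (Bits n)

/-- The security parameter in unary, `1^l`. -/
def unary (l : ℕ) : BitStr := List.replicate l true

/-- `ν(l) * l ^ d → 0` for every `d`. -/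
def Negligible (ν : ℕ → ℝ) : Prop :=
  Asymptotics.SuperpolynomialDecay Filter.atTop (fun l : ℕ => (l : ℝ)) ν

/-- The `ℓ¹` distance (twice the total variation distance); the subtraction is truncated. -/
def l1Dist {α : Type*} (p q : α → ℝ≥0∞) : ℝ≥0∞ := ∑' x, ((p x - q x) + (q x - p x))

/-- The (possibly unnormalised) operator `|φ⟩⟨φ|`. -/
def ketbra {n : ℕ} (φ : Bits n → ℂ) : QOp n := fun u v => φ u * star (φ v)

/-- `ξ ⊗ ψ`. -/
def tens {h n : ℕ} (ξ : Bits h → ℂ) (ψ : Bits n → ℂ) : Bits (h + n) → ℂ :=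
  fun b => ξ (fun i => b (Fin.castAdd n i)) * ψ (fun i => b (Fin.natAdd h i))

def IsUnit2 {n : ℕ} (ψ : Bits n → ℂ) : Prop := ∑ b, ‖ψ b‖ ^ 2 = 1

def IsDensity {n : ℕ} (ρ : QOp n) : Prop := ρ.PosSemidef ∧ ρ.trace = 1

/-- Trace distance at most `ε` between two classical-quantum states `∑ y, |y⟩⟨y| ⊗ σ y` and
`∑ y, |y⟩⟨y| ⊗ τ y` of equal trace: no two-outcome measurement tells them apart with a larger
advantage. -/
def CQClose {Y : Type*} {m : ℕ} (ε : ℝ) (σ τ : Y → QOp m) : Prop :=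
  ∀ (F : Finset Y) (E : Y → QOp m), (∀ y, (E y).PosSemidef ∧ (1 - E y).PosSemidef) →
    |∑ y ∈ F, ((E y * (σ y - τ y)).trace).re| ≤ ε

/-! ## Quantum gates and circuits -/

/-- The gates in use: unitary matrices with algebraic entries. -/
def IsGate {k : ℕ} (U : QOp k) : Prop :=
  U ∈ Matrix.unitaryGroup (Bits k) ℂ ∧ ∀ u v, IsAlgebraic ℚ (U u v)

/-- Action of `U` on the qubits `r 0, …, r (k-1)` of a state vector of qubits labelled by `W`. -/
def applyGate {W : Type} {k : ℕ} (U : QOp k) (r : Fin k ↪ W) (ω : (W → Bool) → ℂ) :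
    (W → Bool) → ℂ :=
  fun s => ∑ u : Bits k, U (fun j => s (r j)) u * ω (Function.extend r u s)

/-- Partial trace of `|ω⟩⟨ω|` onto the qubits `r 0, …, r (m-1)`; `dom` contains the assignments of
the other qubits (with the qubits `r j` set to `0`) that are summed over. -/
def reduceTo {W : Type} {m : ℕ} (dom : Finset (W → Bool)) (r : Fin m → W)
    (ω : (W → Bool) → ℂ) : QOp m :=
  fun u v => ∑ s ∈ dom.filter (fun s => ∀ j, s (r j) = false),
    ω (Function.extend r u s) * star (ω (Function.extend r v s))

structure Gate (W : Type) where
  arity : ℕ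
  mat : QOp arity
  wires : Fin arity ↪ W

/-- A quantum circuit with `N` input qubits, `anc` ancillas (initially `0`), `ℓ` output bits,
obtained by a final measurement of the wires `outC`, and `m` output qubits, the wires `outQ`.
All other wires are discarded. -/
structure Circuit (N ℓ m : ℕ) where
  anc : ℕ
  gates : List (Gate (Fin (N + anc)))
  outC : Fin ℓ ↪ Fin (N + anc)
  outQ : Fin m ↪ Fin (N + anc)
  disjoint : ∀ i j, outC i ≠ outQ j

def Circuit.Admissible {N ℓ m : ℕ} (C : Circuit N ℓ m) : Prop := ∀ g ∈ C.gates, IsGate g.mat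

/-- The state before the final measurement on input `φ`. -/
def Circuit.finalVec {N ℓ m : ℕ} (C : Circuit N ℓ m) (φ : Bits N → ℂ) :
    (Fin (N + C.anc) → Bool) → ℂ :=
  C.gates.foldl (fun ω g => applyGate g.mat g.wires ω)
    (fun s => if ∀ i, s (Fin.natAdd N i) = false then φ (fun i => s (Fin.castAdd C.anc i)) else 0)

/-- The (unnormalised) state of the output qubits together with the classical output `y`. -/
def Circuit.output {N ℓ m : ℕ} (C : Circuit N ℓ m) (φ : Bits N → ℂ) (y : Bits ℓ) : QOp m :=
  reduceTo (Finset.univ.filter (fun s => ∀ i, s (C.outC i) = y i)) C.outQ (C.finalVec φ)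

/-! ## Machines with a step count

Programs act on finitely many stacks of bits and of qubits, can toss coins of algebraic bias and
apply gates with algebraic entries.  Each elementary operation or test takes one step. -/

inductive Cmd : Type
  | skip
  | push (i : ℕ) (b : Bool)
  | drop (i : ℕ)
  | seq (c d : Cmd)
  /-- continue with `e`, `z`, `o` if bit stack `i` is empty, has top bit `0`, top bit `1` -/
  | branch (i : ℕ) (e z o : Cmd)
  /-- repeat `c` as long as bit stack `i` is not empty -/
  | loop (i : ℕ) (c : Cmd)
  /-- push a bit that is `1` with probability `p` -/
  | coin (p : ℝ) (i : ℕ)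
  /-- push a fresh qubit in state `0` on qubit stack `i` -/
  | qnew (i : ℕ)
  /-- move the top qubit of stack `i` to stack `j` -/
  | qmove (i j : ℕ)
  /-- apply a gate to the top qubits of the stacks `r 0, …, r (k-1)` -/
  | qgate (k : ℕ) (U : QOp k) (r : Fin k → ℕ)
  /-- measure and remove the top qubit of stack `i`, and push the result on bit stack `j` -/
  | qmeas (i j : ℕ)

/-- Coins have algebraic bias in `[0,1]` and gates are unitary with algebraic entries. -/
def Cmd.Admissible : Cmd → Prop
  | .seq c d => c.Admissible ∧ d.Admissible
  | .branch _ e z o => e.Admissible ∧ z.Admissible ∧ o.Admissible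
  | .loop _ c => c.Admissible
  | .coin p _ => 0 ≤ p ∧ p ≤ 1 ∧ IsAlgebraic ℚ p
  | .qgate _ U _ => IsGate U
  | _ => True

/-- The program uses no quantum operation. -/
def Cmd.Classical : Cmd → Prop
  | .seq c d => c.Classical ∧ d.Classical
  | .branch _ e z o => e.Classical ∧ z.Classical ∧ o.Classical
  | .loop _ c => c.Classical
  | .qnew _ => False
  | .qmove _ _ => False
  | .qgate _ _ _ => False
  | .qmeas _ _ => False
  | _ => True

/-- One branch of a computation: the commands that remain to be executed, the bit stacks, the
stacks of qubit labels, the number of qubits created so far, the state vector of all qubits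
(projected on the measurement results obtained, not renormalised; it vanishes unless the qubits
not yet created are `0`), and the probability of the coin tosses of this branch. -/
structure Config where
  todo : List Cmd
  bits : ℕ → BitStr
  qubits : ℕ → List ℕ
  fresh : ℕ
  vec : (ℕ → Bool) → ℂ
  wt : ℝ

/-- One step of a computation; the result lists the branches. -/
def Config.step (c : Config) : List Config :=
  match c.todo with
  | [] => [c]
  | .skip :: K => [{ c with todo := K }]
  | .push i b :: K => [{ c with todo := K, bits := Function.update c.bits i (b :: c.bits i) }]
  | .drop i :: K => [{ c with todo := K, bits := Function.update c.bits i (c.bits i).tail }]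
  | .seq a b :: K => [{ c with todo := a :: b :: K }]
  | .branch i e z o :: K =>
      match c.bits i with
      | [] => [{ c with todo := e :: K }]
      | false :: _ => [{ c with todo := z :: K }]
      | true :: _ => [{ c with todo := o :: K }]
  | .loop i a :: K =>
      match c.bits i with
      | [] => [{ c with todo := K }]
      | _ :: _ => [{ c with todo := a :: .loop i a :: K }]
  | .coin p i :: K =>
      [{ c with todo := K, bits := Function.update c.bits i (true :: c.bits i), wt := c.wt * p },
       { c with todo := K, bits := Function.update c.bits i (false :: c.bits i),
                wt := c.wt * (1 - p) }]
  | .qnew i :: K =>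
      [{ c with todo := K, qubits := Function.update c.qubits i (c.fresh :: c.qubits i),
                fresh := c.fresh + 1 }]
  | .qmove i j :: K =>
      match c.qubits i with
      | [] => [{ c with todo := K }]
      | q :: rest =>
          let qs := Function.update c.qubits i rest
          [{ c with todo := K, qubits := Function.update qs j (q :: qs j) }]
  | .qgate k U r :: K =>
      if h : ∃ w : Fin k ↪ ℕ, ∀ j, (c.qubits (r j)).head? = some (w j) then
        [{ c with todo := K, vec := applyGate U h.choose c.vec }]
      else [{ c with todo := K }]
  | .qmeas i j :: K =>
      match c.qubits i with
      | [] => [{ c with todo := K }]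
      | q :: rest =>
          [true, false].map fun b =>
            { c with todo := K, qubits := Function.update c.qubits i rest,
                     bits := Function.update c.bits j (b :: c.bits j),
                     vec := fun s => if s q = b then c.vec s else 0 }

/-- All branches after `T` steps; a branch that has halted stays as it is. -/
def Config.run (T : ℕ) (c : Config) : List Config :=
  (fun cs : List Config => cs.flatMap Config.step)^[T] [c]

/-- Start of `P`: the strings `x 0, …, x (a-1)` are on the bit stacks `0, …, a-1` (first symbol on
top), the `n` input qubits, in state `φ`, on qubit stack `0` (first qubit on top), all other
stacks are empty. -/
def Cmd.initial {a n : ℕ} (P : Cmd) (x : Fin a → BitStr) (φ : Bits n → ℂ) : Config where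
  todo := [P]
  bits := fun i => if h : i < a then x ⟨i, h⟩ else []
  qubits := fun i => if i = 0 then List.range n else []
  fresh := n
  vec := fun s => if ∀ i, n ≤ i → s i = false then φ (fun j => s j) else 0
  wt := 1

/-- The output strings are those on the bit stacks `0, …, b-1`. -/
def Config.out (b : ℕ) (c : Config) : Fin b → BitStr := fun j => c.bits j

/-- The (unnormalised) state of the output qubits, which are the `m` qubits on qubit stack `0`. -/
def Config.qout (m : ℕ) (c : Config) : QOp m :=
  (c.wt : ℂ) • reduceTo
    (Finset.univ.image (fun (s : Bits c.fresh) (i : ℕ) => if h : i < c.fresh then s ⟨i, h⟩ else false))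
    (fun j : Fin m => (c.qubits 0).getD j 0) c.vec

/-- A randomised algorithm: `a` strings in, `b` strings out. -/
abbrev Alg (a b : ℕ) := (Fin a → BitStr) → PMF (Fin b → BitStr)

/-- A quantum algorithm: `a` strings and `n` qubits in, `b` strings and `m` qubits out.  It maps
the input strings and the input state to the (unnormalised) state of the output qubits for each
value of the output strings. -/
abbrev QAlg (a b n m : ℕ) := (Fin a → BitStr) → QOp n → (Fin b → BitStr) → QOp m

def inputSize {a : ℕ} (x : Fin a → BitStr) : ℕ := ∑ i, (x i).length

/-- Probabilistic polynomial time. -/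
def IsPPT {a b : ℕ} (f : Alg a b) : Prop :=
  ∃ P : Cmd, P.Admissible ∧ P.Classical ∧ ∃ p : Polynomial ℕ, ∀ x : Fin a → BitStr,
    let fin := (P.initial x (fun _ : Bits 0 => 1)).run (p.eval (inputSize x))
    (∀ c ∈ fin, c.todo = []) ∧
    ∀ o, f x o = ENNReal.ofReal (((fin.filter (fun c => c.out b = o)).map Config.wt).sum)

/-- Quantum polynomial time. -/
def IsQPT {a b n m : ℕ} (f : QAlg a b n m) : Prop :=
  (∀ x, IsLinearMap ℂ (f x)) ∧
  ∃ P : Cmd, P.Admissible ∧ ∃ p : Polynomial ℕ, ∀ (x : Fin a → BitStr) (φ : Bits n → ℂ),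
    let fin := (P.initial x φ).run (p.eval (inputSize x))
    (∀ c ∈ fin, c.todo = [] ∧ (c.qubits 0).length = m) ∧
    ∀ o, f x (ketbra φ) o = ((fin.filter (fun c => c.out b = o)).map (Config.qout m)).sum

/-- The probability that a one-string algorithm outputs the bit `1`. -/
def probOne (p : PMF (Fin 1 → BitStr)) : ℝ := (p ![[true]]).toReal

/-! ## Contextuality games -/

structure ContextualityGame (Q : Type) [Fintype Q] where
  A : Finset ℝ
  contexts : Finset (Finset Q)
  D : PMF {C // C ∈ contexts}
  pred : (C : Finset Q) → ({q // q ∈ C} → A) → Bool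

namespace ContextualityGame

variable {Q : Type} [Fintype Q] (G : ContextualityGame Q)

abbrev Ans : Type := {a : ℝ // a ∈ G.A}

/-- A family `P[a | C]`. -/
abbrev Strategy : Type := (C : {C // C ∈ G.contexts}) → ({q // q ∈ C.1} → G.Ans) → ℝ

def val (P : G.Strategy) : ℝ :=
  ∑ C : {C // C ∈ G.contexts}, ∑ a : {q // q ∈ C.1} → G.Ans,
    (if G.pred C.1 a = true then 1 else 0) * P C a * (G.D C).toReal

/-- Strategies that come from a joint distribution of answers to all questions. -/
def NCStrategies : Set G.Strategy :=
  {P | ∃ J : PMF (Q → G.Ans), ∀ C a,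
    P C a = ∑ α : Q → G.Ans, if (fun q : {q // q ∈ C.1} => α q.1) = a then (J α).toReal else 0}

/-- A state and observables on the Hilbert space `H`, compatible within each context. -/
structure QStrat (H : Type) [NormedAddCommGroup H] [InnerProductSpace ℂ H] [CompleteSpace H] where
  psi : H
  norm_psi : ‖psi‖ = 1
  O : Q → H →L[ℂ] H
  selfAdjoint : ∀ q, IsSelfAdjoint (O q)
  spec : ∀ q, spectrum ℂ (O q) ⊆ (fun a : ℝ => (a : ℂ)) '' (G.A : Set ℝ)
  commute : ∀ C ∈ G.contexts, ∀ q ∈ C, ∀ q' ∈ C, Commute (O q) (O q')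

variable {G}

section
variable {H : Type} [NormedAddCommGroup H] [InnerProductSpace ℂ H] [CompleteSpace H]

/-- The spectral projection of the observable `O q` for the outcome `a`: the polynomial that is
`1` at `a` and `0` at the other elements of `A`, which contains the spectrum, applied to `O q`. -/
def QStrat.proj (S : G.QStrat H) (q : Q) (a : ℝ) : H →L[ℂ] H :=
  Polynomial.aeval (S.O q) (Lagrange.basis G.A (fun r : ℝ => (r : ℂ)) a)

/-- Born rule for the measurement of the (commuting) observables of a context. -/
def QStrat.strategy (S : G.QStrat H) : G.Strategy :=
  fun C a => ‖((C.1.attach.toList.map (fun q => S.proj q.1 (a q).1)).prod) S.psi‖ ^ 2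

end

variable (G)

def QuStrategies : Set G.Strategy :=
  {P | ∃ (H : Type) (_ : NormedAddCommGroup H) (_ : InnerProductSpace ℂ H) (_ : CompleteSpace H)
    (S : G.QStrat H), P = S.strategy}

def valNC : ℝ := sSup (G.val '' G.NCStrategies)

def valQu : ℝ := sSup (G.val '' G.QuStrategies)

variable {G}

/-- Matrix of the spectral projection. -/
def QStrat.projMat {n : ℕ} (S : G.QStrat (Qubits n)) (q : Q) (a : ℝ) : QOp n :=
  fun u v => (S.proj q a (EuclideanSpace.single v 1)) u

/-- The strategy has a finite classical description: the amplitudes of the state and the entries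
of the spectral projections are algebraic numbers. -/
def QStrat.Described {n : ℕ} (S : G.QStrat (Qubits n)) : Prop :=
  (∀ u, IsAlgebraic ℚ (S.psi u)) ∧
  ∀ q, ∀ a ∈ G.A, ∀ u v, IsAlgebraic ℚ (S.projMat q a u v)

end ContextualityGame

open ContextualityGame

/-! ## Homomorphic encryption -/

/-- Classical fully homomorphic encryption.  Everything that evaluation needs is part of the
ciphertext. -/
structure FHE where
  gen : Alg 1 1
  enc : Alg 2 1
  dec : BitStr → BitStr → BitStr
  eval : ∀ {a b : ℕ}, (Bits a → Bits b) → Alg 1 1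
  gen_ppt : IsPPT gen
  enc_ppt : IsPPT enc
  dec_ppt : IsPPT (fun x : Fin 2 → BitStr => PMF.pure ![dec (x 0) (x 1)])
  eval_ppt : ∀ {a b : ℕ} (f : Bits a → Bits b), IsPPT (eval f)
  dec_enc : ∀ (l : ℕ), ∀ sk ∈ (gen ![unary l]).support, ∀ m : BitStr,
    ∀ c ∈ (enc ![sk 0, m]).support, dec (sk 0) (c 0) = m
  dec_eval : ∀ {a b : ℕ} (f : Bits a → Bits b), ∃ ν : ℕ → ℝ, Negligible ν ∧
    ∀ (l : ℕ), ∀ sk ∈ (gen ![unary l]).support, ∀ m : Bits a,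
    ∀ c ∈ (enc ![sk 0, List.ofFn m]).support,
      1 - ν l ≤ (((eval f c).map (fun c' => dec (sk 0) (c' 0))) (List.ofFn (f m))).toReal

/-- The groups `{U_k}` (up to global phases) of unitaries on `n` qubits used as pads.  They act on
standard basis states by permutations, up to phases. -/
structure PadFamily where
  Key : ℕ → Type
  [group : ∀ n, Group (Key n)]
  [fintype : ∀ n, Fintype (Key n)]
  len : ℕ → ℕ
  code : ∀ n, Key n ↪ Bits (len n)
  U : ∀ n, Key n → QOp n
  isGate : ∀ n k, IsGate (U n k)
  U_mul : ∀ n (k k' : Key n), ∃ ω : ℂ, ‖ω‖ = 1 ∧ U n (k * k') = ω • (U n k * U n k')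
  act : ∀ n, Key n → Bits n → Bits n
  U_basis : ∀ n (k : Key n) (b : Bits n), ∃ ω : ℂ, ‖ω‖ = 1 ∧
    U n k *ᵥ Pi.single b 1 = ω • Pi.single (act n k b) 1

attribute [instance] PadFamily.group PadFamily.fintype

/-- The key as a string. -/
def PadFamily.keyStr (pad : PadFamily) {n : ℕ} (k : pad.Key n) : BitStr := List.ofFn (pad.code n k)

/-- The key denoted by a string; strings that denote none are read as the unit. -/
def PadFamily.readKey (pad : PadFamily) (n : ℕ) (s : BitStr) : pad.Key n :=
  if h : ∃ k : pad.Key n, pad.keyStr k = s then h.choose else 1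

/-- Encryption under a pad: the encryption of an `n`-qubit state `ψ` is `(U_k ψ, k̂)` for a uniform
`k` and a classical homomorphic encryption `k̂` of `k`.  For a classical message this is
a string, the padded message followed by `k̂`. -/
def encStr (pad : PadFamily) (E : FHE) (sk m : BitStr) : PMF BitStr := do
  let k ← PMF.uniformOfFintype (pad.Key m.length)
  let kh ← E.enc ![sk, pad.keyStr k]
  PMF.pure (List.ofFn (pad.act m.length k m.get) ++ kh 0)

/-- The first `n` symbols of a string. -/
def firstBits (n : ℕ) (s : BitStr) : Bits n := fun i => s.getD i false

/-- Decryption of the string ciphertext of an `n`-bit message. -/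
def decStr (pad : PadFamily) (E : FHE) (n : ℕ) (sk c : BitStr) : Bits n :=
  pad.act n (pad.readKey n (E.dec sk (c.drop n)))⁻¹ (firstBits n c)

/-- Quantum fully homomorphic encryption whose ciphertexts have the form `(U_k ψ, k̂)`.

For a circuit `C` with an auxiliary input of `h` qubits, an encrypted input of `n` qubits, `ℓ`
output bits and `m` output qubits, `eval C` takes `k̂`, the auxiliary state and the padded state;
it returns a (classical) ciphertext of the output bits and a ciphertext `(σ, k̂'')` of the output
qubits, as two strings and the state `σ`. -/
structure QFHE (pad : PadFamily) extends FHE where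
  encStr_ppt : IsPPT (fun x : Fin 2 → BitStr =>
    (encStr pad toFHE (x 0) (x 1)).map (fun c => ![c]))
  qeval : ∀ {h n ℓ m : ℕ}, Circuit (h + n) ℓ m → QAlg 1 2 (h + n) m
  qeval_qpt : ∀ {h n ℓ m : ℕ} (C : Circuit (h + n) ℓ m), C.Admissible →
    IsQPT (qeval (h := h) (n := n) C)
  correct : ∀ {h n ℓ m : ℕ} (C : Circuit (h + n) ℓ m), C.Admissible →
    ∃ ν : ℕ → ℝ, Negligible ν ∧
    ∀ (ξ : Bits h → ℂ) (ψ : Bits n → ℂ), IsUnit2 ξ → IsUnit2 ψ →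
    ∀ (l : ℕ), ∀ sk ∈ (gen ![unary l]).support, ∀ k : pad.Key n,
    ∀ kh ∈ (enc ![sk 0, pad.keyStr k]).support,
      CQClose (ν l)
        (fun y : Bits ℓ => ∑ᶠ o : Fin 2 → BitStr,
          if decStr pad toFHE ℓ (sk 0) (o 0) = y then
            let k'' := pad.readKey m (dec (sk 0) (o 1))
            (pad.U m k'')ᴴ * qeval C kh (ketbra (tens ξ (pad.U n k *ᵥ ψ))) o * pad.U m k''
          else 0)
        (C.output (tens ξ ψ))

/-- Indistinguishability of the encryptions of any two messages. -/
def QFHE.Secure {pad : PadFamily} (E : QFHE pad) : Prop :=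
  ∀ dist : Alg 2 1, IsPPT dist → ∀ p : Polynomial ℕ, ∃ ν : ℕ → ℝ, Negligible ν ∧
    ∀ (l : ℕ) (x₀ x₁ : BitStr), x₀.length = p.eval l → x₁.length = p.eval l →
      |probOne (do
          let sk ← E.gen ![unary l]
          let c ← encStr pad E.toFHE (sk 0) x₀
          dist ![unary l, c]) -
        probOne (do
          let sk ← E.gen ![unary l]
          let c ← encStr pad E.toFHE (sk 0) x₁
          dist ![unary l, c])| ≤ ν l

/-- The form of encryption is shared by evaluated ciphertexts: up to a negligible statistical
error, a ciphertext produced by evaluation is distributed like a fresh encryption of the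
result. -/
def QFHE.EvaluatedForm {pad : PadFamily} (E : QFHE pad) : Prop :=
  (∀ {a b : ℕ} (f : Bits a → Bits b), ∃ ν : ℕ → ℝ, Negligible ν ∧
    ∀ (l : ℕ), ∀ sk ∈ (E.gen ![unary l]).support, ∀ m : Bits a,
    ∀ c ∈ (E.enc ![sk 0, List.ofFn m]).support,
      l1Dist (E.eval f c) (E.enc ![sk 0, List.ofFn (f m)]) ≤ ENNReal.ofReal (ν l)) ∧
  (∀ {h n ℓ m : ℕ} (C : Circuit (h + n) ℓ m), C.Admissible →
    ∃ ν : ℕ → ℝ, Negligible ν ∧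
    ∀ (ξ : Bits h → ℂ) (ψ : Bits n → ℂ), IsUnit2 ξ → IsUnit2 ψ →
    ∀ (l : ℕ), ∀ sk ∈ (E.gen ![unary l]).support, ∀ k : pad.Key n,
    ∀ kh ∈ (E.enc ![sk 0, pad.keyStr k]).support,
      CQClose (ν l)
        (E.qeval C kh (ketbra (tens ξ (pad.U n k *ᵥ ψ))))
        (fun o => ∑ y : Bits ℓ, ∑ k'' : pad.Key m,
          (((encStr pad E.toFHE (sk 0) (List.ofFn y) (o 0)).toReal *
            (E.enc ![sk 0, pad.keyStr k''] ![o 1]).toReal / Fintype.card (pad.Key m) : ℝ) : ℂ) •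
          (pad.U m k'' * C.output (tens ξ ψ) y * (pad.U m k'')ᴴ)))

/-! ## Oblivious pads -/

/-- An oblivious `{U_k}`-pad for the unitaries `U_k` on `n` qubits, so compatible with
`QFHE` schemes with the same pads. -/
structure OPad (pad : PadFamily) (n : ℕ) where
  gen : Alg 1 2
  enc : QAlg 1 1 n n
  dec : BitStr → BitStr → pad.Key n
  samp : Alg 1 1
  gen_ppt : IsPPT gen
  enc_qpt : IsQPT enc
  dec_ppt : IsPPT (fun x : Fin 2 → BitStr => PMF.pure ![pad.keyStr (dec (x 0) (x 1))])
  samp_ppt : IsPPT samp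
  correct : ∃ ν : ℕ → ℝ, Negligible ν ∧ ∀ ρ : QOp n, IsDensity ρ → ∀ l : ℕ,
    ENNReal.ofReal (1 - ν l) ≤ ∑' (g : Fin 2 → BitStr) (s : Fin 1 → BitStr),
      gen ![unary l] g *
        (if CQClose (ν l)
            (fun _ : Unit => ((enc ![g 0] ρ s).trace)⁻¹ • enc ![g 0] ρ s)
            (fun _ => pad.U n (dec (g 1) (s 0)) * ρ * (pad.U n (dec (g 1) (s 0)))ᴴ)
          then ENNReal.ofReal ((enc ![g 0] ρ s).trace).re else 0)
  range_sampling : ∃ ν : ℕ → ℝ, Negligible ν ∧ ∀ ρ : QOp n, IsDensity ρ → ∀ l : ℕ,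
    ∑' g : Fin 2 → BitStr, gen ![unary l] g *
      l1Dist (samp ![g 0]) (fun s => ENNReal.ofReal ((enc ![g 0] ρ s).trace).re)
      ≤ ENNReal.ofReal (ν l)

/-- The soundness game of an oblivious pad for a two-stage prover. -/
def OPad.game {pad : PadFamily} {n : ℕ} (P : OPad pad n) (A₁ : Alg 2 2) (A₂ : Alg 2 1) (l : ℕ) :
    PMF Bool := do
  let g ← P.gen ![unary l]
  let r ← A₁ ![unary l, g 0]
  let b ← PMF.uniformOfFintype Bool
  let k₀ ← PMF.uniformOfFintype (pad.Key n)
  let b' ← A₂ ![r 0, pad.keyStr (if b then P.dec (g 1) (r 1) else k₀)]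
  PMF.pure (decide (b' 0 = [b]))

def OPad.Secure {pad : PadFamily} {n : ℕ} (P : OPad pad n) : Prop :=
  ∀ (A₁ : Alg 2 2) (A₂ : Alg 2 1), IsPPT A₁ → IsPPT A₂ → ∃ ν : ℕ → ℝ, Negligible ν ∧
    ∀ l : ℕ, (P.game A₁ A₂ l true).toReal ≤ 1 / 2 + ν l

/-! ## Four-message protocols -/

/-- Verifier of a protocol with four messages, which consist of `n₁`, `m₁`, `n₂`, `m₂` strings.
`VS` holds the private coins of the verifier. -/
structure Protocol (n₁ m₁ n₂ m₂ : ℕ) where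
  VS : Type
  start : ℕ → PMF (VS × (Fin n₁ → BitStr))
  next : VS → (Fin n₁ → BitStr) → (Fin m₁ → BitStr) → PMF (Fin n₂ → BitStr)
  decide : VS → (Fin n₁ → BitStr) → (Fin m₁ → BitStr) → (Fin n₂ → BitStr) →
    (Fin m₂ → BitStr) → Bool

/-- The behaviour of a prover: for security parameter `l`, the probability that it answers the
first message `t₁` with `t₂` and then the third message `t₃` with `t₄`. -/
abbrev Behaviour (n₁ m₁ n₂ m₂ : ℕ) := ℕ → (Fin n₁ → BitStr) → (Fin m₁ → BitStr) →
  (Fin n₂ → BitStr) → (Fin m₂ → BitStr) → ℝ≥0∞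

/-- A classical prover; the first output string is its memory between the two stages. -/
structure CProver (n₁ m₁ n₂ m₂ : ℕ) where
  first : Alg (n₁ + 1) (m₁ + 1)
  second : Alg (n₂ + 1) m₂

def CProver.PPT {n₁ m₁ n₂ m₂ : ℕ} (P : CProver n₁ m₁ n₂ m₂) : Prop :=
  IsPPT P.first ∧ IsPPT P.second

def CProver.behaviour {n₁ m₁ n₂ m₂ : ℕ} (P : CProver n₁ m₁ n₂ m₂) : Behaviour n₁ m₁ n₂ m₂ :=
  fun l t₁ t₂ t₃ t₄ => ∑' st : BitStr,
    P.first (Fin.cons (unary l) t₁) (Fin.cons st t₂) * P.second (Fin.cons st t₃) t₄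

/-- A quantum prover that keeps a string and `n` qubits between the two stages. -/
structure QProver (n₁ m₁ n₂ m₂ n : ℕ) where
  first : QAlg (n₁ + 1) (m₁ + 1) 0 n
  second : QAlg (n₂ + 1) m₂ n 0

def QProver.QPT {n₁ m₁ n₂ m₂ n : ℕ} (P : QProver n₁ m₁ n₂ m₂ n) : Prop :=
  IsQPT P.first ∧ IsQPT P.second

def QProver.behaviour {n₁ m₁ n₂ m₂ n : ℕ} (P : QProver n₁ m₁ n₂ m₂ n) : Behaviour n₁ m₁ n₂ m₂ :=
  fun l t₁ t₂ t₃ t₄ => ∑' st : BitStr,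
    ENNReal.ofReal ((P.second (Fin.cons st t₃)
      (P.first (Fin.cons (unary l) t₁) 1 (Fin.cons st t₂)) t₄).trace).re

section Protocols

variable {n₁ m₁ n₂ m₂ : ℕ}

namespace Protocol

variable (V : Protocol n₁ m₁ n₂ m₂)

/-- An execution: the private coins of the verifier and the four messages. -/
structure Exec where
  vs : V.VS
  t₁ : Fin n₁ → BitStr
  t₂ : Fin m₁ → BitStr
  t₃ : Fin n₂ → BitStr
  t₄ : Fin m₂ → BitStr

/-- Probability of an execution with a prover (or a simulator, whose behaviour may also depend on
the decoding maps and so on the private coins). -/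
def mass (R : V.VS → Behaviour n₁ m₁ n₂ m₂) (l : ℕ) (e : V.Exec) : ℝ≥0∞ :=
  V.start l (e.vs, e.t₁) * V.next e.vs e.t₁ e.t₂ e.t₃ * R e.vs l e.t₁ e.t₂ e.t₃ e.t₄

def Exec.verdict {V : Protocol n₁ m₁ n₂ m₂} (e : V.Exec) : Bool :=
  V.decide e.vs e.t₁ e.t₂ e.t₃ e.t₄

/-- Distribution of the transcript together with the verdict of the verifier. -/
def transcript (R : V.VS → Behaviour n₁ m₁ n₂ m₂) (l : ℕ)
    (t : (Fin n₁ → BitStr) × (Fin m₁ → BitStr) × (Fin n₂ → BitStr) × (Fin m₂ → BitStr) × Bool) :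
    ℝ≥0∞ :=
  ∑' vs : V.VS,
    let e : V.Exec := ⟨vs, t.1, t.2.1, t.2.2.1, t.2.2.2.1⟩
    if e.verdict = t.2.2.2.2 then V.mass R l e else 0

/-- Probability that the verifier accepts. -/
def accept (R : V.VS → Behaviour n₁ m₁ n₂ m₂) (l : ℕ) : ℝ :=
  (∑' e : V.Exec, if e.verdict = true then V.mass R l e else 0).toReal

end Protocol

/-! ## Faithfulness to a contextuality game -/

variable {Q : Type} [Fintype Q]

/-- The maps that tell which strings of a protocol are (encoded) questions and answers of a game:
`none` marks other strings; a question carries its decoding map, an answer the index of the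
question of the same round that it belongs to and its (possibly randomised) encoding map. -/
structure QAMaps (V : Protocol n₁ m₁ n₂ m₂) (G : ContextualityGame Q) where
  q₁ : Fin n₁ → Option (V.VS → BitStr → Q)
  a₁ : Fin m₁ → Option (Fin n₁ × (V.VS → G.Ans → PMF BitStr))
  q₂ : Fin n₂ → Option (V.VS → BitStr → Q)
  a₂ : Fin m₂ → Option (Fin n₂ × (V.VS → G.Ans → PMF BitStr))

variable {V : Protocol n₁ m₁ n₂ m₂} {G : ContextualityGame Q}

/-- The questions decoded from a message. -/
def decodeQuestions {X : Type} {n : ℕ} (r : Fin n → Option (X → BitStr → Q)) (vs : X)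
    (t : Fin n → BitStr) : Fin n → Option Q := fun i => (r i).map (fun f => f vs (t i))

/-- Probability that the answers `a` are encoded by the answer strings of the message `t`. -/
def encodeProb {X : Type} {n m : ℕ} (s : Fin m → Option (Fin n × (X → G.Ans → PMF BitStr)))
    (vs : X) (a : Fin n → Option G.Ans) (t : Fin m → BitStr) : ℝ≥0∞ :=
  ∏ j, match s j with
    | none => 1
    | some (i, f) => match a i with
      | some α => f vs α (t j)
      | none => 0

/-- Each answer string belongs to a question, and each question has one answer string. -/
def Paired {X : Type} {n m : ℕ} (r : Fin n → Option (X → BitStr → Q))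
    (s : Fin m → Option (Fin n × (X → G.Ans → PMF BitStr))) : Prop :=
  (∀ j p, s j = some p → (r p.1).isSome = true) ∧
  ∀ i, (r i).isSome = true → ∃! j, ∃ f, s j = some (i, f)

/-- The questions that the verifier asks in an execution. -/
def QAMaps.asked (M : QAMaps V G) (e : V.Exec) : Finset Q :=
  Finset.univ.filter fun q =>
    (∃ i, decodeQuestions M.q₁ e.vs e.t₁ i = some q) ∨
    (∃ i, decodeQuestions M.q₂ e.vs e.t₃ i = some q)

/-- The strategy of a simulator for the strings that are not answers of the game.  It is an
arbitrary function of the history, which includes the decoded questions and the answers given. -/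
structure Aux (M : QAMaps V G) where
  first : ℕ → (Fin n₁ → BitStr) → (Fin n₁ → Option Q) → (Fin n₁ → Option G.Ans) →
    ({j // (M.a₁ j).isSome = true} → BitStr) →
    PMF ({j // ¬ (M.a₁ j).isSome = true} → BitStr)
  second : ℕ → (Fin n₁ → BitStr) → (Fin n₁ → Option Q) → (Fin n₁ → Option G.Ans) →
    (Fin m₁ → BitStr) → (Fin n₂ → BitStr) → (Fin n₂ → Option Q) → (Fin n₂ → Option G.Ans) →
    ({j // (M.a₂ j).isSome = true} → BitStr) →
    PMF ({j // ¬ (M.a₂ j).isSome = true} → BitStr)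

/-- The probability that the questions of the two rounds are answered in a given way. -/
abbrev Answering (n₁ n₂ : ℕ) (G : ContextualityGame Q) :=
  (Fin n₁ → Option Q) → (Fin n₁ → Option G.Ans) → (Fin n₂ → Option Q) →
    (Fin n₂ → Option G.Ans) → ℝ≥0∞

/-- Answers according to an assignment `τ`. -/
def answerNC (τ : Q → G.Ans) : Answering n₁ n₂ G := fun q₁ a₁ q₂ a₂ =>
  if (∀ i, a₁ i = (q₁ i).map τ) ∧ (∀ i, a₂ i = (q₂ i).map τ) then 1 else 0

section
variable {H : Type} [NormedAddCommGroup H] [InnerProductSpace ℂ H] [CompleteSpace H]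

/-- The projection for one question and its answer; nothing is measured for a string that is not
a question. -/
def answerOp (S : G.QStrat H) : Option Q → Option G.Ans → (H →L[ℂ] H)
  | some q, some a => S.proj q a.1
  | none, none => 1
  | _, _ => 0

/-- The measurements for the questions of a message, the first question being measured first. -/
def answerOps (S : G.QStrat H) {n : ℕ} (q : Fin n → Option Q) (a : Fin n → Option G.Ans) :
    H →L[ℂ] H :=
  ((List.ofFn fun i => answerOp S (q i) (a i)).reverse).prod

/-- Answers obtained by measuring the observables of `S` on its state. -/
def answerQu (S : G.QStrat H) : Answering n₁ n₂ G := fun q₁ a₁ q₂ a₂ =>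
  ENNReal.ofReal (‖answerOps S q₂ a₂ (answerOps S q₁ a₁ S.psi)‖ ^ 2)

end

/-- The simulator that decodes the questions, answers them according to `W`, encodes the answers,
and produces the remaining strings according to `aux`. -/
def simulator (M : QAMaps V G) (W : Answering n₁ n₂ G) (aux : Aux M) :
    V.VS → Behaviour n₁ m₁ n₂ m₂ :=
  fun vs l t₁ t₂ t₃ t₄ =>
    let d₁ := decodeQuestions M.q₁ vs t₁
    let d₂ := decodeQuestions M.q₂ vs t₃
    ∑ a₁ : Fin n₁ → Option G.Ans, ∑ a₂ : Fin n₂ → Option G.Ans,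
      W d₁ a₁ d₂ a₂ *
      encodeProb M.a₁ vs a₁ t₂ *
      aux.first l t₁ d₁ a₁ (fun j => t₂ j.1) (fun j => t₂ j.1) *
      encodeProb M.a₂ vs a₂ t₄ *
      aux.second l t₁ d₁ a₁ t₂ t₃ d₂ a₂ (fun j => t₄ j.1) (fun j => t₄ j.1)

/-- The protocol `V`, with the maps `M` and the map `qProver` from strategies to provers, is
faithful to `G` with parameters `s` and `c`.  Negligible additive terms are ignored. -/
structure Faithful (V : Protocol n₁ m₁ n₂ m₂) (G : ContextualityGame Q) (M : QAMaps V G) {n : ℕ}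
    (qProver : G.QStrat (Qubits n) → QProver n₁ m₁ n₂ m₂ n) (s c : ℝ) : Prop where
  /-- the maps are as required -/
  paired : Paired M.q₁ M.a₁ ∧ Paired M.q₂ M.a₂
  /-- the provers are efficient -/
  qpt : ∀ S : G.QStrat (Qubits n), S.Described → (qProver S).QPT
  /-- when asked questions within a context `C`, the prover for a strategy behaves in a way that
  depends on the state and the observables of `C` only -/
  marginal : ∀ S S' : G.QStrat (Qubits n), S.Described → S'.Described →
    ∀ C ∈ G.contexts, S.psi = S'.psi → (∀ q ∈ C, S.O q = S'.O q) →
    ∃ ν : ℕ → ℝ, Negligible ν ∧ ∀ l,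
      l1Dist
        (fun e : {e : V.Exec // M.asked e ⊆ C} =>
          V.mass (fun _ => (qProver S).behaviour) l e.1)
        (fun e : {e : V.Exec // M.asked e ⊆ C} =>
          V.mass (fun _ => (qProver S').behaviour) l e.1) ≤ ENNReal.ofReal (ν l)
  /-- the verifier only asks questions of one context -/
  wellFormed : ∀ (l : ℕ) (e : V.Exec), V.start l (e.vs, e.t₁) ≠ 0 →
    V.next e.vs e.t₁ e.t₂ e.t₃ ≠ 0 → ∃ C ∈ G.contexts, M.asked e ⊆ C
  /-- classical simulators win with probability at most `s` -/
  soundness : ∃ ν : ℕ → ℝ, Negligible ν ∧ ∀ (τ : Q → G.Ans) (aux : Aux M) (l : ℕ),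
    V.accept (simulator M (answerNC τ) aux) l ≤ s + ν l
  /-- the verdict is given by the predicate if a whole context was asked, and positive otherwise -/
  decision : ∀ (τ : Q → G.Ans) (aux : Aux M) (l : ℕ) (e : V.Exec),
    V.mass (simulator M (answerNC τ) aux) l e ≠ 0 →
    (∀ C ∈ G.contexts, M.asked e = C → e.verdict = G.pred C (fun q => τ q.1)) ∧
    (M.asked e ∉ G.contexts → e.verdict = true)
  /-- some strategy wins with probability `c` -/
  completeness : ∃ S : G.QStrat (Qubits n), S.Described ∧ ∃ ν : ℕ → ℝ, Negligible ν ∧ ∀ l,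
    |V.accept (fun _ => (qProver S).behaviour) l - c| ≤ ν l
  /-- each quantum prover is matched by a quantum simulator with the same strategy -/
  quantumCompleteness : ∀ S : G.QStrat (Qubits n), S.Described →
    ∃ (aux : Aux M) (ν : ℕ → ℝ), Negligible ν ∧ ∀ l,
      l1Dist (V.transcript (simulator M (answerQu S) aux) l)
        (V.transcript (fun _ => (qProver S).behaviour) l) ≤ ENNReal.ofReal (ν l)
  /-- for commuting observables, some efficient classical prover gives the same transcript -/
  classicalCompleteness : ∀ S : G.QStrat (Qubits n), S.Described →
    (∀ q q', Commute (S.O q) (S.O q')) →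
    ∃ P : CProver n₁ m₁ n₂ m₂, P.PPT ∧ ∃ ν : ℕ → ℝ, Negligible ν ∧ ∀ l,
      l1Dist (V.transcript (fun _ => P.behaviour) l)
        (V.transcript (fun _ => (qProver S).behaviour) l) ≤ ENNReal.ofReal (ν l)

end Protocols

/-! ## The compiled game -/

section Compiler

variable {Q : Type} [Fintype Q]

/-- Encodings of the questions and the answers of a game as strings of fixed lengths. -/
structure Encoding (G : ContextualityGame Q) where
  nq : ℕ
  codeQ : Q ↪ Bits nq
  na : ℕ
  codeA : G.Ans ↪ Bits na

variable {G : ContextualityGame Q} (K : Encoding G)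

/-- The question with a given code; arbitrary if there is none. -/
def Encoding.readQ [Nonempty Q] : Bits K.nq → Q := Function.invFun K.codeQ

def Encoding.readA (z : Bits K.na) : Option G.Ans :=
  if h : ∃ a, K.codeA a = z then some h.choose else none

/-- An answer sent in the clear. -/
def Encoding.readAStr (s : BitStr) : Option G.Ans :=
  if h : ∃ a, List.ofFn (K.codeA a) = s then some h.choose else none

variable {pad : PadFamily} (E : QFHE pad) {n : ℕ} (P : OPad pad n)

/-- The private coins of the verifier: the key `sk`, the context, the first question `q'` and the
secret key of the pad. -/
structure Coins (G : ContextualityGame Q) where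
  sk : BitStr
  C : {C // C ∈ G.contexts}
  q' : Q
  opSk : BitStr

/-- A uniform question of the context. -/
def uniformQuestion (h2 : ∀ C ∈ G.contexts, C.card = 2) (C : {C // C ∈ G.contexts}) : PMF Q :=
  PMF.uniformOfFinset C.1 (Finset.card_pos.mp (by rw [h2 C.1 C.2]; norm_num))

variable [Nonempty Q]

/-- The verifier of the compiled game.  The messages are
`(t₁, t₂) = (c_{q'}, OPad.pk)`, `(t₃, t₄, t₅) = (c_{a'}, k̂'', s')`, `(t₆, t₇) = (q, k)`, `t₈ = a`.
The pad on the prover's state is `U_{k'} U_{k''} = U_k` up to a phase. -/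
def compiled (h2 : ∀ C ∈ G.contexts, C.card = 2) : Protocol 2 3 2 1 where
  VS := Coins G
  start l := do
    let sk ← E.gen ![unary l]
    let C ← G.D
    let q' ← uniformQuestion h2 C
    let c ← encStr pad E.toFHE (sk 0) (List.ofFn (K.codeQ q'))
    let g ← P.gen ![unary l]
    PMF.pure (⟨sk 0, C, q', g 1⟩, ![c, g 0])
  next vs _ t := do
    let q ← uniformQuestion h2 vs.C
    let k'' := pad.readKey n (E.dec vs.sk (t 1))
    let k' := P.dec vs.opSk (t 2)
    PMF.pure ![List.ofFn (K.codeQ q), pad.keyStr (k' * k'')]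
  decide vs _ t u w :=
    let q := K.readQ (firstBits K.nq (u 0))
    match K.readA (decStr pad E.toFHE K.na vs.sk (t 0)), K.readAStr (w 0) with
    | some a', some a =>
        if q = vs.q' then decide (a = a')
        else G.pred vs.C.1 (fun x => if x.1 = q then a else a')
    | _, _ => false

/-- The maps of the compiled game: `t₁` is decoded by decryption and `t₃` encoded by encryption,
while `t₆` and `t₈` are in the clear. -/
def compiledMaps (h2 : ∀ C ∈ G.contexts, C.card = 2) : QAMaps (compiled K E P h2) G where
  q₁ := ![some (fun (vs : Coins G) c => K.readQ (decStr pad E.toFHE K.nq vs.sk c)), none]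
  a₁ := ![some (0, fun (vs : Coins G) a =>
            encStr pad E.toFHE vs.sk (List.ofFn (K.codeA a))), none, none]
  q₂ := ![some (fun _ s => K.readQ (firstBits K.nq s)), none]
  a₂ := ![some (0, fun _ a => PMF.pure (List.ofFn (K.codeA a)))]

/-- The unitary `∑ q, |q⟩⟨q| ⊗ ∑ a, Π_{q,a} ⊗ X^a` on `n` qubits, a question and an answer
register. -/
def measurementGate (S : G.QStrat (Qubits n)) : QOp (n + K.nq + K.na) := fun u v =>
  let hu : Bits n := fun i => u (Fin.castAdd K.na (Fin.castAdd K.nq i))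
  let hv : Bits n := fun i => v (Fin.castAdd K.na (Fin.castAdd K.nq i))
  let qu : Bits K.nq := fun i => u (Fin.castAdd K.na (Fin.natAdd n i))
  let qv : Bits K.nq := fun i => v (Fin.castAdd K.na (Fin.natAdd n i))
  let z : Bits K.na := fun i => xor (u (Fin.natAdd (n + K.nq) i)) (v (Fin.natAdd (n + K.nq) i))
  if qu = qv then
    match K.readA z with
    | some a => S.projMat (K.readQ qu) a.1 hu hv
    | none => 0
  else 0

/-- The circuit that measures the observable of the question in the second input register on the
state in the first, and outputs the answer and the post-measurement state. -/
def measurementCircuit (S : G.QStrat (Qubits n)) : Circuit (n + K.nq) K.na n where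
  anc := K.na
  gates := [⟨n + K.nq + K.na, measurementGate K S, Function.Embedding.refl _⟩]
  outC := Fin.natAddEmb (n + K.nq)
  outQ := (Fin.castAddEmb K.nq).trans (Fin.castAddEmb K.na)
  disjoint i j h := by
    have := congrArg Fin.val h
    simp at this
    omega

/-- The honest prover with strategy `S`.  First stage, on `1^l, c_{q'}, OPad.pk`: prepare the state
of `S`, evaluate homomorphically the measurement of the encrypted question, and apply the
oblivious pad to the result; the strings `c_{a'}, k̂'', s'` are sent, the qubits are kept.
Second stage, on `q, k`: measure `U_k O_q U_k†` and send the outcome. -/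
def honest (S : G.QStrat (Qubits n)) : QProver 2 3 2 1 n where
  first x ρ o :=
    let input := ketbra (tens (fun u : Bits n => S.psi u)
      (Pi.single (firstBits K.nq (x 1)) 1))
    let evaluated := E.qeval (measurementCircuit K S) ![(x 1).drop K.nq] input ![o 1, o 2]
    if o 0 = [] then P.enc ![x 2] (ρ.trace • evaluated) ![o 3] else 0
  second x ρ o :=
    let q := K.readQ (firstBits K.nq (x 1))
    let U := pad.U n (pad.readKey n (x 2))
    match K.readAStr (o 0) with
    | some a => (U * S.projMat q a.1 * Uᴴ * ρ).trace • (1 : QOp 0)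
    | none => 0

end Compiler

end

end Contextuality

open Contextuality ContextualityGame

namespace Contextuality

noncomputable section

open scoped Classical ENNReal ComplexOrder Matrix

/-! ## Runs of programs -/

namespace Config

def withTodo (c : Config) (K : List Cmd) : Config := { c with todo := K }

@[simp] theorem withTodo_todo (c : Config) (K) : (c.withTodo K).todo = K := rfl
@[simp] theorem withTodo_bits (c : Config) (K) : (c.withTodo K).bits = c.bits := rfl
@[simp] theorem withTodo_qubits (c : Config) (K) : (c.withTodo K).qubits = c.qubits := rfl
@[simp] theorem withTodo_fresh (c : Config) (K) : (c.withTodo K).fresh = c.fresh := rfl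
@[simp] theorem withTodo_vec (c : Config) (K) : (c.withTodo K).vec = c.vec := rfl
@[simp] theorem withTodo_wt (c : Config) (K) : (c.withTodo K).wt = c.wt := rfl
@[simp] theorem withTodo_withTodo (c : Config) (K K') :
    (c.withTodo K).withTodo K' = c.withTodo K' := rfl
@[simp] theorem withTodo_self (c : Config) : c.withTodo c.todo = c := rfl

theorem flatMap_iterate (T : ℕ) (l : List Config) :
    (fun cs : List Config => cs.flatMap Config.step)^[T] l = l.flatMap (run T) := by
  induction T generalizing l with
  | zero => exact (List.flatMap_singleton' l).symm
  | succ T ih =>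
    rw [Function.iterate_succ_apply, ih, List.flatMap_assoc]
    congr 1
    funext c
    rw [run, Function.iterate_succ_apply, ih]
    simp

@[simp] theorem run_zero (c : Config) : run 0 c = [c] := rfl

theorem run_succ (T : ℕ) (c : Config) : run (T + 1) c = c.step.flatMap (run T) := by
  rw [run, Function.iterate_succ_apply, flatMap_iterate]
  simp

theorem run_add (S T : ℕ) (c : Config) : run (S + T) c = (run S c).flatMap (run T) := by
  rw [run, Nat.add_comm, Function.iterate_add_apply, flatMap_iterate]
  rfl

theorem step_halted {c : Config} (h : c.todo = []) : c.step = [c] := by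
  rw [step]; simp [h]

theorem run_halted {c : Config} (h : c.todo = []) (T : ℕ) : run T c = [c] := by
  induction T with
  | zero => rfl
  | succ T ih => rw [run_succ, step_halted h]; simp [ih]

theorem step_append (c : Config) (P : Cmd) (K K' : List Cmd) :
    (c.withTodo (P :: (K ++ K'))).step =
      (c.withTodo (P :: K)).step.map (fun d => d.withTodo (d.todo ++ K')) := by
  cases P with
  | qgate k U r =>
    by_cases h : ∃ w : Fin k ↪ ℕ, ∀ j, (c.qubits (r j)).head? = some (w j)
    · refine (dif_pos h).trans ?_
      rw [show (c.withTodo (.qgate k U r :: K)).step = _ from dif_pos h]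
      simp [withTodo]
    · refine (dif_neg h).trans ?_
      rw [show (c.withTodo (.qgate k U r :: K)).step = _ from dif_neg h]
      simp [withTodo]
  | _ => simp only [step, withTodo] <;> (try split) <;> simp

/-- Started with the commands `K`, all branches have halted after `T` steps, and `L` lists them. -/
def Yields (K : List Cmd) (c : Config) (T : ℕ) (L : List Config) : Prop :=
  run T (c.withTodo K) = L ∧ ∀ d ∈ L, d.todo = []

theorem Yields.mono {K c T L} (h : Yields K c T L) {T' : ℕ} (hT : T ≤ T') : Yields K c T' L := by
  obtain ⟨k, rfl⟩ := Nat.exists_eq_add_of_le hT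
  refine ⟨?_, h.2⟩
  rw [run_add, h.1]
  conv_rhs => rw [← List.flatMap_singleton' L]
  exact List.flatMap_congr fun d hd => run_halted (h.2 d hd) k

theorem Yields.append {K K' : List Cmd} {c : Config} {T T' : ℕ} {L : List Config}
    {G : Config → List Config} (h : Yields K c T L) (h' : ∀ d ∈ L, Yields K' d T' (G d)) :
    Yields (K ++ K') c (T + T') (L.flatMap G) := by
  refine ⟨?_, ?_⟩
  · induction T generalizing K c L with
    | zero =>
      obtain ⟨rfl, h2⟩ := h
      have hK : K = [] := h2 (c.withTodo K) (by simp)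
      subst hK
      have := (h' (c.withTodo []) (by simp)).1
      simpa using this
    | succ T ih =>
      cases K with
      | nil =>
        have h0 : Yields [] c T L := by
          obtain ⟨h1, h2⟩ := h
          rw [run_halted rfl] at h1
          exact ⟨by rw [run_halted rfl]; exact h1, h2⟩
        have := ih h0 h'
        have hL : L = [c.withTodo []] := by rw [← h.1, run_halted rfl]
        subst hL
        have h3 := (h' (c.withTodo []) (by simp))
        have h4 := (h3.mono (Nat.le_add_left T' (T + 1))).1
        simpa using h4
      | cons P K =>
        obtain ⟨h1, h2⟩ := h
        rw [run_succ] at h1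
        rw [Nat.add_right_comm, run_succ, List.cons_append, step_append, List.flatMap_map]
        subst h1
        rw [List.flatMap_assoc]
        refine List.flatMap_congr fun d hd => ?_
        exact ih (K := d.todo) (c := d) ⟨rfl, fun x hx => h2 x (List.mem_flatMap.2 ⟨d, hd, hx⟩)⟩
          (fun x hx => h' x (List.mem_flatMap.2 ⟨d, hd, hx⟩))
  · intro x hx
    obtain ⟨d, hd, hx⟩ := List.mem_flatMap.1 hx
    exact (h' d hd).2 x hx

theorem Yields.congr_state {K c d T L} (h : Yields K c T L) (hd : d.withTodo [] = c.withTodo []) :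
    Yields K d T L := by
  have : d.withTodo K = c.withTodo K := by
    have := congrArg (fun x => x.withTodo K) hd
    simpa using this
  exact ⟨by rw [this]; exact h.1, h.2⟩

theorem Yields.of_step {P : Cmd} {c : Config} {T : ℕ} {d : Config} {K : List Cmd} {L}
    (hs : (c.withTodo (P :: K)).step = [d]) (h : Yields d.todo d T L) :
    Yields (P :: K) c (T + 1) L := by
  refine ⟨?_, h.2⟩
  rw [run_succ, hs]
  simpa using h.1

theorem Yields.seq {P P' : Cmd} {c : Config} {T T' : ℕ} {L : List Config}
    {G : Config → List Config} (h : Yields [P] c T L) (h' : ∀ d ∈ L, Yields [P'] d T' (G d)) :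
    Yields [.seq P P'] c (T + T' + 1) (L.flatMap G) := by
  refine Yields.of_step (d := c.withTodo [P, P']) rfl ?_
  exact Yields.append (c := c) h h'

theorem Yields.seq_one {P P' : Cmd} {c d : Config} {T T' : ℕ} {L : List Config}
    (h : Yields [P] c T [d]) (h' : Yields [P'] d T' L) :
    Yields [.seq P P'] c (T + T' + 1) L := by
  have := Yields.seq (G := fun _ => L) h (by simpa using h')
  simpa using this

/-! ### Invariants of runs -/

/-- A property kept by steps is kept by runs. -/
theorem run_induction {p : Config → Prop} (hp : ∀ c, p c → ∀ d ∈ c.step, p d) (T : ℕ) :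
    ∀ c, p c → ∀ d ∈ run T c, p d := by
  induction T with
  | zero => intro c hc d hd; simp at hd; exact hd ▸ hc
  | succ T ih =>
    intro c hc d hd
    rw [run_succ] at hd
    obtain ⟨x, hx, hd⟩ := List.mem_flatMap.1 hd
    exact ih x (hp c hc x hx) d hd

end Config

/-- All stacks that occur in the program have a smaller index. -/
def Cmd.bound : Cmd → ℕ
  | .skip => 0
  | .push i _ => i + 1
  | .drop i => i + 1
  | .seq c d => max c.bound d.bound
  | .branch _ e z o => max e.bound (max z.bound o.bound)
  | .loop _ c => c.bound
  | .coin _ i => i + 1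
  | .qnew i => i + 1
  | .qmove i j => max (i + 1) (j + 1)
  | .qgate _ _ _ => 0
  | .qmeas i j => max (i + 1) (j + 1)

namespace Config

theorem step_bound {N : ℕ} {c : Config} (h : ∀ P ∈ c.todo, P.bound ≤ N) :
    ∀ d ∈ c.step, (∀ P ∈ d.todo, P.bound ≤ N) ∧
      ∀ i, N ≤ i → d.bits i = c.bits i ∧ d.qubits i = c.qubits i := by
  obtain ⟨todo, bits, qubits, fresh, vec, wt⟩ := c
  intro d hd
  rcases todo with _ | ⟨P, K⟩
  · simp only [step, List.mem_singleton] at hd; subst hd; simp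
  simp only [List.mem_cons, forall_eq_or_imp] at h
  obtain ⟨hP, hK⟩ := h
  cases P <;> simp only [step] at hd <;> (try split at hd) <;>
    simp only [List.mem_cons, List.map_cons, List.map_nil, List.not_mem_nil,
      or_false] at hd <;> (first | subst hd | (rcases hd with hd | hd <;> subst hd)) <;>
    simp only [Cmd.bound, max_le_iff] at hP <;>
    (refine ⟨?_, ?_⟩
     · simp only [List.mem_cons, forall_eq_or_imp, Cmd.bound]; (try simp only [hP]); grind
     · intro i hi; simp only [Function.update_apply]; grind)

theorem run_bound {N T : ℕ} {c : Config} (h : ∀ P ∈ c.todo, P.bound ≤ N) :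
    ∀ d ∈ run T c, ∀ i, N ≤ i → d.bits i = c.bits i ∧ d.qubits i = c.qubits i := by
  intro d hd
  refine (run_induction (p := fun d => (∀ P ∈ d.todo, P.bound ≤ N) ∧
      ∀ i, N ≤ i → d.bits i = c.bits i ∧ d.qubits i = c.qubits i) ?_ T c ⟨h, by simp⟩ d hd).2
  intro x hx y hy
  obtain ⟨h1, h2⟩ := step_bound hx.1 y hy
  exact ⟨h1, fun i hi => ⟨(h2 i hi).1.trans (hx.2 i hi).1, (h2 i hi).2.trans (hx.2 i hi).2⟩⟩

theorem step_length {c : Config} : ∀ d ∈ c.step, ∀ i, (d.bits i).length ≤ (c.bits i).length + 1 := by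
  obtain ⟨todo, bits, qubits, fresh, vec, wt⟩ := c
  intro d hd i
  rcases todo with _ | ⟨P, K⟩
  · simp only [step, List.mem_singleton] at hd; subst hd; simp
  cases P <;> simp only [step] at hd <;> (try split at hd) <;>
    simp only [List.mem_cons, List.map_cons, List.map_nil, List.not_mem_nil,
      or_false] at hd <;> (first | subst hd | (rcases hd with hd | hd <;> subst hd)) <;>
    simp only [Function.update_apply] <;> (try split) <;> simp_all <;> omega

theorem run_length (T : ℕ) {c : Config} :
    ∀ d ∈ run T c, ∀ i, (d.bits i).length ≤ (c.bits i).length + T := by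
  induction T generalizing c with
  | zero => simp
  | succ T ih =>
    intro d hd i
    rw [run_succ] at hd
    obtain ⟨x, hx, hd⟩ := List.mem_flatMap.1 hd
    have := ih d hd i
    have := step_length x hx i
    omega

theorem step_fresh {c : Config} : ∀ d ∈ c.step, c.fresh ≤ d.fresh := by
  obtain ⟨todo, bits, qubits, fresh, vec, wt⟩ := c
  intro d hd
  rcases todo with _ | ⟨P, K⟩
  · simp only [step, List.mem_singleton] at hd; subst hd; simp
  cases P <;> simp only [step] at hd <;> (try split at hd) <;>
    simp only [List.mem_cons, List.map_cons, List.map_nil, List.not_mem_nil,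
      or_false] at hd <;> (first | subst hd | (rcases hd with hd | hd <;> subst hd)) <;>
    simp

theorem run_fresh (T : ℕ) {c : Config} : ∀ d ∈ run T c, c.fresh ≤ d.fresh := fun d hd =>
  run_induction (p := fun d => c.fresh ≤ d.fresh)
    (fun _ hx y hy => le_trans hx (step_fresh y hy)) T c le_rfl d hd

/-- Qubits have one place, and those not created yet are `0`. -/
structure WellFormed (c : Config) : Prop where
  nodup : ∀ i, (c.qubits i).Nodup
  disjoint : ∀ i j, i ≠ j → ∀ q ∈ c.qubits i, q ∉ c.qubits j
  lt : ∀ i, ∀ q ∈ c.qubits i, q < c.fresh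
  vec : ∀ s : ℕ → Bool, (∃ i, c.fresh ≤ i ∧ s i = true) → c.vec s = 0

theorem applyGate_extend_ne {W : Type} {k : ℕ} (w : Fin k ↪ W) (u : Bits k) (s : W → Bool) (i : W)
    (hi : ∀ j, w j ≠ i) : Function.extend w u s i = s i := by
  rw [Function.extend_apply']
  rintro ⟨j, hj⟩
  exact hi j hj

theorem WellFormed.step {c : Config} (h : c.WellFormed) : ∀ d ∈ c.step, d.WellFormed := by
  obtain ⟨todo, bits, qubits, fresh, vec, wt⟩ := c
  obtain ⟨h1, h2, h3, h4⟩ := h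
  simp only at h1 h2 h3 h4
  intro d hd
  rcases todo with _ | ⟨P, K⟩
  · simp only [Config.step, List.mem_singleton] at hd; subst hd; exact ⟨h1, h2, h3, h4⟩
  cases P with
  | qnew i =>
    simp only [Config.step, List.mem_singleton] at hd; subst hd
    constructor
    · intro j; simp only [Function.update_apply]; split
      · next hj => subst hj; simp [h1]; intro hf; exact absurd (h3 _ _ hf) (lt_irrefl _)
      · exact h1 j
    · intro j k hjk q; simp only [Function.update_apply]
      grind
    · intro j q; simp only [Function.update_apply]; grind
    · rintro s ⟨j, hj, hs⟩; exact h4 s ⟨j, by simp at hj; omega, hs⟩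
  | qmove i j =>
    simp only [Config.step] at hd
    split at hd
    · simp only [List.mem_singleton] at hd; subst hd; exact ⟨h1, h2, h3, h4⟩
    · next q rest hq =>
      simp only [List.mem_singleton] at hd; subst hd
      have n1 := h1 i; rw [hq, List.nodup_cons] at n1
      have n2 := fun j hj => h2 i j hj q (by simp [hq])
      have n3 := fun j hj r hr => h2 i j hj r (by rw [hq]; exact List.mem_cons_of_mem _ hr)
      have n4 := fun r hr => h3 i r (by rw [hq]; exact List.mem_cons_of_mem _ hr)
      have n5 := h3 i q (by simp [hq])
      constructor
      · intro k; simp only [Function.update_apply]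
        grind
      · intro k l hkl r; simp only [Function.update_apply]
        grind
      · intro k r; simp only [Function.update_apply]; grind
      · exact h4
  | qgate k U r =>
    simp only [Config.step] at hd
    split at hd
    · next hw =>
      simp only [List.mem_singleton] at hd; subst hd
      refine ⟨h1, h2, h3, ?_⟩
      rintro s ⟨i, hi, hs⟩
      simp only [applyGate]
      refine Finset.sum_eq_zero fun u _ => ?_
      rw [h4, mul_zero]
      refine ⟨i, hi, ?_⟩
      rw [applyGate_extend_ne, hs]
      intro j hj
      have := h3 _ _ (List.mem_of_mem_head? (hw.choose_spec j))
      simp only at hi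
      omega
    · simp only [List.mem_singleton] at hd; subst hd; exact ⟨h1, h2, h3, h4⟩
  | qmeas i j =>
    simp only [Config.step] at hd
    split at hd
    · simp only [List.mem_singleton] at hd; subst hd; exact ⟨h1, h2, h3, h4⟩
    · next q rest hq =>
      have n1 := h1 i; rw [hq, List.nodup_cons] at n1
      have n3 := fun j hj r hr => h2 i j hj r (by rw [hq]; exact List.mem_cons_of_mem _ hr)
      have n4 := fun r hr => h3 i r (by rw [hq]; exact List.mem_cons_of_mem _ hr)
      simp only [List.mem_cons, List.map_cons, List.map_nil, List.not_mem_nil, or_false] at hd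
      rcases hd with hd | hd <;> subst hd <;>
      (constructor
       · intro k; simp only [Function.update_apply]
         grind
       · intro k l hkl r; simp only [Function.update_apply]
         grind
       · intro k r; simp only [Function.update_apply]; grind
       · intro s hs; simp only; rw [h4 s hs]; simp)
  | _ =>
    simp only [Config.step] at hd
    (try split at hd) <;> simp only [List.mem_cons, List.not_mem_nil,
      or_false] at hd <;> (first | subst hd | (rcases hd with hd | hd <;> subst hd)) <;> exact ⟨h1, h2, h3, h4⟩

theorem WellFormed.run {c : Config} (h : c.WellFormed) (T : ℕ) : ∀ d ∈ run T c, d.WellFormed :=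
  run_induction (fun _ hc => hc.step) T c h

theorem wellFormed_initial {a n : ℕ} (P : Cmd) (x : Fin a → BitStr) (φ : Bits n → ℂ) :
    (P.initial x φ).WellFormed := by
  constructor
  · intro i; simp only [Cmd.initial]; split <;> simp [List.nodup_range]
  · intro i j hij q; simp only [Cmd.initial]; split <;> split <;> simp_all
  · intro i q; simp only [Cmd.initial]; split <;> simp
  · rintro s ⟨i, hi, hs⟩
    simp only [Cmd.initial]
    rw [if_neg]
    intro h
    rw [h i hi] at hs
    exact absurd hs (by simp)

theorem step_wt {c : Config} (h : (∀ P ∈ c.todo, P.Admissible) ∧ 0 ≤ c.wt) :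
    ∀ d ∈ c.step, (∀ P ∈ d.todo, P.Admissible) ∧ 0 ≤ d.wt := by
  obtain ⟨todo, bits, qubits, fresh, vec, wt⟩ := c
  obtain ⟨h1, h2⟩ := h
  intro d hd
  rcases todo with _ | ⟨P, K⟩
  · simp only [step, List.mem_singleton] at hd; subst hd; exact ⟨h1, h2⟩
  simp only [List.mem_cons, forall_eq_or_imp] at h1
  cases P <;> simp only [step] at hd <;> (try split at hd) <;>
    simp only [List.mem_cons, List.map_cons, List.map_nil, List.not_mem_nil,
      or_false] at hd <;> (first | subst hd | (rcases hd with hd | hd <;> subst hd)) <;>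
    simp_all [Cmd.Admissible, mul_nonneg]

theorem run_wt {T : ℕ} {c : Config} (h : (∀ P ∈ c.todo, P.Admissible) ∧ 0 ≤ c.wt) :
    ∀ d ∈ run T c, 0 ≤ d.wt :=
  fun d hd => (run_induction (p := fun c => (∀ P ∈ c.todo, P.Admissible) ∧ 0 ≤ c.wt)
    (fun _ hc => step_wt hc) T c h d hd).2

end Config

/-! ## Relocation of programs -/

/-- The program with bit stacks renamed by `σ` and qubit stacks by `ρ`. -/
def Cmd.relocate (σ ρ : ℕ → ℕ) : Cmd → Cmd
  | .skip => .skip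
  | .push i b => .push (σ i) b
  | .drop i => .drop (σ i)
  | .seq c d => .seq (c.relocate σ ρ) (d.relocate σ ρ)
  | .branch i e z o => .branch (σ i) (e.relocate σ ρ) (z.relocate σ ρ) (o.relocate σ ρ)
  | .loop i c => .loop (σ i) (c.relocate σ ρ)
  | .coin p i => .coin p (σ i)
  | .qnew i => .qnew (ρ i)
  | .qmove i j => .qmove (ρ i) (ρ j)
  | .qgate k U r => .qgate k U (fun j => ρ (r j))
  | .qmeas i j => .qmeas (ρ i) (σ j)

theorem Cmd.Admissible.relocate {P : Cmd} (h : P.Admissible) (σ ρ) :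
    (P.relocate σ ρ).Admissible := by
  induction P <;> simp_all [Cmd.relocate, Cmd.Admissible]

theorem Cmd.Classical.relocate {P : Cmd} (h : P.Classical) (σ ρ) :
    (P.relocate σ ρ).Classical := by
  induction P <;> simp_all [Cmd.relocate, Cmd.Classical]

theorem extend_comp_injective {α β γ δ : Type*} {e : β → γ} (he : Function.Injective e) (r : α → β)
    (u : α → δ) (s : β → δ) (g : γ → δ) :
    Function.extend (e ∘ r) u (Function.extend e s g) =
      Function.extend e (Function.extend r u s) g := by
  funext l
  by_cases h : ∃ i, e i = l
  · obtain ⟨i, rfl⟩ := h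
    rw [he.extend_apply]
    have hp : (fun j => (e ∘ r) j = e i) = (fun j => r j = i) := by
      funext j; simp [he.eq_iff]
    simp only [Function.extend]
    simp only [hp]
    split
    · rfl
    · next h => exact he.extend_apply s g i
  · rw [Function.extend_apply' _ _ _ h, Function.extend_apply', Function.extend_apply' _ _ _ h]
    rintro ⟨j, hj⟩
    exact h ⟨r j, hj⟩

/-- `c'` does what `c` does on relocated stacks and relabelled qubits, as part of a larger state of
which the other qubits have the basis state `γ` and the other bit stacks the contents `B`. -/
structure Simulates (σ ρ e : ℕ → ℕ) (d : ℕ) (γ : ℕ → Bool) (B : ℕ → BitStr) (w : ℝ)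
    (c c' : Config) : Prop where
  todo : c'.todo = c.todo.map (Cmd.relocate σ ρ)
  bits : ∀ i, c'.bits (σ i) = c.bits i
  frame : ∀ i, i ∉ Set.range σ → c'.bits i = B i
  qubits : ∀ i, c'.qubits (ρ i) = (c.qubits i).map e
  fresh : c'.fresh = c.fresh + d
  label : ∀ i, c.fresh ≤ i → e i = i + d
  vec : ∀ s, c.vec s = c'.vec (Function.extend e s γ)
  wt : c'.wt = w * c.wt

section
variable {σ ρ e : ℕ → ℕ} {d : ℕ} {γ : ℕ → Bool} {B : ℕ → BitStr} {w : ℝ}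

theorem applyGate_extend {e : ℕ → ℕ} (he : Function.Injective e) {k : ℕ} (U : QOp k)
    (r : Fin k ↪ ℕ) (r' : Fin k ↪ ℕ) (hr : ∀ j, r' j = e (r j)) (γ : ℕ → Bool)
    {ω ω' : (ℕ → Bool) → ℂ} (h : ∀ s, ω s = ω' (Function.extend e s γ)) (s : ℕ → Bool) :
    applyGate U r ω s = applyGate U r' ω' (Function.extend e s γ) := by
  simp only [applyGate]
  refine Finset.sum_congr rfl fun u _ => ?_
  have h1 : (r' : Fin k → ℕ) = e ∘ r := funext hr
  rw [h1, extend_comp_injective he, ← h]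
  simp [he.extend_apply]

theorem Simulates.step (hσ : Function.Injective σ) (hρ : Function.Injective ρ)
    (he : Function.Injective e) {c c' : Config} (h : Simulates σ ρ e d γ B w c c') :
    List.Forall₂ (Simulates σ ρ e d γ B w) c.step c'.step := by
  obtain ⟨todo, bits, qubits, fresh, vec, wt⟩ := c
  obtain ⟨todo', bits', qubits', fresh', vec', wt'⟩ := c'
  obtain ⟨h1, h2, h3, h4, h5, h6, h7, h8⟩ := h
  simp only at h1 h2 h3 h4 h5 h6 h7 h8
  have hub : ∀ (i : ℕ) (x : BitStr) (j : ℕ),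
      Function.update bits' (σ i) x (σ j) = Function.update bits i x j := by
    intro i x j; simp only [Function.update_apply, hσ.eq_iff, h2]
  have huf : ∀ (i : ℕ) (x : BitStr) (j : ℕ), j ∉ Set.range σ →
      Function.update bits' (σ i) x j = B j := by
    intro i x j hj
    rw [Function.update_of_ne, h3 j hj]
    rintro rfl; exact hj ⟨i, rfl⟩
  rcases todo with _ | ⟨P, K⟩
  · simp only [List.map_nil] at h1; subst h1
    simp only [Config.step]
    exact .cons ⟨rfl, h2, h3, h4, h5, h6, h7, h8⟩ .nil
  simp only [List.map_cons] at h1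
  subst h1
  cases P with
  | skip => exact .cons ⟨rfl, h2, h3, h4, h5, h6, h7, h8⟩ .nil
  | push i b =>
    refine .cons ⟨rfl, ?_, ?_, h4, h5, h6, h7, h8⟩ .nil
    · intro j; simp only [h2]; exact hub i _ j
    · intro j hj; exact huf i _ j hj
  | drop i =>
    refine .cons ⟨rfl, ?_, ?_, h4, h5, h6, h7, h8⟩ .nil
    · intro j; simp only [h2]; exact hub i _ j
    · intro j hj; exact huf i _ j hj
  | seq a b => exact .cons ⟨rfl, h2, h3, h4, h5, h6, h7, h8⟩ .nil
  | branch i x y z =>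
    simp only [Config.step, Cmd.relocate, h2]
    split <;> exact .cons ⟨rfl, h2, h3, h4, h5, h6, h7, h8⟩ .nil
  | loop i a =>
    simp only [Config.step, Cmd.relocate, h2]
    split <;> exact .cons ⟨rfl, h2, h3, h4, h5, h6, h7, h8⟩ .nil
  | coin p i =>
    simp only [Config.step, Cmd.relocate]
    refine .cons ⟨rfl, ?_, ?_, h4, h5, h6, h7, ?_⟩
      (.cons ⟨rfl, ?_, ?_, h4, h5, h6, h7, ?_⟩ .nil)
    · intro j; simp only [h2]; exact hub i _ j
    · intro j hj; exact huf i _ j hj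
    · simp [h8, mul_assoc]
    · intro j; simp only [h2]; exact hub i _ j
    · intro j hj; exact huf i _ j hj
    · simp [h8, mul_assoc]
  | qnew i =>
    simp only [Config.step, Cmd.relocate]
    refine .cons ⟨rfl, h2, h3, ?_, ?_, ?_, h7, h8⟩ .nil
    · intro j; simp only [Function.update_apply, hρ.eq_iff]
      split
      · simp [h4, h5, h6]
      · exact h4 j
    · simp only; omega
    · intro j hj; exact h6 j (by simp only at hj; omega)
  | qmove i j =>
    simp only [Config.step, Cmd.relocate, h4]
    rcases hq : qubits i with _ | ⟨q, rest⟩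
    · simp only [List.map_nil]
      exact .cons ⟨rfl, h2, h3, h4, h5, h6, h7, h8⟩ .nil
    · simp only [List.map_cons]
      refine .cons ⟨rfl, h2, h3, ?_, h5, h6, h7, h8⟩ .nil
      intro l; simp only [Function.update_apply, hρ.eq_iff]
      split <;> (try split) <;> simp [h4]
  | qgate k U r =>
    have hiff : (∃ w : Fin k ↪ ℕ, ∀ j, (qubits (r j)).head? = some (w j)) ↔
        ∃ w : Fin k ↪ ℕ, ∀ j, (qubits' (ρ (r j))).head? = some (w j) := by
      simp only [h4, List.head?_map]
      constructor
      · rintro ⟨w, hw⟩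
        exact ⟨w.trans ⟨e, he⟩, fun j => by simp [hw]⟩
      · rintro ⟨w', hw⟩
        have : ∀ j, ∃ q, (qubits (r j)).head? = some q ∧ e q = w' j := by
          intro j
          have := hw j
          rw [Option.map_eq_some_iff] at this
          exact this
        choose f hf1 hf2 using this
        refine ⟨⟨f, fun a b hab => w'.injective ?_⟩, hf1⟩
        rw [← hf2, ← hf2, hab]
    by_cases hw : ∃ w : Fin k ↪ ℕ, ∀ j, (qubits (r j)).head? = some (w j)
    · have hw' := hiff.1 hw
      simp only [Config.step, Cmd.relocate, dif_pos hw, dif_pos hw']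
      refine .cons ⟨rfl, h2, h3, h4, h5, h6, ?_, h8⟩ .nil
      refine applyGate_extend he U _ _ ?_ γ h7
      intro j
      have a1 := hw.choose_spec j
      have a2 := hw'.choose_spec j
      rw [h4, List.head?_map, a1] at a2
      simpa using a2.symm
    · have hw' := fun x => hw (hiff.2 x)
      simp only [Config.step, Cmd.relocate, dif_neg hw, dif_neg hw']
      exact .cons ⟨rfl, h2, h3, h4, h5, h6, h7, h8⟩ .nil
  | qmeas i j =>
    simp only [Config.step, Cmd.relocate, h4]
    rcases hq : qubits i with _ | ⟨q, rest⟩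
    · simp only [List.map_nil]
      exact .cons ⟨rfl, h2, h3, h4, h5, h6, h7, h8⟩ .nil
    · simp only [List.map_cons, List.map_nil]
      have hqs : ∀ l, Function.update qubits' (ρ i) (List.map e rest) (ρ l) =
          List.map e (Function.update qubits i rest l) := by
        intro l; simp only [Function.update_apply, hρ.eq_iff]
        split <;> simp [h4]
      have hv : ∀ (b : Bool) (s : ℕ → Bool), (if s q = b then vec s else 0) =
          if Function.extend e s γ (e q) = b then vec' (Function.extend e s γ) else 0 := by
        intro b s; rw [he.extend_apply, h7]
      refine .cons ⟨rfl, ?_, ?_, hqs, h5, h6, hv true, h8⟩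
        (.cons ⟨rfl, ?_, ?_, hqs, h5, h6, hv false, h8⟩ .nil)
      · intro l; simp only [h2]; exact hub j _ l
      · intro l hl; exact huf j _ l hl
      · intro l; simp only [h2]; exact hub j _ l
      · intro l hl; exact huf j _ l hl

theorem List.Forall₂.flatMap' {α β γ δ : Type*} {R : α → β → Prop} {S : γ → δ → Prop}
    {f : α → List γ} {g : β → List δ} (hfg : ∀ a b, R a b → List.Forall₂ S (f a) (g b))
    {l : List α} {l' : List β} (h : List.Forall₂ R l l') :
    List.Forall₂ S (l.flatMap f) (l'.flatMap g) := by
  induction h with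
  | nil => exact .nil
  | cons h1 _ ih => simp only [List.flatMap_cons]; exact List.rel_append (hfg _ _ h1) ih

theorem Simulates.run (hσ : Function.Injective σ) (hρ : Function.Injective ρ)
    (he : Function.Injective e) (T : ℕ) {c c' : Config} (h : Simulates σ ρ e d γ B w c c') :
    List.Forall₂ (Simulates σ ρ e d γ B w) (c.run T) (c'.run T) := by
  induction T generalizing c c' with
  | zero => exact .cons h .nil
  | succ T ih =>
    rw [Config.run_succ, Config.run_succ]
    exact List.Forall₂.flatMap' (fun _ _ h => ih h) (h.step hσ hρ he)

end

/-! ### Output states -/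

/-- The assignments of the qubits created so far. -/
def assignments (F : ℕ) : Finset (ℕ → Bool) :=
  Finset.univ.image (fun (s : Bits F) (i : ℕ) => if h : i < F then s ⟨i, h⟩ else false)

theorem mem_assignments {F : ℕ} {s : ℕ → Bool} : s ∈ assignments F ↔ ∀ i, F ≤ i → s i = false := by
  simp only [assignments, Finset.mem_image, Finset.mem_univ, true_and]
  constructor
  · rintro ⟨t, rfl⟩ i hi; simp; omega
  · intro h
    refine ⟨fun i => s i, funext fun i => ?_⟩
    by_cases hi : i < F
    · simp [hi]
    · simp [hi, h i (by omega)]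

/-- The labels of the output qubits. -/
def Config.labels (m : ℕ) (c : Config) : Fin m → ℕ := fun j => (c.qubits 0).getD j 0

theorem Config.qout_eq (m : ℕ) (c : Config) :
    c.qout m = (c.wt : ℂ) • reduceTo (assignments c.fresh) (c.labels m) c.vec := rfl

/-- The basis states of the qubits that are not output. -/
def Config.garbage (m : ℕ) (c : Config) : Finset (ℕ → Bool) :=
  (assignments c.fresh).filter (fun s => ∀ j, s (c.labels m j) = false)

/-- The (unnormalised) state of the output qubits if the others are found in the basis state `γ`. -/
def Config.relative (m : ℕ) (c : Config) (γ : ℕ → Bool) : Bits m → ℂ :=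
  fun u => c.vec (Function.extend (c.labels m) u γ)

theorem Config.qout_eq_sum (m : ℕ) (c : Config) :
    c.qout m = (c.wt : ℂ) • ∑ γ ∈ c.garbage m, ketbra (c.relative m γ) := by
  rw [qout_eq]
  congr 1
  funext u v
  rw [Matrix.sum_apply]
  rfl

theorem sum_ketbra_split {m d F : ℕ} {e : ℕ → ℕ} (he : Function.Injective e)
    (hd : ∀ i, F ≤ i → e i = i + d) (r : Fin m → ℕ)
    (Γ : Finset (ℕ → Bool)) (hΓ : ∀ γ, γ ∈ Γ ↔ (∀ i, F + d ≤ i → γ i = false) ∧ ∀ i, γ (e i) = false)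
    (ω : (ℕ → Bool) → ℂ) :
    reduceTo (assignments (F + d)) (e ∘ r) ω =
      ∑ γ ∈ Γ, reduceTo (assignments F) r (fun s => ω (Function.extend e s γ)) := by
  funext u v
  rw [Matrix.sum_apply]
  simp only [reduceTo]
  rw [← Finset.sum_product']
  symm
  refine Finset.sum_bij' (i := fun x _ => Function.extend e x.2 x.1)
    (j := fun s _ => (fun l => if l ∈ Set.range e then false else s l, s ∘ e)) ?_ ?_ ?_ ?_ ?_
  · rintro ⟨γ, s⟩ hx
    simp only [Finset.mem_product, Finset.mem_filter, hΓ, mem_assignments] at hx ⊢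
    obtain ⟨⟨h1, h2⟩, h3, h4⟩ := hx
    refine ⟨fun i hi => ?_, fun j => ?_⟩
    · have : e (i - d) = i := by rw [hd _ (by omega)]; omega
      rw [← this, he.extend_apply]; exact h3 _ (by omega)
    · simp only [Function.comp_apply, he.extend_apply]; exact h4 j
  · intro s hs
    simp only [Finset.mem_product, Finset.mem_filter, hΓ, mem_assignments] at hs ⊢
    obtain ⟨h1, h2⟩ := hs
    refine ⟨⟨fun i hi => ?_, fun i => by simp⟩, fun i hi => ?_, h2⟩
    · simp [h1 i hi]
    · simp only [Function.comp_apply]; rw [hd i hi]; exact h1 _ (by omega)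
  · rintro ⟨γ, s⟩ hx
    simp only [Finset.mem_product, Finset.mem_filter, hΓ, mem_assignments] at hx
    obtain ⟨⟨h1, h2⟩, h3, h4⟩ := hx
    ext l
    · simp only
      split
      · next h => obtain ⟨i, rfl⟩ := h; rw [h2]
      · next h => rw [Function.extend_apply' _ _ _ h]
    · simp [he.extend_apply]
  · intro s hs
    funext l
    by_cases h : l ∈ Set.range e
    · obtain ⟨i, rfl⟩ := h; rw [he.extend_apply]; rfl
    · rw [Function.extend_apply' _ _ _ h]; exact if_neg h
  · rintro ⟨γ, s⟩ hx
    simp only [extend_comp_injective he]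

/-! ## Deterministic programs on bit stacks -/

def Config.withBits (c : Config) (B : ℕ → BitStr) : Config := { c with todo := [], bits := B }

/-- `P` turns the contents `B` of the bit stacks into `B'` in at most `t` steps, and does nothing
else. -/
def Det (P : Cmd) (B B' : ℕ → BitStr) (t : ℕ) : Prop :=
  ∀ c : Config, c.bits = B → Config.Yields [P] c t [c.withBits B']

theorem Det.mono {P B B' t t'} (h : Det P B B' t) (ht : t ≤ t') : Det P B B' t' :=
  fun c hc => (h c hc).mono ht

theorem Det.seq {P Q : Cmd} {B B' B'' : ℕ → BitStr} {t u : ℕ} (h : Det P B B' t)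
    (h' : Det Q B' B'' u) : Det (.seq P Q) B B'' (t + u + 1) := by
  intro c hc
  exact Config.Yields.seq_one (h c hc) (h' (c.withBits B') rfl)

theorem Det.skip (B : ℕ → BitStr) : Det .skip B B 1 := by
  intro c hc
  subst hc
  exact ⟨rfl, by simp [Config.withBits]⟩

theorem Det.drop (B : ℕ → BitStr) (i : ℕ) :
    Det (.drop i) B (Function.update B i (B i).tail) 1 := by
  intro c hc
  subst hc
  exact ⟨rfl, by simp [Config.withBits]⟩

theorem Det.push (B : ℕ → BitStr) (i : ℕ) (b : Bool) :
    Det (.push i b) B (Function.update B i (b :: B i)) 1 := by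
  intro c hc
  subst hc
  exact ⟨rfl, by simp [Config.withBits]⟩

theorem Det.branch {B B' : ℕ → BitStr} {i : ℕ} {e z o : Cmd} {t : ℕ}
    (h : Det (match B i with | [] => e | false :: _ => z | true :: _ => o) B B' t) :
    Det (.branch i e z o) B B' (t + 1) := by
  intro c hc
  have := h c hc
  refine Config.Yields.of_step
    (d := c.withTodo [match B i with | [] => e | false :: _ => z | true :: _ => o]) ?_ this
  subst hc
  simp only [Config.step, Config.withTodo]
  rcases c.bits i with _ | ⟨_ | _, _⟩ <;> rfl

theorem Det.loop_nil {B : ℕ → BitStr} {i : ℕ} {P : Cmd} (h : B i = []) :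
    Det (.loop i P) B B 1 := by
  intro c hc
  subst hc
  refine ⟨?_, by simp [Config.withBits]⟩
  rw [Config.run_succ]
  simp [Config.step, Config.withTodo, h, Config.withBits]

theorem Det.loop_cons {B B' B'' : ℕ → BitStr} {i : ℕ} {P : Cmd} {t u : ℕ} (h : B i ≠ [])
    (h1 : Det P B B' t) (h2 : Det (.loop i P) B' B'' u) :
    Det (.loop i P) B B'' (t + u + 1) := by
  intro c hc
  refine Config.Yields.of_step (d := c.withTodo [P, .loop i P]) ?_ ?_
  · subst hc
    simp only [Config.step, Config.withTodo]
    rcases hb : c.bits i with _ | ⟨_, _⟩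
    · exact absurd hb h
    · rfl
  · have := Config.Yields.append (c := c) (G := fun _ => [c.withBits B'']) (h1 c hc) (T' := u)
      (K' := [.loop i P]) (by
        intro d hd
        rw [List.mem_singleton] at hd
        subst hd
        exact h2 (c.withBits B') rfl)
    simp only [List.flatMap_cons, List.flatMap_nil, List.append_nil] at this
    exact this

/-- Empty the stack `i`. -/
def Cmd.clear (i : ℕ) : Cmd := .loop i (.drop i)

theorem Det.clear (B : ℕ → BitStr) (i : ℕ) :
    Det (.clear i) B (Function.update B i []) (2 * (B i).length + 1) := by
  generalize hl : B i = l
  induction l generalizing B with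
  | nil => rw [show Function.update B i [] = B by rw [← hl]; simp]; exact Det.loop_nil hl
  | cons b l ih =>
    have := ih (Function.update B i (B i).tail) (by simp [hl])
    rw [Function.update_idem] at this
    exact (Det.loop_cons (by simp [hl]) (Det.drop B i) this).mono (by simp; omega)

/-- Empty the stacks in the list. -/
def Cmd.clearAll : List ℕ → Cmd
  | [] => .skip
  | i :: l => .seq (.clear i) (.clearAll l)

theorem Det.clearAll (l : List ℕ) (B : ℕ → BitStr) (M : ℕ) (hM : ∀ i, (B i).length ≤ M) :
    Det (.clearAll l) B (fun i => if i ∈ l then [] else B i) ((2 * M + 2) * l.length + 1) := by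
  induction l generalizing B with
  | nil => exact (Det.skip B).mono (by simp)
  | cons i l ih =>
    have h1 := Det.clear B i
    have h2 := ih (Function.update B i []) (by
      intro j; simp only [Function.update_apply]; split <;> simp [hM])
    have h3 := h1.seq h2
    have hB : (fun j => if j ∈ l then [] else Function.update B i [] j) =
        fun j => if j ∈ i :: l then [] else B j := by
      funext j
      simp only [List.mem_cons, Function.update_apply]
      by_cases h : j = i <;> simp [h]
    rw [hB] at h3
    refine h3.mono ?_
    · have := hM i
      simp only [List.length_cons]; nlinarith

theorem Cmd.clearAll_admissible (l : List ℕ) : (Cmd.clearAll l).Admissible := by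
  induction l with
  | nil => trivial
  | cons i l ih => exact ⟨trivial, ih⟩

theorem Cmd.clearAll_classical (l : List ℕ) : (Cmd.clearAll l).Classical := by
  induction l with
  | nil => trivial
  | cons i l ih => exact ⟨trivial, ih⟩

/-! ## Realisation of quantum algorithms by programs -/

theorem eval_mono (p : Polynomial ℕ) {x y : ℕ} (h : x ≤ y) : p.eval x ≤ p.eval y := by
  rw [Polynomial.eval_eq_sum, Polynomial.eval_eq_sum]
  exact Finset.sum_le_sum fun i _ => Nat.mul_le_mul_left _ (Nat.pow_le_pow_left h _)

/-- The initial state. -/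
def startConfig {a n : ℕ} (x : Fin a → BitStr) (φ : Bits n → ℂ) : Config :=
  (Cmd.skip.initial x φ).withTodo []

theorem initial_eq {a n : ℕ} (P : Cmd) (x : Fin a → BitStr) (φ : Bits n → ℂ) :
    P.initial x φ = (startConfig x φ).withTodo [P] := rfl

/-- The strings on the bit stacks at the start. -/
def startBits {a : ℕ} (x : Fin a → BitStr) : ℕ → BitStr :=
  fun i => if h : i < a then x ⟨i, h⟩ else []

theorem startConfig_bits {a n : ℕ} (x : Fin a → BitStr) (φ : Bits n → ℂ) :
    (startConfig x φ).bits = startBits x := rfl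

theorem startBits_length {a : ℕ} (x : Fin a → BitStr) (i : ℕ) :
    (startBits x i).length ≤ inputSize x := by
  simp only [startBits]
  split
  · next h =>
    exact Finset.single_le_sum (f := fun i => (x i).length) (fun _ _ => Nat.zero_le _)
      (Finset.mem_univ _)
  · simp

/-- The sum of the output states of the branches with output strings `o`. -/
def outSum (b m : ℕ) (L : List Config) (o : Fin b → BitStr) : QOp m :=
  ((L.filter (fun c => c.out b = o)).map (Config.qout m)).sum

theorem outSum_nil (b m : ℕ) (o) : outSum b m [] o = 0 := rfl

theorem outSum_cons (b m : ℕ) (c : Config) (L o) :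
    outSum b m (c :: L) o = (if c.out b = o then c.qout m else 0) + outSum b m L o := by
  simp only [outSum, List.filter_cons]
  by_cases h : c.out b = o <;> simp [h]

theorem outSum_append (b m : ℕ) (L L' : List Config) (o) :
    outSum b m (L ++ L') o = outSum b m L o + outSum b m L' o := by
  simp [outSum]

theorem outSum_flatMap (b m : ℕ) (L : List Config) (G : Config → List Config) (o) :
    outSum b m (L.flatMap G) o = (L.map (fun c => outSum b m (G c) o)).sum := by
  induction L with
  | nil => rfl
  | cons c L ih => simp [outSum_append, ih]

theorem outSum_eq_zero {b m : ℕ} {L : List Config} {o} (h : ∀ c ∈ L, c.out b ≠ o) :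
    outSum b m L o = 0 := by
  rw [outSum, List.filter_eq_nil_iff.2]
  · rfl
  · simpa using h

theorem finsum_outSum {b m d r : ℕ} (g : QAlg b d m r) (hg : ∀ y, IsLinearMap ℂ (g y))
    (L : List Config) (o) :
    ∑ᶠ y, g y (outSum b m L y) o = (L.map (fun c => g (c.out b) (c.qout m) o)).sum := by
  have hz : ∀ y, g y 0 o = 0 := fun y => by rw [(hg y).map_zero]; rfl
  induction L with
  | nil => simp [outSum_nil, hz]
  | cons c L ih =>
    have hfin : (Function.support fun y => g y (outSum b m L y) o).Finite := by
      refine Set.Finite.subset (List.finite_toSet (L.map (Config.out b))) ?_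
      intro y hy
      by_contra hn
      refine hy ?_
      simp only
      rw [outSum_eq_zero, hz]
      intro c hc hcy
      exact hn (List.mem_map.2 ⟨c, hc, hcy⟩)
    have hone : (Function.support fun y => g y (if c.out b = y then c.qout m else 0) o).Finite := by
      refine Set.Finite.subset (Set.finite_singleton (c.out b)) ?_
      intro y hy
      by_contra hn
      refine hy ?_
      simp only
      rw [if_neg (fun h => hn h.symm), hz]
    simp only [outSum_cons, (hg _).map_add, Pi.add_apply]
    rw [finsum_add_distrib hone hfin, ih, List.map_cons, List.sum_cons,
      finsum_eq_single _ (c.out b)]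
    · simp
    · intro y hy
      rw [if_neg (Ne.symm hy), hz]

/-- `P` computes `f` in polynomial time. -/
def Realizes {a b n m : ℕ} (P : Cmd) (f : QAlg a b n m) : Prop :=
  ∃ p : Polynomial ℕ, ∀ (x : Fin a → BitStr) (φ : Bits n → ℂ), ∃ L : List Config,
    Config.Yields [P] (startConfig x φ) (p.eval (inputSize x)) L ∧
    (∀ c ∈ L, (c.qubits 0).length = m) ∧ ∀ o, f x (ketbra φ) o = outSum b m L o

/-- There is a program for `f`, which is classical if `cl` holds. -/
def Computable (cl : Prop) {a b n m : ℕ} (f : QAlg a b n m) : Prop :=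
  ∃ P : Cmd, P.Admissible ∧ (cl → P.Classical) ∧ Realizes P f

theorem isQPT_iff {a b n m : ℕ} {f : QAlg a b n m} :
    IsQPT f ↔ (∀ x, IsLinearMap ℂ (f x)) ∧ Computable False f := by
  refine and_congr Iff.rfl ⟨?_, ?_⟩
  · rintro ⟨P, hP, p, h⟩
    refine ⟨P, hP, False.elim, p, fun x φ => ⟨_, ⟨rfl, fun c hc => ((h x φ).1 c hc).1⟩,
      fun c hc => ((h x φ).1 c hc).2, (h x φ).2⟩⟩
  · rintro ⟨P, hP, -, p, h⟩
    refine ⟨P, hP, p, fun x φ => ?_⟩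
    obtain ⟨L, ⟨h1, h2⟩, h3, h4⟩ := h x φ
    have h1' : Config.run (p.eval (inputSize x)) (P.initial x φ) = L := h1
    simp only [h1']
    exact ⟨fun c hc => ⟨h2 c hc, h3 c hc⟩, h4⟩

/-! ### Composition -/

/-- The second program is started on the output of the first one. -/
def Cmd.comp (P Q : Cmd) (a b : ℕ) : Cmd :=
  let N := max P.bound (max a b) + 1
  .seq P (.seq (.clearAll ((List.range N).filter (b ≤ ·)))
    (Q.relocate id (fun i => if i = 0 then 0 else i + N)))

theorem outSum_simulates {b m d : ℕ} {ρ e : ℕ → ℕ} (hρ0 : ρ 0 = 0) (he : Function.Injective e)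
    {B : ℕ → BitStr} {w : ℝ} (Γ : Finset (ℕ → Bool)) (hΓn : Γ.Nonempty) (L' : List Config)
    (G : (ℕ → Bool) → List Config)
    (hL : ∀ γ ∈ Γ, List.Forall₂ (Simulates id ρ e d γ B w) (G γ) L')
    (hlen : ∀ γ ∈ Γ, ∀ c ∈ G γ, (c.qubits 0).length = m)
    (hΓ : ∀ c' ∈ L', ∀ γ, γ ∈ Γ ↔ (∀ i, c'.fresh ≤ i → γ i = false) ∧ ∀ i, γ (e i) = false)
    (o : Fin b → BitStr) :
    outSum b m L' o = (w : ℂ) • ∑ γ ∈ Γ, outSum b m (G γ) o := by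
  induction L' generalizing G with
  | nil =>
    rw [Finset.sum_eq_zero, smul_zero]; · rfl
    intro γ hγ
    have := hL γ hγ
    rw [List.forall₂_nil_right_iff] at this
    rw [this]; rfl
  | cons c' L' ih =>
    have hex : ∀ γ ∈ Γ, ∃ c L, G γ = c :: L ∧ Simulates id ρ e d γ B w c c' ∧
        List.Forall₂ (Simulates id ρ e d γ B w) L L' := by
      intro γ hγ
      have := hL γ hγ
      rw [List.forall₂_cons_right_iff] at this
      obtain ⟨c, L, h1, h2, h3⟩ := this
      exact ⟨c, L, h3, h1, h2⟩
    have : Inhabited Config := ⟨c'⟩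
    choose! C LL hG hC hLL using hex
    rw [outSum_cons, ih LL hLL
      (fun γ hγ c hc => hlen γ hγ c (by rw [hG γ hγ]; exact List.mem_cons_of_mem _ hc))
      (fun c hc => hΓ c (List.mem_cons_of_mem _ hc))]
    have hsum : ∑ γ ∈ Γ, outSum b m (G γ) o =
        ∑ γ ∈ Γ, ((if (C γ).out b = o then (C γ).qout m else 0) + outSum b m (LL γ) o) :=
      Finset.sum_congr rfl fun γ hγ => by rw [hG γ hγ, outSum_cons]
    rw [hsum, Finset.sum_add_distrib, smul_add]
    congr 1
    have hout : ∀ γ ∈ Γ, (C γ).out b = c'.out b := fun γ hγ => by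
      funext j; exact ((hC γ hγ).bits j).symm
    by_cases ho : c'.out b = o
    · rw [if_pos ho]
      have : ∑ γ ∈ Γ, (if (C γ).out b = o then (C γ).qout m else 0) = ∑ γ ∈ Γ, (C γ).qout m :=
        Finset.sum_congr rfl fun γ hγ => by rw [if_pos (by rw [hout γ hγ, ho])]
      rw [this]
      obtain ⟨γ₀, hγ₀⟩ := hΓn
      have hF : c'.fresh = (C γ₀).fresh + d := (hC γ₀ hγ₀).fresh
      have hfr : ∀ γ ∈ Γ, (C γ).fresh = (C γ₀).fresh := fun γ hγ => by
        have := (hC γ hγ).fresh; omega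
      have hlab' : ∀ γ ∈ Γ, c'.labels m = e ∘ (C γ).labels m := fun γ hγ => by
        funext j
        have h1 := (hC γ hγ).qubits 0
        rw [hρ0] at h1
        have h2 := hlen γ hγ (C γ) (by rw [hG γ hγ]; exact List.mem_cons_self)
        have hj : (j : ℕ) < ((C γ).qubits 0).length := by rw [h2]; exact j.2
        simp [Config.labels, h1, List.getD_eq_getElem?_getD, hj]
      have hlab : ∀ γ ∈ Γ, (C γ).labels m = (C γ₀).labels m := fun γ hγ => by
        have := (hlab' γ hγ).symm.trans (hlab' γ₀ hγ₀)
        funext j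
        exact he (congrFun this j)
      rw [Config.qout_eq, hlab' γ₀ hγ₀, hF, sum_ketbra_split he (hC γ₀ hγ₀).label _ Γ
        (by rw [← hF]; exact hΓ c' List.mem_cons_self), Finset.smul_sum, Finset.smul_sum]
      refine Finset.sum_congr rfl fun γ hγ => ?_
      rw [Config.qout_eq, hfr γ hγ, hlab γ hγ, (hC γ₀ hγ₀).wt]
      have hwt : (C γ).wt = (C γ).wt := rfl
      rw [← funext (hC γ hγ).vec, smul_smul]
      have h1 := (hC γ hγ).wt
      have h2 := (hC γ₀ hγ₀).wt
      have h3 : w * (C γ₀).wt = w * (C γ).wt := h2.symm.trans h1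
      rw [h3]; push_cast; rfl
    · rw [if_neg ho, Finset.sum_eq_zero, smul_zero]
      intro γ hγ
      rw [if_neg (by rw [hout γ hγ]; exact ho)]

theorem Simulates.yields {σ ρ e : ℕ → ℕ} {d : ℕ} {γ : ℕ → Bool} {B : ℕ → BitStr} {w : ℝ}
    (hσ : Function.Injective σ) (hρ : Function.Injective ρ) (he : Function.Injective e)
    {P : Cmd} {c c' : Config} {T : ℕ} {L : List Config}
    (h : Simulates σ ρ e d γ B w (c.withTodo [P]) (c'.withTodo [P.relocate σ ρ]))
    (hL : Config.Yields [P] c T L) :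
    ∃ L', Config.Yields [P.relocate σ ρ] c' T L' ∧
      List.Forall₂ (Simulates σ ρ e d γ B w) L L' := by
  have h1 := h.run hσ hρ he T
  rw [hL.1] at h1
  refine ⟨_, ⟨rfl, ?_⟩, h1⟩
  intro y hy
  obtain ⟨i, hi, rfl⟩ := List.mem_iff_getElem.1 hy
  have hi' : i < L.length := by rw [h1.length_eq]; exact hi
  have h2 := List.forall₂_iff_get.1 h1
  have h3 := (h2.2 i hi' hi).todo
  simp only [List.get_eq_getElem] at h3
  rw [h3, hL.2 _ (List.getElem_mem hi')]
  rfl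

/-- The labels of the qubits `0, …, m-1`, which are `r`, and of those created later. -/
def embedLabels {m : ℕ} (r : Fin m → ℕ) (F : ℕ) : ℕ → ℕ :=
  fun i => if h : i < m then r ⟨i, h⟩ else i + (F - m)

theorem embedLabels_injective {m : ℕ} {r : Fin m → ℕ} {F : ℕ} (hr : Function.Injective r)
    (hF : ∀ j, r j < F) (hm : m ≤ F) : Function.Injective (embedLabels r F) := by
  intro i j hij
  simp only [embedLabels] at hij
  by_cases hi : i < m <;> by_cases hj : j < m
  · simp only [hi, hj, dif_pos] at hij; simpa using hr hij
  · simp only [hi, hj, dif_pos, dif_neg, not_false_eq_true] at hij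
    have := hF ⟨i, hi⟩; omega
  · simp only [hi, hj, dif_pos, dif_neg, not_false_eq_true] at hij
    have := hF ⟨j, hj⟩; omega
  · simp only [hi, hj, dif_neg, not_false_eq_true] at hij; omega

/-- A program that is started on the output of another one computes on each of the components of
its state. -/
theorem Config.WellFormed.continue {b m d r : ℕ} {c : Config} (hc : c.WellFormed)
    (hlen : (c.qubits 0).length = m) {N : ℕ} (hN : ∀ i, N ≤ i → c.qubits i = [])
    {Q : Cmd} {g : QAlg b d m r} (hg : ∀ y, IsLinearMap ℂ (g y)) {T : ℕ}
    (hQ : ∀ φ : Bits m → ℂ, ∃ L, Config.Yields [Q] (startConfig (c.out b) φ) T L ∧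
      (∀ c ∈ L, (c.qubits 0).length = r) ∧ ∀ o, g (c.out b) (ketbra φ) o = outSum d r L o) :
    ∃ L, Config.Yields [Q.relocate id (fun i => if i = 0 then 0 else i + N)]
        (c.withBits (fun i => if i < b then c.bits i else [])) T L ∧
      (∀ c ∈ L, (c.qubits 0).length = r) ∧
      ∀ o, g (c.out b) (c.qout m) o = outSum d r L o := by
  set ρ : ℕ → ℕ := fun i => if i = 0 then 0 else i + N with hρdef
  have hρ : Function.Injective ρ := by
    intro i j hij
    simp only [hρdef] at hij
    split at hij <;> split at hij <;> omega
  set lab := c.labels m with hlab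
  set F := c.fresh with hFdef
  have hgetD : ∀ j : Fin m, lab j = (c.qubits 0)[(j : ℕ)]'(by rw [hlen]; exact j.2) := fun j => by
    simp [hlab, Config.labels, List.getD_eq_getElem?_getD, hlen]
  have hlabinj : Function.Injective lab := by
    intro i j hij
    rw [hgetD, hgetD] at hij
    exact Fin.ext ((hc.nodup 0).getElem_inj_iff.1 hij)
  have hlabF : ∀ j, lab j < F := fun j => by
    rw [hgetD]; exact hc.lt 0 _ (List.getElem_mem _)
  have hmF : m ≤ F := by
    have : Fintype.card (Fin m) ≤ Fintype.card (Fin F) :=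
      Fintype.card_le_of_injective (fun j => ⟨lab j, hlabF j⟩)
        (fun i j hij => hlabinj (by simpa using hij))
    simpa using this
  set e := embedLabels lab F with hedef
  have he : Function.Injective e := embedLabels_injective hlabinj hlabF hmF
  have hge : ∀ i, F ≤ i → e (i - (F - m)) = i := fun i hi => by
    simp only [hedef, embedLabels]; rw [dif_neg (by omega)]; omega
  have hel : ∀ j : Fin m, e j = lab j := fun j => by simp [hedef, embedLabels]
  choose G hG1 hG2 hG3 using hQ
  have hsim : ∀ γ ∈ c.garbage m, Simulates id ρ e (F - m) γ (fun _ => []) c.wt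
      ((startConfig (c.out b) (c.relative m γ)).withTodo [Q])
      ((c.withBits (fun i => if i < b then c.bits i else [])).withTodo [Q.relocate id ρ]) := by
    intro γ hγ
    simp only [Config.garbage, Finset.mem_filter, mem_assignments] at hγ
    obtain ⟨hγ1, hγ2⟩ := hγ
    constructor
    · rfl
    · intro i
      change (if i < b then c.bits i else []) = startBits (c.out b) i
      simp only [startBits]
      split <;> rfl
    · intro i hi; exact absurd ⟨i, rfl⟩ hi
    · intro i
      change c.qubits (ρ i) = (if i = 0 then List.range m else []).map e
      by_cases hi : i = 0
      · subst hi
        simp only [hρdef, if_true]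
        refine List.ext_getElem (by simp [hlen]) fun k h1 h2 => ?_
        rw [List.getElem_map, List.getElem_range]
        have hk : k < m := by rw [hlen] at h1; exact h1
        exact ((hgetD ⟨k, hk⟩).symm.trans (hel ⟨k, hk⟩).symm)
      · simp only [hρdef, if_neg hi]
        exact hN _ (by omega)
    · change F = m + (F - m); omega
    · intro i hi
      change m ≤ i at hi
      simp only [hedef, embedLabels]; rw [dif_neg (by omega)]
    · intro s
      change (if ∀ i, m ≤ i → s i = false then c.relative m γ (fun j => s j) else 0) =
        c.vec (Function.extend e s γ)
      by_cases hs : ∀ i, m ≤ i → s i = false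
      · rw [if_pos hs]
        simp only [Config.relative]
        congr 1
        funext l
        by_cases hl : ∃ i, e i = l
        · obtain ⟨i, rfl⟩ := hl
          rw [he.extend_apply]
          by_cases hi : i < m
          · rw [show e i = lab ⟨i, hi⟩ from hel ⟨i, hi⟩, ← hlab, hlabinj.extend_apply]
          · have hei : F ≤ e i := by
              simp only [hedef, embedLabels]; rw [dif_neg hi]; omega
            rw [hs i (by omega), Function.extend_apply', hγ1 _ hei]
            rintro ⟨j, hj⟩
            rw [← hj] at hei
            exact absurd (hlabF j) (by rw [hlab]; omega)
        · rw [Function.extend_apply' _ _ _ hl, Function.extend_apply']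
          rintro ⟨j, hj⟩
          exact hl ⟨j, by rw [hel, hlab, hj]⟩
      · rw [if_neg hs]
        push Not at hs
        obtain ⟨i, hi, hsi⟩ := hs
        refine (hc.vec _ ⟨e i, ?_, ?_⟩).symm
        · simp only [hedef, embedLabels]; rw [dif_neg (by omega)]; omega
        · rw [he.extend_apply]; simpa using hsi
    · change c.wt = c.wt * 1; simp
  have hΓne : (c.garbage m).Nonempty := ⟨fun _ => false, by
    simp [Config.garbage, mem_assignments]⟩
  obtain ⟨γ₀, hγ₀⟩ := hΓne
  obtain ⟨L', hL', -⟩ := (hsim γ₀ hγ₀).yields Function.injective_id hρ he (hG1 _)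
  have hall : ∀ γ ∈ c.garbage m, List.Forall₂ (Simulates id ρ e (F - m) γ (fun _ => []) c.wt)
      (G (c.relative m γ)) L' := by
    intro γ hγ
    obtain ⟨L'', hL'', h⟩ := (hsim γ hγ).yields Function.injective_id hρ he (hG1 _)
    have : L'' = L' := by rw [← hL'.1, ← hL''.1]
    rwa [this] at h
  refine ⟨L', hL', ?_, ?_⟩
  · intro y hy
    have h1 := hall γ₀ hγ₀
    obtain ⟨i, hi, rfl⟩ := List.mem_iff_getElem.1 hy
    have hi' : i < (G (c.relative m γ₀)).length := by rw [h1.length_eq]; exact hi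
    have h3 := ((List.forall₂_iff_get.1 h1).2 i hi' hi).qubits 0
    simp only [List.get_eq_getElem] at h3
    rw [show (0 : ℕ) = ρ 0 from rfl, h3, List.length_map]
    exact hG2 _ _ (List.getElem_mem hi')
  · intro o
    rw [Config.qout_eq_sum, (hg _).map_smul]
    have hsum : g (c.out b) (∑ γ ∈ c.garbage m, ketbra (c.relative m γ)) =
        ∑ γ ∈ c.garbage m, g (c.out b) (ketbra (c.relative m γ)) :=
      map_sum (hg (c.out b)).mk' _ _
    rw [hsum, outSum_simulates (ρ := ρ) rfl he (c.garbage m) ⟨γ₀, hγ₀⟩ L'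
      (fun γ => G (c.relative m γ)) hall (fun γ _ => hG2 _) ?_, Pi.smul_apply, Finset.sum_apply]
    · simp only [hG3]
    · intro y hy γ
      have hfresh : F ≤ y.fresh := by
        have h1 := hall γ₀ hγ₀
        obtain ⟨i, hi, rfl⟩ := List.mem_iff_getElem.1 hy
        have hi' : i < (G (c.relative m γ₀)).length := by rw [h1.length_eq]; exact hi
        have h3 := ((List.forall₂_iff_get.1 h1).2 i hi' hi)
        have h4 := h3.fresh
        have h5 : m ≤ (G (c.relative m γ₀))[i].fresh := by
          have h6 := (hG1 (c.relative m γ₀)).1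
          exact Config.run_fresh _ _ (by rw [h6]; exact List.getElem_mem hi')
        simp only [List.get_eq_getElem] at h4
        omega
      simp only [Config.garbage, Finset.mem_filter, mem_assignments]
      constructor
      · rintro ⟨h1, h2⟩
        refine ⟨fun i hi => h1 i (by omega), fun i => ?_⟩
        by_cases hi : i < m
        · rw [show e i = lab ⟨i, hi⟩ from hel ⟨i, hi⟩]; exact h2 _
        · exact h1 _ (by simp only [hedef, embedLabels]; rw [dif_neg hi]; omega)
      · rintro ⟨h1, h2⟩
        refine ⟨fun i hi => ?_, fun j => ?_⟩
        · rw [← hge i hi]; exact h2 _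
        · rw [← hlab, ← hel j]; exact h2 _

theorem inputSize_le {a : ℕ} {x : Fin a → BitStr} {M : ℕ} (h : ∀ i, (x i).length ≤ M) :
    inputSize x ≤ a * M := by
  refine (Finset.sum_le_card_nsmul _ _ M fun i _ => h i).trans ?_
  simp

theorem Config.Yields.out_length {a b n : ℕ} {P : Cmd} {x : Fin a → BitStr} {φ : Bits n → ℂ} {T L}
    (h : Config.Yields [P] (startConfig x φ) T L) :
    ∀ c ∈ L, inputSize (c.out b) ≤ b * (inputSize x + T) := by
  intro c hc
  refine inputSize_le fun i => ?_
  rw [← h.1] at hc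
  refine (Config.run_length T c hc i).trans ?_
  rw [Config.withTodo_bits, startConfig_bits]
  exact Nat.add_le_add_right (startBits_length x i) T

theorem Config.Yields.out_bits_length {a n : ℕ} {P : Cmd} {x : Fin a → BitStr} {φ : Bits n → ℂ}
    {T L} (h : Config.Yields [P] (startConfig x φ) T L) :
    ∀ c ∈ L, ∀ i, (c.bits i).length ≤ inputSize x + T := by
  intro c hc i
  rw [← h.1] at hc
  refine (Config.run_length T c hc i).trans ?_
  rw [Config.withTodo_bits, startConfig_bits]
  exact Nat.add_le_add_right (startBits_length x i) T

theorem Realizes.comp {a b d n m r : ℕ} {P Q : Cmd} {f : QAlg a b n m} {g : QAlg b d m r}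
    (hf : Realizes P f) (hg : Realizes Q g) (hgl : ∀ y, IsLinearMap ℂ (g y)) :
    Realizes (Cmd.comp P Q a b) (fun x ρ o => ∑ᶠ y, g y (f x ρ y) o) := by
  obtain ⟨p, hp⟩ := hf
  obtain ⟨q, hq⟩ := hg
  set N := max P.bound (max a b) + 1 with hN
  set l := (List.range N).filter (b ≤ ·) with hl
  refine ⟨p + ((2 * (Polynomial.X + p) + 2) * (Polynomial.C l.length) + 1 +
    q.comp (Polynomial.C b * (Polynomial.X + p)) + 1) + 1, fun x φ => ?_⟩
  obtain ⟨L, hL, hlen, hout⟩ := hp x φ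
  set T := p.eval (inputSize x) with hT
  have hcont : ∀ c ∈ L, ∃ L', Config.Yields
      [.seq (.clearAll l) (Q.relocate id (fun i => if i = 0 then 0 else i + N))] c
      ((2 * (inputSize x + T) + 2) * l.length + 1 +
        q.eval (b * (inputSize x + T)) + 1) L' ∧ (∀ c ∈ L', (c.qubits 0).length = r) ∧
      ∀ o, g (c.out b) (c.qout m) o = outSum d r L' o := by
    intro c hc
    have hrun := hc
    rw [← hL.1] at hrun
    have hbound := Config.run_bound (N := N) (by simp [hN]; omega) c hrun
    have hwf := (Config.wellFormed_initial P x φ).run T c hrun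
    have hq0 : ∀ i, N ≤ i → c.qubits i = [] ∨ i = 0 := by
      intro i hi
      rw [(hbound i hi).2]
      by_cases h0 : i = 0
      · exact Or.inr h0
      · left; change (if i = 0 then List.range n else []) = []; rw [if_neg h0]
    have hclr := Det.clearAll l c.bits (inputSize x + T) (hL.out_bits_length c hc) c rfl
    have hB : (fun i => if i ∈ l then [] else c.bits i) = fun i => if i < b then c.bits i else [] := by
      funext i
      simp only [hl, List.mem_filter, List.mem_range, decide_eq_true_eq]
      by_cases h1 : i < b
      · rw [if_neg (by omega), if_pos h1]
      · rw [if_neg h1]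
        by_cases h2 : i < N
        · rw [if_pos ⟨h2, by omega⟩]
        · rw [if_neg (by omega), (hbound i (by omega)).1]
          change startBits x i = []
          simp only [startBits]
          rw [dif_neg]
          have : a ≤ N := by omega
          omega
    rw [hB] at hclr
    obtain ⟨L', h1, h2, h3⟩ := hwf.continue (hlen c hc)
        (fun i hi => (hq0 i hi).resolve_right (by omega)) hgl
        (T := q.eval (b * (inputSize x + T))) (Q := Q) (fun φ' => by
          obtain ⟨L', h1, h2, h3⟩ := hq (c.out b) φ'
          exact ⟨L', h1.mono (eval_mono q (hL.out_length c hc)), h2, h3⟩)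
    exact ⟨L', hclr.seq_one h1, h2, h3⟩
  choose! G hG using hcont
  refine ⟨L.flatMap G, ?_, ?_, ?_⟩
  · have := hL.seq (fun c hc => (hG c hc).1)
    simpa [Cmd.comp, T] using this
  · intro c hc
    obtain ⟨y, hy, hc⟩ := List.mem_flatMap.1 hc
    exact (hG y hy).2.1 c hc
  · intro o
    have h1 : (fun y => g y (f x (ketbra φ) y) o) = fun y => g y (outSum b m L y) o := by
      funext y; rw [hout]
    simp only [h1]
    rw [finsum_outSum g hgl, outSum_flatMap]
    congr 1
    exact List.map_congr_left fun c hc => (hG c hc).2.2 o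

/-! ### Other ways to build programs -/

theorem ketbra_zero_apply {n : ℕ} : ketbra (0 : Bits n → ℂ) = 0 := by
  funext u v; simp [ketbra]

theorem qout_startConfig {a n : ℕ} (x : Fin a → BitStr) (φ : Bits n → ℂ) :
    (startConfig x φ).qout n = ketbra φ := by
  have hl : (startConfig x φ).labels n = fun j : Fin n => (j : ℕ) := by
    funext j
    simp [Config.labels, startConfig, Cmd.initial, List.getD_eq_getElem?_getD]
  have hg : (startConfig x φ).garbage n = {fun _ => false} := by
    ext γ
    simp only [Config.garbage, Finset.mem_filter, mem_assignments, hl, Finset.mem_singleton]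
    constructor
    · rintro ⟨h1, h2⟩
      funext i
      by_cases hi : i < n
      · exact h2 ⟨i, hi⟩
      · exact h1 i (by change n ≤ i; omega)
    · rintro rfl; simp
  rw [Config.qout_eq_sum, hg, Finset.sum_singleton]
  have hr : (startConfig x φ).relative n (fun _ => false) = φ := by
    funext u
    rw [Config.relative, hl]
    change (if ∀ i, n ≤ i → Function.extend (fun j : Fin n => (j : ℕ)) u (fun _ => false) i = false
      then φ (fun j => Function.extend (fun j : Fin n => (j : ℕ)) u (fun _ => false) (j : ℕ)) else 0)
      = φ u
    rw [if_pos]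
    · congr 1; funext j
      exact Fin.val_injective.extend_apply u _ j
    · intro i hi
      rw [Function.extend_apply']
      rintro ⟨j, hj⟩
      have := j.2; omega
  rw [hr]
  change ((1 : ℝ) : ℂ) • ketbra φ = ketbra φ
  simp

/-- The state of the qubits is kept and the output strings are `F x`. -/
def relabelAlg {a b : ℕ} (n : ℕ) (F : (Fin a → BitStr) → (Fin b → BitStr)) : QAlg a b n n :=
  fun x ρ o => if o = F x then ρ else 0

theorem Realizes.of_det {a b n : ℕ} {P : Cmd} {F : (Fin a → BitStr) → (Fin b → BitStr)}
    (p : Polynomial ℕ)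
    (h : ∀ x, ∃ B', Det P (startBits x) B' (p.eval (inputSize x)) ∧ ∀ j : Fin b, B' j = F x j) :
    Realizes P (relabelAlg n F) := by
  refine ⟨p, fun x φ => ?_⟩
  obtain ⟨B', h1, h2⟩ := h x
  refine ⟨_, h1 (startConfig x φ) rfl, ?_, ?_⟩
  · intro c hc
    rw [List.mem_singleton] at hc
    subst hc
    change (List.range n).length = n
    simp
  · intro o
    rw [outSum_cons, outSum_nil, add_zero]
    have : ((startConfig x φ).withBits B').out b = F x := funext h2
    rw [this, show ((startConfig x φ).withBits B').qout n = ketbra φ from qout_startConfig x φ]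
    simp only [relabelAlg, eq_comm]

theorem outSum_forall₂ {b b' m : ℕ} {L L' : List Config} {R : Config → Config → Prop}
    (h : List.Forall₂ R L L') {w : ℝ} {o : Fin b → BitStr} {o' : Fin b' → BitStr}
    (hR : ∀ c c', c ∈ L → R c c' → (c'.out b' = o' ↔ c.out b = o) ∧ c'.qout m = (w : ℂ) • c.qout m) :
    outSum b' m L' o' = (w : ℂ) • outSum b m L o := by
  induction h with
  | nil => simp [outSum_nil]
  | cons h1 _ ih =>
    obtain ⟨h3, h4⟩ := hR _ _ List.mem_cons_self h1
    rw [outSum_cons, outSum_cons, ih (fun c c' hc => hR c c' (List.mem_cons_of_mem _ hc)),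
      smul_add]
    simp only [h3, h4]
    congr 1
    split <;> simp

/-- If only bit stacks are relocated, the qubits do not change. -/
theorem Simulates.qout {σ : ℕ → ℕ} {γ : ℕ → Bool} {B : ℕ → BitStr} {w : ℝ} {c c' : Config}
    (h : Simulates σ id id 0 γ B w c c') (m : ℕ) : c'.qout m = (w : ℂ) • c.qout m := by
  have h1 : c'.qubits = c.qubits := funext fun i => by have := h.qubits i; simpa using this
  have h2 : c'.fresh = c.fresh := h.fresh
  have h3 : c'.vec = c.vec := funext fun s => by
    rw [h.vec s]; congr 1; funext i
    exact (Function.injective_id.extend_apply s γ i).symm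
  rw [Config.qout_eq, Config.qout_eq, h.wt]
  have h4 : c'.labels m = c.labels m := by funext j; simp only [Config.labels, h1]
  simp only [h4, h2, h3, smul_smul]
  push_cast; rfl

/-- The first `r` strings are kept, and `f` is applied to the others. -/
def frameAlg (r : ℕ) {a b n m : ℕ} (f : QAlg a b n m) : QAlg (r + a) (r + b) n m :=
  fun x ρ o => if (fun i => o (Fin.castAdd b i)) = (fun i => x (Fin.castAdd a i)) then
    f (fun i => x (Fin.natAdd r i)) ρ (fun i => o (Fin.natAdd r i)) else 0

theorem inputSize_add {r a : ℕ} (x : Fin (r + a) → BitStr) :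
    inputSize x = inputSize (fun i => x (Fin.castAdd a i)) +
      inputSize (fun i => x (Fin.natAdd r i)) := by
  simp only [inputSize, Fin.sum_univ_add]

theorem Realizes.frame (r : ℕ) {a b n m : ℕ} {P : Cmd} {f : QAlg a b n m} (h : Realizes P f) :
    Realizes (P.relocate (r + ·) id) (frameAlg r f) := by
  obtain ⟨p, hp⟩ := h
  refine ⟨p, fun x φ => ?_⟩
  obtain ⟨L, hL, hlen, hout⟩ := hp (fun i => x (Fin.natAdd r i)) φ
  have hσ : Function.Injective (fun i : ℕ => r + i) := fun i j hij => by simpa using hij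
  have hsim : Simulates (r + ·) id id 0 (fun _ => false) (startBits x) 1
      ((startConfig (fun i => x (Fin.natAdd r i)) φ).withTodo [P])
      ((startConfig x φ).withTodo [P.relocate (r + ·) id]) := by
    constructor
    · rfl
    · intro i
      change startBits x (r + i) = startBits (fun i => x (Fin.natAdd r i)) i
      simp only [startBits]
      by_cases hi : i < a
      · rw [dif_pos (by omega), dif_pos hi]; rfl
      · rw [dif_neg (by omega), dif_neg hi]
    · intro i hi; rfl
    · intro i; simp; rfl
    · rfl
    · intro i _; rfl
    · intro s
      change (startConfig x φ).vec s = (startConfig x φ).vec _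
      congr 1; funext i
      exact (Function.injective_id.extend_apply s _ i).symm
    · change (1 : ℝ) = 1 * 1; simp
  obtain ⟨L', hL', hLL'⟩ := hsim.yields hσ Function.injective_id Function.injective_id hL
  refine ⟨L', hL'.mono (eval_mono p (by rw [inputSize_add x]; omega)), ?_, ?_⟩
  · intro y hy
    obtain ⟨i, hi, rfl⟩ := List.mem_iff_getElem.1 hy
    have hi' : i < L.length := by rw [hLL'.length_eq]; exact hi
    have h3 := ((List.forall₂_iff_get.1 hLL').2 i hi' hi).qubits 0
    simp only [List.get_eq_getElem, id] at h3
    rw [h3, List.length_map]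
    exact hlen _ (List.getElem_mem hi')
  · intro o
    simp only [frameAlg]
    by_cases ho : (fun i => o (Fin.castAdd b i)) = (fun i => x (Fin.castAdd a i))
    · rw [if_pos ho, hout, outSum_forall₂ (w := 1) (o := fun i => o (Fin.natAdd r i)) hLL']
      · simp
      · intro c c' _ hcc
        refine ⟨?_, hcc.qout m⟩
        rw [funext_iff, funext_iff, Fin.forall_fin_add]
        have h1 : ∀ i : Fin r, c'.out (r + b) (Fin.castAdd b i) = o (Fin.castAdd b i) := fun i => by
          rw [congrFun ho i]
          change c'.bits i = _
          rw [hcc.frame i]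
          · simp only [startBits]
            rw [dif_pos (by have := i.2; omega)]; rfl
          · rintro ⟨j, hj⟩; simp at hj; have := i.2; omega
        simp only [h1, true_and, implies_true]
        refine forall_congr' fun i => ?_
        rw [show c'.out (r + b) (Fin.natAdd r i) = c'.bits (r + i) from rfl, hcc.bits]
        rfl
    · rw [if_neg ho]
      symm
      refine outSum_eq_zero fun c' hc' hcon => ho ?_
      obtain ⟨i, hi, rfl⟩ := List.mem_iff_getElem.1 hc'
      have hi' : i < L.length := by rw [hLL'.length_eq]; exact hi
      have h3 := ((List.forall₂_iff_get.1 hLL').2 i hi' hi)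
      simp only [List.get_eq_getElem] at h3
      subst hcon
      funext j
      change (L'[i]).bits j = _
      rw [h3.frame j]
      · simp only [startBits]
        rw [dif_pos (by have := j.2; omega)]; rfl
      · rintro ⟨k, hk⟩; simp at hk; have := j.2; omega

/-- Continue with one of three algorithms, depending on the top of string `i`. -/
def branchAlg {a b n m : ℕ} (i : Fin a) (f g h : QAlg a b n m) : QAlg a b n m :=
  fun x => match x i with
    | [] => f x
    | false :: _ => g x
    | true :: _ => h x

theorem Realizes.branch {a b n m : ℕ} (i : Fin a) {P Q R : Cmd} {f g h : QAlg a b n m}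
    (hf : Realizes P f) (hg : Realizes Q g) (hh : Realizes R h) :
    Realizes (.branch i P Q R) (branchAlg i f g h) := by
  obtain ⟨p, hp⟩ := hf
  obtain ⟨q, hq⟩ := hg
  obtain ⟨r, hr⟩ := hh
  refine ⟨p + q + r + 1, fun x φ => ?_⟩
  have hb : (startConfig x φ).bits i = x i := by
    rw [startConfig_bits]; simp [startBits]
  simp only [Polynomial.eval_add, Polynomial.eval_one, branchAlg]
  rcases hx : x i with _ | ⟨_ | _, y⟩
  · obtain ⟨L, h1, h2⟩ := hp x φ
    refine ⟨L, Config.Yields.of_step (d := (startConfig x φ).withTodo [P]) ?_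
      (h1.mono (by omega)), h2⟩
    simp only [Config.step, Config.withTodo, hb, hx]
  · obtain ⟨L, h1, h2⟩ := hq x φ
    refine ⟨L, Config.Yields.of_step (d := (startConfig x φ).withTodo [Q]) ?_
      (h1.mono (by omega)), h2⟩
    simp only [Config.step, Config.withTodo, hb, hx]
  · obtain ⟨L, h1, h2⟩ := hr x φ
    refine ⟨L, Config.Yields.of_step (d := (startConfig x φ).withTodo [R]) ?_
      (h1.mono (by omega)), h2⟩
    simp only [Config.step, Config.withTodo, hb, hx]

theorem startBits_update {a : ℕ} (x : Fin a → BitStr) (i : Fin a) (s : BitStr) :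
    startBits (Function.update x i s) = Function.update (startBits x) i s := by
  funext j
  simp only [startBits, Function.update_apply]
  by_cases hj : j < a
  · simp only [hj, dif_pos, Fin.ext_iff]
  · have := i.2; rw [dif_neg hj, dif_neg hj, if_neg (by omega)]

theorem inputSize_update {a : ℕ} (x : Fin a → BitStr) (i : Fin a) (s : BitStr) :
    inputSize (Function.update x i s) ≤ inputSize x + s.length := by
  simp only [inputSize]
  rw [← Finset.sum_erase_add _ _ (Finset.mem_univ i)]
  simp only [Function.update_self]
  refine Nat.add_le_add_right ?_ _
  calc _ = ∑ j ∈ Finset.univ.erase i, (x j).length :=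
        Finset.sum_congr rfl fun j hj => by rw [Function.update_of_ne (Finset.ne_of_mem_erase hj)]
    _ ≤ _ := Finset.sum_le_univ_sum_of_nonneg fun _ => Nat.zero_le _

theorem Realizes.drop {a b n m : ℕ} (i : Fin a) {P : Cmd} {f : QAlg a b n m} (hf : Realizes P f) :
    Realizes (.seq (.drop i) P) (fun x => f (Function.update x i (x i).tail)) := by
  obtain ⟨p, hp⟩ := hf
  refine ⟨p.comp (2 * Polynomial.X) + 2, fun x φ => ?_⟩
  obtain ⟨L, h1, h2⟩ := hp (Function.update x i (x i).tail) φ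
  refine ⟨L, ?_, h2⟩
  have h3 := Det.drop (startBits x) i (startConfig x φ) rfl
  have hsb : startBits x i = x i := by simp [startBits]
  have h4 : (startConfig x φ).withBits (Function.update (startBits x) i (startBits x i).tail) =
      startConfig (Function.update x i (x i).tail) φ := by
    rw [hsb, ← startBits_update]; rfl
  rw [h4] at h3
  refine (h3.seq_one (h1.mono (T' := p.eval (2 * inputSize x)) (eval_mono p ?_))).mono (by
    simp; omega)
  refine (inputSize_update _ _ _).trans ?_
  have : (x i).length ≤ inputSize x := by
    rw [← hsb]; exact startBits_length x i
  simp; omega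

theorem Realizes.push {a b n m : ℕ} (i : Fin a) (β : Bool) {P : Cmd} {f : QAlg a b n m}
    (hf : Realizes P f) :
    Realizes (.seq (.push i β) P) (fun x => f (Function.update x i (β :: x i))) := by
  obtain ⟨p, hp⟩ := hf
  refine ⟨p.comp (2 * Polynomial.X + 1) + 2, fun x φ => ?_⟩
  obtain ⟨L, h1, h2⟩ := hp (Function.update x i (β :: x i)) φ
  refine ⟨L, ?_, h2⟩
  have h3 := Det.push (startBits x) i β (startConfig x φ) rfl
  have hsb : startBits x i = x i := by simp [startBits]
  have h4 : (startConfig x φ).withBits (Function.update (startBits x) i (β :: startBits x i)) =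
      startConfig (Function.update x i (β :: x i)) φ := by
    rw [hsb, ← startBits_update]; rfl
  rw [h4] at h3
  refine (h3.seq_one (h1.mono (T' := p.eval (2 * inputSize x + 1)) (eval_mono p ?_))).mono (by
    simp; omega)
  refine (inputSize_update _ _ _).trans ?_
  have : (x i).length ≤ inputSize x := by
    rw [← hsb]; exact startBits_length x i
  simp; omega

theorem Cmd.relocate_id (P : Cmd) : P.relocate id id = P := by
  induction P <;> simp_all [Cmd.relocate]

/-- The same program on a branch of weight `w`. -/
theorem Config.Yields.weight {P : Cmd} {c : Config} {T : ℕ} {L : List Config} (w : ℝ)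
    (h : Yields [P] c T L) :
    ∃ L', Yields [P] { c with wt := w * c.wt } T L' ∧
      (∀ m, (∀ d ∈ L, (d.qubits 0).length = m) → ∀ d ∈ L', (d.qubits 0).length = m) ∧
      ∀ b m o, outSum b m L' o = (w : ℂ) • outSum b m L o := by
  have hP := P.relocate_id
  have hsim : Simulates id id id 0 (fun _ => false) (fun _ => []) w (c.withTodo [P])
      (Config.withTodo { c with wt := w * c.wt } [P.relocate id id]) := by
    constructor
    · rfl
    · intro i; rfl
    · intro i hi; exact absurd ⟨i, rfl⟩ hi
    · intro i; simp
    · rfl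
    · intro i _; rfl
    · intro s
      change c.vec s = c.vec _
      congr 1; funext i
      exact (Function.injective_id.extend_apply s _ i).symm
    · rfl
  obtain ⟨L', hL', hLL'⟩ := hsim.yields Function.injective_id Function.injective_id
    Function.injective_id h
  rw [hP] at hL'
  refine ⟨L', hL', ?_, ?_⟩
  · intro m hm y hy
    obtain ⟨i, hi, rfl⟩ := List.mem_iff_getElem.1 hy
    have hi' : i < L.length := by rw [hLL'.length_eq]; exact hi
    have h3 := ((List.forall₂_iff_get.1 hLL').2 i hi' hi).qubits 0
    simp only [List.get_eq_getElem, id] at h3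
    rw [h3, List.length_map]
    exact hm _ (List.getElem_mem hi')
  · intro b m o
    refine outSum_forall₂ hLL' fun c c' _ hcc => ⟨?_, hcc.qout m⟩
    have : c'.out b = c.out b := funext fun j => hcc.bits j
    rw [this]

/-- Continue with `P` with probability `p`, and with `Q` otherwise; the stack `a` is empty. -/
def Cmd.mix (p : ℝ) (a : ℕ) (P Q : Cmd) : Cmd :=
  .seq (.coin p a) (.branch a .skip (.seq (.drop a) Q) (.seq (.drop a) P))

theorem Realizes.mix {a b n m : ℕ} (t : ℝ) {P Q : Cmd} {f g : QAlg a b n m}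
    (hf : Realizes P f) (hg : Realizes Q g) :
    Realizes (Cmd.mix t a P Q) (fun x ρ o => (t : ℂ) • f x ρ o + ((1 - t : ℝ) : ℂ) • g x ρ o) := by
  obtain ⟨p, hp⟩ := hf
  obtain ⟨q, hq⟩ := hg
  refine ⟨p + q + 5, fun x φ => ?_⟩
  obtain ⟨L, h1, h2, h3⟩ := hp x φ
  obtain ⟨M, k1, k2, k3⟩ := hq x φ
  obtain ⟨L', h4, h5, h6⟩ := h1.weight t
  obtain ⟨M', k4, k5, k6⟩ := k1.weight (1 - t)
  refine ⟨L' ++ M', ?_, ?_, ?_⟩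
  · set c := startConfig x φ with hc
    have hba : startBits x a = [] := by simp [startBits]
    have hdrop : ∀ (β : Bool) (w : ℝ) (R : Cmd) (T : ℕ) (K : List Config),
        Config.Yields [R] { c with wt := w * c.wt } T K →
        Config.Yields [.branch a .skip (.seq (.drop a) Q) (.seq (.drop a) P)]
          { c with bits := Function.update c.bits a (β :: c.bits a), wt := c.wt * w } (T + 3) K ∨
        R ≠ (if β then P else Q) := by
      intro β w R T K hR
      by_cases hRe : R = (if β then P else Q)
      · left
        have e1 : (Config.withTodo { c with bits := Function.update c.bits a (β :: c.bits a), wt := c.wt * w }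
            [Cmd.branch a .skip (.seq (.drop a) Q) (.seq (.drop a) P)]).step =
            [Config.withTodo { c with bits := Function.update c.bits a (β :: c.bits a), wt := c.wt * w }
              [.seq (.drop a) R]] := by
          subst hRe
          cases β <;> simp [Config.step, Config.withTodo]
        refine Config.Yields.of_step e1 ?_
        have e2 := Det.drop (Function.update c.bits a (β :: c.bits a)) a
          { c with bits := Function.update c.bits a (β :: c.bits a), wt := c.wt * w } rfl
        have e3 : Config.Yields [R] (Config.withBits
            { c with bits := Function.update c.bits a (β :: c.bits a), wt := c.wt * w }
            (Function.update (Function.update c.bits a (β :: c.bits a)) a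
              (Function.update c.bits a (β :: c.bits a) a).tail)) T K := by
          refine hR.congr_state ?_
          simp [Config.withTodo, Config.withBits, mul_comm]
        exact (e2.seq_one e3).mono (by omega)
      · exact Or.inr hRe
    have y1 := (hdrop true t P _ _ h4).resolve_right (by simp)
    have y2 := (hdrop false (1 - t) Q _ _ k4).resolve_right (by simp)
    set T := p.eval (inputSize x) + q.eval (inputSize x) + 3 with hT
    refine Config.Yields.of_step (T := T + 1) (d := c.withTodo
      [.coin t a, .branch a .skip (.seq (.drop a) Q) (.seq (.drop a) P)]) rfl ?_ |>.mono (by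
        simp [hT]; omega)
    have y1' := y1.mono (T' := T) (by omega)
    have y2' := y2.mono (T' := T) (by omega)
    refine ⟨?_, ?_⟩
    · rw [Config.run_succ]
      change List.flatMap _ [_, _] = _
      rw [List.flatMap_cons, List.flatMap_cons, List.flatMap_nil, List.append_nil]
      exact congrArg₂ _ y1'.1 y2'.1
    · intro d hd
      rcases List.mem_append.1 hd with hd | hd
      · exact y1'.2 d hd
      · exact y2'.2 d hd
  · intro d hd
    rcases List.mem_append.1 hd with hd | hd
    · exact h5 m h2 d hd
    · exact k5 m k2 d hd
  · intro o
    simp only [h3, k3]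
    rw [outSum_append, h6, k6]

/-! ### Copying and rearranging strings -/

/-- Move the contents of stack `i` to stack `t`, reversing it. -/
def Cmd.pour (i t : ℕ) : Cmd :=
  .loop i (.branch i .skip (.seq (.drop i) (.push t false)) (.seq (.drop i) (.push t true)))

/-- Move the contents of stack `t` to the stacks `i` and `j`, reversing it. -/
def Cmd.pourTwo (t i j : ℕ) : Cmd :=
  .loop t (.branch t .skip (.seq (.drop t) (.seq (.push i false) (.push j false)))
    (.seq (.drop t) (.seq (.push i true) (.push j true))))

theorem Det.pour {i t : ℕ} (hit : i ≠ t) (B : ℕ → BitStr) :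
    Det (.pour i t) B (fun k => if k = i then [] else if k = t then (B i).reverse ++ B t else B k)
      (5 * (B i).length + 1) := by
  generalize hl : B i = l
  induction l generalizing B with
  | nil =>
    have : (fun k => if k = i then [] else if k = t then ([] : BitStr).reverse ++ B t else B k) = B := by
      funext k
      grind
    rw [this]
    exact Det.loop_nil hl
  | cons b l ih =>
    set B1 := Function.update B i l with hB1
    set B2 := Function.update B1 t (b :: B1 t) with hB2
    have h1 : Det (.branch i .skip (.seq (.drop i) (.push t false)) (.seq (.drop i) (.push t true)))
        B B2 4 := by
      have hd : ∀ β, Det (.seq (.drop i) (.push t β)) B (Function.update B1 t (β :: B1 t)) 3 := by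
        intro β
        have := (Det.drop B i).seq (Det.push (Function.update B i (B i).tail) t β)
        rw [hl] at this
        exact this
      refine Det.branch (t := 3) ?_
      rw [hl]
      cases b
      · exact hd false
      · exact hd true
    have h2 := ih B2 (by simp [hB2, hB1, hit])
    have h3 := Det.loop_cons (by simp [hl]) h1 h2
    have : (fun k => if k = i then [] else if k = t then l.reverse ++ B2 t else B2 k) =
        fun k => if k = i then [] else if k = t then (b :: l).reverse ++ B t else B k := by
      funext k
      simp only [hB2, hB1, Function.update_apply]
      grind
    rw [this] at h3
    exact h3.mono (by simp only [List.length_cons]; omega)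

theorem Det.pourTwo {t i j : ℕ} (hti : t ≠ i) (htj : t ≠ j) (hij : i ≠ j) (B : ℕ → BitStr) :
    Det (.pourTwo t i j) B
      (fun k => if k = t then [] else if k = i then (B t).reverse ++ B i else
        if k = j then (B t).reverse ++ B j else B k)
      (7 * (B t).length + 1) := by
  generalize hl : B t = l
  induction l generalizing B with
  | nil =>
    have : (fun k => if k = t then [] else if k = i then ([] : BitStr).reverse ++ B i else
        if k = j then ([] : BitStr).reverse ++ B j else B k) = B := by
      funext k
      grind
    rw [this]
    exact Det.loop_nil hl
  | cons b l ih =>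
    set B1 := Function.update B t l with hB1
    set B2 := Function.update B1 i (b :: B1 i) with hB2
    set B3 := Function.update B2 j (b :: B2 j) with hB3
    have h1 : Det (.branch t .skip (.seq (.drop t) (.seq (.push i false) (.push j false)))
        (.seq (.drop t) (.seq (.push i true) (.push j true)))) B B3 6 := by
      have hd : ∀ β, Det (.seq (.drop t) (.seq (.push i β) (.push j β))) B
          (Function.update (Function.update B1 i (β :: B1 i)) j
            (β :: Function.update B1 i (β :: B1 i) j)) 5 := by
        intro β
        have h0 := Det.drop B t
        rw [hl] at h0
        exact h0.seq ((Det.push B1 i β).seq (Det.push (Function.update B1 i (β :: B1 i)) j β))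
      refine Det.branch (t := 5) ?_
      rw [hl]
      cases b
      · exact hd false
      · exact hd true
    have h2 := ih B3 (by simp [hB3, hB2, hB1, hti, htj])
    have h3 := Det.loop_cons (by simp [hl]) h1 h2
    have : (fun k => if k = t then [] else if k = i then l.reverse ++ B3 i else
        if k = j then l.reverse ++ B3 j else B3 k) =
        fun k => if k = t then [] else if k = i then (b :: l).reverse ++ B i else
        if k = j then (b :: l).reverse ++ B j else B k := by
      funext k
      simp only [hB3, hB2, hB1, Function.update_apply]
      grind
    rw [this] at h3
    exact h3.mono (by simp only [List.length_cons]; omega)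

/-- Append the contents of stack `i` on top of stack `j`, with the help of the empty stack `t`. -/
def Cmd.copy (i j t : ℕ) : Cmd := .seq (.pour i t) (.pourTwo t i j)

theorem Det.copy {i j t : ℕ} (hit : i ≠ t) (hjt : j ≠ t) (hij : i ≠ j) {B : ℕ → BitStr}
    (ht : B t = []) (hj : B j = []) :
    Det (.copy i j t) B (Function.update B j (B i)) (12 * (B i).length + 3) := by
  have h1 := Det.pour hit B
  have h2 := Det.pourTwo (Ne.symm hit) (Ne.symm hjt) hij
    (fun k => if k = i then [] else if k = t then (B i).reverse ++ B t else B k)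
  have h3 := h1.seq h2
  have h4 : (if t = i then [] else if t = t then (B i).reverse ++ B t else B t) = (B i).reverse := by
    rw [if_neg (Ne.symm hit), if_pos rfl, ht, List.append_nil]
  rw [h4] at h3
  have : (fun k => if k = t then [] else
      if k = i then (B i).reverse.reverse ++
        (if i = i then [] else if i = t then (B i).reverse ++ B t else B i) else
      if k = j then (B i).reverse.reverse ++
        (if j = i then [] else if j = t then (B i).reverse ++ B t else B j) else
      if k = i then [] else if k = t then (B i).reverse ++ B t else B k) =
      Function.update B j (B i) := by
    funext k
    by_cases k1 : k = t
    · subst k1; simp [Function.update_of_ne (Ne.symm hjt), ht]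
    · by_cases k2 : k = i
      · subst k2; simp [k1, hij]
      · by_cases k3 : k = j
        · subst k3; simp [k1, k2, hj]
        · simp [k1, k2, k3]
  rw [this] at h3
  exact h3.mono (by simp; omega)

/-- Move the contents of stack `i` to the empty stack `j`, with the help of the empty stack `t`. -/
def Cmd.move (i j t : ℕ) : Cmd := .seq (.pour i t) (.pour t j)

theorem Det.move {i j t : ℕ} (hit : i ≠ t) (hjt : j ≠ t) (hij : i ≠ j) {B : ℕ → BitStr}
    (ht : B t = []) (hj : B j = []) :
    Det (.move i j t) B (Function.update (Function.update B i []) j (B i))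
      (10 * (B i).length + 3) := by
  have h1 := Det.pour hit B
  have h2 := Det.pour (Ne.symm hjt)
    (fun k => if k = i then [] else if k = t then (B i).reverse ++ B t else B k)
  have h3 := h1.seq h2
  have h4 : (if t = i then [] else if t = t then (B i).reverse ++ B t else B t) = (B i).reverse := by
    rw [if_neg (Ne.symm hit), if_pos rfl, ht, List.append_nil]
  rw [h4] at h3
  have : (fun k => if k = t then [] else
      if k = j then (B i).reverse.reverse ++
        (if j = i then [] else if j = t then (B i).reverse ++ B t else B j) else
      if k = i then [] else if k = t then (B i).reverse ++ B t else B k) =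
      Function.update (Function.update B i []) j (B i) := by
    funext k
    by_cases k1 : k = t
    · subst k1; simp [Function.update_of_ne (Ne.symm hjt), Function.update_of_ne (Ne.symm hit), ht]
    · by_cases k3 : k = j
      · subst k3; simp [k1, hj, Ne.symm hij]
      · by_cases k2 : k = i
        · subst k2; simp [k1, k3]
        · simp [k1, k2, k3]
  rw [this] at h3
  exact h3.mono (by simp; omega)

/-- Copies of the strings `σ 0, σ 1, …` on the stacks `N, N+1, …`. -/
def Cmd.copies (σ : ℕ → ℕ) (N t : ℕ) : ℕ → Cmd
  | 0 => .skip
  | k + 1 => .seq (.copies σ N t k) (.copy (σ k) (N + k) t)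

/-- Move the contents of the stacks `N, N+1, …` to the stacks `0, 1, …`. -/
def Cmd.moves (N t : ℕ) : ℕ → Cmd
  | 0 => .skip
  | k + 1 => .seq (.moves N t k) (.seq (.clear k) (.move (N + k) k t))

theorem Det.copies {σ : ℕ → ℕ} {N b t : ℕ} (hσ : ∀ k < b, σ k < N) (ht : N + b ≤ t)
    {B : ℕ → BitStr} (hB : ∀ i, N ≤ i → B i = []) {M : ℕ} (hM : ∀ i, (B i).length ≤ M)
    (k : ℕ) (hk : k ≤ b) :
    Det (.copies σ N t k) B (fun i => if N ≤ i ∧ i < N + k then B (σ (i - N)) else B i)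
      ((12 * M + 5) * k + 1) := by
  induction k with
  | zero =>
    have : (fun i => if N ≤ i ∧ i < N + 0 then B (σ (i - N)) else B i) = B := by
      funext i; rw [if_neg (by omega)]
    rw [this]
    exact (Det.skip B).mono (by omega)
  | succ k ih =>
    have h1 := ih (by omega)
    have hsk := hσ k (by omega)
    have h2 := Det.copy (i := σ k) (j := N + k) (t := t)
      (B := fun i => if N ≤ i ∧ i < N + k then B (σ (i - N)) else B i)
      (by omega) (by omega) (by omega) (by rw [if_neg (by omega), hB _ (by omega)])
      (by rw [if_neg (by omega), hB _ (by omega)])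
    have h3 := h1.seq h2
    have e1 : (if N ≤ σ k ∧ σ k < N + k then B (σ (σ k - N)) else B (σ k)) = B (σ k) := by
      rw [if_neg (by omega)]
    rw [e1] at h3
    have : Function.update (fun i => if N ≤ i ∧ i < N + k then B (σ (i - N)) else B i) (N + k)
        (B (σ k)) = fun i => if N ≤ i ∧ i < N + (k + 1) then B (σ (i - N)) else B i := by
      funext i
      by_cases hi : i = N + k
      · subst hi; simp
      · rw [Function.update_of_ne hi]
        by_cases h : N ≤ i ∧ i < N + k
        · rw [if_pos h, if_pos (by omega)]
        · rw [if_neg h, if_neg (by omega)]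
    rw [this] at h3
    refine h3.mono ?_
    have := hM (σ k)
    nlinarith

theorem Det.moves {N b t : ℕ} (hb : b ≤ N) (ht : N + b ≤ t) {B : ℕ → BitStr} (hB : B t = [])
    {M : ℕ} (hM : ∀ i, (B i).length ≤ M) (k : ℕ) (hk : k ≤ b) :
    Det (.moves N t k) B (fun i => if i < k then B (N + i) else
      if N ≤ i ∧ i < N + k then [] else B i) ((12 * M + 8) * k + 1) := by
  induction k with
  | zero =>
    have : (fun i => if i < 0 then B (N + i) else if N ≤ i ∧ i < N + 0 then [] else B i) = B := by
      funext i; rw [if_neg (by omega), if_neg (by omega)]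
    rw [this]
    exact (Det.skip B).mono (by omega)
  | succ k ih =>
    have h1 := ih (by omega)
    set B1 : ℕ → BitStr := fun i => if i < k then B (N + i) else
      if N ≤ i ∧ i < N + k then [] else B i with hB1
    have e1 : B1 k = B k := by simp only [hB1]; rw [if_neg (by omega), if_neg (by omega)]
    have e2 : B1 (N + k) = B (N + k) := by
      simp only [hB1]; rw [if_neg (by omega), if_neg (by omega)]
    have h2 := Det.clear B1 k
    have h3 := Det.move (i := N + k) (j := k) (t := t) (B := Function.update B1 k [])
      (by omega) (by omega) (by omega)
      (by
        rw [Function.update_of_ne (by omega)]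
        simp only [hB1]; rw [if_neg (by omega), if_neg (by omega), hB])
      (by simp)
    have h4 := h1.seq (h2.seq h3)
    rw [Function.update_of_ne (show N + k ≠ k by omega), e2, e1] at h4
    have : Function.update (Function.update (Function.update B1 k []) (N + k) []) k (B (N + k)) =
        fun i => if i < k + 1 then B (N + i) else if N ≤ i ∧ i < N + (k + 1) then [] else B i := by
      funext i
      by_cases hi : i = k
      · subst hi; simp
      · rw [Function.update_of_ne hi]
        by_cases hi2 : i = N + k
        · subst hi2; simp only [Function.update_self]; grind
        · rw [Function.update_of_ne hi2, Function.update_of_ne hi]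
          simp only [hB1]
          grind
    rw [this] at h4
    refine h4.mono ?_
    have := hM (N + k)
    have := hM k
    nlinarith

theorem Cmd.copies_good (σ : ℕ → ℕ) (N t k : ℕ) :
    (Cmd.copies σ N t k).Admissible ∧ (Cmd.copies σ N t k).Classical := by
  induction k with
  | zero => exact ⟨trivial, trivial⟩
  | succ k ih =>
    simp [Cmd.copies, Cmd.copy, Cmd.pour, Cmd.pourTwo, Cmd.Admissible, Cmd.Classical, ih]

theorem Cmd.moves_good (N t k : ℕ) :
    (Cmd.moves N t k).Admissible ∧ (Cmd.moves N t k).Classical := by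
  induction k with
  | zero => exact ⟨trivial, trivial⟩
  | succ k ih =>
    simp [Cmd.moves, Cmd.move, Cmd.clear, Cmd.pour, Cmd.Admissible, Cmd.Classical, ih]

/-! ### The calculus -/

namespace Computable

variable {cl : Prop} {a b d n m r : ℕ}

theorem comp {f : QAlg a b n m} {g : QAlg b d m r} (hf : Computable cl f) (hg : Computable cl g)
    (hgl : ∀ y, IsLinearMap ℂ (g y)) : Computable cl (fun x ρ o => ∑ᶠ y, g y (f x ρ y) o) := by
  obtain ⟨P, hP1, hP2, hP3⟩ := hf
  obtain ⟨Q, hQ1, hQ2, hQ3⟩ := hg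
  exact ⟨Cmd.comp P Q a b, ⟨hP1, Cmd.clearAll_admissible _, hQ1.relocate _ _⟩,
    fun h => ⟨hP2 h, Cmd.clearAll_classical _, (hQ2 h).relocate _ _⟩, hP3.comp hQ3 hgl⟩

theorem frame (k : ℕ) {f : QAlg a b n m} (hf : Computable cl f) : Computable cl (frameAlg k f) := by
  obtain ⟨P, hP1, hP2, hP3⟩ := hf
  exact ⟨P.relocate (k + ·) id, hP1.relocate _ _, fun h => (hP2 h).relocate _ _, hP3.frame k⟩

theorem branch (i : Fin a) {f g h : QAlg a b n m} (hf : Computable cl f) (hg : Computable cl g)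
    (hh : Computable cl h) : Computable cl (branchAlg i f g h) := by
  obtain ⟨P, hP1, hP2, hP3⟩ := hf
  obtain ⟨Q, hQ1, hQ2, hQ3⟩ := hg
  obtain ⟨R, hR1, hR2, hR3⟩ := hh
  exact ⟨.branch i P Q R, ⟨hP1, hQ1, hR1⟩, fun h => ⟨hP2 h, hQ2 h, hR2 h⟩, hP3.branch i hQ3 hR3⟩

theorem drop (i : Fin a) {f : QAlg a b n m} (hf : Computable cl f) :
    Computable cl (fun x => f (Function.update x i (x i).tail)) := by
  obtain ⟨P, hP1, hP2, hP3⟩ := hf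
  exact ⟨.seq (.drop i) P, ⟨trivial, hP1⟩, fun h => ⟨trivial, hP2 h⟩, hP3.drop i⟩

theorem push (i : Fin a) (β : Bool) {f : QAlg a b n m} (hf : Computable cl f) :
    Computable cl (fun x => f (Function.update x i (β :: x i))) := by
  obtain ⟨P, hP1, hP2, hP3⟩ := hf
  exact ⟨.seq (.push i β) P, ⟨trivial, hP1⟩, fun h => ⟨trivial, hP2 h⟩, hP3.push i β⟩

theorem mix {t : ℝ} (h0 : 0 ≤ t) (h1 : t ≤ 1) (ht : IsAlgebraic ℚ t) {f g : QAlg a b n m}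
    (hf : Computable cl f) (hg : Computable cl g) :
    Computable cl (fun x ρ o => (t : ℂ) • f x ρ o + ((1 - t : ℝ) : ℂ) • g x ρ o) := by
  obtain ⟨P, hP1, hP2, hP3⟩ := hf
  obtain ⟨Q, hQ1, hQ2, hQ3⟩ := hg
  exact ⟨Cmd.mix t a P Q, ⟨⟨h0, h1, ht⟩, trivial, ⟨trivial, hQ1⟩, ⟨trivial, hP1⟩⟩,
    fun h => ⟨trivial, trivial, ⟨trivial, hQ2 h⟩, ⟨trivial, hP2 h⟩⟩, hP3.mix t hQ3⟩

/-- Rearrange the strings; strings that do not exist are read as empty. -/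
theorem relabel (cl : Prop) (n : ℕ) (σ : Fin b → ℕ) :
    Computable cl (relabelAlg n (fun (x : Fin a → BitStr) j => startBits x (σ j))) := by
  set τ : ℕ → ℕ := fun k => if h : k < b then σ ⟨k, h⟩ else 0 with hτ
  set N := (Finset.univ.sup σ) + 1 + a + b with hN
  set t := N + b with ht
  have hτN : ∀ k < b, τ k < N := by
    intro k hk
    simp only [hτ, dif_pos hk]
    have := Finset.le_sup (f := σ) (Finset.mem_univ ⟨k, hk⟩)
    omega
  refine ⟨.seq (.copies τ N t b) (.moves N t b), ⟨(Cmd.copies_good _ _ _ _).1,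
    (Cmd.moves_good _ _ _).1⟩, fun _ => ⟨(Cmd.copies_good _ _ _ _).2, (Cmd.moves_good _ _ _).2⟩,
    Realizes.of_det ((12 * Polynomial.X + 5) * (Polynomial.C b) + 1 +
      ((12 * Polynomial.X + 8) * (Polynomial.C b) + 1) + 1) fun x => ?_⟩
  have hz : ∀ i, N ≤ i → startBits x i = [] := fun i hi => by
    simp only [startBits]; rw [dif_neg (by omega)]
  have h1 := Det.copies (b := b) hτN le_rfl hz (startBits_length x) b le_rfl
  have h2 := Det.moves (N := N) (b := b) (t := t) (M := inputSize x)
    (B := fun i => if N ≤ i ∧ i < N + b then startBits x (τ (i - N)) else startBits x i)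
    (by omega) le_rfl (by rw [if_neg (by omega), hz _ (by omega)])
    (by intro i; split <;> exact startBits_length x _) b le_rfl
  refine ⟨_, (h1.seq h2).mono (le_of_eq (by simp)), fun j => ?_⟩
  have : τ j = σ j := by simp [hτ]
  simp [this]

/-- Read the first `k` bits of string `i`, remove them and continue according to their values. -/
theorem dispatch (i : Fin a) (k : ℕ) (F : BitStr → QAlg a b n m) (hF : ∀ v, Computable cl (F v)) :
    Computable cl (fun x => F ((x i).take k) (Function.update x i ((x i).drop k))) := by
  induction k generalizing F with
  | zero => simpa using hF []
  | succ k ih =>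
    have hb : ∀ β : Bool, Computable cl (fun x : Fin a → BitStr =>
        F (β :: (x i).take k) (Function.update x i ((x i).drop k))) := fun β =>
      ih (fun v => F (β :: v)) (fun v => hF _)
    have h := branch i (hF []) (drop i (hb false)) (drop i (hb true))
    convert h using 2 with x
    simp only [branchAlg]
    rcases hx : x i with _ | ⟨_ | _, y⟩ <;> simp
    rw [← hx, Function.update_eq_self]

end Computable

/-- Every `f x` is linear in the state. -/
def QAlg.Linear {a b n m : ℕ} (f : QAlg a b n m) : Prop := ∀ x, IsLinearMap ℂ (f x)

theorem IsLinearMap.map_zero_apply {a b n m : ℕ} {f : QAlg a b n m} (hf : f.Linear) (x o) :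
    f x 0 o = 0 := by rw [(hf x).map_zero]; rfl

namespace Computable

variable {cl : Prop} {a b d n m r : ℕ}

theorem congr {f g : QAlg a b n m} (hf : Computable cl f)
    (h : ∀ x φ o, g x (ketbra φ) o = f x (ketbra φ) o) : Computable cl g := by
  obtain ⟨P, hP1, hP2, p, hp⟩ := hf
  refine ⟨P, hP1, hP2, p, fun x φ => ?_⟩
  obtain ⟨L, h1, h2, h3⟩ := hp x φ
  exact ⟨L, h1, h2, fun o => by rw [h, h3]⟩

theorem precomp {f : QAlg b d n m} (hf : Computable cl f) (hl : f.Linear) (σ : Fin b → ℕ) :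
    Computable cl (fun (x : Fin a → BitStr) => f (fun j => startBits x (σ j))) := by
  refine (comp (relabel cl n σ) hf hl).congr fun x φ o => ?_
  rw [finsum_eq_single _ (fun j => startBits x (σ j))]
  · simp [relabelAlg]
  · intro y hy
    simp only [relabelAlg, if_neg hy]
    exact IsLinearMap.map_zero_apply hl _ _

theorem prepend (i : Fin a) (s : BitStr) {f : QAlg a b n m} (hf : Computable cl f) :
    Computable cl (fun x => f (Function.update x i (s ++ x i))) := by
  induction s generalizing f with
  | nil => simpa using hf
  | cons β s ih => simpa using ih (push i β hf)

theorem modify (i : Fin a) (s : BitStr) (k : ℕ) {f : QAlg a b n m} (hf : Computable cl f) :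
    Computable cl (fun x => f (Function.update x i (s ++ (x i).drop k))) := by
  have := dispatch i k (fun _ => _) (fun _ => prepend i s hf)
  simpa using this

theorem modifyAll (s : Fin a → BitStr) (k : Fin a → ℕ) {f : QAlg a b n m} (hf : Computable cl f) :
    Computable cl (fun x => f (fun j => s j ++ (x j).drop (k j))) := by
  have key : ∀ l : List (Fin a), l.Nodup → ∀ f : QAlg a b n m, Computable cl f →
      Computable cl (fun x => f (fun j => if j ∈ l then s j ++ (x j).drop (k j) else x j)) := by
    intro l
    induction l with
    | nil => intro _ f hf; simpa using hf
    | cons i l ih =>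
      intro hl f hf
      rw [List.nodup_cons] at hl
      have h1 := modify i (s i) (k i) (ih hl.2 f hf)
      convert h1 using 3 with x
      funext j
      by_cases hj : j = i
      · subst hj; simp [hl.1]
      · simp [hj]
  simpa using key (List.finRange a) (List.nodup_finRange a) f hf

/-- Each argument of `f` is a fixed string followed by a final part of one of the strings. -/
theorem subst (s : Fin b → BitStr) (σ : Fin b → ℕ) (k : Fin b → ℕ) {f : QAlg b d n m}
    (hf : Computable cl f) (hl : f.Linear) :
    Computable cl (fun (x : Fin a → BitStr) =>
      f (fun j => s j ++ (startBits x (σ j)).drop (k j))) :=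
  precomp (modifyAll s k hf) (fun _ => hl _) σ

/-- A case distinction on the first bits of a string. -/
theorem cases (i : Fin a) (k : ℕ) (F : BitStr → QAlg a b n m) (hF : ∀ v, Computable cl (F v))
    (hl : ∀ v, (F v).Linear) : Computable cl (fun x => F ((x i).take k) x) := by
  have h1 : ∀ v, Computable cl (fun z : Fin (a + 1) → BitStr =>
      F v (fun j => startBits z (j : ℕ))) := fun v => precomp (hF v) (hl v) _
  have h2 := dispatch (Fin.last a) k _ h1
  have h3 := precomp (a := a) h2 (fun _ => hl _ _)
    (fun j : Fin (a + 1) => if (j : ℕ) = a then (i : ℕ) else j)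
  convert h3 using 2 with x
  have e1 : ∀ j : Fin a, startBits x (j : ℕ) = x j := fun j => by simp [startBits]
  congr 1
  · simp [e1]
  · funext j
    have hj : (j.castSucc : Fin (a + 1)) ≠ Fin.last a := Fin.castSucc_lt_last j |>.ne
    have hja : (j : ℕ) ≠ a := j.2.ne
    rw [show (j : ℕ) = ((j.castSucc : Fin (a + 1)) : ℕ) from rfl, startBits]
    rw [dif_pos j.castSucc.2]
    simp only [Fin.eta]
    rw [Function.update_of_ne hj]
    simp [hja, e1]

theorem mixture {ι : Type*} (s : Finset ι) (hs : s.Nonempty) (F : ι → QAlg a b n m)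
    (hF : ∀ i, Computable cl (F i)) (w : ι → ℝ) (h0 : ∀ i, 0 ≤ w i) (h1 : ∑ i ∈ s, w i = 1)
    (ha : ∀ i, IsAlgebraic ℚ (w i)) :
    Computable cl (fun x ρ o => ∑ i ∈ s, (w i : ℂ) • F i x ρ o) := by
  induction hs using Finset.Nonempty.cons_induction generalizing w with
  | singleton i =>
    simp only [Finset.sum_singleton] at h1 ⊢
    simpa [h1] using hF i
  | cons i s hi hs ih =>
    simp only [Finset.sum_cons] at h1 ⊢
    have hsum : 0 ≤ ∑ j ∈ s, w j := Finset.sum_nonneg fun j _ => h0 j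
    by_cases hw : w i = 1
    · have hz : ∀ j ∈ s, w j = 0 :=
        (Finset.sum_eq_zero_iff_of_nonneg fun j _ => h0 j).1 (by linarith)
      refine (hF i).congr fun x φ o => ?_
      rw [Finset.sum_eq_zero fun j hj => by rw [hz j hj]; simp, hw]
      simp
    · have hlt : 0 < 1 - w i := by
        rcases lt_or_eq_of_le (show w i ≤ 1 by linarith) with h | h
        · linarith
        · exact absurd h hw
      have halg : IsAlgebraic ℚ (1 - w i) := isAlgebraic_one.sub (ha i)
      have h2 := ih (fun j => w j / (1 - w i)) (fun j => div_nonneg (h0 j) hlt.le)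
        (by rw [← Finset.sum_div, div_eq_one_iff_eq hlt.ne']; linarith)
        (fun j => by rw [div_eq_mul_inv]; exact (ha j).mul halg.inv)
      refine (mix (h0 i) (by linarith) (ha i) (hF i) h2).congr fun x φ o => ?_
      congr 1
      rw [Finset.smul_sum]
      refine Finset.sum_congr rfl fun j _ => ?_
      rw [smul_smul]
      congr 1
      rw [← Complex.ofReal_mul]
      congr 1
      field_simp

end Computable

/-! ### Classical algorithms as quantum algorithms without qubits -/

def liftAlg {a b : ℕ} (f : Alg a b) : QAlg a b 0 0 := fun x ρ o => ((f x o).toReal : ℂ) • ρ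

theorem liftAlg_linear {a b : ℕ} (f : Alg a b) : (liftAlg f).Linear := fun x =>
  ⟨fun ρ σ => by funext o; simp [liftAlg], fun c ρ => by
    funext o; simp only [liftAlg, Pi.smul_apply]; rw [smul_comm]⟩

namespace Config

def withVec (c : Config) (v : (ℕ → Bool) → ℂ) : Config := { c with vec := v }

theorem step_classical {c : Config} (h : ∀ P ∈ c.todo, P.Classical) (v : (ℕ → Bool) → ℂ) :
    (c.withVec v).step = c.step.map (fun d => d.withVec v) ∧
    ∀ d ∈ c.step, (∀ P ∈ d.todo, P.Classical) ∧ d.fresh = c.fresh ∧ d.vec = c.vec ∧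
      d.qubits = c.qubits := by
  obtain ⟨todo, bits, qubits, fresh, vec, wt⟩ := c
  rcases todo with _ | ⟨P, K⟩
  · simp [step, withVec]
  simp only [List.mem_cons, forall_eq_or_imp] at h
  cases P <;> simp only [Cmd.Classical, false_and] at h <;> simp only [step, withVec] <;>
    (try split) <;> simp_all [Cmd.Classical]

theorem run_classical {T : ℕ} {c : Config} (h : ∀ P ∈ c.todo, P.Classical)
    (v : (ℕ → Bool) → ℂ) :
    run T (c.withVec v) = (run T c).map (fun d => d.withVec v) ∧
    ∀ d ∈ run T c, d.fresh = c.fresh ∧ d.vec = c.vec ∧ d.qubits = c.qubits := by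
  induction T generalizing c with
  | zero => simp
  | succ T ih =>
    obtain ⟨h1, h2⟩ := step_classical h v
    constructor
    · rw [run_succ, run_succ, h1, List.flatMap_map, List.map_flatMap]
      exact List.flatMap_congr fun d hd => (ih (h2 d hd).1).1
    · intro d hd
      rw [run_succ] at hd
      obtain ⟨x, hx, hd⟩ := List.mem_flatMap.1 hd
      obtain ⟨k1, k2, k3⟩ := (ih (h2 x hx).1).2 d hd
      obtain ⟨l1, l2, l3⟩ := (h2 x hx).2
      exact ⟨k1.trans l1, k2.trans l2, k3.trans l3⟩

end Config

theorem outSum_classical {a b : ℕ} {P : Cmd} (hP : P.Classical) {x : Fin a → BitStr}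
    {φ : Bits 0 → ℂ} {T : ℕ} {L : List Config} (h : Config.Yields [P] (startConfig x φ) T L)
    (o : Fin b → BitStr) :
    outSum b 0 L o = (((L.filter (fun c => c.out b = o)).map Config.wt).sum : ℂ) • ketbra φ := by
  have h1 : ∀ d ∈ L, d.qout 0 = (d.wt : ℂ) • ketbra φ := by
    intro d hd
    rw [← h.1] at hd
    obtain ⟨k1, k2, k3⟩ := (Config.run_classical (by simpa using hP) (fun _ => 0)).2 d hd
    have h0 := qout_startConfig x φ
    rw [Config.qout_eq] at h0 ⊢
    have hw : (startConfig x φ).wt = 1 := rfl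
    rw [hw] at h0
    simp only [Complex.ofReal_one, one_smul] at h0
    rw [k1, k2, ← h0]
    congr 2
    exact Subsingleton.elim _ _
  have h2 : ∀ l : List Config, (∀ d ∈ l, d.qout 0 = (d.wt : ℂ) • ketbra φ) →
      (l.map (Config.qout 0)).sum = ((l.map Config.wt).sum : ℂ) • ketbra φ := by
    intro l hl
    induction l with
    | nil => simp
    | cons c l ih =>
      simp only [List.map_cons, List.sum_cons]
      rw [ih (fun d hd => hl d (List.mem_cons_of_mem _ hd)), hl c List.mem_cons_self]
      push_cast
      rw [add_smul]
  exact h2 _ fun d hd => h1 d (List.mem_of_mem_filter hd)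

theorem isPPT_iff {a b : ℕ} {f : Alg a b} : IsPPT f ↔ Computable True (liftAlg f) := by
  constructor
  · rintro ⟨P, hP1, hP2, p, hp⟩
    refine ⟨P, hP1, fun _ => hP2, p, fun x φ => ?_⟩
    have hc : ∀ Q ∈ (startConfig x (fun _ : Bits 0 => 1)).withTodo [P] |>.todo, Q.Classical := by
      simpa using hP2
    have h1 := Config.run_classical (T := p.eval (inputSize x)) hc (startConfig x φ).vec
    have h2 : ((startConfig x (fun _ : Bits 0 => 1)).withTodo [P]).withVec (startConfig x φ).vec =
        (startConfig x φ).withTodo [P] := rfl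
    rw [h2] at h1
    obtain ⟨h3, h4⟩ := hp x
    have hy : Config.Yields [P] (startConfig x φ) (p.eval (inputSize x))
        (Config.run (p.eval (inputSize x)) ((startConfig x φ).withTodo [P])) := by
      refine ⟨rfl, ?_⟩
      rw [h1.1]
      intro d hd
      obtain ⟨y, hy, rfl⟩ := List.mem_map.1 hd
      exact h3 y hy
    refine ⟨_, hy, ?_, ?_⟩
    · intro c hc'
      rw [h1.1] at hc'
      obtain ⟨y, hy, rfl⟩ := List.mem_map.1 hc'
      change (y.qubits 0).length = 0
      rw [(h1.2 y hy).2.2]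
      rfl
    · intro o
      rw [outSum_classical hP2 hy, h1.1]
      simp only [liftAlg]
      congr 1
      rw [h4 o]
      have hnn : ∀ l : List Config, (∀ c ∈ l, 0 ≤ c.wt) → 0 ≤ (l.map Config.wt).sum := by
        intro l hl
        refine List.sum_nonneg ?_
        intro w hw
        obtain ⟨c, hc, rfl⟩ := List.mem_map.1 hw
        exact hl c hc
      rw [ENNReal.toReal_ofReal]
      · rw [initial_eq, List.filter_map, List.map_map]; rfl
      · refine hnn _ fun c hc => ?_
        refine Config.run_wt (c := P.initial x (fun _ : Bits 0 => 1)) (T := p.eval (inputSize x))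
          ⟨?_, ?_⟩ c (List.mem_of_mem_filter hc)
        · simpa [Cmd.initial] using hP1
        · simp [Cmd.initial]
  · rintro ⟨P, hP1, hP2, p, hp⟩
    refine ⟨P, hP1, hP2 trivial, p, fun x => ?_⟩
    obtain ⟨L, h1, h2, h3⟩ := hp x (fun _ : Bits 0 => 1)
    have hL : Config.run (p.eval (inputSize x)) (P.initial x (fun _ : Bits 0 => 1)) = L := h1.1
    simp only [hL]
    refine ⟨h1.2, fun o => ?_⟩
    have h4 := h3 o
    rw [outSum_classical (hP2 trivial) h1] at h4
    simp only [liftAlg] at h4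
    have h5 := congrFun (congrFun h4 default) default
    simp only [Matrix.smul_apply, ketbra, star_one, mul_one, smul_eq_mul] at h5
    rw [← Complex.ofReal_inj.1 h5, ENNReal.ofReal_toReal (PMF.apply_ne_top _ _)]

/-! ### Probabilistic polynomial time -/

theorem IsPPT.finite_support {a b : ℕ} {f : Alg a b} (hf : IsPPT f) (x) : (f x).support.Finite := by
  obtain ⟨P, -, -, p, hp⟩ := hf
  refine Set.Finite.subset (List.finite_toSet
    (((P.initial x (fun _ : Bits 0 => 1)).run (p.eval (inputSize x))).map (Config.out b))) ?_
  intro o ho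
  by_contra hn
  refine ho ?_
  rw [(hp x).2, List.filter_eq_nil_iff.2]
  · simp
  · intro c hc h
    exact hn (List.mem_map.2 ⟨c, hc, by simpa using h⟩)

theorem toReal_bind_eq_finsum {α β : Type*} (p : PMF α) (q : α → PMF β) (hp : p.support.Finite)
    (o : β) : ((p.bind q) o).toReal = ∑ᶠ y, (p y).toReal * (q y o).toReal := by
  have h1 : ∀ y, y ∉ hp.toFinset → p y = 0 := fun y hy => by
    by_contra h; exact hy (hp.mem_toFinset.2 h)
  rw [PMF.bind_apply, tsum_eq_sum (s := hp.toFinset) (fun y hy => by rw [h1 y hy, zero_mul]),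
    ENNReal.toReal_sum (fun y _ => ENNReal.mul_ne_top (PMF.apply_ne_top _ _) (PMF.apply_ne_top _ _))]
  rw [finsum_eq_sum_of_support_subset (s := hp.toFinset)]
  · exact Finset.sum_congr rfl fun y _ => ENNReal.toReal_mul
  · intro y hy
    by_contra h
    refine hy ?_
    simp only
    rw [h1 y h]; simp

namespace IsPPT

variable {a b c d r : ℕ}

theorem bind {f : Alg a b} {g : Alg b d} (hf : IsPPT f) (hg : IsPPT g) :
    IsPPT (fun x => (f x).bind g) := by
  have hfin := hf.finite_support
  rw [isPPT_iff] at hf hg ⊢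
  refine (hf.comp hg (liftAlg_linear g)).congr fun x φ o => ?_
  have h := toReal_bind_eq_finsum (f x) g (hfin x) o
  simp only [liftAlg]
  rw [h]
  have hsup : (Function.support fun y => (f x y).toReal * (g y o).toReal).Finite := by
    refine (hfin x).subset fun y hy => ?_
    intro h0
    refine hy ?_
    simp only
    rw [show f x y = 0 from h0]; simp
  rw [show ((∑ᶠ y, (f x y).toReal * (g y o).toReal : ℝ) : ℂ) =
    ∑ᶠ y, (((f x y).toReal * (g y o).toReal : ℝ) : ℂ) from
      map_finsum Complex.ofRealHom.toAddMonoidHom hsup]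
  rw [finsum_smul]
  refine finsum_congr fun y => ?_
  rw [smul_smul]; push_cast; rw [mul_comm]

theorem subst (s : Fin b → BitStr) (σ : Fin b → ℕ) (k : Fin b → ℕ) {f : Alg b d} (hf : IsPPT f) :
    IsPPT (fun (x : Fin a → BitStr) => f (fun j => s j ++ (startBits x (σ j)).drop (k j))) := by
  rw [isPPT_iff] at hf ⊢
  exact Computable.subst s σ k hf (liftAlg_linear f)

theorem pure_id (a : ℕ) : IsPPT (fun x : Fin a → BitStr => PMF.pure x) := by
  rw [isPPT_iff]
  refine (Computable.relabel True 0 (fun j : Fin a => (j : ℕ))).congr fun x φ o => ?_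
  have h1 : (fun j : Fin a => startBits x (j : ℕ)) = x := by funext j; simp [startBits]
  simp only [liftAlg, relabelAlg, h1, PMF.pure_apply]
  split <;> simp

/-- Output strings that consist of a fixed string and a final part of an input string. -/
theorem output (s : Fin b → BitStr) (σ : Fin b → ℕ) (k : Fin b → ℕ) :
    IsPPT (fun (x : Fin a → BitStr) =>
      PMF.pure (fun j => s j ++ (startBits x (σ j)).drop (k j))) :=
  subst s σ k (pure_id b)

theorem const (s : Fin b → BitStr) : IsPPT (fun _ : Fin a → BitStr => PMF.pure s) := by
  have := output (a := a) s (fun _ => a) (fun _ => 0)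
  simpa [startBits] using this

theorem frame (k : ℕ) {f : Alg a b} (hf : IsPPT f) :
    IsPPT (fun x : Fin (k + a) → BitStr => (f (fun i => x (Fin.natAdd k i))).map
      (fun y => Fin.append (fun i => x (Fin.castAdd a i)) y)) := by
  rw [isPPT_iff] at hf ⊢
  refine (hf.frame k).congr fun x φ o => ?_
  simp only [frameAlg, liftAlg]
  have hinj : ∀ y : Fin b → BitStr, (o = Fin.append (fun i => x (Fin.castAdd a i)) y) ↔
      ((fun i => o (Fin.castAdd b i)) = (fun i => x (Fin.castAdd a i))) ∧
        y = fun i => o (Fin.natAdd k i) := by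
    intro y
    constructor
    · rintro rfl
      constructor <;> funext i <;> simp
    · rintro ⟨h1, rfl⟩
      rw [← h1]
      funext i
      refine Fin.addCases (fun i => ?_) (fun i => ?_) i <;> simp
  rw [PMF.map_apply]
  by_cases ho : (fun i => o (Fin.castAdd b i)) = (fun i => x (Fin.castAdd a i))
  · rw [if_pos ho, tsum_eq_single (fun i => o (Fin.natAdd k i))]
    · rw [if_pos ((hinj _).2 ⟨ho, rfl⟩)]
    · intro y hy
      rw [if_neg fun h => hy ((hinj y).1 h).2]
  · rw [if_neg ho]
    refine Eq.trans (b := (((0 : ℝ≥0∞).toReal : ℝ) : ℂ) • ketbra φ) ?_ (by simp)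
    congr 3
    exact ENNReal.tsum_eq_zero.2 fun y => if_neg fun h => ho ((hinj y).1 h).1

/-- Run `f` on some of the strings, and continue with all strings and its output. -/
theorem call {f : Alg a b} (hf : IsPPT f) (s : Fin a → BitStr) (σ : Fin a → ℕ) (k : Fin a → ℕ)
    (g : (Fin r → BitStr) → Alg b d)
    (hg : IsPPT (fun z : Fin (r + b) → BitStr =>
      g (fun i => z (Fin.castAdd b i)) (fun i => z (Fin.natAdd r i)))) :
    IsPPT (fun x : Fin r → BitStr =>
      (f (fun j => s j ++ (startBits x (σ j)).drop (k j))).bind (g x)) := by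
  have h1 := subst (a := r) (Fin.append (fun _ : Fin r => []) s)
    (Fin.append (fun i : Fin r => (i : ℕ)) σ) (Fin.append (fun _ : Fin r => 0) k) (frame r hf)
  have h2 := h1.bind hg
  convert h2 using 2 with x
  simp only [Fin.append_left, Fin.append_right, PMF.bind_map]
  congr 1
  funext y
  simp only [Function.comp_apply, Fin.append_left, Fin.append_right]
  congr 1
  funext i
  simp [startBits]

theorem cases (i : Fin a) (k : ℕ) (F : BitStr → Alg a b) (hF : ∀ v, IsPPT (F v)) :
    IsPPT (fun x => F ((x i).take k) x) := by
  simp only [isPPT_iff] at hF ⊢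
  exact Computable.cases i k (fun v => liftAlg (F v)) hF (fun v => liftAlg_linear _)

theorem sample {ι : Type} [Fintype ι] (p : PMF ι) (hp : ∀ i, IsAlgebraic ℚ (p i).toReal)
    (F : ι → Alg a b) (hF : ∀ i, IsPPT (F i)) : IsPPT (fun x => p.bind (fun i => F i x)) := by
  simp only [isPPT_iff] at hF ⊢
  have hsum : ∑ i, (p i).toReal = 1 := by
    rw [← ENNReal.toReal_sum (fun i _ => PMF.apply_ne_top _ _), ← tsum_fintype (L := .unconditional ι),
      PMF.tsum_coe]
    simp
  have hne : (Finset.univ : Finset ι).Nonempty := by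
    obtain ⟨i, _⟩ := p.support_nonempty
    exact ⟨i, Finset.mem_univ i⟩
  refine (Computable.mixture Finset.univ hne (fun i => liftAlg (F i)) hF (fun i => (p i).toReal)
    (fun i => ENNReal.toReal_nonneg) hsum hp).congr fun x φ o => ?_
  simp only [liftAlg]
  rw [PMF.bind_apply, tsum_fintype, ENNReal.toReal_sum
    (fun i _ => ENNReal.mul_ne_top (PMF.apply_ne_top _ _) (PMF.apply_ne_top _ _))]
  push_cast
  rw [Finset.sum_smul]
  refine Finset.sum_congr rfl fun i _ => ?_
  rw [smul_smul, ENNReal.toReal_mul]; push_cast; rfl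

theorem uniform {ι : Type} [Fintype ι] [Nonempty ι]
    (F : ι → Alg a b) (hF : ∀ i, IsPPT (F i)) :
    IsPPT (fun x => (PMF.uniformOfFintype ι).bind (fun i => F i x)) := by
  refine sample _ (fun i => ?_) F hF
  simp only [PMF.uniformOfFintype_apply, ENNReal.toReal_inv, ENNReal.toReal_natCast]
  exact (isAlgebraic_natCast _).inv

end IsPPT

/-! ### Reading finite information -/

theorem firstBits_take {n k : ℕ} (h : n ≤ k) (s : BitStr) : firstBits n (s.take k) = firstBits n s := by
  funext i
  have hi : (i : ℕ) < k := lt_of_lt_of_le i.2 h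
  simp [firstBits, List.getD_eq_getElem?_getD, hi]

theorem eq_take_iff {s t : BitStr} {k : ℕ} (h : t.length < k) : t = s.take k ↔ t = s := by
  constructor
  · intro ht
    have : (s.take k).length < k := by rw [← ht]; exact h
    rw [List.length_take] at this
    rw [ht, List.take_of_length_le (by omega)]
  · rintro rfl
    rw [List.take_of_length_le h.le]

theorem readKey_take (pad : PadFamily) (n : ℕ) (s : BitStr) :
    pad.readKey n (s.take (pad.len n + 1)) = pad.readKey n s := by
  have : (fun k : pad.Key n => pad.keyStr k = s.take (pad.len n + 1)) =
      fun k => pad.keyStr k = s := by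
    funext k
    exact propext (eq_take_iff (by simp [PadFamily.keyStr]))
  simp only [PadFamily.readKey, this]

theorem keyStr_injective (pad : PadFamily) (n : ℕ) :
    Function.Injective (pad.keyStr : pad.Key n → BitStr) := fun _ _ h =>
  (pad.code n).injective (List.ofFn_injective h)

@[simp] theorem readKey_keyStr (pad : PadFamily) {n : ℕ} (k : pad.Key n) :
    pad.readKey n (pad.keyStr k) = k := by
  have h : ∃ k' : pad.Key n, pad.keyStr k' = pad.keyStr k := ⟨k, rfl⟩
  rw [PadFamily.readKey, dif_pos h]
  exact keyStr_injective pad n h.choose_spec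

@[simp] theorem firstBits_ofFn {n : ℕ} (v : Bits n) (s : BitStr) :
    firstBits n (List.ofFn v ++ s) = v := by
  funext i
  simp [firstBits, List.getD_eq_getElem?_getD, List.getElem?_append]

@[simp] theorem firstBits_ofFn' {n : ℕ} (v : Bits n) : firstBits n (List.ofFn v) = v := by
  simpa using firstBits_ofFn v []

section
variable {Q : Type} [Fintype Q] {G : ContextualityGame Q} (K : Encoding G)

theorem readAStr_take (s : BitStr) : K.readAStr (s.take (K.na + 1)) = K.readAStr s := by
  have : (fun a => List.ofFn (K.codeA a) = s.take (K.na + 1)) =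
      fun a => List.ofFn (K.codeA a) = s := by
    funext k
    exact propext (eq_take_iff (by simp))
  simp only [Encoding.readAStr, this]

theorem readAStr_ofFn (a : G.Ans) : K.readAStr (List.ofFn (K.codeA a)) = some a := by
  have h : ∃ a', List.ofFn (K.codeA a') = List.ofFn (K.codeA a) := ⟨a, rfl⟩
  rw [Encoding.readAStr, dif_pos h]
  exact congrArg some (K.codeA.injective (List.ofFn_injective h.choose_spec))

theorem readAStr_eq_some {s : BitStr} {a : G.Ans} (h : K.readAStr s = some a) :
    s = List.ofFn (K.codeA a) := by
  rw [Encoding.readAStr] at h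
  split at h
  · next h' =>
    have := h'.choose_spec
    rw [← Option.some.inj h, this]
  · exact absurd h (by simp)

@[simp] theorem readA_codeA (a : G.Ans) : K.readA (K.codeA a) = some a := by
  have h : ∃ a', K.codeA a' = K.codeA a := ⟨a, rfl⟩
  rw [Encoding.readA, dif_pos h]
  exact congrArg some (K.codeA.injective h.choose_spec)

theorem readA_eq_some {z : Bits K.na} {a : G.Ans} (h : K.readA z = some a) : z = K.codeA a := by
  rw [Encoding.readA] at h
  split at h
  · next h' => rw [← Option.some.inj h, h'.choose_spec]
  · exact absurd h (by simp)

@[simp] theorem readQ_codeQ [Nonempty Q] (q : Q) : K.readQ (K.codeQ q) = q :=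
  Function.leftInverse_invFun K.codeQ.injective q

end

/-! ## Preparation and measurement of qubits -/

/-- The first `k` of the qubits `0, …, N-1` are on the stacks `1, …, k`, the others on stack `0`. -/
def unloaded (N k : ℕ) : ℕ → List ℕ :=
  fun i => if i = 0 then (List.range N).drop k else if i ≤ k then [i - 1] else []

def Config.withQubits (c : Config) (q : ℕ → List ℕ) (F : ℕ) : Config :=
  { c with todo := [], qubits := q, fresh := F }

/-- Move `k` qubits from stack `0` to the stacks `1, …, k`. -/
def Cmd.unload : ℕ → Cmd
  | 0 => .skip
  | k + 1 => .seq (.unload k) (.qmove 0 (k + 1))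

/-- Move the qubits on the stacks `1, …, k` to stack `0`. -/
def Cmd.load : ℕ → Cmd
  | 0 => .skip
  | k + 1 => .seq (.qmove (k + 1) 0) (.load k)

/-- New qubits on the stacks `n+1, …, n+k`. -/
def Cmd.news (n : ℕ) : ℕ → Cmd
  | 0 => .skip
  | k + 1 => .seq (.news n k) (.qnew (n + k + 1))

theorem yields_skip (c : Config) : Config.Yields [.skip] c 1 [c.withTodo []] :=
  ⟨rfl, by simp⟩

theorem range_drop_cons {N k : ℕ} (h : k < N) :
    (List.range N).drop k = k :: (List.range N).drop (k + 1) := by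
  rw [List.drop_eq_getElem_cons (by simpa using h)]
  simp

theorem yields_unload (N : ℕ) (c : Config) (hc : c.qubits = unloaded N 0) (k : ℕ) (hk : k ≤ N) :
    Config.Yields [.unload k] c (3 * k + 1) [c.withQubits (unloaded N k) c.fresh] := by
  induction k with
  | zero => 
    have : c.withQubits (unloaded N 0) c.fresh = c.withTodo [] := by rw [← hc]; rfl
    rw [this]; exact yields_skip c
  | succ k ih =>
    have h1 := ih (by omega)
    have h2 : Config.Yields [.qmove 0 (k + 1)] (c.withQubits (unloaded N k) c.fresh) 1
        [c.withQubits (unloaded N (k + 1)) c.fresh] := by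
      refine ⟨?_, by simp [Config.withQubits]⟩
      have hq : unloaded N k 0 = k :: (List.range N).drop (k + 1) := by
        simp only [unloaded, if_true]; exact range_drop_cons (by omega)
      have hU : Function.update (Function.update (unloaded N k) 0 ((List.range N).drop (k + 1)))
          (k + 1) (k :: Function.update (unloaded N k) 0 ((List.range N).drop (k + 1)) (k + 1)) =
          unloaded N (k + 1) := by
        funext i
        simp only [Function.update_apply, unloaded]
        grind
      rw [Config.run_succ]
      simp only [Config.step, Config.withTodo, Config.withQubits, hq, hU]
      rfl
    exact (h1.seq_one h2).mono (by omega)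

theorem yields_load (N : ℕ) (c : Config) (k : ℕ) (hk : k ≤ N) (hc : c.qubits = unloaded N k) :
    Config.Yields [.load k] c (3 * k + 1) [c.withQubits (unloaded N 0) c.fresh] := by
  induction k generalizing c with
  | zero =>
    have : c.withQubits (unloaded N 0) c.fresh = c.withTodo [] := by rw [← hc]; rfl
    rw [this]; exact yields_skip c
  | succ k ih =>
    have h2 : Config.Yields [.qmove (k + 1) 0] c 1 [c.withQubits (unloaded N k) c.fresh] := by
      refine ⟨?_, by simp [Config.withQubits]⟩
      have hq : c.qubits (k + 1) = [k] := by rw [hc]; simp [unloaded]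
      have hU : Function.update (Function.update c.qubits (k + 1) []) 0
          (k :: Function.update c.qubits (k + 1) [] 0) = unloaded N k := by
        rw [hc]
        funext i
        simp only [Function.update_apply, unloaded]
        by_cases h0 : i = 0
        · subst h0; simp [range_drop_cons (show k < N by omega)]
        · grind
      rw [Config.run_succ]
      simp only [Config.step, Config.withTodo, Config.withQubits, hq, hU]
      rfl
    exact (h2.seq_one (ih (c.withQubits (unloaded N k) c.fresh) (by omega) rfl)).mono (by omega)

theorem yields_news (n : ℕ) (c : Config) (hc : c.qubits = unloaded n n) (hf : c.fresh = n) (k : ℕ) :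
    Config.Yields [.news n k] c (3 * k + 1)
      [c.withQubits (unloaded (n + k) (n + k)) (n + k)] := by
  induction k with
  | zero =>
    have : c.withQubits (unloaded (n + 0) (n + 0)) (n + 0) = c.withTodo [] := by
      rw [add_zero, ← hc, ← hf]; rfl
    rw [this]; exact yields_skip c
  | succ k ih =>
    have h2 : Config.Yields [.qnew (n + k + 1)] (c.withQubits (unloaded (n + k) (n + k)) (n + k)) 1
        [c.withQubits (unloaded (n + (k + 1)) (n + (k + 1))) (n + (k + 1))] := by
      refine ⟨?_, by simp [Config.withQubits]⟩
      have hU : Function.update (unloaded (n + k) (n + k)) (n + k + 1)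
          ((n + k) :: unloaded (n + k) (n + k) (n + k + 1)) =
          unloaded (n + (k + 1)) (n + (k + 1)) := by
        funext i
        simp only [Function.update_apply, unloaded]
        by_cases h0 : i = 0
        · subst h0; simp [List.drop_of_length_le]
        · grind
      rw [Config.run_succ]
      simp only [Config.step, Config.withTodo, Config.withQubits, hU]
      rfl
    exact (ih.seq_one h2).mono (by omega)

theorem yields_gate {N : ℕ} (V : QOp N) (c : Config) (hc : c.qubits = unloaded N N) :
    Config.Yields [.qgate N V (fun j : Fin _ => (j : ℕ) + 1)] c 1
      [(c.withTodo []).withVec (applyGate V (Fin.valEmbedding : Fin N ↪ ℕ) c.vec)] := by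
  refine ⟨?_, by simp [Config.withVec]⟩
  have hh : ∀ j : Fin N, (c.qubits (j + 1)).head? = some (Fin.valEmbedding j) := by
    intro j; rw [hc]; simp [unloaded]
  have h : ∃ w : Fin N ↪ ℕ, ∀ j : Fin N, (c.qubits (j + 1)).head? = some (w j) := ⟨_, hh⟩
  have hw : h.choose = Fin.valEmbedding := by
    ext j
    have h1 := h.choose_spec j
    rw [hh j] at h1
    exact (Option.some.inj h1).symm
  rw [Config.run_succ]
  have : (c.withTodo [.qgate N V (fun j : Fin _ => (j : ℕ) + 1)]).step =
      [(c.withTodo []).withVec (applyGate V h.choose c.vec)] := dif_pos h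
  rw [this, hw]
  rfl

/-- Prepare the state that `V` makes of the basis state `0`. -/
def Cmd.prepare (N : ℕ) (V : QOp N) : Cmd :=
  .seq (.news 0 N) (.seq (.qgate N V (fun j : Fin _ => (j : ℕ) + 1)) (.load N))

/-- The strings are kept, and a state is prepared. -/
def prepareAlg (a : ℕ) {N : ℕ} (v : Bits N → ℂ) : QAlg a a 0 N :=
  fun x ρ o => if o = x then ρ.trace • ketbra v else 0

theorem trace_bits_zero (ρ : QOp 0) : ρ.trace = ρ default default := by
  simp only [Matrix.trace, Matrix.diag_apply, Finset.univ_unique, Finset.sum_singleton]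
  exact congrArg₂ ρ (Subsingleton.elim _ _) (Subsingleton.elim _ _)

theorem ketbra_mul {n : ℕ} (z : ℂ) (v : Bits n → ℂ) :
    ketbra (fun u => v u * z) = (z * star z) • ketbra v := by
  funext u w
  simp only [ketbra, star_mul', Matrix.smul_apply, smul_eq_mul]
  ring

theorem Realizes.prepare (a : ℕ) {N : ℕ} (V : QOp N) :
    Realizes (Cmd.prepare N V) (prepareAlg a (fun u => V u (fun _ => false))) := by
  refine ⟨Polynomial.C (3 * N + 1 + (1 + (3 * N + 1) + 1) + 1), fun x φ => ?_⟩
  set c := startConfig x φ with hc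
  have h1 := yields_news 0 c (by funext i; simp [unloaded, hc, startConfig, Cmd.initial]) rfl N
  rw [Nat.zero_add] at h1
  have h2 := yields_gate V (c.withQubits (unloaded N N) N) rfl
  have h3 := yields_load N (((c.withQubits (unloaded N N) N).withTodo []).withVec
      (applyGate V (Fin.valEmbedding : Fin N ↪ ℕ) c.vec)) N le_rfl rfl
  have hv : applyGate V (Fin.valEmbedding : Fin N ↪ ℕ) c.vec =
      (startConfig x (fun u => V u (fun _ => false) * φ default)).vec := by
    funext s
    change ∑ w : Bits N, V (fun j => s j) w * (if ∀ i, 0 ≤ i →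
        Function.extend (fun j : Fin N => (j : ℕ)) w s i = false then φ _ else 0) =
      if ∀ i, N ≤ i → s i = false then _ else 0
    by_cases hs : ∀ i, N ≤ i → s i = false
    · rw [if_pos hs, Finset.sum_eq_single (fun _ => false)]
      · rw [if_pos]
        · congr 2
          exact Subsingleton.elim _ _
        · intro i _
          by_cases hi : i < N
          · rw [show i = ((⟨i, hi⟩ : Fin N) : ℕ) from rfl, Fin.val_injective.extend_apply]
          · rw [Function.extend_apply', hs i (by omega)]
            rintro ⟨j, rfl⟩
            exact hi j.2
      · intro w _ hw
        rw [if_neg, mul_zero]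
        intro h
        refine hw (funext fun j => ?_)
        have := h j (Nat.zero_le _)
        rwa [Fin.val_injective.extend_apply] at this
      · simp
    · rw [if_neg hs, Finset.sum_eq_zero]
      intro w _
      rw [if_neg, mul_zero]
      intro h
      refine hs fun i hi => ?_
      have := h i (Nat.zero_le _)
      rwa [Function.extend_apply'] at this
      rintro ⟨j, rfl⟩
      have := j.2
      omega
  rw [show (c.withQubits (unloaded N N) N).vec = c.vec from rfl, hv] at h2
  rw [hv] at h3
  have hfin : (((c.withQubits (unloaded N N) N).withTodo []).withVec
      (startConfig x (fun u => V u (fun _ => false) * φ default)).vec).withQubits (unloaded N 0) N =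
      startConfig x (fun u => V u (fun _ => false) * φ default) := by
    have : unloaded N 0 = fun i => if i = 0 then List.range N else [] := by
      funext i; simp only [unloaded]; grind
    rw [this]
    rfl
  have h4 := h1.seq_one (h2.seq_one h3)
  rw [show (((c.withQubits (unloaded N N) N).withTodo []).withVec
      (startConfig x (fun u => V u (fun _ => false) * φ default)).vec).fresh = N from rfl,
    hfin] at h4
  refine ⟨_, h4.mono (le_of_eq (by simp)), ?_, ?_⟩
  · intro d hd
    rw [List.mem_singleton] at hd
    subst hd
    change (List.range N).length = N
    simp
  · intro o
    rw [outSum_cons, outSum_nil, add_zero, qout_startConfig, ketbra_mul]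
    have : (startConfig x (fun u => V u (fun _ => false) * φ default)).out a = x := by
      funext j
      change startBits x j = x j
      simp [startBits]
    rw [this, prepareAlg, trace_bits_zero]
    simp only [eq_comm]
    rfl

/-- Measure the qubits on the stacks `n+1, …, n+k`, and push the results on bit stack `0`. -/
def Cmd.measures (n : ℕ) : ℕ → Cmd
  | 0 => .skip
  | k + 1 => .seq (.qmeas (n + k + 1) 0) (.measures n k)

/-- Projection on the states for which the qubits `n, …, n+k-1` have the value `z`. -/
def restrictVec (n : ℕ) {k : ℕ} (z : Bits k) (v : (ℕ → Bool) → ℂ) : (ℕ → Bool) → ℂ :=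
  fun s => if ∀ j : Fin k, s (n + j) = z j then v s else 0

theorem ofFn_snoc {k : ℕ} (z : Bits k) (b : Bool) (s : BitStr) :
    List.ofFn (Fin.snoc z b : Bits (k + 1)) ++ s = List.ofFn z ++ b :: s := by
  rw [List.ofFn_succ']
  simp

theorem sum_bits_snoc {M : Type*} [AddCommMonoid M] {k : ℕ} (f : Bits (k + 1) → M) :
    ∑ z, f z = (∑ z : Bits k, f (Fin.snoc z true)) + ∑ z : Bits k, f (Fin.snoc z false) := by
  rw [← (Fin.snocEquiv (fun _ : Fin (k + 1) => Bool)).sum_comp, Fintype.sum_prod_type,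
    Fintype.sum_bool]
  rfl

theorem yields_measures (n k : ℕ) (c : Config) (hc : ∀ j < k, c.qubits (n + j + 1) = [n + j]) :
    ∃ L, Config.Yields [.measures n k] c (3 * k + 1) L ∧
      (∀ d ∈ L, d.qubits 0 = c.qubits 0) ∧ ∀ o : Fin 1 → BitStr, outSum 1 0 L o =
        ∑ z : Bits k, if o 0 = List.ofFn z ++ c.bits 0 then
          (c.withVec (restrictVec n z c.vec)).qout 0 else 0 := by
  induction k generalizing c with
  | zero =>
    refine ⟨_, yields_skip c, by simp, fun o => ?_⟩
    rw [outSum_cons, outSum_nil, add_zero]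
    rw [Fintype.sum_subsingleton _ (default : Bits 0)]
    simp only [List.ofFn_zero, List.nil_append]
    have h1 : c.withVec (restrictVec n (default : Bits 0) c.vec) = c := by
      have : restrictVec n (default : Bits 0) c.vec = c.vec := by
        funext s; simp [restrictVec]
      rw [this]; rfl
    have h2 : ((c.withTodo []).out 1 = o) ↔ (o 0 = c.bits 0) := by
      constructor
      · intro h; rw [← h]; rfl
      · intro h; funext j; rw [Subsingleton.elim j 0, h]; rfl
    simp only [h2]
    have h3 : (c.withVec (restrictVec n (default : Bits 0) c.vec)).qout 0 = (c.withTodo []).qout 0 := by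
      rw [h1]; rfl
    rw [h3]
  | succ k ih =>
    have hq : c.qubits (n + k + 1) = [n + k] := hc k (by omega)
    set br : Bool → Config := fun b => { c with
      todo := [], qubits := Function.update c.qubits (n + k + 1) []
      bits := Function.update c.bits 0 (b :: c.bits 0)
      vec := fun s => if s (n + k) = b then c.vec s else 0 } with hbr
    have hy : Config.Yields [.qmeas (n + k + 1) 0] c 1 [br true, br false] := by
      refine ⟨?_, by simp [hbr]⟩
      rw [Config.run_succ]
      simp only [Config.step, Config.withTodo, hq]
      rfl
    have hcb : ∀ b, ∀ j < k, (br b).qubits (n + j + 1) = [n + j] := by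
      intro b j hj
      simp only [hbr]
      rw [Function.update_of_ne (by omega), hc j (by omega)]
    choose G hG1 hG2 hG3 using fun b => ih (br b) (hcb b)
    have hall := hy.seq (P' := .measures n k) (T' := 3 * k + 1)
      (G := fun d => if d.bits 0 = true :: c.bits 0 then G true else G false) (by
        intro d hd
        rcases List.mem_cons.1 hd with rfl | hd
        · simpa [hbr] using hG1 true
        · rw [List.mem_singleton] at hd
          subst hd
          simpa [hbr] using hG1 false)
    have hL : [br true, br false].flatMap
        (fun d => if d.bits 0 = true :: c.bits 0 then G true else G false) = G true ++ G false := by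
      simp [hbr]
    rw [hL] at hall
    refine ⟨_, hall.mono (by omega), ?_, fun o => ?_⟩
    · intro d hd
      have h0 : ∀ b, (br b).qubits 0 = c.qubits 0 := fun b => by
        simp only [hbr]; rw [Function.update_of_ne (by omega)]
      rcases List.mem_append.1 hd with hd | hd
      · rw [hG2 _ d hd, h0]
      · rw [hG2 _ d hd, h0]
    · rw [outSum_append, hG3, hG3, sum_bits_snoc]
      have key : ∀ b, (∑ z : Bits k, if o 0 = List.ofFn z ++ (br b).bits 0 then
          ((br b).withVec (restrictVec n z (br b).vec)).qout 0 else 0) =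
          ∑ z : Bits k, if o 0 = List.ofFn (Fin.snoc z b : Bits (k + 1)) ++ c.bits 0 then
          (c.withVec (restrictVec n (Fin.snoc z b : Bits (k + 1)) c.vec)).qout 0 else 0 := by
        intro b
        refine Finset.sum_congr rfl fun z _ => ?_
        rw [ofFn_snoc]
        have hb : (br b).bits 0 = b :: c.bits 0 := by simp [hbr]
        rw [hb]
        congr 1
        have hv : restrictVec n z (br b).vec =
            restrictVec n (Fin.snoc z b : Bits (k + 1)) c.vec := by
          funext s
          simp only [restrictVec, hbr, Fin.forall_fin_succ', Fin.snoc_castSucc, Fin.snoc_last,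
            Fin.val_castSucc, Fin.val_last]
          by_cases h1 : ∀ j : Fin k, s (n + j) = z j <;> by_cases h2 : s (n + k) = b <;>
            simp [h1, h2]
        rw [hv, Config.qout_eq, Config.qout_eq]
        congr 2
      rw [key, key]

/-! ### Projective measurements -/

structure IsPVM {n : ℕ} {ι : Type*} [Fintype ι] (Pv : ι → QOp n) : Prop where
  herm : ∀ z, (Pv z)ᴴ = Pv z
  mul : ∀ z z', Pv z * Pv z' = if z = z' then Pv z else 0
  sum : ∑ z, Pv z = 1

/-- The unitary `∑ z, Pv z ⊗ X^z`. -/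
def pvmGate {n k : ℕ} (Pv : Bits k → QOp n) : QOp (n + k) := fun u v =>
  Pv (fun i => xor (u (Fin.natAdd n i)) (v (Fin.natAdd n i)))
    (fun i => u (Fin.castAdd k i)) (fun i => v (Fin.castAdd k i))

/-- Joining the values of two registers. -/
def bitsAppend (n k : ℕ) : Bits n × Bits k ≃ Bits (n + k) := Fin.appendEquiv n k

@[simp] theorem bitsAppend_castAdd {n k : ℕ} (p : Bits n × Bits k) (i : Fin n) :
    bitsAppend n k p (Fin.castAdd k i) = p.1 i := Fin.append_left _ _ _

@[simp] theorem bitsAppend_natAdd {n k : ℕ} (p : Bits n × Bits k) (i : Fin k) :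
    bitsAppend n k p (Fin.natAdd n i) = p.2 i := Fin.append_right _ _ _

theorem sum_bitsAppend {M : Type*} [AddCommMonoid M] {n k : ℕ} (f : Bits (n + k) → M) :
    ∑ v, f v = ∑ z : Bits k, ∑ h : Bits n, f (bitsAppend n k (h, z)) := by
  rw [← (bitsAppend n k).sum_comp, Fintype.sum_prod_type, Finset.sum_comm]

def xorEquiv {k : ℕ} (z : Bits k) : Bits k ≃ Bits k where
  toFun w := fun i => xor (z i) (w i)
  invFun w := fun i => xor (z i) (w i)
  left_inv w := by funext i; simp
  right_inv w := by funext i; simp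

theorem isGate_pvmGate {n k : ℕ} {Pv : Bits k → QOp n} (h : IsPVM Pv)
    (halg : ∀ z u v, IsAlgebraic ℚ (Pv z u v)) : IsGate (pvmGate Pv) := by
  refine ⟨?_, fun u v => halg _ _ _⟩
  rw [Matrix.mem_unitaryGroup_iff]
  ext u w
  obtain ⟨⟨hu, zu⟩, rfl⟩ := (bitsAppend n k).surjective u
  obtain ⟨⟨hw, zw⟩, rfl⟩ := (bitsAppend n k).surjective w
  rw [Matrix.mul_apply, sum_bitsAppend]
  simp only [Matrix.star_eq_conjTranspose, Matrix.conjTranspose_apply, pvmGate,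
    bitsAppend_castAdd, bitsAppend_natAdd]
  have h1 : ∀ z : Bits k, ∑ x : Bits n, Pv (fun i => xor (zu i) (z i)) hu x *
      star (Pv (fun i => xor (zw i) (z i)) hw x) =
      (if zu = zw then Pv (xorEquiv zu z) else 0) hu hw := by
    intro z
    have h2 : ∀ x, star (Pv (fun i => xor (zw i) (z i)) hw x) = Pv (xorEquiv zw z) x hw := fun x => by
      rw [← Matrix.conjTranspose_apply, h.herm]; rfl
    simp only [h2]
    have h3 := congrFun (congrFun (h.mul (xorEquiv zu z) (xorEquiv zw z)) hu) hw
    rw [Matrix.mul_apply] at h3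
    have h4 : (xorEquiv zu z = xorEquiv zw z) ↔ zu = zw := by
      constructor
      · intro h; funext i; have := congrFun h i; simpa [xorEquiv] using this
      · rintro rfl; rfl
    simp only [h4] at h3
    exact h3
  simp only [h1]
  by_cases hz : zu = zw
  · subst hz
    simp only [if_true]
    have h5 : ∑ z, Pv (xorEquiv zu z) hu hw = (1 : QOp n) hu hw := by
      rw [(xorEquiv zu).sum_comp (fun z => Pv z hu hw), ← h.sum, Matrix.sum_apply]
    rw [h5]
    simp [Matrix.one_apply]
  · simp only [if_neg hz]
    rw [Matrix.one_apply, if_neg]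
    · exact Finset.sum_const_zero
    · intro he
      have := (bitsAppend n k).injective he
      exact hz (by simpa using congrArg Prod.snd this)

theorem ketbra_mulVec {n : ℕ} (A : QOp n) (φ : Bits n → ℂ) :
    ketbra (A *ᵥ φ) = A * ketbra φ * Aᴴ := by
  have h : ∀ ψ : Bits n → ℂ, ketbra ψ = Matrix.vecMulVec ψ (star ψ) := fun ψ => rfl
  rw [h, h, Matrix.star_mulVec, Matrix.mul_vecMulVec, Matrix.vecMulVec_mul]

theorem trace_ketbra {n : ℕ} (φ : Bits n → ℂ) : (ketbra φ).trace = ∑ u, φ u * star (φ u) := rfl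

theorem IsPVM.trace_mul_ketbra {n : ℕ} {ι : Type*} [Fintype ι] {Pv : ι → QOp n} (h : IsPVM Pv) (z : ι)
    (φ : Bits n → ℂ) : (Pv z * ketbra φ).trace = (ketbra (Pv z *ᵥ φ)).trace := by
  rw [ketbra_mulVec, Matrix.trace_mul_comm (Pv z * ketbra φ), ← Matrix.mul_assoc, h.herm, h.mul, if_pos rfl]

/-- Measure `Pv` and output the result. -/
def measureAlg {n k : ℕ} (Pv : Bits k → QOp n) : QAlg 0 1 n 0 := fun _ ρ o =>
  ∑ z : Bits k, if o 0 = List.ofFn z then (Pv z * ρ).trace • (1 : QOp 0) else 0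

def Cmd.measure (n k : ℕ) (V : QOp (n + k)) : Cmd :=
  .seq (.unload n) (.seq (.news n k) (.seq (.qgate (n + k) V (fun j : Fin _ => (j : ℕ) + 1))
    (.measures n k)))

theorem sum_assignments {M : Type*} [AddCommMonoid M] (N : ℕ) (f : (ℕ → Bool) → M) :
    ∑ s ∈ assignments N, f s =
      ∑ u : Bits N, f (Function.extend (fun j : Fin N => (j : ℕ)) u (fun _ => false)) := by
  have he : ∀ u : Bits N, (fun i => if h : i < N then u ⟨i, h⟩ else false) =
      Function.extend (fun j : Fin N => (j : ℕ)) u (fun _ => false) := by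
    intro u
    funext i
    by_cases hi : i < N
    · rw [dif_pos hi]; exact (Fin.val_injective.extend_apply u _ ⟨i, hi⟩).symm
    · rw [dif_neg hi, Function.extend_apply']
      rintro ⟨j, rfl⟩
      exact hi j.2
  rw [assignments, Finset.sum_image]
  · exact Finset.sum_congr rfl fun u _ => by rw [he]
  · intro u _ v _ huv
    funext i
    have := congrFun huv i
    simpa using this

theorem Realizes.measure {n k : ℕ} {Pv : Bits k → QOp n} (h : IsPVM Pv) :
    Realizes (Cmd.measure n k (pvmGate Pv)) (measureAlg Pv) := by
  refine ⟨Polynomial.C (3 * n + 1 + (3 * k + 1 + (1 + (3 * k + 1) + 1) + 1) + 1), fun x φ => ?_⟩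
  set c := startConfig x φ with hc
  have hq0 : c.qubits = unloaded n 0 := by
    funext i
    simp only [hc, startConfig, Config.withTodo, Cmd.initial, unloaded]
    grind
  have h1 := yields_unload n c hq0 n le_rfl
  have h2 := yields_news n (c.withQubits (unloaded n n) c.fresh) rfl rfl k
  set c2 := (c.withQubits (unloaded n n) c.fresh).withQubits (unloaded (n + k) (n + k)) (n + k)
    with hc2
  have h3 := yields_gate (pvmGate Pv) c2 rfl
  set v := applyGate (pvmGate Pv) (Fin.valEmbedding : Fin (n + k) ↪ ℕ) c2.vec with hv
  obtain ⟨L, h4, h5, h6⟩ := yields_measures n k ((c2.withTodo []).withVec v) (by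
    intro j hj
    change unloaded (n + k) (n + k) (n + j + 1) = [n + j]
    simp only [unloaded]
    rw [if_neg (by omega), if_pos (by omega)]
    rfl)
  refine ⟨L, ?_, ?_, ?_⟩
  · exact (h1.seq_one (h2.seq_one (h3.seq_one h4))).mono (le_of_eq (by simp))
  · intro d hd
    rw [h5 d hd]
    change (unloaded (n + k) (n + k) 0).length = 0
    simp [unloaded]
  · intro o
    rw [h6]
    simp only [measureAlg]
    refine Finset.sum_congr rfl fun z _ => ?_
    have hb : ((c2.withTodo []).withVec v).bits 0 = [] := by
      change startBits x 0 = []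
      simp [startBits]
    rw [hb, List.append_nil]
    congr 1
    rw [h.trace_mul_ketbra, trace_ketbra, Config.qout_eq]
    have hw : ((((c2.withTodo []).withVec v).withVec
      (restrictVec n z ((c2.withTodo []).withVec v).vec)).wt : ℂ) = 1 := by
      change ((1 : ℝ) : ℂ) = 1; simp
    rw [hw, one_smul]
    ext p q
    have hp : p = default := Subsingleton.elim _ _
    have hqd : q = default := Subsingleton.elim _ _
    subst hp; subst hqd
    simp only [reduceTo, Matrix.smul_apply, Matrix.one_apply_eq, smul_eq_mul, mul_one]
    rw [Finset.filter_true_of_mem (by intro s _ j; exact j.elim0)]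
    change _ = ∑ s ∈ assignments (n + k), _
    rw [sum_assignments, sum_bitsAppend]
    have hext : ∀ (r : Fin 0 → ℕ) (u : Bits 0) (s : ℕ → Bool), Function.extend r u s = s := by
      intro r u s; funext i; rw [Function.extend_apply']; rintro ⟨j, _⟩; exact j.elim0
    simp only [hext]
    have hval : ∀ (u : Bits n) (z' : Bits k) (j : Fin k),
        Function.extend (fun j : Fin (n + k) => (j : ℕ)) (bitsAppend n k (u, z'))
          (fun _ => false) (n + j) = z' j := by
      intro u z' j
      rw [show n + (j : ℕ) = ((Fin.natAdd n j : Fin (n + k)) : ℕ) from rfl,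
        Fin.val_injective.extend_apply, bitsAppend_natAdd]
    have hrv : ∀ (u : Bits n) (z' : Bits k), restrictVec n z v
        (Function.extend (fun j : Fin (n + k) => (j : ℕ)) (bitsAppend n k (u, z')) (fun _ => false)) =
        if z' = z then (Pv z *ᵥ φ) u else 0 := by
      intro u z'
      simp only [restrictVec, hval, ← funext_iff]
      by_cases hz : z' = z
      · subst hz
        rw [if_pos rfl, if_pos rfl, hv]
        simp only [applyGate]
        rw [sum_bitsAppend, Finset.sum_eq_single (fun _ => false)]
        · rw [Matrix.mulVec, dotProduct]
          refine Finset.sum_congr rfl fun w _ => ?_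
          congr 1
          · simp only [pvmGate, bitsAppend_castAdd, bitsAppend_natAdd]
            have e1 : ∀ i, Function.extend (fun j : Fin (n + k) => (j : ℕ)) (bitsAppend n k (u, z'))
                (fun _ => false) (Fin.valEmbedding i : ℕ) = bitsAppend n k (u, z') i :=
              fun i => Fin.val_injective.extend_apply _ _ _
            simp only [e1, bitsAppend_castAdd, bitsAppend_natAdd, Bool.xor_false]
          · change (if _ then φ _ else 0) = _
            have e2 : ∀ (g : ℕ → Bool) (i : Fin (n + k)), Function.extend
                (Fin.valEmbedding : Fin (n + k) ↪ ℕ) (bitsAppend n k (w, fun _ => false)) g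
                (i : ℕ) = bitsAppend n k (w, fun _ => false) i :=
              fun g i => Fin.val_injective.extend_apply _ _ _
            rw [if_pos]
            · congr 1
              funext j
              have := e2 (Function.extend (fun j : Fin (n + k) => (j : ℕ)) (bitsAppend n k (u, z'))
                (fun _ => false)) (Fin.castAdd k j)
              rw [bitsAppend_castAdd] at this
              exact this
            · intro i hi
              by_cases hik : i < n + k
              · have := e2 (Function.extend (fun j : Fin (n + k) => (j : ℕ)) (bitsAppend n k (u, z'))
                  (fun _ => false)) ⟨i, hik⟩
                refine this.trans ?_
                have hi2 : (⟨i, hik⟩ : Fin (n + k)) = Fin.natAdd n ⟨i - n, by omega⟩ := by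
                  ext; simp; omega
                rw [hi2, bitsAppend_natAdd]
              · rw [Function.extend_apply', Function.extend_apply']
                · rintro ⟨j, rfl⟩; exact hik j.2
                · rintro ⟨j, rfl⟩; exact hik j.2
        · intro z2 _ hz2
          refine Finset.sum_eq_zero fun w _ => ?_
          have : c2.vec (Function.extend (Fin.valEmbedding : Fin (n + k) ↪ ℕ)
              (bitsAppend n k (w, z2)) (Function.extend (fun j : Fin (n + k) => (j : ℕ))
                (bitsAppend n k (u, z')) (fun _ => false))) = 0 := by
            change (if _ then φ _ else 0) = _
            rw [if_neg]
            intro hall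
            refine hz2 (funext fun j => ?_)
            have := hall (n + j) (by omega)
            rw [show n + (j : ℕ) = (Fin.valEmbedding (Fin.natAdd n j : Fin (n + k)) : ℕ) from rfl,
              Fin.valEmbedding.injective.extend_apply, bitsAppend_natAdd] at this
            exact this
          rw [this, mul_zero]
        · simp
      · rw [if_neg hz, if_neg hz]
    rw [Finset.sum_eq_single z]
    · refine Finset.sum_congr rfl fun u _ => ?_
      change _ = restrictVec n z v _ * star (restrictVec n z v _)
      rw [hrv, if_pos rfl]
    · intro z' _ hz'
      refine Finset.sum_eq_zero fun u _ => ?_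
      change restrictVec n z v _ * star (restrictVec n z v _) = 0
      rw [hrv, if_neg hz', zero_mul]
    · simp

/-! ### Preparation of states with algebraic amplitudes -/

theorem isAlgebraic_star {z : ℂ} (h : IsAlgebraic ℚ z) : IsAlgebraic ℚ (star z) :=
  h.algHom (Complex.conjAe.toAlgHom.restrictScalars ℚ)

theorem isAlgebraic_norm {z : ℂ} (h : IsAlgebraic ℚ z) : IsAlgebraic ℚ ((‖z‖ : ℝ) : ℂ) := by
  refine IsAlgebraic.of_pow two_pos ?_
  rw [← Complex.mul_conj']
  exact h.mul (isAlgebraic_star h)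

/-- A unit vector with algebraic entries is, up to a phase, a column of a Householder reflection. -/
theorem exists_gate {N : ℕ} (v : Bits N → ℂ) (i : Bits N) (hv : ∑ u, v u * star (v u) = 1)
    (ha : ∀ u, IsAlgebraic ℚ (v u)) :
    ∃ (V : QOp N) (z : ℂ), IsGate V ∧ z * star z = 1 ∧ ∀ u, V u i = v u * z := by
  obtain ⟨z, hza, hz, hzi⟩ : ∃ z : ℂ, IsAlgebraic ℚ z ∧ z * star z = 1 ∧ v i * z = (‖v i‖ : ℝ) := by
    by_cases h0 : v i = 0
    · exact ⟨1, isAlgebraic_one, by simp, by simp [h0]⟩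
    · have hn : ((‖v i‖ : ℝ) : ℂ) ≠ 0 := by simpa using h0
      have h1 : v i * star (v i) = ((‖v i‖ : ℝ) : ℂ) ^ 2 := Complex.mul_conj' _
      refine ⟨star (v i) * ((‖v i‖ : ℝ) : ℂ)⁻¹,
        (isAlgebraic_star (ha i)).mul (isAlgebraic_norm (ha i)).inv, ?_, ?_⟩
      · have h2 : star (((‖v i‖ : ℝ) : ℂ)⁻¹) = ((‖v i‖ : ℝ) : ℂ)⁻¹ := by
          rw [star_inv₀]; congr 1; exact Complex.conj_ofReal _
        rw [star_mul', star_star, h2]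
        field_simp
        linear_combination h1
      · field_simp
        exact h1
  set r : ℝ := ‖v i‖ with hr
  have hr0 : 0 ≤ r := norm_nonneg _
  have hr1 : (1 + (r : ℂ)) ≠ 0 := by
    rw [← Complex.ofReal_one, ← Complex.ofReal_add, Complex.ofReal_ne_zero]; positivity
  set w : Bits N → ℂ := fun u => v u * z with hw
  set x : Bits N → ℂ := fun u => Pi.single (M := fun _ => ℂ) i 1 u + w u with hx
  set c : ℂ := (1 + (r : ℂ))⁻¹ with hc
  have hcs : star c = c := by
    rw [hc, star_inv₀, star_add, star_one]; congr 2; exact Complex.conj_ofReal _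
  have hwi : w i = r := hzi
  have hww : ∑ u, star (w u) * w u = 1 := by
    rw [← hv]
    refine Finset.sum_congr rfl fun u _ => ?_
    simp only [hw, star_mul']
    linear_combination (v u * star (v u)) * hz
  have hxx : star x ⬝ᵥ x = 2 * (1 + r) := by
    have h1 : ∀ u, star (x u) * x u = star (w u) * w u +
        (if u = i then 1 + star (w u) + w u else 0) := by
      intro u
      simp only [hx, Pi.single_apply]
      split <;> simp <;> ring
    simp only [dotProduct, Pi.star_apply, h1]
    rw [Finset.sum_add_distrib, hww, Finset.sum_ite_eq' Finset.univ i, if_pos (Finset.mem_univ _),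
      hwi, show star (r : ℂ) = r from Complex.conj_ofReal _]
    ring
  set B : QOp N := Matrix.vecMulVec x (star x) with hB
  have hBB : B * B = (2 * (1 + r) : ℂ) • B := by
    rw [hB, Matrix.vecMulVec_mul_vecMulVec, hxx, Matrix.vecMulVec_smul]
  have hBs : Bᴴ = B := by
    ext a b; simp [hB, Matrix.vecMulVec_apply, mul_comm]
  refine ⟨c • B - 1, z, ⟨?_, fun u t => ?_⟩, hz, fun u => ?_⟩
  · rw [Matrix.mem_unitaryGroup_iff, Matrix.star_eq_conjTranspose, Matrix.conjTranspose_sub,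
      Matrix.conjTranspose_smul, hBs, hcs, Matrix.conjTranspose_one]
    rw [mul_sub, sub_mul, mul_one, one_mul, smul_mul_smul_comm, hBB, smul_smul]
    have : c * c * (2 * (1 + r)) = c + c := by
      rw [hc]; field_simp; ring
    rw [this, add_smul]
    abel
  · have hxa : ∀ u, IsAlgebraic ℚ (x u) := fun u => by
      refine IsAlgebraic.add ?_ ((ha u).mul hza)
      rw [Pi.single_apply]; split
      · exact isAlgebraic_one
      · exact isAlgebraic_zero
    refine IsAlgebraic.sub (IsAlgebraic.mul ?_ ((hxa u).mul (isAlgebraic_star (hxa t)))) ?_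
    · exact (isAlgebraic_one.add (isAlgebraic_norm (ha i))).inv
    · rw [Matrix.one_apply]; split
      · exact isAlgebraic_one
      · exact isAlgebraic_zero
  · have hxi : star (x i) = 1 + r := by
      simp only [hx, Pi.single_eq_same, hwi]
      rw [star_add, star_one]; congr 1; exact Complex.conj_ofReal _
    simp only [Matrix.sub_apply, Matrix.smul_apply, hB, Matrix.vecMulVec_apply, Pi.star_apply, hxi,
      smul_eq_mul, Matrix.one_apply]
    have h1 : c * (x u * (1 + r)) = x u := by rw [hc]; field_simp
    rw [h1]
    simp only [hx, Pi.single_apply]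
    ring

theorem Computable.prepare (a : ℕ) {N : ℕ} (v : Bits N → ℂ) (hv : ∑ u, v u * star (v u) = 1)
    (ha : ∀ u, IsAlgebraic ℚ (v u)) : Computable False (prepareAlg a v) := by
  obtain ⟨V, z, hV, hz, hcol⟩ := exists_gate v (fun _ => false) hv ha
  have h1 : ∀ k, (Cmd.news 0 k).Admissible := fun k => by
    induction k with
    | zero => trivial
    | succ k ih => simp_all [Cmd.news, Cmd.Admissible]
  have h2 : ∀ k, (Cmd.load k).Admissible := fun k => by
    induction k with
    | zero => trivial
    | succ k ih => simp_all [Cmd.load, Cmd.Admissible]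
  have h3 : Computable False (prepareAlg a (fun u => V u (fun _ => false))) :=
    ⟨Cmd.prepare N V, by simp [Cmd.prepare, Cmd.Admissible, h1, h2, hV], False.elim,
      Realizes.prepare a V⟩
  refine h3.congr fun x φ o => ?_
  simp only [prepareAlg, hcol]
  rw [ketbra_mul, hz, one_smul]

theorem Computable.measure {n k : ℕ} {Pv : Bits k → QOp n} (h : IsPVM Pv)
    (ha : ∀ z u v, IsAlgebraic ℚ (Pv z u v)) : Computable False (measureAlg Pv) := by
  have h1 : ∀ k, (Cmd.news n k).Admissible := fun k => by
    induction k with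
    | zero => trivial
    | succ k ih => simp_all [Cmd.news, Cmd.Admissible]
  have h2 : ∀ k, (Cmd.unload k).Admissible := fun k => by
    induction k with
    | zero => trivial
    | succ k ih => simp_all [Cmd.unload, Cmd.Admissible]
  have h3 : ∀ k, (Cmd.measures n k).Admissible := fun k => by
    induction k with
    | zero => trivial
    | succ k ih => simp_all [Cmd.measures, Cmd.Admissible]
  exact ⟨Cmd.measure n k (pvmGate Pv), by
    simp [Cmd.measure, Cmd.Admissible, h1, h2, h3, isGate_pvmGate h ha], False.elim,
      Realizes.measure h⟩

/-! ### The spectral projections of a strategy -/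

open ContextualityGame

namespace ContextualityGame.QStrat

variable {Q : Type} [Fintype Q] {G : ContextualityGame Q}
section
variable {H : Type} [NormedAddCommGroup H] [InnerProductSpace ℂ H] [CompleteSpace H]
  (S : G.QStrat H)

/-- A polynomial in an observable depends on its values on the answers only. -/
theorem aeval_congr (q : Q) {p p' : Polynomial ℂ} (h : ∀ r ∈ G.A, p.eval (r : ℂ) = p'.eval (r : ℂ)) :
    Polynomial.aeval (S.O q) p = Polynomial.aeval (S.O q) p' := by
  have hn : IsStarNormal (S.O q) := (S.selfAdjoint q).isStarNormal
  rw [← cfc_polynomial p (S.O q), ← cfc_polynomial p' (S.O q)]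
  refine cfc_congr fun x hx => ?_
  obtain ⟨r, hr, rfl⟩ := S.spec q hx
  exact h r hr

theorem eval_basis (a r : ℝ) (ha : a ∈ G.A) (hr : r ∈ G.A) :
    (Lagrange.basis G.A (fun r : ℝ => (r : ℂ)) a).eval (r : ℂ) = if a = r then 1 else 0 := by
  by_cases h : a = r
  · subst h
    rw [if_pos rfl]
    exact Lagrange.eval_basis_self (v := fun r : ℝ => (r : ℂ)) (Complex.ofReal_injective.injOn) ha
  · rw [if_neg h]
    exact Lagrange.eval_basis_of_ne (v := fun r : ℝ => (r : ℂ)) h hr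

theorem proj_mul_proj (q : Q) (a b : G.Ans) :
    S.proj q a.1 * S.proj q b.1 = if a = b then S.proj q a.1 else 0 := by
  rw [proj, proj, ← map_mul]
  have : (if a = b then Polynomial.aeval (S.O q) (Lagrange.basis G.A (fun r : ℝ => (r : ℂ)) a.1)
      else 0) = Polynomial.aeval (S.O q)
        (if a = b then (Lagrange.basis G.A (fun r : ℝ => (r : ℂ)) a.1) else 0) := by
    split <;> simp
  rw [this]
  refine S.aeval_congr q fun r hr => ?_
  rw [Polynomial.eval_mul, eval_basis _ _ a.2 hr, eval_basis _ _ b.2 hr]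
  by_cases h : a = b
  · subst h
    rw [if_pos rfl, eval_basis _ _ a.2 hr]
    split <;> simp
  · have h' : a.1 ≠ b.1 := fun h' => h (Subtype.ext h')
    rw [if_neg h, Polynomial.eval_zero]
    by_cases h1 : a.1 = r
    · rw [if_neg (fun h2 : b.1 = r => h' (h1.trans h2.symm)), mul_zero]
    · rw [if_neg h1, zero_mul]

theorem sum_proj (q : Q) : ∑ a : G.Ans, S.proj q a.1 = 1 := by
  simp only [proj]
  rw [← map_sum, ← map_one (Polynomial.aeval (R := ℂ) (S.O q))]
  refine S.aeval_congr q fun r hr => ?_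
  rw [Polynomial.eval_finsetSum, Polynomial.eval_one,
    Finset.sum_congr rfl fun a _ => eval_basis _ _ a.2 hr,
    Finset.sum_eq_single (⟨r, hr⟩ : G.Ans)]
  · simp
  · intro b _ hb
    exact if_neg fun h => hb (Subtype.ext h)
  · simp

theorem star_proj (q : Q) (a : G.Ans) : star (S.proj q a.1) = S.proj q a.1 := by
  have hn : IsStarNormal (S.O q) := (S.selfAdjoint q).isStarNormal
  rw [proj, ← cfc_polynomial _ (S.O q), ← cfc_star]
  refine cfc_congr fun x hx => ?_
  obtain ⟨r, hr, rfl⟩ := S.spec q hx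
  simp only
  rw [eval_basis _ _ a.2 hr]
  split <;> simp

theorem commute_proj {q q' : Q} (h : Commute (S.O q) (S.O q')) (a b : ℝ) :
    Commute (S.proj q a) (S.proj q' b) := by
  have key : ∀ (x : H →L[ℂ] H) (y : H →L[ℂ] H), Commute x y → ∀ p : Polynomial ℂ,
      Commute (Polynomial.aeval x p) y := by
    intro x y hxy p
    induction p using Polynomial.induction_on' with
    | add p p' hp hp' => rw [map_add]; exact hp.add_left hp'
    | monomial n c =>
      rw [Polynomial.aeval_monomial]
      exact Commute.mul_left (Algebra.commutes c y) (hxy.pow_left n)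
  exact key _ _ (key _ _ h.symm _).symm _

theorem nonempty_ans [Nonempty Q] (S : G.QStrat H) : Nonempty G.Ans := by
  have : Nontrivial H := by
    refine ⟨S.psi, 0, fun h => ?_⟩
    have := S.norm_psi
    rw [h] at this
    simp at this
  obtain ⟨x, hx⟩ := spectrum.nonempty (S.O (Classical.arbitrary Q))
  obtain ⟨r, hr, -⟩ := S.spec _ hx
  exact ⟨⟨r, hr⟩⟩

end

variable {n : ℕ} (S : G.QStrat (Qubits n))

theorem projMat_eq (q : Q) (a : ℝ) : Matrix.toEuclideanCLM (n := Bits n) (𝕜 := ℂ) (S.projMat q a) =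
    S.proj q a := by
  have h : S.projMat q a = (Matrix.toEuclideanCLM (n := Bits n) (𝕜 := ℂ)).symm (S.proj q a) := by
    obtain ⟨M, hM⟩ := EquivLike.surjective (Matrix.toEuclideanCLM (n := Bits n) (𝕜 := ℂ)) (S.proj q a)
    ext u v
    rw [projMat, ← hM, StarAlgEquiv.symm_apply_apply]
    rw [Matrix.ofLp_toEuclideanCLM, PiLp.ofLp_single, Matrix.mulVec_single_one]
    rfl
  rw [h, StarAlgEquiv.apply_symm_apply]

theorem projMat_mulVec (q : Q) (a : ℝ) (φ : Qubits n) : S.projMat q a *ᵥ φ.ofLp =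
    (S.proj q a φ).ofLp := by
  rw [← projMat_eq, Matrix.ofLp_toEuclideanCLM]

theorem isPVM_projMat (q : Q) : IsPVM (fun a : G.Ans => S.projMat q a.1) := by
  have hinj := EquivLike.injective (Matrix.toEuclideanCLM (n := Bits n) (𝕜 := ℂ))
  refine ⟨fun a => hinj ?_, fun a b => hinj ?_, hinj ?_⟩
  · rw [← Matrix.star_eq_conjTranspose, map_star, projMat_eq, star_proj]
  · rw [map_mul, projMat_eq, projMat_eq, proj_mul_proj]
    split
    · rw [projMat_eq]
    · rw [map_zero]
  · rw [map_sum, map_one]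
    simp only [projMat_eq, sum_proj]

theorem commute_projMat {q q' : Q} (h : Commute (S.O q) (S.O q')) (a b : ℝ) :
    S.projMat q a * S.projMat q' b = S.projMat q' b * S.projMat q a := by
  have hinj := EquivLike.injective (Matrix.toEuclideanCLM (n := Bits n) (𝕜 := ℂ))
  apply hinj
  rw [map_mul, map_mul, projMat_eq, projMat_eq]
  exact S.commute_proj h a b

end ContextualityGame.QStrat

theorem isAlgebraic_sum {ι : Type*} (s : Finset ι) {f : ι → ℂ} (h : ∀ i ∈ s, IsAlgebraic ℚ (f i)) :
    IsAlgebraic ℚ (∑ i ∈ s, f i) := by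
  induction s using Finset.cons_induction with
  | empty => simpa using isAlgebraic_zero
  | cons i s hi ih =>
    rw [Finset.sum_cons]
    exact (h i (by simp)).add (ih fun j hj => h j (by simp [hj]))

theorem isAlgebraic_matrix_mul {n : ℕ} {A B : QOp n} (hA : ∀ u v, IsAlgebraic ℚ (A u v))
    (hB : ∀ u v, IsAlgebraic ℚ (B u v)) (u v) : IsAlgebraic ℚ ((A * B) u v) := by
  rw [Matrix.mul_apply]
  exact isAlgebraic_sum _ fun w _ => (hA _ _).mul (hB _ _)

theorem IsPVM.conj {n : ℕ} {ι : Type*} [Fintype ι] {M : ι → QOp n} (h : IsPVM M) {U : QOp n}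
    (hU : U ∈ Matrix.unitaryGroup (Bits n) ℂ) : IsPVM (fun z => U * M z * Uᴴ) := by
  have h1 : Uᴴ * U = 1 := Matrix.mem_unitaryGroup_iff'.1 hU
  have h2 : U * Uᴴ = 1 := Matrix.mem_unitaryGroup_iff.1 hU
  refine ⟨fun z => ?_, fun z z' => ?_, ?_⟩
  · rw [Matrix.conjTranspose_mul, Matrix.conjTranspose_mul, Matrix.conjTranspose_conjTranspose,
      h.herm, Matrix.mul_assoc]
  · have : U * M z * Uᴴ * (U * M z' * Uᴴ) = U * (M z * M z') * Uᴴ := by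
      calc _ = U * M z * (Uᴴ * U) * M z' * Uᴴ := by simp only [Matrix.mul_assoc]
        _ = _ := by rw [h1, Matrix.mul_one, Matrix.mul_assoc U]
    rw [this, h.mul]
    split <;> simp
  · rw [← Finset.sum_mul, ← Finset.mul_sum, h.sum, Matrix.mul_one, h2]

/-- The operator `∑ w, M w ⊗ |w⟩⟨w|`. -/
def controlled {n k : ℕ} (M : Bits k → QOp n) : QOp (n + k) := fun u v =>
  if (fun i => u (Fin.natAdd n i)) = (fun i => v (Fin.natAdd n i)) then
    M (fun i => u (Fin.natAdd n i)) (fun i => u (Fin.castAdd k i)) (fun i => v (Fin.castAdd k i))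
  else 0

theorem controlled_append {n k : ℕ} (M : Bits k → QOp n) (p q : Bits n × Bits k) :
    controlled M (bitsAppend n k p) (bitsAppend n k q) =
      if p.2 = q.2 then M p.2 p.1 q.1 else 0 := by
  simp only [controlled, bitsAppend_natAdd, bitsAppend_castAdd]

theorem ext_append {n k : ℕ} {A B : QOp (n + k)}
    (h : ∀ p q, A (bitsAppend n k p) (bitsAppend n k q) = B (bitsAppend n k p) (bitsAppend n k q)) :
    A = B := by
  ext u v
  obtain ⟨p, rfl⟩ := (bitsAppend n k).surjective u
  obtain ⟨q, rfl⟩ := (bitsAppend n k).surjective v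
  exact h p q

theorem IsPVM.controlled {n k : ℕ} {ι : Type*} [Fintype ι] {M : Bits k → ι → QOp n}
    (h : ∀ w, IsPVM (M w)) : IsPVM (fun z => controlled (fun w => M w z)) := by
  refine ⟨fun z => ext_append fun p q => ?_, fun z z' => ext_append fun p q => ?_,
    ext_append fun p q => ?_⟩
  · rw [Matrix.conjTranspose_apply, controlled_append, controlled_append]
    by_cases hpq : p.2 = q.2
    · rw [if_pos hpq, if_pos hpq.symm, ← Matrix.conjTranspose_apply, (h _).herm, hpq]
    · rw [if_neg hpq, if_neg (Ne.symm hpq), star_zero]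
  · rw [Matrix.mul_apply, sum_bitsAppend]
    simp only [controlled_append]
    have h1 : ∀ w : Bits k, (∑ u : Bits n, (if p.2 = w then M p.2 z p.1 u else 0) *
        (if w = q.2 then M w z' u q.1 else 0)) =
        if w = p.2 then (if p.2 = q.2 then (M p.2 z * M p.2 z') p.1 q.1 else 0) else 0 := by
      intro w
      by_cases hw : w = p.2
      · subst hw
        by_cases hpq : p.2 = q.2
        · simp [hpq, Matrix.mul_apply]
        · simp [hpq]
      · rw [if_neg hw]
        exact Finset.sum_eq_zero fun u _ => by rw [if_neg (Ne.symm hw), zero_mul]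
    simp only [h1, Finset.sum_ite_eq', Finset.mem_univ, if_true, (h _).mul]
    by_cases hz : z = z'
    · rw [if_pos hz, if_pos hz, controlled_append]
    · rw [if_neg hz, if_neg hz]
      simp
  · rw [Matrix.sum_apply]
    simp only [controlled_append]
    by_cases hpq : p.2 = q.2
    · simp only [if_pos hpq]
      rw [← Matrix.sum_apply, (h _).sum, Matrix.one_apply, Matrix.one_apply]
      refine if_congr ?_ rfl rfl
      rw [(bitsAppend n k).apply_eq_iff_eq, Prod.ext_iff]
      simp [hpq]
    · simp only [if_neg hpq, Finset.sum_const_zero]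
      rw [Matrix.one_apply, if_neg]
      intro he
      exact hpq (congrArg Prod.snd ((bitsAppend n k).injective he))

section
variable {Q : Type} [Fintype Q] {G : ContextualityGame Q} (K : Encoding G)

/-- A family indexed by the answers as a family indexed by all strings of the length of a code. -/
def Encoding.byCode {R : Type*} [Zero R] (f : G.Ans → R) (z : Bits K.na) : R :=
  match K.readA z with
  | some a => f a
  | none => 0

theorem Encoding.byCode_codeA {R : Type*} [Zero R] (f : G.Ans → R) (a : G.Ans) :
    K.byCode f (K.codeA a) = f a := by
  rw [byCode, readA_codeA]

theorem Encoding.byCode_of_ne {R : Type*} [Zero R] (f : G.Ans → R) (z : Bits K.na)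
    (h : ∀ a, K.codeA a ≠ z) : K.byCode f z = 0 := by
  rw [byCode]
  split
  · next a ha => exact absurd (readA_eq_some K ha).symm (h a)
  · rfl

theorem Encoding.sum_byCode {R : Type*} [AddCommMonoid R] (f : G.Ans → R) :
    ∑ z, K.byCode f z = ∑ a, f a := by
  rw [← Finset.sum_subset (Finset.subset_univ (Finset.univ.map K.codeA))]
  · rw [Finset.sum_map]
    exact Finset.sum_congr rfl fun a _ => K.byCode_codeA f a
  · intro z _ hz
    exact K.byCode_of_ne f z fun a ha => hz (Finset.mem_map.2 ⟨a, Finset.mem_univ _, ha⟩)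

theorem IsPVM.byCode {n : ℕ} {M : G.Ans → QOp n} (h : IsPVM M) : IsPVM (K.byCode M) := by
  refine ⟨fun z => ?_, fun z z' => ?_, (K.sum_byCode M).trans h.sum⟩
  · by_cases hz : ∃ a, K.codeA a = z
    · obtain ⟨a, rfl⟩ := hz
      rw [K.byCode_codeA, h.herm]
    · rw [K.byCode_of_ne M z (by simpa using hz), Matrix.conjTranspose_zero]
  · by_cases hz : ∃ a, K.codeA a = z
    · obtain ⟨a, rfl⟩ := hz
      by_cases hz' : ∃ a, K.codeA a = z'
      · obtain ⟨b, rfl⟩ := hz'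
        rw [K.byCode_codeA, K.byCode_codeA, h.mul]
        by_cases hab : a = b
        · subst hab
          rw [if_pos rfl, if_pos rfl]
        · rw [if_neg hab, if_neg fun h => hab (K.codeA.injective h)]
      · rw [K.byCode_of_ne M z' (by simpa using hz'), mul_zero, if_neg]
        exact fun h => hz' ⟨a, h⟩
    · rw [K.byCode_of_ne M z (by simpa using hz), zero_mul]
      split <;> rfl

theorem Encoding.isAlgebraic_byCode {n : ℕ} {M : G.Ans → QOp n} (h : ∀ a u v, IsAlgebraic ℚ (M a u v))
    (z u v) : IsAlgebraic ℚ (K.byCode M z u v) := by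
  by_cases hz : ∃ a, K.codeA a = z
  · obtain ⟨a, rfl⟩ := hz
    rw [K.byCode_codeA]
    exact h _ _ _
  · rw [K.byCode_of_ne M z (by simpa using hz)]
    exact isAlgebraic_zero

variable [Nonempty Q] {n : ℕ} (S : G.QStrat (Qubits n))

/-- The measurement of the observable of the question in the second register. -/
def questionPVM (z : Bits K.na) : QOp (n + K.nq) :=
  controlled fun w => K.byCode (fun a => S.projMat (K.readQ w) a.1) z

theorem isPVM_questionPVM : IsPVM (questionPVM K S) :=
  IsPVM.controlled fun _ => (S.isPVM_projMat _).byCode K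

theorem measurementGate_eq : measurementGate K S = pvmGate (questionPVM K S) := by
  ext u v
  simp only [measurementGate, pvmGate, questionPVM, controlled, Encoding.byCode]
  refine if_congr Iff.rfl ?_ rfl
  split <;> rename_i heq <;> rw [heq]
  rfl

theorem measurementCircuit_admissible (hS : S.Described) :
    (measurementCircuit K S).Admissible := by
  intro g hg
  obtain rfl : g = ⟨n + K.nq + K.na, measurementGate K S, Function.Embedding.refl _⟩ :=
    List.mem_singleton.1 hg
  change IsGate (measurementGate K S)
  rw [measurementGate_eq]
  refine isGate_pvmGate (isPVM_questionPVM K S) fun z u v => ?_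
  rw [questionPVM, controlled]
  split
  · exact K.isAlgebraic_byCode (fun a => hS.2 _ _ a.2) _ _ _
  · exact isAlgebraic_zero

end

/-! ### The honest prover is efficient -/

theorem frameAlg_linear {a b n m : ℕ} (r : ℕ) {f : QAlg a b n m} (hf : f.Linear) :
    (frameAlg r f).Linear := fun x =>
  ⟨fun ρ σ => by
    funext o
    simp only [frameAlg, Pi.add_apply]
    split
    · rw [(hf _).map_add]; rfl
    · simp, fun c ρ => by
    funext o
    simp only [frameAlg, Pi.smul_apply]
    split
    · rw [(hf _).map_smul]; rfl
    · simp⟩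

theorem trace_smul_linear {n m : ℕ} (A : QOp n) (B : QOp m) :
    IsLinearMap ℂ (fun ρ : QOp n => (A * ρ).trace • B) :=
  ⟨fun ρ σ => by rw [mul_add, Matrix.trace_add, add_smul],
    fun c ρ => by rw [mul_smul_comm, Matrix.trace_smul, smul_assoc]⟩

theorem QStrat.sum_psi {Q : Type} [Fintype Q] {G : ContextualityGame Q} {n : ℕ}
    (S : G.QStrat (Qubits n)) : ∑ u, S.psi u * star (S.psi u) = 1 := by
  have h := S.norm_psi
  rw [EuclideanSpace.norm_eq, Real.sqrt_eq_one] at h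
  have h2 := congrArg (fun r : ℝ => (r : ℂ)) h
  push_cast at h2
  rw [← h2]
  exact Finset.sum_congr rfl fun u _ => Complex.mul_conj' _

section
variable {Q : Type} [Fintype Q] {G : ContextualityGame Q} (K : Encoding G) [Nonempty Q]
  {pad : PadFamily} (E : QFHE pad) {n : ℕ} (P : OPad pad n) (S : G.QStrat (Qubits n))

theorem sum_tens_basis {h k : ℕ} (ξ : Bits h → ℂ) (w : Bits k) (hξ : ∑ u, ξ u * star (ξ u) = 1) :
    ∑ u, tens ξ (Pi.single w 1) u * star (tens ξ (Pi.single w 1) u) = 1 := by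
  rw [sum_bitsAppend, Finset.sum_eq_single w]
  · refine Eq.trans ?_ hξ
    refine Finset.sum_congr rfl fun u _ => ?_
    simp [tens]
  · intro z _ hz
    refine Finset.sum_eq_zero fun u _ => ?_
    have : (Pi.single w 1 : Bits k → ℂ) z = 0 := by simp [hz]
    simp [tens, this]
  · simp

theorem honest_second_qpt (hS : S.Described) : IsQPT (honest K E P S).second := by
  rw [isQPT_iff]
  let M : Q → pad.Key n → Bits K.na → QOp n := fun q k z =>
    pad.U n k * K.byCode (fun a => S.projMat q a.1) z * (pad.U n k)ᴴ
  have hM : ∀ q k, IsPVM (M q k) := fun q k =>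
    ((S.isPVM_projMat q).byCode K).conj (pad.isGate n k).1
  have hlin : ∀ q k, (measureAlg (M q k)).Linear := fun q k x =>
    ⟨fun ρ σ => by
      funext o
      simp only [measureAlg, Pi.add_apply, ← Finset.sum_add_distrib]
      refine Finset.sum_congr rfl fun z _ => ?_
      split
      · exact (trace_smul_linear _ _).map_add _ _
      · simp, fun c ρ => by
      funext o
      simp only [measureAlg, Pi.smul_apply, Finset.smul_sum]
      refine Finset.sum_congr rfl fun z _ => ?_
      split
      · exact (trace_smul_linear _ _).map_smul _ _
      · simp⟩
  have hsec : ∀ x ρ o, (honest K E P S).second x ρ o =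
      measureAlg (M (K.readQ (firstBits K.nq (x 1))) (pad.readKey n (x 2))) ![] ρ o := by
    intro x ρ o
    simp only [honest, measureAlg]
    split
    · next a ha =>
      have ho := readAStr_eq_some K ha
      rw [Finset.sum_eq_single (K.codeA a)]
      · rw [if_pos ho]
        simp only [M, K.byCode_codeA]
      · intro z _ hz
        rw [if_neg]
        intro h
        exact hz (List.ofFn_injective (h.symm.trans ho))
      · simp
    · next ha =>
      refine (Finset.sum_eq_zero fun z _ => ?_).symm
      split
      · next ho =>
        have : K.byCode (fun a => S.projMat (K.readQ (firstBits K.nq (x 1))) a.1) z = 0 := by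
          refine K.byCode_of_ne _ _ fun a haz => ?_
          rw [ho, ← haz, readAStr_ofFn] at ha
          exact absurd ha (by simp)
        simp [M, this]
      · rfl
  have hsec' : (honest K E P S).second = fun x =>
      measureAlg (M (K.readQ (firstBits K.nq (x 1))) (pad.readKey n (x 2))) ![] := by
    funext x ρ o; exact hsec x ρ o
  rw [hsec']
  refine ⟨fun x => hlin _ _ _, ?_⟩
  have h0 : ∀ q k, Computable False (fun _ : Fin (2 + 1) → BitStr => measureAlg (M q k) ![]) := by
    intro q k
    have := Computable.subst (a := 2 + 1) ![] ![] ![] (Computable.measure (hM q k) fun z u v =>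
      isAlgebraic_matrix_mul (isAlgebraic_matrix_mul (pad.isGate n k).2
        (K.isAlgebraic_byCode (fun a => hS.2 _ _ a.2) z))
        (fun u v => isAlgebraic_star ((pad.isGate n k).2 v u)) u v) (hlin q k)
    exact this
  have h1 := fun q : Q => Computable.cases (a := 2 + 1) 2 (pad.len n + 1)
    (fun v _ => measureAlg (M q (pad.readKey n v)) ![]) (fun v => h0 q _) (fun v x => hlin _ _ _)
  have h2 := Computable.cases (a := 2 + 1) 1 K.nq
    (fun v x => measureAlg (M (K.readQ (firstBits K.nq v))
      (pad.readKey n ((x 2).take (pad.len n + 1)))) ![]) (fun v => h1 _) (fun v x => hlin _ _ _)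
  simp only [readKey_take, firstBits_take le_rfl] at h2
  exact h2

theorem honest_first_qpt (hS : S.Described) : IsQPT (honest K E P S).first := by
  rw [isQPT_iff]
  have hev := (isQPT_iff.1 (E.qeval_qpt (measurementCircuit K S)
    (measurementCircuit_admissible K S hS)))
  have hen := isQPT_iff.1 P.enc_qpt
  let N := n + K.nq
  let ψ : Bits K.nq → Bits N → ℂ := fun w => tens (fun u : Bits n => S.psi u) (Pi.single w 1)
  let F : Bits K.nq → QAlg 2 4 0 n := fun w z ρ o =>
    if o 0 = [] then P.enc ![z 0] (ρ.trace •
      E.qeval (measurementCircuit K S) ![z 1] (ketbra (ψ w)) ![o 1, o 2]) ![o 3] else 0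
  have hFl : ∀ w, (F w).Linear := fun w z =>
    ⟨fun ρ σ => by
      funext o
      simp only [F, Pi.add_apply, Matrix.trace_add, add_smul]
      split
      · rw [(hen.1 _).map_add]; rfl
      · simp, fun c ρ => by
      funext o
      simp only [F, Pi.smul_apply, Matrix.trace_smul, smul_assoc]
      split
      · rw [(hen.1 _).map_smul]; rfl
      · simp⟩
  have hF : ∀ w, Computable False (F w) := by
    intro w
    have h1 : Computable False (prepareAlg 2 (ψ w)) := by
      refine Computable.prepare 2 _ (sum_tens_basis _ w (QStrat.sum_psi S)) fun u => ?_
      refine (hS.1 _).mul ?_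
      rw [Pi.single_apply]; split
      · exact isAlgebraic_one
      · exact isAlgebraic_zero
    have hl2 := frameAlg_linear 1 (show QAlg.Linear _ from hev.1)
    have h2 := Computable.comp h1 (Computable.frame 1 hev.2) hl2
    have hl3 := frameAlg_linear 3 (show QAlg.Linear _ from hen.1)
    have h3 := Computable.comp h2 (Computable.precomp (a := 3) (Computable.frame 3 hen.2) hl3
      (![3, 1, 2, 0] : Fin 4 → ℕ)) (fun _ => hl3 _)
    refine h3.congr fun z φ o => ?_
    have e1 : ∀ y, ∑ᶠ y', frameAlg 1 (E.qeval (measurementCircuit K S)) y'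
        (prepareAlg 2 (ψ w) z (ketbra φ) y') y =
        frameAlg 1 (E.qeval (measurementCircuit K S)) z ((ketbra φ).trace • ketbra (ψ w)) y := by
      intro y
      rw [finsum_eq_single _ z]
      · simp only [prepareAlg, if_true]
      · intro y' hy'
        simp only [prepareAlg, if_neg hy']
        exact IsLinearMap.map_zero_apply hl2 _ _
    simp only [e1]
    rw [finsum_eq_single _ (![z 0, o 1, o 2] : Fin 3 → BitStr)]
    · simp only [F, frameAlg]
      have e2 : (fun i : Fin 1 => (![z 0, o 1, o 2] : Fin 3 → BitStr) (Fin.castAdd 2 i)) =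
          fun i => z (Fin.castAdd 1 i) := by
        funext i; fin_cases i; rfl
      rw [if_pos e2, (hev.1 _).map_smul]
      have e3 : ((fun i : Fin 3 => o (Fin.castAdd 1 i)) = fun i => startBits
          (![z 0, o 1, o 2] : Fin 3 → BitStr)
          ((![3, 1, 2, 0] : Fin 4 → ℕ) (Fin.castAdd 1 i))) ↔ o 0 = [] := by
        constructor
        · intro h; exact congrFun h 0
        · intro h; funext i; fin_cases i
          · exact h
          · rfl
          · rfl
      by_cases h0 : o 0 = []
      · rw [if_pos h0, if_pos (e3.2 h0)]
        congr 2
        · funext i; fin_cases i; rfl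
        · congr 2
          · funext i; fin_cases i; rfl
          · funext i; fin_cases i <;> rfl
        · funext i; fin_cases i; rfl
      · rw [if_neg h0, if_neg (mt e3.1 h0)]
    · intro y hy
      simp only [frameAlg]
      split
      · next h1 =>
        rw [if_neg, (hen.1 _).map_zero]
        · rfl
        · intro h2
          refine hy (funext fun i => ?_)
          fin_cases i
          · exact congrFun h2 0
          · exact (congrFun h1 1).symm
          · exact (congrFun h1 2).symm
      · rfl
  have hfirst : (honest K E P S).first = fun x =>
      F (firstBits K.nq (x 1)) (fun j => (![[], []] : Fin 2 → BitStr) j ++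
        (startBits x ((![2, 1] : Fin 2 → ℕ) j)).drop ((![0, K.nq] : Fin 2 → ℕ) j)) := by
    funext x ρ o
    simp [honest, F, startBits, ψ]
  rw [hfirst]
  refine ⟨fun x => hFl (firstBits K.nq (x 1)) (fun j => (![[], []] : Fin 2 → BitStr) j ++
    (startBits x ((![2, 1] : Fin 2 → ℕ) j)).drop ((![0, K.nq] : Fin 2 → ℕ) j)), ?_⟩
  have h4 := Computable.cases (a := 3) 1 K.nq (fun v x => F (firstBits K.nq v)
    (fun j => (![[], []] : Fin 2 → BitStr) j ++
        (startBits x ((![2, 1] : Fin 2 → ℕ) j)).drop ((![0, K.nq] : Fin 2 → ℕ) j)))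
    (fun v => Computable.subst _ _ _ (hF _) (hFl _))
    (fun v x => hFl (firstBits K.nq v) (fun j => (![[], []] : Fin 2 → BitStr) j ++
      (startBits x ((![2, 1] : Fin 2 → ℕ) j)).drop ((![0, K.nq] : Fin 2 → ℕ) j)))
  simp only [firstBits_take le_rfl] at h4
  exact h4

end

/-! ### Distances of nonnegative functions -/

/-- The difference of two numbers. -/
def gap (a b : ℝ≥0∞) : ℝ≥0∞ := (a - b) + (b - a)

theorem l1Dist_eq {α : Type*} (p q : α → ℝ≥0∞) : l1Dist p q = ∑' x, gap (p x) (q x) := rfl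

theorem gap_comm (a b : ℝ≥0∞) : gap a b = gap b a := add_comm _ _

@[simp] theorem gap_self (a : ℝ≥0∞) : gap a a = 0 := by simp [gap]

theorem le_add_gap (a b : ℝ≥0∞) : a ≤ b + gap a b :=
  le_add_tsub.trans (add_le_add_right (le_add_right le_rfl) _)

theorem gap_triangle (a b c : ℝ≥0∞) : gap a c ≤ gap a b + gap b c := by
  have h : ∀ a b c : ℝ≥0∞, a - c ≤ (a - b) + (b - c) := fun a b c => tsub_le_tsub_add_tsub
  calc gap a c ≤ ((a - b) + (b - c)) + ((c - b) + (b - a)) := add_le_add (h a b c) (h c b a)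
    _ = gap a b + gap b c := by simp only [gap]; ring

theorem gap_mul (c a b : ℝ≥0∞) (hc : c ≠ ⊤) : gap (c * a) (c * b) = c * gap a b := by
  rw [gap, gap, ← ENNReal.mul_sub (fun _ _ => hc), ← ENNReal.mul_sub (fun _ _ => hc), mul_add]

theorem gap_tsum_le {α : Type*} (f g : α → ℝ≥0∞) : gap (∑' x, f x) (∑' x, g x) ≤ ∑' x, gap (f x) (g x) := by
  have h : ∀ f g : α → ℝ≥0∞, ∑' x, f x - ∑' x, g x ≤ ∑' x, (f x - g x) := fun f g => by
    rw [tsub_le_iff_left, ← ENNReal.tsum_add]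
    exact ENNReal.tsum_le_tsum fun x => le_add_tsub
  calc _ ≤ ∑' x, (f x - g x) + ∑' x, (g x - f x) := add_le_add (h f g) (h g f)
    _ = _ := ENNReal.tsum_add.symm

theorem gap_ofReal (x y : ℝ) : gap (ENNReal.ofReal x) (ENNReal.ofReal y) ≤ ENNReal.ofReal |x - y| := by
  have h : ∀ x y : ℝ, x ≤ y → gap (ENNReal.ofReal x) (ENNReal.ofReal y) ≤ ENNReal.ofReal |x - y| := by
    intro x y h
    rw [gap, tsub_eq_zero_of_le (ENNReal.ofReal_le_ofReal h), zero_add, tsub_le_iff_left, abs_sub_comm]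
    refine (ENNReal.ofReal_le_ofReal ?_).trans ENNReal.ofReal_add_le
    linarith [le_abs_self (y - x)]
  rcases le_total x y with hxy | hxy
  · exact h x y hxy
  · rw [gap_comm, abs_sub_comm]; exact h y x hxy

theorem abs_toReal_sub_le {a b : ℝ≥0∞} {r : ℝ} (ha : a ≠ ⊤) (hb : b ≠ ⊤) (hr : 0 ≤ r)
    (h : gap a b ≤ ENNReal.ofReal r) : |a.toReal - b.toReal| ≤ r := by
  have h1 : ∀ {a b : ℝ≥0∞}, a ≠ ⊤ → b ≠ ⊤ → gap a b ≤ ENNReal.ofReal r → a.toReal ≤ b.toReal + r := by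
    intro a b ha hb h
    have h2 := ENNReal.toReal_mono (ENNReal.add_ne_top.2 ⟨hb, ENNReal.ofReal_ne_top⟩)
      ((le_add_gap a b).trans (add_le_add_right h _))
    rwa [ENNReal.toReal_add hb ENNReal.ofReal_ne_top, ENNReal.toReal_ofReal hr] at h2
  rw [abs_le]
  constructor
  · linarith [h1 hb ha (by rwa [gap_comm])]
  · linarith [h1 ha hb h]

theorem tsum_fin_succ {α : Type*} {k : ℕ} (f : (Fin (k + 1) → α) → ℝ≥0∞) :
    ∑' t, f t = ∑' a, ∑' t : Fin k → α, f (Fin.cons a t) := by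
  rw [← (Fin.consEquiv (fun _ : Fin (k + 1) => α)).tsum_eq, ← ENNReal.tsum_prod]
  rfl

theorem tsum_fin_one {α : Type*} (f : (Fin 1 → α) → ℝ≥0∞) : ∑' t, f t = ∑' a, f ![a] := by
  rw [tsum_fin_succ]
  refine tsum_congr fun a => ?_
  rw [tsum_eq_single (![] : Fin 0 → α) (fun t ht => absurd (Subsingleton.elim _ _) ht)]
  rfl

theorem tsum_fin_two {α : Type*} (f : (Fin 2 → α) → ℝ≥0∞) : ∑' t, f t = ∑' (a) (b), f ![a, b] := by
  rw [tsum_fin_succ]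
  exact tsum_congr fun a => tsum_fin_one _

theorem tsum_fin_three {α : Type*} (f : (Fin 3 → α) → ℝ≥0∞) :
    ∑' t, f t = ∑' (a) (b) (c), f ![a, b, c] := by
  rw [tsum_fin_succ]
  exact tsum_congr fun a => tsum_fin_two _

namespace Negligible

theorem zero : Negligible 0 := Asymptotics.superpolynomialDecay_zero _ _

theorem add {ν μ : ℕ → ℝ} (h : Negligible ν) (h' : Negligible μ) : Negligible (fun l => ν l + μ l) :=
  Asymptotics.SuperpolynomialDecay.add h h'

theorem mul {ν μ : ℕ → ℝ} (h : Negligible ν) (h' : Negligible μ) : Negligible (fun l => ν l * μ l) :=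
  Asymptotics.SuperpolynomialDecay.mul h h'

theorem const_mul {ν : ℕ → ℝ} (h : Negligible ν) (c : ℝ) : Negligible (fun l => c * ν l) :=
  Asymptotics.SuperpolynomialDecay.const_mul h c

theorem abs {ν : ℕ → ℝ} (h : Negligible ν) : Negligible (fun l => |ν l|) :=
  Asymptotics.SuperpolynomialDecay.trans_abs_le h fun l => by rw [abs_abs]

theorem sum {ι : Type*} (s : Finset ι) {ν : ι → ℕ → ℝ} (h : ∀ i ∈ s, Negligible (ν i)) :
    Negligible (fun l => ∑ i ∈ s, ν i l) := by
  induction s using Finset.cons_induction with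
  | empty => simp only [Finset.sum_empty]; exact zero
  | cons i s hi ih =>
    simp only [Finset.sum_cons]
    exact (h i (by simp)).add (ih fun j hj => h j (by simp [hj]))

end Negligible

/-! ### Positivity -/

theorem posSemidef_ketbra {n : ℕ} (φ : Bits n → ℂ) : (ketbra φ).PosSemidef :=
  Matrix.posSemidef_vecMulVec_self_star φ

theorem PosSemidef.exists_ketbra {n : ℕ} {ρ : QOp n} (h : ρ.PosSemidef) :
    ∃ (m : ℕ) (v : Fin m → Bits n → ℂ), ρ = ∑ i, ketbra (v i) :=
  Matrix.posSemidef_iff_eq_sum_vecMulVec.1 h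

theorem trace_mul_ketbra {n : ℕ} (A : QOp n) (φ : Bits n → ℂ) :
    (A * ketbra φ).trace = star φ ⬝ᵥ (A *ᵥ φ) := by
  have : ketbra φ = Matrix.vecMulVec φ (star φ) := rfl
  rw [this, Matrix.mul_vecMulVec, Matrix.trace_vecMulVec, dotProduct_comm]

theorem trace_mul_nonneg {n : ℕ} {A X : QOp n} (hA : A.PosSemidef) (hX : X.PosSemidef) :
    0 ≤ (A * X).trace := by
  obtain ⟨m, v, rfl⟩ := PosSemidef.exists_ketbra hX
  rw [Finset.mul_sum, Matrix.trace_sum]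
  refine Finset.sum_nonneg fun i _ => ?_
  rw [trace_mul_ketbra]
  exact hA.dotProduct_mulVec_nonneg _

theorem re_trace_mul_nonneg {n : ℕ} {A X : QOp n} (hA : A.PosSemidef) (hX : X.PosSemidef) :
    0 ≤ ((A * X).trace).re := (Complex.le_def.1 (trace_mul_nonneg hA hX)).1

theorem re_trace_nonneg {n : ℕ} {X : QOp n} (hX : X.PosSemidef) : 0 ≤ (X.trace).re :=
  (Complex.le_def.1 hX.trace_nonneg).1

theorem ofReal_re_trace {n : ℕ} {X : QOp n} (hX : X.PosSemidef) : ((X.trace.re : ℝ) : ℂ) = X.trace :=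
  Complex.ext rfl (Complex.le_def.1 hX.trace_nonneg).2

theorem re_trace_mul_le {n : ℕ} {A X : QOp n} (hA : (1 - A).PosSemidef) (hX : X.PosSemidef) :
    ((A * X).trace).re ≤ (X.trace).re := by
  have := re_trace_mul_nonneg hA hX
  rw [sub_mul, one_mul, Matrix.trace_sub, Complex.sub_re] at this
  linarith

theorem IsPVM.posSemidef {n : ℕ} {ι : Type*} [Fintype ι] {M : ι → QOp n} (h : IsPVM M) (s : Finset ι) :
    (∑ z ∈ s, M z).PosSemidef ∧ (1 - ∑ z ∈ s, M z).PosSemidef := by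
  have h0 : ∀ z, (M z).PosSemidef := fun z => by
    have := Matrix.posSemidef_conjTranspose_mul_self (M z)
    rwa [h.herm, h.mul, if_pos rfl] at this
  refine ⟨Matrix.posSemidef_sum s fun z _ => h0 z, ?_⟩
  rw [← h.sum, ← Finset.sum_compl_add_sum s, add_sub_cancel_right]
  exact Matrix.posSemidef_sum _ fun z _ => h0 z

section
variable {a b n m : ℕ} {f : QAlg a b n m}

theorem IsQPT.map_finset_sum {ι : Type*} (hf : f.Linear) (x) (s : Finset ι) (ρ : ι → QOp n) (o) :
    f x (∑ i ∈ s, ρ i) o = ∑ i ∈ s, f x (ρ i) o := by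
  have := congrFun (map_sum (IsLinearMap.mk' (f x) (hf x)) ρ s) o
  rw [Finset.sum_apply] at this
  exact this

theorem IsQPT.smul_apply (hf : f.Linear) (x) (c : ℂ) (ρ : QOp n) (o) :
    f x (c • ρ) o = c • f x ρ o := by rw [(hf x).map_smul]; rfl

theorem IsQPT.posSemidef (hf : IsQPT f) (x) {ρ : QOp n} (hρ : ρ.PosSemidef) (o) :
    (f x ρ o).PosSemidef := by
  obtain ⟨hl, P, hP, p, hp⟩ := hf
  obtain ⟨k, v, rfl⟩ := PosSemidef.exists_ketbra hρ
  rw [IsQPT.map_finset_sum hl]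
  refine Matrix.posSemidef_sum _ fun i _ => ?_
  rw [(hp x (v i)).2]
  have hnn : ∀ L : List (QOp m), (∀ A ∈ L, A.PosSemidef) → L.sum.PosSemidef := by
    intro L hL
    induction L with
    | nil => exact Matrix.PosSemidef.zero
    | cons A L ih =>
      rw [List.sum_cons]
      exact (hL A (by simp)).add (ih fun B hB => hL B (by simp [hB]))
  refine hnn _ fun A hA => ?_
  obtain ⟨c, hc, rfl⟩ := List.mem_map.1 hA
  rw [Config.qout_eq_sum]
  refine Matrix.PosSemidef.smul (Matrix.posSemidef_sum _ fun γ _ => posSemidef_ketbra _) ?_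
  have := Config.run_wt (c := P.initial x (v i)) (T := p.eval (inputSize x))
    ⟨by simpa [Cmd.initial] using hP, by simp [Cmd.initial]⟩ c (List.mem_of_mem_filter hc)
  exact_mod_cast this

theorem IsQPT.finite_support (hf : IsQPT f) (x) (φ : Bits n → ℂ) :
    {o | f x (ketbra φ) o ≠ 0}.Finite := by
  obtain ⟨hl, P, hP, p, hp⟩ := hf
  refine Set.Finite.subset (List.finite_toSet
    (((P.initial x φ).run (p.eval (inputSize x))).map (Config.out b))) ?_
  intro o ho
  by_contra hn
  refine ho ?_
  rw [(hp x φ).2, List.filter_eq_nil_iff.2]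
  · rfl
  · intro c hc h
    exact hn (List.mem_map.2 ⟨c, hc, by simpa using h⟩)

end

theorem CQClose.tsum_le {Y : Type*} {m : ℕ} {ε : ℝ} {σ τ : Y → QOp m} (h : CQClose ε σ τ)
    (E : Y → QOp m) (hE : ∀ y, (E y).PosSemidef ∧ (1 - E y).PosSemidef) :
    ∑' y, ENNReal.ofReal |((E y * (σ y - τ y)).trace).re| ≤ ENNReal.ofReal (2 * ε) := by
  rw [ENNReal.tsum_eq_iSup_sum]
  refine iSup_le fun F => ?_
  rw [← ENNReal.ofReal_sum_of_nonneg fun _ _ => abs_nonneg _]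
  refine ENNReal.ofReal_le_ofReal ?_
  have key : ∀ (p : Y → Prop) [DecidablePred p], |∑ y ∈ F, if p y then ((E y * (σ y - τ y)).trace).re else 0| ≤ ε := by
    intro p _
    have := h F (fun y => if p y then E y else 0) (fun y => by
      split
      · exact hE y
      · exact ⟨Matrix.PosSemidef.zero, by rw [sub_zero]; exact Matrix.PosSemidef.one⟩)
    convert this using 3
    split <;> simp
  have h1 := (abs_le.1 (key fun y => 0 ≤ ((E y * (σ y - τ y)).trace).re)).2
  have h2 := (abs_le.1 (key fun y => ¬ 0 ≤ ((E y * (σ y - τ y)).trace).re)).1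
  have h3 : ∑ y ∈ F, |((E y * (σ y - τ y)).trace).re| =
      (∑ y ∈ F, if 0 ≤ ((E y * (σ y - τ y)).trace).re then ((E y * (σ y - τ y)).trace).re else 0) -
      ∑ y ∈ F, if ¬ 0 ≤ ((E y * (σ y - τ y)).trace).re then ((E y * (σ y - τ y)).trace).re else 0 := by
    rw [← Finset.sum_sub_distrib]
    refine Finset.sum_congr rfl fun y _ => ?_
    by_cases hy : 0 ≤ ((E y * (σ y - τ y)).trace).re
    · rw [if_pos hy, if_neg (not_not.2 hy), abs_of_nonneg hy, sub_zero]
    · rw [if_neg hy, if_pos hy, abs_of_neg (not_le.1 hy), zero_sub]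
  linarith

/-! ### Pads -/

namespace PadFamily

variable (pad : PadFamily) {n : ℕ}

theorem U_mul_conjTranspose (k : pad.Key n) : pad.U n k * (pad.U n k)ᴴ = 1 :=
  Matrix.mem_unitaryGroup_iff.1 (pad.isGate n k).1

theorem conjTranspose_U_mul (k : pad.Key n) : (pad.U n k)ᴴ * pad.U n k = 1 :=
  Matrix.mem_unitaryGroup_iff'.1 (pad.isGate n k).1

theorem conj_mul (k k' : pad.Key n) (A : QOp n) : pad.U n (k * k') * A * (pad.U n (k * k'))ᴴ =
    pad.U n k * (pad.U n k' * A * (pad.U n k')ᴴ) * (pad.U n k)ᴴ := by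
  obtain ⟨ω, hω, h⟩ := pad.U_mul n k k'
  have h1 : ω * star ω = 1 := by
    have := Complex.mul_conj' ω
    rw [hω] at this
    simpa using this
  rw [h, Matrix.conjTranspose_smul, Matrix.smul_mul, Matrix.smul_mul, Matrix.mul_smul, smul_smul, h1,
    one_smul, Matrix.conjTranspose_mul]
  simp only [Matrix.mul_assoc]

theorem ketbra_phase {z : ℂ} (hz : ‖z‖ = 1) (v : Bits n → ℂ) : ketbra (z • v) = ketbra v := by
  have h1 : z * star z = 1 := by
    have := Complex.mul_conj' z
    rw [hz] at this
    simpa using this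
  have h2 := ketbra_mul z v
  rw [h1, one_smul] at h2
  rw [← h2]
  congr 1
  funext u
  simp [mul_comm]

theorem single_act {ω : ℂ} {b c : Bits n} (hω : ‖ω‖ = 1) {ω' : ℂ}
    (h : ω • (Pi.single b 1 : Bits n → ℂ) = ω' • (Pi.single c 1 : Bits n → ℂ)) : b = c := by
  by_contra hbc
  have := congrFun h b
  simp only [Pi.smul_apply, Pi.single_eq_same, Pi.single_eq_of_ne hbc, smul_eq_mul, mul_one,
    mul_zero] at this
  rw [this] at hω
  simp at hω

theorem act_mul (k k' : pad.Key n) (b : Bits n) :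
    pad.act n (k * k') b = pad.act n k (pad.act n k' b) := by
  obtain ⟨ω, hω, h⟩ := pad.U_mul n k k'
  obtain ⟨ω₁, hω₁, h₁⟩ := pad.U_basis n (k * k') b
  obtain ⟨ω₂, hω₂, h₂⟩ := pad.U_basis n k' b
  obtain ⟨ω₃, hω₃, h₃⟩ := pad.U_basis n k (pad.act n k' b)
  rw [h, Matrix.smul_mulVec, ← Matrix.mulVec_mulVec, h₂, Matrix.mulVec_smul, h₃] at h₁
  rw [smul_smul, smul_smul] at h₁
  exact (single_act (by simp [hω, hω₂, hω₃]) h₁).symm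

theorem act_injective (k : pad.Key n) : Function.Injective (pad.act n k) := by
  intro b c hbc
  obtain ⟨ω₁, hω₁, h₁⟩ := pad.U_basis n k b
  obtain ⟨ω₂, hω₂, h₂⟩ := pad.U_basis n k c
  rw [← hbc] at h₂
  refine single_act (ω := ω₂) hω₂ (ω' := ω₁) ?_
  have h3 : pad.U n k *ᵥ (ω₂ • (Pi.single b 1 : Bits n → ℂ)) =
      pad.U n k *ᵥ (ω₁ • (Pi.single c 1 : Bits n → ℂ)) := by
    rw [Matrix.mulVec_smul, Matrix.mulVec_smul, h₁, h₂, smul_smul, smul_smul, mul_comm]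
  have h4 := congrArg (fun v => (pad.U n k)ᴴ *ᵥ v) h3
  simpa only [Matrix.mulVec_mulVec, conjTranspose_U_mul, Matrix.one_mulVec] using h4

@[simp] theorem act_one (b : Bits n) : pad.act n 1 b = b :=
  pad.act_injective 1 (by rw [← act_mul, one_mul])

@[simp] theorem act_inv_act (k : pad.Key n) (b : Bits n) : pad.act n k⁻¹ (pad.act n k b) = b := by
  rw [← act_mul, inv_mul_cancel, act_one]

end PadFamily

/-! ### Decryption of ciphertexts of strings -/

/-- A fresh ciphertext of a string is the padded string followed by a ciphertext of the key. -/
theorem mem_support_encStr {pad : PadFamily} {E : FHE} {sk m c : BitStr}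
    (h : c ∈ (encStr pad E sk m).support) : ∃ k : pad.Key m.length,
      ∃ kh ∈ (E.enc ![sk, pad.keyStr k]).support,
        c = List.ofFn (pad.act m.length k m.get) ++ kh 0 := by
  obtain ⟨k, -, h⟩ := (PMF.mem_support_bind_iff _ _ _).1 h
  obtain ⟨kh, hkh, h⟩ := (PMF.mem_support_bind_iff _ _ _).1 h
  exact ⟨k, kh, hkh, (PMF.mem_support_pure_iff _ _).1 h⟩

theorem ofFn_act_get {pad : PadFamily} {N : ℕ} (b : Bits N) (k : pad.Key (List.ofFn b).length) :
    ∃ k' : pad.Key N, pad.keyStr k' = pad.keyStr k ∧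
      List.ofFn (pad.act (List.ofFn b).length k (List.ofFn b).get) = List.ofFn (pad.act N k' b) := by
  have h : ∀ (M : ℕ) (hM : M = N) (k : pad.Key M) (b' : Bits M), (∀ i, b' i = b (Fin.cast hM i)) →
      ∃ k' : pad.Key N, pad.keyStr k' = pad.keyStr k ∧
        List.ofFn (pad.act M k b') = List.ofFn (pad.act N k' b) := by
    rintro M rfl k b' hb
    exact ⟨k, rfl, by rw [show b' = b from funext hb]⟩
  exact h _ List.length_ofFn k _ fun i => by simp; rfl

theorem mem_support_encStr_ofFn {pad : PadFamily} {E : FHE} {sk c : BitStr} {N : ℕ} {b : Bits N}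
    (h : c ∈ (encStr pad E sk (List.ofFn b)).support) : ∃ k : pad.Key N,
      ∃ kh ∈ (E.enc ![sk, pad.keyStr k]).support, c = List.ofFn (pad.act N k b) ++ kh 0 := by
  obtain ⟨k, kh, hkh, rfl⟩ := mem_support_encStr h
  obtain ⟨k', h1, h2⟩ := ofFn_act_get b k
  exact ⟨k', kh, by rwa [h1], by rw [h2]⟩

theorem decStr_encStr {pad : PadFamily} {E : FHE} {l : ℕ} {sk : Fin 1 → BitStr}
    (hsk : sk ∈ (E.gen ![unary l]).support) {N : ℕ} {b : Bits N} {c : BitStr}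
    (h : c ∈ (encStr pad E (sk 0) (List.ofFn b)).support) : decStr pad E N (sk 0) c = b := by
  obtain ⟨k, kh, hkh, rfl⟩ := mem_support_encStr_ofFn h
  have h1 : (List.ofFn (pad.act N k b) ++ kh 0).drop N = kh 0 := by
    rw [List.drop_left' (by simp)]
  rw [decStr, h1, E.dec_enc l sk hsk _ kh hkh, readKey_keyStr, firstBits_ofFn, PadFamily.act_inv_act]

/-! ### The output of the measurement circuit -/

theorem extend_append {n k m : ℕ} (u h : Bits n) (w : Bits k) (y : Bits m) :
    Function.extend ((Fin.castAddEmb k).trans (Fin.castAddEmb m)) u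
      (bitsAppend (n + k) m (bitsAppend n k (h, w), y)) =
      bitsAppend (n + k) m (bitsAppend n k (u, w), y) := by
  funext i
  refine Fin.addCases (fun i => ?_) (fun i => ?_) i
  · refine Fin.addCases (fun i => ?_) (fun i => ?_) i
    · simp only [bitsAppend_castAdd]
      exact ((Fin.castAddEmb k).trans (Fin.castAddEmb m)).injective.extend_apply u _ i
    · rw [Function.extend_apply']
      · simp only [bitsAppend_castAdd, bitsAppend_natAdd]
      rintro ⟨j, hj⟩
      have h2 := congrArg Fin.val hj
      simp at h2
      omega
  · rw [Function.extend_apply', bitsAppend_natAdd, bitsAppend_natAdd]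
    rintro ⟨j, hj⟩
    have h2 := congrArg Fin.val hj
    simp at h2
    omega

theorem reduceTo_append {n k m : ℕ} (y : Bits m) (ω : Bits (n + k + m) → ℂ) (u v : Bits n) :
    reduceTo (Finset.univ.filter fun s => ∀ i, s (Fin.natAdd (n + k) i) = y i)
      ((Fin.castAddEmb k).trans (Fin.castAddEmb m)) ω u v =
    ∑ w : Bits k, ω (bitsAppend (n + k) m (bitsAppend n k (u, w), y)) *
      star (ω (bitsAppend (n + k) m (bitsAppend n k (v, w), y))) := by
  simp only [reduceTo, Finset.filter_filter]
  rw [Finset.sum_filter, sum_bitsAppend, Finset.sum_eq_single y]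
  · rw [sum_bitsAppend]
    refine Finset.sum_congr rfl fun w _ => ?_
    rw [Finset.sum_eq_single (fun _ => false)]
    · rw [if_pos, extend_append, extend_append]
      refine ⟨fun i => by rw [bitsAppend_natAdd], fun j => ?_⟩
      simp only [Function.Embedding.trans_apply, Fin.castAddEmb_apply, bitsAppend_castAdd]
    · intro h _ hh
      rw [if_neg]
      rintro ⟨-, h2⟩
      refine hh (funext fun j => ?_)
      have := h2 j
      simpa only [Function.Embedding.trans_apply, Fin.castAddEmb_apply, bitsAppend_castAdd] using this
    · simp
  · intro z _ hz
    refine Finset.sum_eq_zero fun p _ => ?_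
    rw [if_neg]
    rintro ⟨h1, -⟩
    refine hz (funext fun i => ?_)
    have := h1 i
    rwa [bitsAppend_natAdd] at this
  · simp

theorem applyGate_pvmGate {N m : ℕ} (M : Bits m → QOp N) (φ : Bits N → ℂ) (p : Bits N) (z : Bits m) :
    applyGate (pvmGate M) (Function.Embedding.refl (Fin (N + m)))
      (fun s => if ∀ i, s (Fin.natAdd N i) = false then φ (fun i => s (Fin.castAdd m i)) else 0)
      (bitsAppend N m (p, z)) = (M z *ᵥ φ) p := by
  simp only [applyGate]
  have hext : ∀ u v : Bits (N + m),
      Function.extend (Function.Embedding.refl (Fin (N + m))) u v = u := by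
    intro u v
    funext i
    exact (Function.Embedding.refl (Fin (N + m))).injective.extend_apply u v i
  simp only [hext]
  rw [sum_bitsAppend, Finset.sum_eq_single (fun _ => false)]
  · rw [Matrix.mulVec, dotProduct]
    refine Finset.sum_congr rfl fun h _ => ?_
    rw [if_pos (fun i => by rw [bitsAppend_natAdd])]
    simp only [Function.Embedding.refl_apply, pvmGate, bitsAppend_natAdd, bitsAppend_castAdd,
      Bool.xor_false]
  · intro z' _ hz'
    refine Finset.sum_eq_zero fun h _ => ?_
    rw [if_neg, mul_zero]
    intro hall
    refine hz' (funext fun i => ?_)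
    have := hall i
    rwa [bitsAppend_natAdd] at this
  · simp

section
variable {Q : Type} [Fintype Q] {G : ContextualityGame Q} (K : Encoding G) [Nonempty Q]
  {n : ℕ} (S : G.QStrat (Qubits n))

theorem questionPVM_mulVec (z : Bits K.na) (w : Bits K.nq) (ψ : Bits n → ℂ) (p : Bits n × Bits K.nq) :
    (questionPVM K S z *ᵥ tens ψ (Pi.single w 1)) (bitsAppend n K.nq p) =
      if p.2 = w then (K.byCode (fun a => S.projMat (K.readQ w) a.1) z *ᵥ ψ) p.1 else 0 := by
  rw [Matrix.mulVec, dotProduct, sum_bitsAppend, Finset.sum_eq_single w]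
  · simp only [questionPVM, controlled_append, tens, bitsAppend_castAdd, bitsAppend_natAdd,
      Pi.single_eq_same, mul_one]
    by_cases h : p.2 = w
    · simp only [h, if_true]
      rfl
    · simp only [if_neg h, zero_mul, Finset.sum_const_zero]
  · intro w' _ hw'
    refine Finset.sum_eq_zero fun h _ => ?_
    have : (Pi.single w 1 : Bits K.nq → ℂ) w' = 0 := by simp [hw']
    simp [tens, this]
  · simp

theorem output_measurementCircuit (ψ : Bits n → ℂ) (w : Bits K.nq) (y : Bits K.na) :
    (measurementCircuit K S).output (tens ψ (Pi.single w 1)) y =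
      K.byCode (fun a => ketbra (S.projMat (K.readQ w) a.1 *ᵥ ψ)) y := by
  have hk : K.byCode (fun a => ketbra (S.projMat (K.readQ w) a.1 *ᵥ ψ)) y =
      ketbra (K.byCode (fun a => S.projMat (K.readQ w) a.1) y *ᵥ ψ) := by
    by_cases hz : ∃ a, K.codeA a = y
    · obtain ⟨a, rfl⟩ := hz
      rw [K.byCode_codeA, K.byCode_codeA]
    · rw [K.byCode_of_ne _ y (by simpa using hz), K.byCode_of_ne _ y (by simpa using hz),
        Matrix.zero_mulVec, ketbra_zero_apply]
  rw [hk]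
  ext u v
  refine (reduceTo_append (n := n) (k := K.nq) (m := K.na) y (applyGate (measurementGate K S)
    (Function.Embedding.refl (Fin (n + K.nq + K.na))) (fun s => if ∀ i,
      s (Fin.natAdd (n + K.nq) i) = false then
        tens ψ (Pi.single w 1) (fun i => s (Fin.castAdd K.na i)) else 0)) u v).trans ?_
  rw [measurementGate_eq]
  simp only [applyGate_pvmGate, questionPVM_mulVec]
  rw [Finset.sum_eq_single w]
  · rw [if_pos rfl, if_pos rfl]
    rfl
  · intro w' _ hw'
    rw [if_neg hw', zero_mul]
  · simp

end

/-! ### Expectations -/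

/-- The expectation of `Φ`. -/
def mean {α : Type*} (p : PMF α) (Φ : α → ℝ≥0∞) : ℝ≥0∞ := ∑' x, p x * Φ x

section
variable {α β : Type*}

theorem bind_apply_mean (p : PMF α) (f : α → PMF β) (b : β) : (p.bind f) b = mean p (fun a => f a b) :=
  rfl

theorem mean_pure (a : α) (Φ : α → ℝ≥0∞) : mean (PMF.pure a) Φ = Φ a := by
  rw [mean, tsum_eq_single a]
  · simp
  · intro b hb; simp [hb]

theorem mean_bind (p : PMF α) (f : α → PMF β) (Φ : β → ℝ≥0∞) :
    mean (p.bind f) Φ = mean p (fun a => mean (f a) Φ) := by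
  simp only [mean, PMF.bind_apply, ← ENNReal.tsum_mul_right, ← ENNReal.tsum_mul_left]
  rw [ENNReal.tsum_comm]
  simp only [mul_assoc]

theorem mean_map (p : PMF α) (f : α → β) (Φ : β → ℝ≥0∞) :
    mean (p.map f) Φ = mean p (fun a => Φ (f a)) := by
  rw [PMF.map, mean_bind]
  simp only [Function.comp_apply, mean_pure]

theorem mean_const (p : PMF α) (c : ℝ≥0∞) : mean p (fun _ => c) = c := by
  rw [mean, ENNReal.tsum_mul_right, p.tsum_coe, one_mul]

theorem mean_mono {p : PMF α} {Φ Ψ : α → ℝ≥0∞} (h : ∀ a ∈ p.support, Φ a ≤ Ψ a) :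
    mean p Φ ≤ mean p Ψ := by
  refine ENNReal.tsum_le_tsum fun a => ?_
  by_cases ha : a ∈ p.support
  · exact mul_le_mul_right (h a ha) _
  · rw [(PMF.apply_eq_zero_iff p a).2 ha, zero_mul, zero_mul]

theorem mean_congr {p : PMF α} {Φ Ψ : α → ℝ≥0∞} (h : ∀ a ∈ p.support, Φ a = Ψ a) :
    mean p Φ = mean p Ψ :=
  le_antisymm (mean_mono fun a ha => (h a ha).le) (mean_mono fun a ha => (h a ha).ge)

theorem mean_le {p : PMF α} {Φ : α → ℝ≥0∞} {c : ℝ≥0∞} (h : ∀ a ∈ p.support, Φ a ≤ c) :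
    mean p Φ ≤ c := (mean_mono h).trans (mean_const p c).le

theorem mean_mul_left (p : PMF α) (c : ℝ≥0∞) (Φ : α → ℝ≥0∞) :
    mean p (fun a => c * Φ a) = c * mean p Φ := by
  rw [mean, mean, ← ENNReal.tsum_mul_left]
  exact tsum_congr fun a => mul_left_comm _ _ _

theorem mean_mul_right (p : PMF α) (c : ℝ≥0∞) (Φ : α → ℝ≥0∞) :
    mean p (fun a => Φ a * c) = mean p Φ * c := by
  simp only [mul_comm _ c, mean_mul_left]

theorem mean_add (p : PMF α) (Φ Ψ : α → ℝ≥0∞) :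
    mean p (fun a => Φ a + Ψ a) = mean p Φ + mean p Ψ := by
  simp only [mean, mul_add, ENNReal.tsum_add]

theorem mean_tsum (p : PMF α) (Φ : α → β → ℝ≥0∞) :
    mean p (fun a => ∑' b, Φ a b) = ∑' b, mean p (fun a => Φ a b) := by
  simp only [mean, ← ENNReal.tsum_mul_left]
  exact ENNReal.tsum_comm

theorem mean_sum (p : PMF α) (s : Finset β) (Φ : α → β → ℝ≥0∞) :
    mean p (fun a => ∑ b ∈ s, Φ a b) = ∑ b ∈ s, mean p (fun a => Φ a b) := by
  simp only [mean, Finset.mul_sum]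
  exact Summable.tsum_finsetSum fun _ _ => ENNReal.summable

theorem mean_comm (p : PMF α) (q : PMF β) (Φ : α → β → ℝ≥0∞) :
    mean p (fun a => mean q (Φ a)) = mean q (fun b => mean p (fun a => Φ a b)) := by
  simp only [mean, ← ENNReal.tsum_mul_left]
  rw [ENNReal.tsum_comm]
  exact tsum_congr fun b => tsum_congr fun a => mul_left_comm _ _ _

theorem gap_mean_le (p : PMF α) (Φ Ψ : α → ℝ≥0∞) :
    gap (mean p Φ) (mean p Ψ) ≤ mean p (fun a => gap (Φ a) (Ψ a)) :=
  (gap_tsum_le _ _).trans (ENNReal.tsum_le_tsum fun a => (gap_mul _ _ _ (p.apply_ne_top a)).le)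

theorem mean_uniform [Fintype α] [Nonempty α] (Φ : α → ℝ≥0∞) :
    mean (PMF.uniformOfFintype α) Φ = ∑ a, (Fintype.card α : ℝ≥0∞)⁻¹ * Φ a := by
  rw [mean, tsum_fintype]
  simp only [PMF.uniformOfFintype_apply]

end

/-! ### Comparison of executions -/

namespace Protocol

variable {n₁ m₁ n₂ m₂ : ℕ} (V : Protocol n₁ m₁ n₂ m₂)

/-- The sum of `F` over all executions, weighted with the probabilities of the messages of the
verifier. -/
def total (l : ℕ) (F : V.Exec → ℝ≥0∞) : ℝ≥0∞ :=
  ∑' e : V.Exec, V.start l (e.vs, e.t₁) * V.next e.vs e.t₁ e.t₂ e.t₃ * F e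

/-- The distance of two behaviours. -/
def distance (l : ℕ) (R R' : V.VS → Behaviour n₁ m₁ n₂ m₂) : ℝ≥0∞ :=
  V.total l fun e => gap (R e.vs l e.t₁ e.t₂ e.t₃ e.t₄) (R' e.vs l e.t₁ e.t₂ e.t₃ e.t₄)

/-- The probability that the verifier accepts. -/
def acceptWeight (R : V.VS → Behaviour n₁ m₁ n₂ m₂) (l : ℕ) : ℝ≥0∞ :=
  V.total l fun e => if e.verdict = true then R e.vs l e.t₁ e.t₂ e.t₃ e.t₄ else 0

def execEquiv : ((V.VS × (Fin n₁ → BitStr)) × (Fin m₁ → BitStr) × (Fin n₂ → BitStr) ×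
    (Fin m₂ → BitStr)) ≃ V.Exec where
  toFun x := ⟨x.1.1, x.1.2, x.2.1, x.2.2.1, x.2.2.2⟩
  invFun e := ((e.vs, e.t₁), e.t₂, e.t₃, e.t₄)
  left_inv _ := rfl
  right_inv _ := rfl

theorem total_eq (l : ℕ) (F : V.Exec → ℝ≥0∞) :
    V.total l F = mean (V.start l) (fun x => ∑' t₂, mean (V.next x.1 x.2 t₂)
      (fun t₃ => ∑' t₄, F ⟨x.1, x.2, t₂, t₃, t₄⟩)) := by
  rw [total, ← V.execEquiv.tsum_eq]
  refine (ENNReal.tsum_prod (f := fun (x : V.VS × (Fin n₁ → BitStr))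
    (y : (Fin m₁ → BitStr) × (Fin n₂ → BitStr) × (Fin m₂ → BitStr)) =>
    V.start l (x.1, x.2) * V.next x.1 x.2 y.1 y.2.1 * F ⟨x.1, x.2, y.1, y.2.1, y.2.2⟩)).trans (tsum_congr fun x => ?_)
  rw [← ENNReal.tsum_mul_left]
  refine (ENNReal.tsum_prod (f := fun (t₂ : Fin m₁ → BitStr)
    (y : (Fin n₂ → BitStr) × (Fin m₂ → BitStr)) => V.start l (x.1, x.2) * V.next x.1 x.2 t₂ y.1 *
    F ⟨x.1, x.2, t₂, y.1, y.2⟩)).trans (tsum_congr fun t₂ => ?_)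
  rw [mean, ← ENNReal.tsum_mul_left]
  refine (ENNReal.tsum_prod (f := fun t₃ t₄ => V.start l (x.1, x.2) * V.next x.1 x.2 t₂ t₃ *
    F ⟨x.1, x.2, t₂, t₃, t₄⟩)).trans (tsum_congr fun t₃ => ?_)
  rw [ENNReal.tsum_mul_left, mul_assoc]

theorem accept_eq (R : V.VS → Behaviour n₁ m₁ n₂ m₂) (l : ℕ) :
    V.accept R l = (V.acceptWeight R l).toReal := by
  rw [accept, acceptWeight, total]
  congr 1
  refine tsum_congr fun e => ?_
  split
  · rfl
  · rw [mul_zero]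

theorem weight_ne_top (l : ℕ) (e : V.Exec) :
    V.start l (e.vs, e.t₁) * V.next e.vs e.t₁ e.t₂ e.t₃ ≠ ⊤ :=
  ENNReal.mul_ne_top (PMF.apply_ne_top _ _) (PMF.apply_ne_top _ _)

theorem gap_mass (R R' : V.VS → Behaviour n₁ m₁ n₂ m₂) (l : ℕ) (e : V.Exec) :
    gap (V.mass R l e) (V.mass R' l e) = V.start l (e.vs, e.t₁) * V.next e.vs e.t₁ e.t₂ e.t₃ *
      gap (R e.vs l e.t₁ e.t₂ e.t₃ e.t₄) (R' e.vs l e.t₁ e.t₂ e.t₃ e.t₄) :=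
  gap_mul _ _ _ (V.weight_ne_top l e)

theorem gap_acceptWeight_le (R R' : V.VS → Behaviour n₁ m₁ n₂ m₂) (l : ℕ) :
    gap (V.acceptWeight R l) (V.acceptWeight R' l) ≤ V.distance l R R' := by
  refine (gap_tsum_le _ _).trans (ENNReal.tsum_le_tsum fun e => ?_)
  rw [gap_mul _ _ _ (V.weight_ne_top l e)]
  refine mul_le_mul_right ?_ _
  dsimp only
  split
  · exact le_rfl
  · simp

theorem l1Dist_transcript_le (R R' : V.VS → Behaviour n₁ m₁ n₂ m₂) (l : ℕ) :
    l1Dist (V.transcript R l) (V.transcript R' l) ≤ V.distance l R R' := by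
  rw [l1Dist_eq, distance, total]
  refine (ENNReal.tsum_le_tsum fun t => gap_tsum_le _ _).trans ?_
  have h1 : ∀ e : V.Exec, V.start l (e.vs, e.t₁) * V.next e.vs e.t₁ e.t₂ e.t₃ *
      gap (R e.vs l e.t₁ e.t₂ e.t₃ e.t₄) (R' e.vs l e.t₁ e.t₂ e.t₃ e.t₄) =
      ∑' b : Bool, if e.verdict = b then gap (V.mass R l e) (V.mass R' l e) else 0 := by
    intro e
    rw [tsum_eq_single e.verdict (fun b hb => if_neg (Ne.symm hb)), if_pos rfl, gap_mass]
  simp only [h1]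
  let eqv : ((Fin n₁ → BitStr) × (Fin m₁ → BitStr) × (Fin n₂ → BitStr) × (Fin m₂ → BitStr) × Bool) ×
      V.VS ≃ V.Exec × Bool :=
    { toFun := fun x => (⟨x.2, x.1.1, x.1.2.1, x.1.2.2.1, x.1.2.2.2.1⟩, x.1.2.2.2.2)
      invFun := fun y => ((y.1.t₁, y.1.t₂, y.1.t₃, y.1.t₄, y.2), y.1.vs)
      left_inv := fun _ => rfl
      right_inv := fun _ => rfl }
  rw [← ENNReal.tsum_prod, ← ENNReal.tsum_prod, ← eqv.tsum_eq]
  refine ENNReal.tsum_le_tsum fun x => ?_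
  change gap (if (eqv x).1.verdict = (eqv x).2 then V.mass R l (eqv x).1 else 0)
    (if (eqv x).1.verdict = (eqv x).2 then V.mass R' l (eqv x).1 else 0) ≤
    if (eqv x).1.verdict = (eqv x).2 then gap (V.mass R l (eqv x).1) (V.mass R' l (eqv x).1) else 0
  split
  · exact le_rfl
  · simp

theorem distance_triangle (l : ℕ) (R R' R'' : V.VS → Behaviour n₁ m₁ n₂ m₂) :
    V.distance l R R'' ≤ V.distance l R R' + V.distance l R' R'' := by
  rw [distance, distance, distance, total, total, total, ← ENNReal.tsum_add]
  refine ENNReal.tsum_le_tsum fun e => ?_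
  rw [← mul_add]
  exact mul_le_mul_right (gap_triangle _ _ _) _

theorem distance_comm (l : ℕ) (R R' : V.VS → Behaviour n₁ m₁ n₂ m₂) :
    V.distance l R R' = V.distance l R' R := by
  simp only [distance, gap_comm]

/-- Behaviours that are close to behaviours that agree on some executions. -/
theorem l1Dist_subtype_le (p : V.Exec → Prop) (R T T' R' : V.VS → Behaviour n₁ m₁ n₂ m₂) (l : ℕ)
    (h : ∀ e, p e → V.mass T l e = V.mass T' l e) :
    l1Dist (fun e : {e : V.Exec // p e} => V.mass R l e.1)
      (fun e : {e : V.Exec // p e} => V.mass R' l e.1) ≤ V.distance l R T + V.distance l T' R' := by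
  rw [l1Dist_eq, distance, distance, total, total, ← ENNReal.tsum_add]
  refine le_trans (ENNReal.tsum_le_tsum fun e => ?_)
    (ENNReal.tsum_comp_le_tsum_of_injective (f := fun e : {e : V.Exec // p e} => e.1)
      Subtype.val_injective _)
  rw [← gap_mass, ← gap_mass, ← h _ e.2]
  exact gap_triangle _ _ _

end Protocol

/-! ### Executions of the compiled game -/

section
variable {Q : Type} [Fintype Q] {G : ContextualityGame Q} (K : Encoding G)
  (h2 : ∀ C ∈ G.contexts, C.card = 2)

theorem mean_uniformQuestion (C : {C // C ∈ G.contexts}) (Φ : Q → ℝ≥0∞) :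
    mean (uniformQuestion h2 C) Φ = ∑ q ∈ C.1, 2⁻¹ * Φ q := by
  rw [mean, tsum_eq_sum (s := C.1)]
  · refine Finset.sum_congr rfl fun q hq => ?_
    rw [uniformQuestion, PMF.uniformOfFinset_apply, if_pos hq, h2 C.1 C.2]
    rfl
  · intro q hq
    rw [uniformQuestion, PMF.uniformOfFinset_apply, if_neg hq, zero_mul]

theorem mem_support_uniformQuestion (C : {C // C ∈ G.contexts}) (q : Q) :
    q ∈ (uniformQuestion h2 C).support ↔ q ∈ C.1 := by
  rw [uniformQuestion, PMF.mem_support_uniformOfFinset_iff]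

/-- A function of an answer sent in the clear, that vanishes if the string is no answer. -/
def Encoding.onAnswer (f : G.Ans → ℝ≥0∞) (s : BitStr) : ℝ≥0∞ :=
  match K.readAStr s with
  | some a => f a
  | none => 0

theorem Encoding.onAnswer_ofFn (f : G.Ans → ℝ≥0∞) (a : G.Ans) :
    K.onAnswer f (List.ofFn (K.codeA a)) = f a := by rw [onAnswer, readAStr_ofFn]

theorem Encoding.tsum_answer (Ψ : (Fin 1 → BitStr) → ℝ≥0∞)
    (h : ∀ t, K.readAStr (t 0) = none → Ψ t = 0) :
    ∑' t, Ψ t = ∑ a : G.Ans, Ψ ![List.ofFn (K.codeA a)] := by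
  have hinj : Function.Injective (fun a : G.Ans => (![List.ofFn (K.codeA a)] : Fin 1 → BitStr)) :=
    fun a b hab => K.codeA.injective (List.ofFn_injective (congrFun hab 0))
  rw [tsum_eq_sum (s := Finset.univ.map ⟨_, hinj⟩), Finset.sum_map]
  · rfl
  · intro t ht
    cases ha : K.readAStr (t 0) with
    | none => exact h t ha
    | some a =>
      refine absurd (Finset.mem_map.2 ⟨a, Finset.mem_univ _, ?_⟩) ht
      funext i
      fin_cases i
      exact (readAStr_eq_some K ha).symm

theorem Encoding.tsum_gap_onAnswer (f g : G.Ans → ℝ≥0∞) :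
    ∑' t : Fin 1 → BitStr, gap (K.onAnswer f (t 0)) (K.onAnswer g (t 0)) =
      ∑ a : G.Ans, gap (f a) (g a) := by
  rw [K.tsum_answer]
  · refine Finset.sum_congr rfl fun a _ => ?_
    change gap (K.onAnswer f (List.ofFn _)) (K.onAnswer g (List.ofFn _)) = _
    rw [K.onAnswer_ofFn, K.onAnswer_ofFn]
  · intro t ht
    simp [onAnswer, ht]

end

section
variable {Q : Type} [Fintype Q] {G : ContextualityGame Q} (K : Encoding G) [Nonempty Q]
  {pad : PadFamily} (E : QFHE pad) {n : ℕ} (P : OPad pad n)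
  (h2 : ∀ C ∈ G.contexts, C.card = 2)

/-- The key of the pad on the state of the prover. -/
def finalKey (sk osk kh s : BitStr) : pad.Key n := P.dec osk s * pad.readKey n (E.dec sk kh)

theorem total_compiled (l : ℕ) (F : (compiled K E P h2).Exec → ℝ≥0∞) :
    (compiled K E P h2).total l F =
      mean (E.gen ![unary l]) fun sk => mean G.D fun C => mean (uniformQuestion h2 C) fun q' =>
      mean (encStr pad E.toFHE (sk 0) (List.ofFn (K.codeQ q'))) fun c =>
      mean (P.gen ![unary l]) fun g => ∑' t₂ : Fin 3 → BitStr,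
      mean (uniformQuestion h2 C) fun q => ∑' t₄ : Fin 1 → BitStr,
        F ⟨(⟨sk 0, C, q', g 1⟩ : Coins G), ![c, g 0], t₂, ![List.ofFn (K.codeQ q), pad.keyStr
          (finalKey E P (sk 0) (g 1) (t₂ 1) (t₂ 2))], t₄⟩ := by
  rw [Protocol.total_eq]
  have h1 : (compiled K E P h2).start l = (E.gen ![unary l]).bind fun sk => G.D.bind fun C =>
      (uniformQuestion h2 C).bind fun q' =>
      (encStr pad E.toFHE (sk 0) (List.ofFn (K.codeQ q'))).bind fun c =>
      (P.gen ![unary l]).bind fun g =>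
      PMF.pure ((⟨sk 0, C, q', g 1⟩ : Coins G), ![c, g 0]) := rfl
  have h3 : ∀ (vs : Coins G) t₁ t₂, (compiled K E P h2).next vs t₁ t₂ =
      (uniformQuestion h2 vs.C).bind fun q => PMF.pure ![List.ofFn (K.codeQ q), pad.keyStr
          (finalKey E P vs.sk vs.opSk (t₂ 1) (t₂ 2))] := fun _ _ _ => rfl
  rw [h1]
  refine (mean_bind _ _ _).trans (congrArg _ (funext fun sk => ?_))
  refine (mean_bind _ _ _).trans (congrArg _ (funext fun C => ?_))
  refine (mean_bind _ _ _).trans (congrArg _ (funext fun q' => ?_))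
  refine (mean_bind _ _ _).trans (congrArg _ (funext fun c => ?_))
  refine (mean_bind _ _ _).trans (congrArg _ (funext fun g => ?_))
  refine (mean_pure _ _).trans (tsum_congr fun t₂ => ?_)
  rw [h3]
  refine (mean_bind _ _ _).trans (congrArg _ (funext fun q => ?_))
  exact mean_pure _ _

end

/-! ### The oblivious pad hides its input -/

theorem IsPVM.effect {n : ℕ} {ι : Type*} [Fintype ι] {M : ι → QOp n} (h : IsPVM M) (z : ι) :
    (M z).PosSemidef ∧ (1 - M z).PosSemidef := by simpa using h.posSemidef {z}

theorem PadFamily.effect_conj {pad : PadFamily} {n : ℕ} (k : pad.Key n) {Y : QOp n}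
    (hY : Y.PosSemidef ∧ (1 - Y).PosSemidef) :
    (pad.U n k * Y * (pad.U n k)ᴴ).PosSemidef ∧ (1 - pad.U n k * Y * (pad.U n k)ᴴ).PosSemidef := by
  refine ⟨hY.1.mul_mul_conjTranspose_same _, ?_⟩
  have := hY.2.mul_mul_conjTranspose_same (pad.U n k)
  rwa [mul_sub, sub_mul, mul_one, pad.U_mul_conjTranspose] at this

theorem PadFamily.trace_conj {pad : PadFamily} {n : ℕ} (k : pad.Key n) (Y ρ : QOp n) :
    (pad.U n k * Y * (pad.U n k)ᴴ * (pad.U n k * ρ * (pad.U n k)ᴴ)).trace = (Y * ρ).trace := by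
  have : pad.U n k * Y * (pad.U n k)ᴴ * (pad.U n k * ρ * (pad.U n k)ᴴ) =
      pad.U n k * (Y * ρ) * (pad.U n k)ᴴ := by
    calc _ = pad.U n k * Y * ((pad.U n k)ᴴ * pad.U n k) * ρ * (pad.U n k)ᴴ := by
          simp only [Matrix.mul_assoc]
      _ = _ := by rw [pad.conjTranspose_U_mul]; simp only [Matrix.mul_assoc, Matrix.one_mul]
  rw [this, Matrix.trace_mul_comm, ← Matrix.mul_assoc, pad.conjTranspose_U_mul, Matrix.one_mul]

/-- A measurement under the pad is independent of the string that the pad outputs. -/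
theorem OPad.hiding {pad : PadFamily} {n : ℕ} (P : OPad pad n) : ∃ ν : ℕ → ℝ, Negligible ν ∧
    ∀ (ρ : QOp n), IsDensity ρ → ∀ Y : QOp n, Y.PosSemidef ∧ (1 - Y).PosSemidef → ∀ l : ℕ,
      mean (P.gen ![unary l]) (fun g => ∑' s : Fin 1 → BitStr,
        gap (ENNReal.ofReal ((pad.U n (P.dec (g 1) (s 0)) * Y * (pad.U n (P.dec (g 1) (s 0)))ᴴ *
            P.enc ![g 0] ρ s).trace).re)
          (P.samp ![g 0] s * ENNReal.ofReal ((Y * ρ).trace).re)) ≤ ENNReal.ofReal (ν l) := by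
  obtain ⟨ν₁, hν₁, h₁⟩ := P.correct
  obtain ⟨ν₂, hν₂, h₂⟩ := P.range_sampling
  refine ⟨fun l => (|ν₁ l| + |ν₁ l| * |ν₂ l|) + (|ν₁ l| + |ν₂ l|) + |ν₂ l|,
    ((hν₁.abs.add (hν₁.abs.mul hν₂.abs)).add (hν₁.abs.add hν₂.abs)).add hν₂.abs, ?_⟩
  intro ρ hρ Y hY l
  set μ := P.gen ![unary l] with hμ
  let e : (Fin 2 → BitStr) → (Fin 1 → BitStr) → ℝ := fun g s => ((P.enc ![g 0] ρ s).trace).re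
  let U : (Fin 2 → BitStr) → (Fin 1 → BitStr) → QOp n := fun g s => pad.U n (P.dec (g 1) (s 0))
  let good : (Fin 2 → BitStr) → (Fin 1 → BitStr) → Prop := fun g s => CQClose (ν₁ l)
    (fun _ : Unit => ((P.enc ![g 0] ρ s).trace)⁻¹ • P.enc ![g 0] ρ s)
    (fun _ => U g s * ρ * (U g s)ᴴ)
  let D : (Fin 2 → BitStr) → ℝ≥0∞ := fun g =>
    l1Dist (P.samp ![g 0]) (fun s => ENNReal.ofReal (e g s))
  have hpos : ∀ (g : Fin 2 → BitStr) (s : Fin 1 → BitStr), (P.enc ![g 0] ρ s).PosSemidef := fun g s => P.enc_qpt.posSemidef _ hρ.1 _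
  have he0 : ∀ g s, 0 ≤ e g s := fun g s => re_trace_nonneg (hpos g s)
  have hy0 : 0 ≤ ((Y * ρ).trace).re := re_trace_mul_nonneg hY.1 hρ.1
  have hy1 : ((Y * ρ).trace).re ≤ 1 := by
    have := re_trace_mul_le hY.2 hρ.1
    rwa [hρ.2, Complex.one_re] at this
  have hD : mean μ D ≤ ENNReal.ofReal |ν₂ l| :=
    (h₂ ρ hρ l).trans (ENNReal.ofReal_le_ofReal (le_abs_self _))
  have hC : ENNReal.ofReal (1 - |ν₁ l|) ≤ mean μ fun g => ∑' s, if good g s then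
      ENNReal.ofReal (e g s) else 0 := by
    refine (ENNReal.ofReal_le_ofReal (by linarith [le_abs_self (ν₁ l)])).trans ((h₁ ρ hρ l).trans ?_)
    refine le_of_eq (tsum_congr fun g => ?_)
    rw [ENNReal.tsum_mul_left]
  have hE : mean μ (fun g => ∑' s, ENNReal.ofReal (e g s)) ≤ 1 + ENNReal.ofReal |ν₂ l| := by
    calc _ ≤ mean μ (fun g => 1 + D g) := by
          refine mean_mono fun g _ => ?_
          rw [← (P.samp ![g 0]).tsum_coe]
          simp only [D]
          rw [l1Dist_eq, ← ENNReal.tsum_add]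
          refine ENNReal.tsum_le_tsum fun s => ?_
          rw [gap_comm]
          exact le_add_gap _ _
      _ ≤ _ := by
          rw [mean_add, mean_const]
          exact add_le_add_right hD _
  have hbad : mean μ (fun g => ∑' s, if good g s then 0 else ENNReal.ofReal (e g s)) ≤
      ENNReal.ofReal |ν₁ l| + ENNReal.ofReal |ν₂ l| := by
    have hsplit : mean μ (fun g => ∑' s, ENNReal.ofReal (e g s)) =
        mean μ (fun g => ∑' s, if good g s then 0 else ENNReal.ofReal (e g s)) +
        mean μ (fun g => ∑' s, if good g s then ENNReal.ofReal (e g s) else 0) := by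
      rw [← mean_add]
      congr 1
      funext g
      rw [← ENNReal.tsum_add]
      refine tsum_congr fun s => ?_
      split <;> simp
    have h1 : (1 : ℝ≥0∞) ≤ ENNReal.ofReal (1 - |ν₁ l|) + ENNReal.ofReal |ν₁ l| := by
      rw [← ENNReal.ofReal_one]
      refine (ENNReal.ofReal_le_ofReal (by linarith)).trans ENNReal.ofReal_add_le
    rw [hsplit] at hE
    have h3 : mean μ (fun g => ∑' s, if good g s then 0 else ENNReal.ofReal (e g s)) +
        ENNReal.ofReal (1 - |ν₁ l|) ≤
        (ENNReal.ofReal |ν₁ l| + ENNReal.ofReal |ν₂ l|) + ENNReal.ofReal (1 - |ν₁ l|) := by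
      refine (add_le_add_right hC _).trans (hE.trans ((add_le_add_left h1 _).trans ?_))
      exact le_of_eq (by ring)
    exact (ENNReal.add_le_add_iff_right ENNReal.ofReal_ne_top).1 h3
  have hpoint : ∀ g s, gap (ENNReal.ofReal ((U g s * Y * (U g s)ᴴ * P.enc ![g 0] ρ s).trace).re)
      (P.samp ![g 0] s * ENNReal.ofReal ((Y * ρ).trace).re) ≤
      (ENNReal.ofReal |ν₁ l| * ENNReal.ofReal (e g s) +
        (if good g s then 0 else ENNReal.ofReal (e g s))) +
      gap (P.samp ![g 0] s) (ENNReal.ofReal (e g s)) := by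
    intro g s
    have hY' := PadFamily.effect_conj (P.dec (g 1) (s 0)) hY
    refine (gap_triangle _ (ENNReal.ofReal (e g s) * ENNReal.ofReal ((Y * ρ).trace).re) _).trans
      (add_le_add ?_ ?_)
    · rw [← ENNReal.ofReal_mul (he0 g s)]
      refine (gap_ofReal _ _).trans ?_
      set A := ((U g s * Y * (U g s)ᴴ * P.enc ![g 0] ρ s).trace).re with hA
      have hA0 : 0 ≤ A := re_trace_mul_nonneg hY'.1 (hpos g s)
      have hA1 : A ≤ e g s := re_trace_mul_le hY'.2 (hpos g s)
      by_cases hg : good g s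
      · rw [if_pos hg, add_zero, ← ENNReal.ofReal_mul (abs_nonneg _)]
        refine ENNReal.ofReal_le_ofReal ?_
        by_cases hz : e g s = 0
        · have : A = 0 := le_antisymm (hA1.trans hz.le) hA0
          rw [this, hz]; simp
        · have hep : 0 < e g s := lt_of_le_of_ne (he0 g s) (Ne.symm hz)
          have h3 := hg {()} (fun _ => U g s * Y * (U g s)ᴴ) (fun _ => hY')
          rw [Finset.sum_singleton, mul_sub, Matrix.trace_sub, PadFamily.trace_conj, mul_smul_comm,
            Matrix.trace_smul, Complex.sub_re] at h3
          have h4 : (((P.enc ![g 0] ρ s).trace)⁻¹ • (U g s * Y * (U g s)ᴴ *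
              P.enc ![g 0] ρ s).trace).re = (e g s)⁻¹ * A := by
            rw [← ofReal_re_trace (hpos g s), ← Complex.ofReal_inv, smul_eq_mul,
              Complex.re_ofReal_mul]
          rw [h4] at h3
          have h5 : A - e g s * ((Y * ρ).trace).re =
              e g s * ((e g s)⁻¹ * A - ((Y * ρ).trace).re) := by field_simp
          rw [h5, abs_mul, abs_of_pos hep, mul_comm]
          exact mul_le_mul_of_nonneg_right (h3.trans (le_abs_self _)) hep.le
      · rw [if_neg hg]
        refine le_trans (ENNReal.ofReal_le_ofReal ?_) le_add_self
        rw [abs_le]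
        constructor <;> nlinarith [he0 g s]
    · rw [mul_comm, mul_comm (P.samp ![g 0] s), gap_mul _ _ _ ENNReal.ofReal_ne_top, gap_comm]
      refine mul_le_of_le_one_left' ?_
      rw [← ENNReal.ofReal_one]
      exact ENNReal.ofReal_le_ofReal hy1
  calc _ ≤ mean μ (fun g => (ENNReal.ofReal |ν₁ l| * ∑' s, ENNReal.ofReal (e g s) +
        ∑' s, (if good g s then 0 else ENNReal.ofReal (e g s))) + D g) := by
        refine mean_mono fun g _ => ?_
        rw [← ENNReal.tsum_mul_left, ← ENNReal.tsum_add, show D g = ∑' s, gap (P.samp ![g 0] s)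
          (ENNReal.ofReal (e g s)) from rfl, ← ENNReal.tsum_add]
        exact ENNReal.tsum_le_tsum fun s => hpoint g s
    _ ≤ ENNReal.ofReal |ν₁ l| * (1 + ENNReal.ofReal |ν₂ l|) +
        (ENNReal.ofReal |ν₁ l| + ENNReal.ofReal |ν₂ l|) + ENNReal.ofReal |ν₂ l| := by
        rw [mean_add, mean_add, mean_mul_left]
        exact add_le_add (add_le_add (mul_le_mul_right hE _) hbad) hD
    _ = _ := by
        rw [mul_add, mul_one, ← ENNReal.ofReal_mul (abs_nonneg _)]
        rw [← ENNReal.ofReal_add, ← ENNReal.ofReal_add, ← ENNReal.ofReal_add, ← ENNReal.ofReal_add]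
        all_goals positivity

/-! ### The honest prover -/

/-- The observable of the second question under the pad. -/
def paddedProj {Q : Type} [Fintype Q] {G : ContextualityGame Q} {pad : PadFamily} {n : ℕ}
    (S : G.QStrat (Qubits n)) (q : Q) (a : G.Ans) (k : pad.Key n) : QOp n :=
  pad.U n k * S.projMat q a.1 * (pad.U n k)ᴴ

theorem effect_paddedProj {Q : Type} [Fintype Q] {G : ContextualityGame Q} {pad : PadFamily} {n : ℕ}
    (S : G.QStrat (Qubits n)) (q : Q) (a : G.Ans) (k : pad.Key n) :
    (paddedProj S q a k).PosSemidef ∧ (1 - paddedProj S q a k).PosSemidef :=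
  PadFamily.effect_conj k ((S.isPVM_projMat q).effect a)

section
variable {Q : Type} [Fintype Q] {G : ContextualityGame Q} (K : Encoding G) [Nonempty Q]
  {pad : PadFamily} (E : QFHE pad) {n : ℕ} (P : OPad pad n) (S : G.QStrat (Qubits n))

/-- The padded post-measurement state for the encrypted question `c` and the ciphertexts `ca`, `kh`
of the answer and of the pad. -/
def evaluated (c ca kh : BitStr) : QOp n :=
  E.qeval (measurementCircuit K S) ![c.drop K.nq]
    (ketbra (tens (fun u : Bits n => S.psi u) (Pi.single (firstBits K.nq c) 1))) ![ca, kh]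

theorem honest_behaviour (l t₁ t₂ t₃ t₄) : (honest K E P S).behaviour l t₁ t₂ t₃ t₄ =
    K.onAnswer (fun a => ENNReal.ofReal ((paddedProj S (K.readQ (firstBits K.nq (t₃ 0))) a
      (pad.readKey n (t₃ 1)) * P.enc ![t₁ 1] (evaluated K E S (t₁ 0) (t₂ 0) (t₂ 1))
        ![t₂ 2]).trace).re) (t₄ 0) := by
  have h1 : (1 : QOp 0).trace = 1 := by rw [trace_bits_zero, Matrix.one_apply_eq]
  have hf : ∀ st, (honest K E P S).first (Fin.cons (unary l) t₁) 1 (Fin.cons st t₂) =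
      if st = [] then P.enc ![t₁ 1] (evaluated K E S (t₁ 0) (t₂ 0) (t₂ 1)) ![t₂ 2] else 0 := by
    intro st
    simp only [honest, h1, one_smul]
    rfl
  have hs : ∀ st ρ, (((honest K E P S).second (Fin.cons st t₃) ρ t₄).trace).re =
      match K.readAStr (t₄ 0) with
      | some a => ((paddedProj S (K.readQ (firstBits K.nq (t₃ 0))) a
          (pad.readKey n (t₃ 1)) * ρ).trace).re
      | none => 0 := by
    intro st ρ
    have h3 : (honest K E P S).second (Fin.cons st t₃) ρ t₄ =
        match K.readAStr (t₄ 0) with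
        | some a => ((paddedProj S (K.readQ (firstBits K.nq (t₃ 0))) a
            (pad.readKey n (t₃ 1)) * ρ).trace) • (1 : QOp 0)
        | none => 0 := rfl
    rw [h3]
    cases K.readAStr (t₄ 0) with
    | none => simp
    | some a => simp only [Matrix.trace_smul, h1, smul_eq_mul, mul_one]
  rw [QProver.behaviour, tsum_eq_single []]
  · rw [hs, hf, if_pos rfl, Encoding.onAnswer]
    cases K.readAStr (t₄ 0) with
    | none => simp
    | some a => rfl
  · intro st hst
    rw [hs, hf, if_neg hst]
    cases K.readAStr (t₄ 0) <;> simp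

/-- The behaviour of the honest prover with an ideal pad. -/
def idealBehaviour (vs : Coins G) : Behaviour 2 3 2 1 := fun _ t₁ t₂ t₃ t₄ =>
  K.onAnswer (fun a => P.samp ![t₁ 1] ![t₂ 2] * ENNReal.ofReal
    ((paddedProj S (K.readQ (firstBits K.nq (t₃ 0))) a (pad.readKey n (E.dec vs.sk (t₂ 1))) *
      evaluated K E S (t₁ 0) (t₂ 0) (t₂ 1)).trace).re) (t₄ 0)

variable {S} in
theorem posSemidef_evaluated (hS : S.Described) (c ca kh) :
    (evaluated K E S c ca kh).PosSemidef :=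
  (E.qeval_qpt _ (measurementCircuit_admissible K S hS)).posSemidef _ (posSemidef_ketbra _) _

end

namespace ContextualityGame.QStrat

variable {Q : Type} [Fintype Q] {G : ContextualityGame Q}

/-- The probability of the answers `a'` and `a` if `q'` and then `q` are measured. -/
def joint {H : Type} [NormedAddCommGroup H] [InnerProductSpace ℂ H] [CompleteSpace H]
    (S : G.QStrat H) (q' : Q) (a' : G.Ans) (q : Q) (a : G.Ans) : ℝ :=
  ‖S.proj q a.1 (S.proj q' a'.1 S.psi)‖ ^ 2

theorem joint_nonneg {H : Type} [NormedAddCommGroup H] [InnerProductSpace ℂ H] [CompleteSpace H]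
    (S : G.QStrat H) (q' : Q) (a' : G.Ans) (q : Q) (a : G.Ans) : 0 ≤ S.joint q' a' q a :=
  sq_nonneg _

variable {n : ℕ} (S : G.QStrat (Qubits n))

/-- The unnormalised state after the measurement of `q'`. -/
def post (q' : Q) (a' : G.Ans) : QOp n := ketbra (S.projMat q' a'.1 *ᵥ S.psi.ofLp)

theorem trace_ketbra_ofLp (φ : Qubits n) : (ketbra φ.ofLp).trace = ((‖φ‖ ^ 2 : ℝ) : ℂ) := by
  rw [trace_ketbra, EuclideanSpace.norm_eq, Real.sq_sqrt (Finset.sum_nonneg fun _ _ => sq_nonneg _)]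
  push_cast
  exact Finset.sum_congr rfl fun u _ => Complex.mul_conj' _

theorem trace_projMat_mul_post (q' : Q) (a' : G.Ans) (q : Q) (a : G.Ans) :
    (S.projMat q a.1 * S.post q' a').trace = ((S.joint q' a' q a : ℝ) : ℂ) := by
  rw [post, (S.isPVM_projMat q).trace_mul_ketbra a, projMat_mulVec, projMat_mulVec,
    trace_ketbra_ofLp, joint]

theorem sum_trace_post (q' : Q) : ∑ a', (S.post q' a').trace = 1 := by
  simp only [post]
  simp only [← (S.isPVM_projMat q').trace_mul_ketbra]
  rw [← Matrix.trace_sum, ← Finset.sum_mul, (S.isPVM_projMat q').sum, one_mul, trace_ketbra]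
  exact QStrat.sum_psi S

theorem sum_joint (q' q : Q) : ∑ a', ∑ a, S.joint q' a' q a = 1 := by
  have h : ((∑ a', ∑ a, S.joint q' a' q a : ℝ) : ℂ) = 1 := by
    push_cast
    simp only [← trace_projMat_mul_post]
    rw [← S.sum_trace_post q']
    refine Finset.sum_congr rfl fun a' _ => ?_
    rw [← Matrix.trace_sum, ← Finset.sum_mul, (S.isPVM_projMat q).sum, one_mul]
  exact_mod_cast h

theorem joint_self (q : Q) (a' a : G.Ans) (h : a ≠ a') : S.joint q a' q a = 0 := by
  have : S.proj q a.1 (S.proj q a'.1 S.psi) = (S.proj q a.1 * S.proj q a'.1) S.psi := rfl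
  rw [joint, this, proj_mul_proj, if_neg h]
  simp

end ContextualityGame.QStrat

/-! ### Decrypted outputs -/

theorem trace_sum_decoded {O : Type*} {m ℓ : ℕ} (T : Finset O) (d : O → Bits ℓ) (A : O → QOp m)
    (hA : ∀ o, A o ≠ 0 → o ∈ T) (Y : Bits ℓ → QOp m) :
    ∑ y, (Y y * ∑ᶠ o, if d o = y then A o else 0).trace = ∑ o ∈ T, (Y (d o) * A o).trace := by
  have h1 : ∀ y, ∑ᶠ o, (if d o = y then A o else 0) = ∑ o ∈ T, if d o = y then A o else 0 := by
    intro y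
    refine finsum_eq_sum_of_support_subset _ fun o ho => ?_
    refine hA o fun h0 => ho ?_
    simp [h0]
  simp only [h1, Finset.mul_sum, Matrix.trace_sum]
  rw [Finset.sum_comm]
  refine Finset.sum_congr rfl fun o _ => ?_
  rw [Finset.sum_eq_single (d o)]
  · rw [if_pos rfl]
  · intro y _ hy
    rw [if_neg (Ne.symm hy), mul_zero, Matrix.trace_zero]
  · simp

theorem isUnit2_single {N : ℕ} (b : Bits N) : IsUnit2 (Pi.single b 1 : Bits N → ℂ) := by
  rw [IsUnit2, Finset.sum_eq_single b]
  · simp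
  · intro b' _ hb; simp [hb]
  · simp

theorem ContextualityGame.QStrat.isUnit2_psi {Q : Type} [Fintype Q] {G : ContextualityGame Q} {n : ℕ}
    (S : G.QStrat (Qubits n)) : IsUnit2 (fun u : Bits n => S.psi u) := by
  have h := S.norm_psi
  rwa [EuclideanSpace.norm_eq, Real.sqrt_eq_one] at h

section
variable {Q : Type} [Fintype Q] {G : ContextualityGame Q} (K : Encoding G) [Nonempty Q]
  {pad : PadFamily} (E : QFHE pad) {n : ℕ} (P : OPad pad n) {S : G.QStrat (Qubits n)}

theorem qeval_eq_evaluated (k : pad.Key K.nq) (kh : Fin 1 → BitStr) (q' : Q)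
    (o : Fin 2 → BitStr) : E.qeval (measurementCircuit K S) kh (ketbra (tens (fun u => S.psi u)
      (pad.U K.nq k *ᵥ Pi.single (K.codeQ q') 1))) o =
      evaluated K E S (List.ofFn (pad.act K.nq k (K.codeQ q')) ++ kh 0) (o 0) (o 1) := by
  obtain ⟨ω, hω, hb⟩ := pad.U_basis K.nq k (K.codeQ q')
  have h1 : tens (fun u => S.psi u) (ω • (Pi.single (pad.act K.nq k (K.codeQ q')) 1 :
      Bits K.nq → ℂ)) = ω • tens (fun u : Bits n => S.psi u)
        (Pi.single (pad.act K.nq k (K.codeQ q')) 1) := by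
    funext u
    simp only [tens, Pi.smul_apply, smul_eq_mul]
    ring
  rw [hb, h1, PadFamily.ketbra_phase hω, evaluated, firstBits_ofFn, List.drop_left' (by simp)]
  congr 1
  · funext i; fin_cases i; rfl
  · funext i; fin_cases i <;> rfl

/-- Measurements of the decrypted answer and, after removal of the pad, of the state. -/
theorem evaluated_correct (hS : S.Described) : ∃ ν : ℕ → ℝ, Negligible ν ∧
    ∀ (l : ℕ), ∀ sk ∈ (E.gen ![unary l]).support, ∀ q' : Q,
    ∀ c ∈ (encStr pad E.toFHE (sk 0) (List.ofFn (K.codeQ q'))).support,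
    ∃ T : Finset (Fin 2 → BitStr), (∀ o, evaluated K E S c (o 0) (o 1) ≠ 0 → o ∈ T) ∧
    ∀ Y : Bits K.na → QOp n, (∀ y, (Y y).PosSemidef ∧ (1 - Y y).PosSemidef) →
      |∑ o ∈ T, ((pad.U n (pad.readKey n (E.dec (sk 0) (o 1))) *
          Y (decStr pad E.toFHE K.na (sk 0) (o 0)) *
          (pad.U n (pad.readKey n (E.dec (sk 0) (o 1))))ᴴ * evaluated K E S c (o 0) (o 1)).trace).re -
        ∑ a', ((Y (K.codeA a') * S.post q' a').trace).re| ≤ ν l := by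
  obtain ⟨ν, hν, h⟩ := E.correct (h := n) (n := K.nq) (measurementCircuit K S)
    (measurementCircuit_admissible K S hS)
  refine ⟨ν, hν, fun l sk hsk q' c hc => ?_⟩
  obtain ⟨k, kh, hkh, rfl⟩ := mem_support_encStr_ofFn hc
  have hψ := S.isUnit2_psi
  have he := isUnit2_single (K.codeQ q')
  have hcl := h _ _ hψ he l sk hsk k kh hkh
  have hX := qeval_eq_evaluated K E (S := S) k kh q'
  obtain ⟨T, hT⟩ : ∃ T : Finset (Fin 2 → BitStr), ∀ o, evaluated K E S
      (List.ofFn (pad.act K.nq k (K.codeQ q')) ++ kh 0) (o 0) (o 1) ≠ 0 → o ∈ T := by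
    have hfin := (E.qeval_qpt _ (measurementCircuit_admissible K S hS)).finite_support kh
      (tens (fun u => S.psi u) (pad.U K.nq k *ᵥ Pi.single (K.codeQ q') 1))
    refine ⟨hfin.toFinset, fun o ho => hfin.mem_toFinset.2 ?_⟩
    rw [← hX] at ho
    exact ho
  refine ⟨T, hT, fun Y hY => ?_⟩
  have h2 := hcl Finset.univ Y hY
  simp only [mul_sub, Matrix.trace_sub, Complex.sub_re, Finset.sum_sub_distrib] at h2
  rw [← Complex.re_sum, ← Complex.re_sum] at h2 ⊢
  refine le_of_eq_of_le ?_ h2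
  congr 1
  congr 1
  · simp only [hX]
    rw [trace_sum_decoded T (fun o => decStr pad E.toFHE K.na (sk 0) (o 0))]
    · refine congrArg Complex.re (Finset.sum_congr rfl fun o _ => ?_)
      rw [Matrix.mul_assoc, Matrix.mul_assoc, Matrix.trace_mul_comm]
      simp only [Matrix.mul_assoc]
    · intro o ho
      refine hT o fun h0 => ho ?_
      rw [h0, mul_zero, zero_mul]
  · congr 1
    simp only [output_measurementCircuit, readQ_codeQ]
    rw [← K.sum_byCode]
    refine Finset.sum_congr rfl fun y _ => ?_
    by_cases hz : ∃ a, K.codeA a = y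
    · obtain ⟨a, rfl⟩ := hz
      rw [K.byCode_codeA, K.byCode_codeA]
      rfl
    · rw [K.byCode_of_ne _ y (by simpa using hz), K.byCode_of_ne _ y (by simpa using hz), mul_zero,
        Matrix.trace_zero]

theorem tsum_eq_sum_of_evaluated {c : BitStr} {T : Finset (Fin 2 → BitStr)}
    (hT : ∀ o : Fin 2 → BitStr, evaluated K E S c (o 0) (o 1) ≠ 0 → o ∈ T)
    (Y : (Fin 2 → BitStr) → QOp n) :
    ∑' o : Fin 2 → BitStr, ENNReal.ofReal ((Y o * evaluated K E S c (o 0) (o 1)).trace).re =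
      ∑ o ∈ T, ENNReal.ofReal ((Y o * evaluated K E S c (o 0) (o 1)).trace).re := by
  refine tsum_eq_sum fun o ho => ?_
  have : evaluated K E S c (o 0) (o 1) = 0 := by
    by_contra h
    exact ho (hT o h)
  rw [this]; simp

/-- The total weight of the evaluated states. -/
theorem tsum_trace_evaluated_le (hS : S.Described) : ∃ ν : ℕ → ℝ, Negligible ν ∧
    ∀ (l : ℕ), ∀ sk ∈ (E.gen ![unary l]).support, ∀ q' : Q,
    ∀ c ∈ (encStr pad E.toFHE (sk 0) (List.ofFn (K.codeQ q'))).support,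
      ∑' (ca) (kh), ENNReal.ofReal ((evaluated K E S c ca kh).trace).re ≤
        ENNReal.ofReal (1 + |ν l|) := by
  obtain ⟨ν, hν, h⟩ := evaluated_correct K E hS
  refine ⟨ν, hν, fun l sk hsk q' c hc => ?_⟩
  obtain ⟨T, hT, h1⟩ := h l sk hsk q' c hc
  have h2 := h1 (fun _ => 1) fun _ => ⟨Matrix.PosSemidef.one, by
    rw [sub_self]; exact Matrix.PosSemidef.zero⟩
  simp only [mul_one, pad.U_mul_conjTranspose, one_mul] at h2
  rw [← Complex.re_sum Finset.univ, S.sum_trace_post q', Complex.one_re] at h2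
  have h3 := tsum_eq_sum_of_evaluated K E hT (fun _ => 1)
  simp only [one_mul] at h3
  rw [tsum_fin_two] at h3
  refine h3.le.trans ?_
  rw [← ENNReal.ofReal_sum_of_nonneg fun o _ => re_trace_nonneg (posSemidef_evaluated K E hS _ _ _)]
  refine ENNReal.ofReal_le_ofReal ?_
  have := (abs_le.1 h2).2
  linarith [le_abs_self (ν l)]

/-- A general form of `OPad.hiding` for states that are not normalised. -/
theorem OPad.hiding_of_posSemidef : ∃ ν : ℕ → ℝ, Negligible ν ∧
    ∀ (X : QOp n), X.PosSemidef → ∀ Y : QOp n, Y.PosSemidef ∧ (1 - Y).PosSemidef → ∀ l : ℕ,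
      mean (P.gen ![unary l]) (fun g => ∑' s : BitStr,
        gap (ENNReal.ofReal ((pad.U n (P.dec (g 1) s) * Y * (pad.U n (P.dec (g 1) s))ᴴ *
            P.enc ![g 0] X ![s]).trace).re)
          (P.samp ![g 0] ![s] * ENNReal.ofReal ((Y * X).trace).re)) ≤
        ENNReal.ofReal (X.trace).re * ENNReal.ofReal (ν l) := by
  obtain ⟨ν, hν, h⟩ := P.hiding
  refine ⟨ν, hν, fun X hX Y hY l => ?_⟩
  set t := (X.trace).re with ht
  have ht0 : 0 ≤ t := re_trace_nonneg hX
  by_cases hz : t = 0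
  · have h0 : X = 0 := hX.trace_eq_zero_iff.1 (by rw [← ofReal_re_trace hX, ← ht, hz]; simp)
    have h1 : ∀ (g : Fin 2 → BitStr) (s : BitStr), P.enc ![g 0] 0 ![s] = 0 := fun g s =>
      IsLinearMap.map_zero_apply P.enc_qpt.1 _ _
    subst h0
    simp [h1, mean]
  · have htp : 0 < t := lt_of_le_of_ne ht0 (Ne.symm hz)
    set ρ : QOp n := ((t⁻¹ : ℝ) : ℂ) • X with hρ
    have hXρ : X = (t : ℂ) • ρ := by
      rw [hρ, smul_smul, ← Complex.ofReal_mul, mul_inv_cancel₀ hz, Complex.ofReal_one, one_smul]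
    have hd : IsDensity ρ := by
      refine ⟨Matrix.PosSemidef.smul hX ?_, ?_⟩
      · exact_mod_cast (inv_pos.2 htp).le
      · rw [hρ, Matrix.trace_smul, ← ofReal_re_trace hX, ← ht, smul_eq_mul, ← Complex.ofReal_mul,
          inv_mul_cancel₀ hz, Complex.ofReal_one]
    have h1 := h ρ hd Y hY l
    rw [← ENNReal.ofReal_toReal (a := ENNReal.ofReal t) ENNReal.ofReal_ne_top] at *
    refine le_trans (le_of_eq ?_) (mul_le_mul_right h1 _)
    rw [← mean_mul_left]
    congr 1
    funext g
    rw [tsum_fin_one, ← ENNReal.tsum_mul_left]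
    refine tsum_congr fun s => ?_
    have h2 : ∀ (A B : QOp n), ((A * ((t : ℂ) • B)).trace).re = t * ((A * B).trace).re := by
      intro A B
      rw [mul_smul_comm, Matrix.trace_smul, smul_eq_mul, Complex.re_ofReal_mul]
    rw [ENNReal.toReal_ofReal ht0, ← gap_mul _ _ _ ENNReal.ofReal_ne_top, ← ENNReal.ofReal_mul ht0,
      mul_left_comm, ← ENNReal.ofReal_mul ht0, ← h2, ← h2, ← hXρ]
    congr 4
    rw [hXρ, IsQPT.smul_apply P.enc_qpt.1]
    rfl

end

section
variable {Q : Type} [Fintype Q] {G : ContextualityGame Q} {n : ℕ}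

/-- The predicate of the verifier, for the answers `a'` and `a` to the questions `q'` and `q`. -/
def wins (C : Finset Q) (q' q : Q) (a' a : G.Ans) : Bool :=
  if q = q' then decide (a = a') else G.pred C (fun x => if x.1 = q then a else a')

/-- The probability to win for given questions. -/
def winProb (S : G.QStrat (Qubits n)) (C : Finset Q) (q' q : Q) : ℝ :=
  ∑ a', ∑ a, if wins C q' q a' a = true then S.joint q' a' q a else 0

end

section
variable {Q : Type} [Fintype Q] {G : ContextualityGame Q} (K : Encoding G) [Nonempty Q]
  {pad : PadFamily} (E : QFHE pad) {n : ℕ} (P : OPad pad n)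
  (h2 : ∀ C ∈ G.contexts, C.card = 2) {S : G.QStrat (Qubits n)}

theorem honest_close_ideal (hS : S.Described) : ∃ ν : ℕ → ℝ, Negligible ν ∧ ∀ l,
    (compiled K E P h2).distance l (fun _ => (honest K E P S).behaviour)
      (idealBehaviour K E P S) ≤ ENNReal.ofReal (ν l) := by
  obtain ⟨ν, hν, hide⟩ := OPad.hiding_of_posSemidef P
  obtain ⟨μ, hμ, htr⟩ := tsum_trace_evaluated_le K E hS
  refine ⟨fun l => Fintype.card G.Ans * (|ν l| + |μ l| * |ν l|),
    (hν.abs.add (hμ.abs.mul hν.abs)).const_mul _, fun l => ?_⟩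
  refine (le_of_eq (total_compiled K E P h2 l _)).trans ?_
  refine mean_le fun sk hsk => mean_le fun C _ => mean_le fun q' hq' => mean_le fun c hc => ?_
  simp only [honest_behaviour, idealBehaviour, Matrix.cons_val_zero, Matrix.cons_val_one,
    firstBits_ofFn', readQ_codeQ, readKey_keyStr, K.tsum_gap_onAnswer]
  have hprod : ∀ (q : Q) (a : G.Ans) (k k' : pad.Key n), paddedProj S q a (k * k') =
      pad.U n k * paddedProj S q a k' * (pad.U n k)ᴴ := fun q a k k' => by
    rw [paddedProj, pad.conj_mul]; rfl
  simp only [finalKey, hprod, tsum_fin_three, Matrix.cons_val_zero, Matrix.cons_val_one,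
    Matrix.cons_val_two, Matrix.tail_cons, Matrix.head_cons]
  rw [mean_tsum]
  simp only [mean_tsum (P.gen ![unary l])]
  calc _ = ∑' (ca) (kh), mean (uniformQuestion h2 C) fun q => ∑ a : G.Ans,
        mean (P.gen ![unary l]) fun g => ∑' s, gap
          (ENNReal.ofReal ((pad.U n (P.dec (g 1) s) *
            paddedProj S q a (pad.readKey n (E.dec (sk 0) kh)) * (pad.U n (P.dec (g 1) s))ᴴ *
            P.enc ![g 0] (evaluated K E S c ca kh) ![s]).trace).re)
          (P.samp ![g 0] ![s] * ENNReal.ofReal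
            ((paddedProj S q a (pad.readKey n (E.dec (sk 0) kh)) *
              evaluated K E S c ca kh).trace).re) := by
        refine tsum_congr fun ca => tsum_congr fun kh => ?_
        simp only [mean_tsum, mean_comm (P.gen ![unary l]), mean_sum]
        exact Summable.tsum_finsetSum fun _ _ => ENNReal.summable
    _ ≤ ∑' (ca) (kh), (Fintype.card G.Ans : ℝ≥0∞) *
        (ENNReal.ofReal ((evaluated K E S c ca kh).trace).re * ENNReal.ofReal (|ν l|)) := by
        refine ENNReal.tsum_le_tsum fun ca => ENNReal.tsum_le_tsum fun kh => mean_le fun q _ => ?_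
        refine (Finset.sum_le_card_nsmul Finset.univ _ (ENNReal.ofReal
          ((evaluated K E S c ca kh).trace).re * ENNReal.ofReal (|ν l|)) fun a _ => ?_).trans
          (le_of_eq (by rw [nsmul_eq_mul, Finset.card_univ]))
        exact (hide _ (posSemidef_evaluated K E hS c ca kh) _ (effect_paddedProj S q a _) l).trans
          (mul_le_mul_right (ENNReal.ofReal_le_ofReal (le_abs_self _)) _)
    _ = (Fintype.card G.Ans : ℝ≥0∞) * ((∑' (ca) (kh),
        ENNReal.ofReal ((evaluated K E S c ca kh).trace).re) * ENNReal.ofReal (|ν l|)) := by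
        simp only [ENNReal.tsum_mul_left, ENNReal.tsum_mul_right]
    _ ≤ (Fintype.card G.Ans : ℝ≥0∞) * (ENNReal.ofReal (1 + |μ l|) * ENNReal.ofReal (|ν l|)) :=
        mul_le_mul_right (mul_le_mul_left (htr l sk hsk q' c hc) _) _
    _ = _ := by
        rw [← ENNReal.ofReal_mul (by positivity), ← ENNReal.ofReal_natCast,
          ← ENNReal.ofReal_mul (by positivity)]
        congr 1; ring

theorem verdict_eq (vs : Coins G) (t₁ : Fin 2 → BitStr) (t₂ : Fin 3 → BitStr)
    (t₃ : Fin 2 → BitStr) (t₄ : Fin 1 → BitStr) :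
    Protocol.Exec.verdict (V := compiled K E P h2) ⟨vs, t₁, t₂, t₃, t₄⟩ =
      match K.readA (decStr pad E.toFHE K.na vs.sk (t₂ 0)), K.readAStr (t₄ 0) with
      | some a', some a => wins vs.C.1 vs.q' (K.readQ (firstBits K.nq (t₃ 0))) a' a
      | _, _ => false := rfl

theorem samp_total (l : ℕ) (Z : ℝ≥0∞) :
    mean (P.gen ![unary l]) (fun g => ∑' s : BitStr, P.samp ![g 0] ![s] * Z) = Z := by
  have h1 : ∀ g : Fin 2 → BitStr, ∑' s : BitStr, P.samp ![g 0] ![s] = 1 := fun g => by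
    rw [← tsum_fin_one (fun t => P.samp ![g 0] t), PMF.tsum_coe]
  simp only [ENNReal.tsum_mul_right, h1, one_mul]
  exact mean_const _ _

theorem acceptWeight_ideal (hS : S.Described) : ∃ ν : ℕ → ℝ, Negligible ν ∧ ∀ l,
    gap ((compiled K E P h2).acceptWeight (idealBehaviour K E P S) l)
      (mean G.D fun C => mean (uniformQuestion h2 C) fun q' => mean (uniformQuestion h2 C) fun q =>
        ENNReal.ofReal (winProb S C.1 q' q)) ≤ ENNReal.ofReal (ν l) := by
  obtain ⟨ν, hν, hcor⟩ := evaluated_correct K E hS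
  refine ⟨ν, hν, fun l => ?_⟩
  change gap ((compiled K E P h2).total l _) _ ≤ _
  rw [total_compiled]
  have h0 := mean_const (E.gen ![unary l]) (mean G.D fun C => mean (uniformQuestion h2 C) fun q' =>
    mean (uniformQuestion h2 C) fun q => ENNReal.ofReal (winProb S C.1 q' q))
  rw [← h0]
  refine (gap_mean_le _ _ _).trans (mean_le fun sk hsk => ?_)
  refine (gap_mean_le _ _ _).trans (mean_le fun C _ => ?_)
  refine (gap_mean_le _ _ _).trans (mean_le fun q' _ => ?_)
  rw [← mean_const (encStr pad E.toFHE (sk 0) (List.ofFn (K.codeQ q')))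
    (mean (uniformQuestion h2 C) fun q => ENNReal.ofReal (winProb S C.1 q' q))]
  refine (gap_mean_le _ _ _).trans (mean_le fun c hc => ?_)
  obtain ⟨T, hT, hY⟩ := hcor l sk hsk q' c hc
  let d : BitStr → Bits K.na := decStr pad E.toFHE K.na (sk 0)
  let k : BitStr → pad.Key n := fun kh => pad.readKey n (E.dec (sk 0) kh)
  let w : Q → Bits K.na → G.Ans → Bool := fun q y a =>
    match K.readA y with
    | some a' => wins C.1 q' q a' a
    | none => false
  have hver : ∀ (g : Fin 2 → BitStr) (ca kh s : BitStr) (q : Q) (s₃ : BitStr),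
      (∑' t₄ : Fin 1 → BitStr, if Protocol.Exec.verdict (V := compiled K E P h2)
        ⟨(⟨sk 0, C, q', g 1⟩ : Coins G), ![c, g 0], ![ca, kh, s], ![List.ofFn (K.codeQ q), s₃], t₄⟩ = true then
          idealBehaviour K E P S (⟨sk 0, C, q', g 1⟩ : Coins G) l ![c, g 0] ![ca, kh, s]
            ![List.ofFn (K.codeQ q), s₃] t₄ else 0) =
      P.samp ![g 0] ![s] * ∑ a, if w q (d ca) a = true then ENNReal.ofReal
        ((paddedProj S q a (k kh) * evaluated K E S c ca kh).trace).re else 0 := by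
    intro g ca kh s q s₃
    rw [K.tsum_answer, Finset.mul_sum]
    · refine Finset.sum_congr rfl fun a _ => ?_
      rw [verdict_eq]
      simp only [idealBehaviour, Matrix.cons_val_zero, Matrix.cons_val_one, Matrix.cons_val_fin_one,
        Matrix.cons_val_two, Matrix.tail_cons, Matrix.head_cons,
        firstBits_ofFn', readQ_codeQ, readAStr_ofFn, K.onAnswer_ofFn, w, d, k]
      cases K.readA (decStr pad E.toFHE K.na (sk 0) ca) with
      | none => simp
      | some a' => simp only [mul_ite, mul_zero]
    · intro t ht
      rw [verdict_eq]
      simp only [ht]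
      cases K.readA (decStr pad E.toFHE K.na (sk 0) ca) <;> simp
  simp only [tsum_fin_three, hver, mean_mul_left, mean_tsum (P.gen ![unary l])]
  have hsamp : ∀ Z : ℝ≥0∞, ∑' s, mean (P.gen ![unary l]) (fun g => P.samp ![g 0] ![s] * Z) = Z :=
    fun Z => by rw [← mean_tsum, samp_total]
  simp only [hsamp, ← mean_tsum (uniformQuestion h2 C)]
  refine (gap_mean_le _ _ _).trans (mean_le fun q _ => ?_)
  have heff : ∀ y : Bits K.na, (∑ a with w q y a = true, S.projMat q a.1).PosSemidef ∧
      (1 - ∑ a with w q y a = true, S.projMat q a.1).PosSemidef := fun y =>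
    (S.isPVM_projMat q).posSemidef _
  have h3 := hY (fun y => ∑ a with w q y a = true, S.projMat q a.1) heff
  have h4 : (∑' (ca) (kh), ∑ a, if w q (d ca) a = true then ENNReal.ofReal
      ((paddedProj S q a (k kh) * evaluated K E S c ca kh).trace).re else 0) =
      ENNReal.ofReal (∑ o ∈ T, ((pad.U n (k (o 1)) * (∑ a with w q (d (o 0)) a = true,
        S.projMat q a.1) * (pad.U n (k (o 1)))ᴴ * evaluated K E S c (o 0) (o 1)).trace).re) := by
    rw [ENNReal.ofReal_sum_of_nonneg fun o _ => re_trace_mul_nonneg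
      (PadFamily.effect_conj _ (heff _)).1 (posSemidef_evaluated K E hS _ _ _)]
    rw [← tsum_eq_sum_of_evaluated K E hT (fun o => pad.U n (k (o 1)) *
      (∑ a with w q (d (o 0)) a = true, S.projMat q a.1) * (pad.U n (k (o 1)))ᴴ), tsum_fin_two]
    refine tsum_congr fun ca => tsum_congr fun kh => ?_
    simp only [Matrix.cons_val_zero, Matrix.cons_val_one, Finset.mul_sum, Finset.sum_mul,
      Matrix.trace_sum, Complex.re_sum]
    rw [ENNReal.ofReal_sum_of_nonneg]
    · exact (Finset.sum_filter _ _).symm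
    · intro a _
      exact re_trace_mul_nonneg (effect_paddedProj S q a _).1 (posSemidef_evaluated K E hS _ _ _)
  have h5 : winProb S C.1 q' q = ∑ a', (((∑ a with w q (K.codeA a') a = true, S.projMat q a.1) *
      S.post q' a').trace).re := by
    rw [winProb]
    refine Finset.sum_congr rfl fun a' _ => ?_
    rw [Finset.sum_mul, Matrix.trace_sum, Complex.re_sum, Finset.sum_filter]
    refine Finset.sum_congr rfl fun a _ => ?_
    simp only [w, readA_codeA, S.trace_projMat_mul_post, Complex.ofReal_re]
  rw [h4, h5]
  exact (gap_ofReal _ _).trans (ENNReal.ofReal_le_ofReal h3)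

end

section
variable {Q : Type} [Fintype Q] {G : ContextualityGame Q}

theorem sum_pair_context {M : Type*} [AddCommMonoid M] {C : Finset Q} {q' q : Q}
    (hC : C = {q', q}) (hne : q ≠ q') (F : ({x // x ∈ C} → G.Ans) → M) :
    ∑ α, F α = ∑ a' : G.Ans, ∑ a : G.Ans, F (fun x => if x.1 = q then a else a') := by
  subst hC
  rw [← Fintype.sum_prod_type' (f := fun (a' a : G.Ans) => F (fun x => if x.1 = q then a else a'))]
  symm
  refine Fintype.sum_bijective (fun p : G.Ans × G.Ans => fun x : {x // x ∈ ({q', q} : Finset Q)} =>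
    if x.1 = q then p.2 else p.1) ⟨?_, ?_⟩ _ _ fun _ => rfl
  · intro p p' h
    have h1 := congrFun h ⟨q', by simp⟩
    have h3 := congrFun h ⟨q, by simp⟩
    simp only [if_neg (Ne.symm hne), if_pos] at h1 h3
    exact Prod.ext h1 h3
  · intro α
    refine ⟨(α ⟨q', by simp⟩, α ⟨q, by simp⟩), ?_⟩
    funext ⟨x, hx⟩
    dsimp only
    split
    · rename_i h; subst h; rfl
    · rename_i h
      have : x = q' := by simpa [h] using hx
      subst this; rfl

theorem ContextualityGame.QStrat.strategy_pair {H : Type} [NormedAddCommGroup H]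
    [InnerProductSpace ℂ H] [CompleteSpace H] (S : G.QStrat H) (C : {C // C ∈ G.contexts})
    {q' q : Q} (hC : C.1 = {q', q}) (hne : q ≠ q') (a' a : G.Ans) :
    S.strategy C (fun x => if x.1 = q then a else a') = S.joint q' a' q a := by
  have hq : q ∈ C.1 := by rw [hC]; simp
  have hq' : q' ∈ C.1 := by rw [hC]; simp
  have hperm : List.Perm [(⟨q, hq⟩ : {x // x ∈ C.1}), ⟨q', hq'⟩] C.1.attach.toList := by
    refine List.perm_of_nodup_nodup_toFinset_eq (by simpa using hne) (Finset.nodup_toList _) ?_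
    ext ⟨x, hx⟩
    have : x = q' ∨ x = q := by simpa [hC] using hx
    simpa using this.symm
  have hprod := ((hperm.map (fun x : {x // x ∈ C.1} =>
    S.proj x.1 (if x.1 = q then a else a').1)).prod_eq' (by
      simpa using S.commute_proj (S.commute C.1 C.2 q hq q' hq') _ _)).symm
  rw [strategy, hprod]
  simp only [List.map_cons, List.map_nil, List.prod_cons, List.prod_nil, mul_one, if_neg hne.symm,
    if_true]
  rfl

variable {n : ℕ} (S : G.QStrat (Qubits n))

theorem winProb_self (C : Finset Q) (q : Q) : winProb S C q q = 1 := by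
  rw [winProb, ← S.sum_joint q q]
  refine Finset.sum_congr rfl fun a' _ => Finset.sum_congr rfl fun a _ => ?_
  rw [wins, if_pos rfl]
  by_cases h : a = a'
  · simp [h]
  · simp [h, S.joint_self q a' a h]

theorem winProb_pair (C : {C // C ∈ G.contexts}) {q' q : Q} (hC : C.1 = {q', q}) (hne : q ≠ q') :
    winProb S C.1 q' q = ∑ α, (if G.pred C.1 α = true then 1 else 0) * S.strategy C α := by
  rw [sum_pair_context hC hne, winProb]
  refine Finset.sum_congr rfl fun a' _ => Finset.sum_congr rfl fun a _ => ?_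
  rw [S.strategy_pair C hC hne, wins, if_neg hne]
  split <;> simp

theorem mean_ofReal_fintype {α : Type*} [Fintype α] (p : PMF α) (f : α → ℝ) (hf : ∀ x, 0 ≤ f x) :
    mean p (fun x => ENNReal.ofReal (f x)) = ENNReal.ofReal (∑ x, (p x).toReal * f x) := by
  rw [ENNReal.ofReal_sum_of_nonneg fun x _ => mul_nonneg ENNReal.toReal_nonneg (hf x), mean,
    tsum_fintype]
  refine Finset.sum_congr rfl fun x _ => ?_
  rw [ENNReal.ofReal_mul ENNReal.toReal_nonneg, ENNReal.ofReal_toReal (p.apply_ne_top x)]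

theorem sum_toReal {α : Type*} [Fintype α] (p : PMF α) : ∑ x, (p x).toReal = 1 := by
  rw [← ENNReal.toReal_sum fun x _ => p.apply_ne_top x, ← ENNReal.toReal_one, ← p.tsum_coe,
    tsum_fintype]

/-- If the weight of equal questions is one, the average over the questions is half of one plus
that of the weights of different questions. -/
theorem mean_questions (h2 : ∀ C ∈ G.contexts, C.card = 2) (w : {C // C ∈ G.contexts} → Q → Q → ℝ)
    (v : {C // C ∈ G.contexts} → ℝ) (hv : ∀ C, 0 ≤ v C) (hself : ∀ C, ∀ q ∈ C.1, w C q q = 1)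
    (hpair : ∀ C, ∀ q' q, C.1 = {q', q} → q ≠ q' → w C q' q = v C) :
    (mean G.D fun C => mean (uniformQuestion h2 C) fun q' => mean (uniformQuestion h2 C) fun q =>
        ENNReal.ofReal (w C q' q)) =
      ENNReal.ofReal (1 / 2 * (1 + ∑ C, v C * (G.D C).toReal)) := by
  have h1 : ∀ C, (mean (uniformQuestion h2 C) fun q' => mean (uniformQuestion h2 C) fun q =>
        ENNReal.ofReal (w C q' q)) = ENNReal.ofReal (1 / 2 * (1 + v C)) := by
    intro C
    obtain ⟨x, y, hxy, hC⟩ := Finset.card_eq_two.1 (h2 C.1 C.2)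
    have hxC : x ∈ C.1 := by rw [hC]; simp
    have hyC : y ∈ C.1 := by rw [hC]; simp
    have hC' : C.1 = {y, x} := by rw [hC, Finset.pair_comm]
    have htwo : (2⁻¹ : ℝ≥0∞) = ENNReal.ofReal (1 / 2) := by
      rw [one_div, ENNReal.ofReal_inv_of_pos two_pos, ENNReal.ofReal_ofNat]
    simp only [mean_uniformQuestion]
    have hsum : ∀ Φ : Q → ℝ≥0∞, ∑ q ∈ C.1, Φ q = Φ x + Φ y := fun Φ => by
      rw [hC, Finset.sum_pair hxy]
    rw [hsum, hsum, hsum, hself C x hxC, hself C y hyC, hpair C x y hC hxy.symm,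
      hpair C y x hC' hxy, htwo]
    have hvC := hv C
    rw [← ENNReal.ofReal_mul (by norm_num), ← ENNReal.ofReal_mul (by norm_num),
      ← ENNReal.ofReal_add (by norm_num) (by positivity),
      ← ENNReal.ofReal_add (by positivity) (by norm_num), ← ENNReal.ofReal_mul (by norm_num),
      ← ENNReal.ofReal_mul (by norm_num), ← ENNReal.ofReal_add (by positivity) (by positivity)]
    congr 1
    ring
  simp only [h1]
  rw [mean_ofReal_fintype _ _ fun C => by have := hv C; positivity]
  congr 1
  calc ∑ C, (G.D C).toReal * (1 / 2 * (1 + v C)) =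
        1 / 2 * (∑ C, (G.D C).toReal + ∑ C, v C * (G.D C).toReal) := by
        rw [← Finset.sum_add_distrib, Finset.mul_sum]
        exact Finset.sum_congr rfl fun C _ => by ring
    _ = _ := by rw [sum_toReal]

theorem mean_winProb (h2 : ∀ C ∈ G.contexts, C.card = 2) :
    (mean G.D fun C => mean (uniformQuestion h2 C) fun q' => mean (uniformQuestion h2 C) fun q =>
        ENNReal.ofReal (winProb S C.1 q' q)) =
      ENNReal.ofReal (1 / 2 * (1 + G.val S.strategy)) := by
  rw [mean_questions h2 (fun C => winProb S C.1)
    (fun C => ∑ α, (if G.pred C.1 α = true then 1 else 0) * S.strategy C α)]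
  · simp only [val, Finset.sum_mul]
  · intro C
    refine Finset.sum_nonneg fun α _ => mul_nonneg ?_ (sq_nonneg _)
    split <;> norm_num
  · exact fun C q _ => winProb_self S C.1 q
  · exact fun C q' q hC hne => winProb_pair S C hC hne

theorem val_strategy_nonneg : 0 ≤ G.val S.strategy :=
  Finset.sum_nonneg fun C _ => Finset.sum_nonneg fun α _ => mul_nonneg
    (mul_nonneg (by split <;> norm_num) (sq_nonneg _)) ENNReal.toReal_nonneg

end

section
variable {Q : Type} [Fintype Q] {G : ContextualityGame Q} (K : Encoding G) [Nonempty Q]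
  {pad : PadFamily} (E : QFHE pad) {n : ℕ} (P : OPad pad n)
  (h2 : ∀ C ∈ G.contexts, C.card = 2) {S : G.QStrat (Qubits n)}

theorem accept_honest (hS : S.Described) : ∃ ν : ℕ → ℝ, Negligible ν ∧ ∀ l,
    |(compiled K E P h2).accept (fun _ => (honest K E P S).behaviour) l -
      1 / 2 * (1 + G.val S.strategy)| ≤ ν l := by
  obtain ⟨ν, hν, h⟩ := honest_close_ideal K E P h2 hS
  obtain ⟨μ, hμ, h'⟩ := acceptWeight_ideal K E P h2 hS
  refine ⟨fun l => |ν l| + |μ l|, hν.abs.add hμ.abs, fun l => ?_⟩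
  have hg : gap ((compiled K E P h2).acceptWeight (fun _ => (honest K E P S).behaviour) l)
      (ENNReal.ofReal (1 / 2 * (1 + G.val S.strategy))) ≤ ENNReal.ofReal (|ν l| + |μ l|) := by
    rw [ENNReal.ofReal_add (abs_nonneg _) (abs_nonneg _)]
    refine (gap_triangle _ _ _).trans (add_le_add
      (((compiled K E P h2).gap_acceptWeight_le _ _ l).trans ((h l).trans
        (ENNReal.ofReal_le_ofReal (le_abs_self _)))) ?_)
    rw [← mean_winProb S h2]
    exact (h' l).trans (ENNReal.ofReal_le_ofReal (le_abs_self _))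
  have hv := val_strategy_nonneg S
  have := abs_toReal_sub_le (ne_top_of_le_ne_top (ENNReal.add_ne_top.2
    ⟨ENNReal.ofReal_ne_top, ENNReal.ofReal_ne_top⟩) ((le_add_gap _ _).trans
      (add_le_add_right hg _))) ENNReal.ofReal_ne_top (by positivity) hg
  rwa [ENNReal.toReal_ofReal (by positivity), ← Protocol.accept_eq] at this

end

/-! ### More efficient procedures -/

namespace IsPPT

variable {a b d r : ℕ}

/-- Branch on a property of a string that depends on a prefix only. -/
theorem lookup {ι : Type*} (i : Fin a) (k : ℕ) (φ : BitStr → ι) (hφ : ∀ s, φ (s.take k) = φ s)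
    (F : ι → Alg a b) (hF : ∀ j, IsPPT (F j)) : IsPPT (fun x => F (φ (x i)) x) := by
  have := cases i k (fun v => F (φ v)) fun v => hF (φ v)
  simpa only [hφ] using this

/-- Run `f` and continue with the given strings and the output of `f`. -/
theorem run {f : Alg a b} (hf : IsPPT f) (s : Fin a → BitStr) (σ : Fin a → ℕ) (k : Fin a → ℕ)
    (arg : (Fin r → BitStr) → Fin a → BitStr)
    (harg : ∀ x j, arg x j = s j ++ (startBits x (σ j)).drop (k j))
    (g : (Fin r → BitStr) → Alg b d)
    (hg : IsPPT (fun z : Fin (r + b) → BitStr =>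
      g (fun i => z (Fin.castAdd b i)) (fun i => z (Fin.natAdd r i)))) :
    IsPPT (fun x : Fin r → BitStr => (f (arg x)).bind (g x)) := by
  have h : arg = fun x j => s j ++ (startBits x (σ j)).drop (k j) := funext fun x => funext (harg x)
  subst h
  exact call hf s σ k g hg

theorem write (s : Fin b → BitStr) (σ : Fin b → ℕ) (k : Fin b → ℕ)
    (arg : (Fin a → BitStr) → Fin b → BitStr)
    (harg : ∀ x j, arg x j = s j ++ (startBits x (σ j)).drop (k j)) :
    IsPPT (fun x : Fin a → BitStr => PMF.pure (arg x)) := by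
  have h : arg = fun x j => s j ++ (startBits x (σ j)).drop (k j) := funext fun x => funext (harg x)
  subst h
  exact output s σ k

end IsPPT

theorem exists_code (ι : Type*) [Fintype ι] [Nonempty ι] :
    ∃ (L : ℕ) (code : ι → BitStr) (read : BitStr → ι), (∀ i, (code i).length = L) ∧
      ∀ i, read (code i) = i := by
  let code : ι → BitStr := fun i =>
    List.ofFn (fun j : Fin (Fintype.card ι) => decide (Fintype.equivFin ι i = j))
  have hinj : Function.Injective code := by
    intro i i' h
    have h1 := congrFun (List.ofFn_injective h) (Fintype.equivFin ι i)
    simp only [decide_true] at h1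
    exact (Fintype.equivFin ι).injective (of_decide_eq_true h1.symm).symm
  exact ⟨_, code, Function.invFun code, fun i => List.length_ofFn, Function.leftInverse_invFun hinj⟩

theorem mean_cons {m : ℕ} (p : PMF (Fin (m + 1) → BitStr)) (Φ : (Fin (m + 1) → BitStr) → ℝ≥0∞) :
    mean p Φ = ∑' (t : Fin m → BitStr) (st : BitStr), p (Fin.cons st t) * Φ (Fin.cons st t) := by
  rw [mean, ← (Fin.consEquiv (fun _ : Fin (m + 1) => BitStr)).tsum_eq, ENNReal.tsum_comm]
  exact ENNReal.tsum_prod (f := fun st (t : Fin m → BitStr) =>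
    p (Fin.cons st t : Fin (m + 1) → BitStr) * Φ (Fin.cons st t))

theorem mean_le_one {α : Type*} {p : PMF α} {Φ : α → ℝ≥0∞} (h : ∀ a, Φ a ≤ 1) : mean p Φ ≤ 1 :=
  mean_le fun a _ => h a

/-! ### Classical provers -/

section
variable {Q : Type} [Fintype Q] {G : ContextualityGame Q} (K : Encoding G) [Nonempty Q]
  {pad : PadFamily} (E : QFHE pad) {n : ℕ} (P : OPad pad n)
  (h2 : ∀ C ∈ G.contexts, C.card = 2) (A : CProver 2 3 2 1)

/-- The verdict for the decrypted answer `a'` and the last message `w`. -/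
def Encoding.accepts (C : Finset Q) (q' q : Q) (a' : Option G.Ans) (w : BitStr) : Bool :=
  match a', K.readAStr w with
  | some a', some a => wins C q' q a' a
  | _, _ => false

/-- The expectation of `Φ` over the secret key and the keys of the pad and the first message of the
prover, if the message `m` is encrypted. -/
def firstRound (m : BitStr) (l : ℕ)
    (Φ : BitStr → (Fin 2 → BitStr) → (Fin 4 → BitStr) → ℝ≥0∞) : ℝ≥0∞ :=
  mean (E.gen ![unary l]) fun sk => mean (encStr pad E.toFHE (sk 0) m) fun c =>
    mean (P.gen ![unary l]) fun g => mean (A.first ![unary l, c, g 0]) fun r => Φ (sk 0) g r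

/-- The probability that the second message of the prover for the question `q` and the key `k` is
accepted. -/
def secondRound (C : Finset Q) (q' q : Q) (sk : BitStr) (r : Fin 4 → BitStr) (k : pad.Key n) :
    ℝ≥0∞ :=
  mean (A.second ![r 0, List.ofFn (K.codeQ q), pad.keyStr k]) fun t =>
    if K.accepts C q' q (K.readA (decStr pad E.toFHE K.na sk (r 1))) (t 0) = true then 1 else 0

theorem verdict_eq_accepts (vs : Coins G) (t₁ : Fin 2 → BitStr) (t₂ : Fin 3 → BitStr)
    (t₃ : Fin 2 → BitStr) (t₄ : Fin 1 → BitStr) :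
    Protocol.Exec.verdict (V := compiled K E P h2) ⟨vs, t₁, t₂, t₃, t₄⟩ =
      K.accepts vs.C.1 vs.q' (K.readQ (firstBits K.nq (t₃ 0)))
        (K.readA (decStr pad E.toFHE K.na vs.sk (t₂ 0))) (t₄ 0) := rfl

theorem acceptWeight_classical (l : ℕ) :
    (compiled K E P h2).acceptWeight (fun _ => A.behaviour) l =
      mean G.D fun C => mean (uniformQuestion h2 C) fun q' => mean (uniformQuestion h2 C) fun q =>
        firstRound E P A (List.ofFn (K.codeQ q')) l fun sk g r =>
          secondRound K E A C.1 q' q sk r (finalKey E P sk (g 1) (r 2) (r 3)) := by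
  refine (total_compiled K E P h2 l _).trans ?_
  rw [mean_comm]
  congr 1; funext C
  rw [mean_comm]
  congr 1; funext q'
  have key : ∀ (sk : BitStr) (c : BitStr) (g : Fin 2 → BitStr),
      (∑' t₂ : Fin 3 → BitStr, mean (uniformQuestion h2 C) fun q => ∑' t₄ : Fin 1 → BitStr,
        if Protocol.Exec.verdict (V := compiled K E P h2) ⟨(⟨sk, C, q', g 1⟩ : Coins G), ![c, g 0], t₂,
            ![List.ofFn (K.codeQ q), pad.keyStr (finalKey E P sk (g 1) (t₂ 1) (t₂ 2))], t₄⟩ = true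
        then A.behaviour l ![c, g 0] t₂ ![List.ofFn (K.codeQ q),
          pad.keyStr (finalKey E P sk (g 1) (t₂ 1) (t₂ 2))] t₄ else 0) =
      mean (uniformQuestion h2 C) fun q => mean (A.first ![unary l, c, g 0]) fun r =>
        secondRound K E A C.1 q' q sk r (finalKey E P sk (g 1) (r 2) (r 3)) := by
    intro sk c g
    rw [← mean_tsum]
    congr 1; funext q
    rw [mean_cons]
    refine tsum_congr fun t₂ => ?_
    simp only [secondRound, mean, ← ENNReal.tsum_mul_left]
    rw [ENNReal.tsum_comm]
    refine tsum_congr fun t₄ => ?_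
    rw [verdict_eq_accepts]
    simp only [Matrix.cons_val_zero, firstBits_ofFn', readQ_codeQ]
    have hacc : ∀ st : BitStr, K.accepts C.1 q' q (K.readA (decStr pad E.toFHE K.na sk
        ((Fin.cons st t₂ : Fin 4 → BitStr) 1))) (t₄ 0) =
        K.accepts C.1 q' q (K.readA (decStr pad E.toFHE K.na sk (t₂ 0))) (t₄ 0) := fun st => rfl
    simp only [hacc]
    cases K.accepts C.1 q' q (K.readA (decStr pad E.toFHE K.na sk (t₂ 0))) (t₄ 0)
    · simp
    · simp only [if_true, mul_one]
      rfl
  simp only [firstRound]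
  rw [mean_comm (uniformQuestion h2 C)]
  congr 1; funext sk
  rw [mean_comm (uniformQuestion h2 C)]
  congr 1; funext c
  rw [mean_comm (uniformQuestion h2 C)]
  congr 1; funext g
  exact key (sk 0) c g

end

theorem mean_mul_right_group {k : Type*} [Group k] [Fintype k] (y : k) (Φ : k → ℝ≥0∞) :
    mean (PMF.uniformOfFintype k) (fun x => Φ (x * y)) = mean (PMF.uniformOfFintype k) Φ := by
  rw [mean_uniform, mean_uniform]
  exact Equiv.sum_comp (Equiv.mulRight y) fun x => (Fintype.card k : ℝ≥0∞)⁻¹ * Φ x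

section
variable {Q : Type} [Fintype Q] {G : ContextualityGame Q} (K : Encoding G)
  {pad : PadFamily} (E : QFHE pad) {n : ℕ} (P : OPad pad n) (A : CProver 2 3 2 1)

theorem Encoding.accepts_take (C : Finset Q) (q' q : Q) (a' : Option G.Ans) (w : BitStr) :
    K.accepts C q' q a' (w.take (K.na + 1)) = K.accepts C q' q a' w := by
  simp only [accepts, readAStr_take]

section
variable {E P A} {m : BitStr} {l : ℕ} {Φ Ψ : BitStr → (Fin 2 → BitStr) → (Fin 4 → BitStr) → ℝ≥0∞}

theorem firstRound_add : firstRound E P A m l (fun sk g r => Φ sk g r + Ψ sk g r) =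
    firstRound E P A m l Φ + firstRound E P A m l Ψ := by
  simp only [firstRound, mean_add]

theorem firstRound_mul_left (c : ℝ≥0∞) : firstRound E P A m l (fun sk g r => c * Φ sk g r) =
    c * firstRound E P A m l Φ := by
  simp only [firstRound, mean_mul_left]

theorem firstRound_const (c : ℝ≥0∞) : firstRound E P A m l (fun _ _ _ => c) = c := by
  simp only [firstRound, mean_const]

theorem firstRound_mono (h : ∀ sk g r, Φ sk g r ≤ Ψ sk g r) :
    firstRound E P A m l Φ ≤ firstRound E P A m l Ψ :=
  mean_mono fun _ _ => mean_mono fun _ _ => mean_mono fun _ _ => mean_mono fun _ _ => h _ _ _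

end

/-- The first stage of an attack on the oblivious pad. -/
def padAttack₁ (m : BitStr) (code : Option G.Ans × pad.Key n → BitStr) : Alg 2 2 := fun x =>
  (E.gen ![x 0]).bind fun sk =>
  ((encStr pad E.toFHE (sk 0) m).map (fun c => ![c])).bind fun c : Fin 1 → BitStr =>
  (A.first ![x 0, c 0, x 1]).bind fun r =>
  (PMF.pure ![E.dec (sk 0) ((r 1).drop K.na)]).bind fun d : Fin 1 → BitStr =>
  (PMF.pure ![E.dec (sk 0) (r 2)]).bind fun d' : Fin 1 → BitStr =>
  PMF.pure ![code (K.readA (pad.act K.na (pad.readKey K.na (d 0))⁻¹ (firstBits K.na (r 1))),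
    pad.readKey n (d' 0)) ++ r 0, r 3]

/-- The second stage of an attack on the oblivious pad. -/
def padAttack₂ (C : Finset Q) (q' q : Q) (L : ℕ) (read : BitStr → Option G.Ans × pad.Key n) :
    Alg 2 1 := fun x =>
  (A.second ![(x 0).drop L, List.ofFn (K.codeQ q),
    pad.keyStr (pad.readKey n (x 1) * (read ((x 0).take L)).2)]).bind fun t =>
  PMF.pure ![[K.accepts C q' q (read ((x 0).take L)).1 (t 0)]]

variable {A}

theorem padAttack₁_ppt (hA : A.PPT) (m : BitStr) (code : Option G.Ans × pad.Key n → BitStr) :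
    IsPPT (padAttack₁ K E A m code) := by
  refine IsPPT.run E.gen_ppt ![[]] ![0] ![0] _ (fun x j => by fin_cases j; rfl) _ ?_
  refine IsPPT.run E.encStr_ppt ![[], m] ![2, 3] ![0, 0] (fun z => ![z 2, m])
    (fun x j => by fin_cases j <;> simp [startBits]) _ ?_
  refine IsPPT.run hA.1 ![[], [], []] ![0, 3, 1] ![0, 0, 0] _
    (fun x j => by fin_cases j <;> rfl) _ ?_
  refine IsPPT.run E.dec_ppt ![[], []] ![2, 5] ![0, K.na] (fun z => ![z 2, (z 5).drop K.na])
    (fun x j => by fin_cases j <;> rfl) _ ?_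
  refine IsPPT.run E.dec_ppt ![[], []] ![2, 6] ![0, 0] (fun z => ![z 2, z 6])
    (fun x j => by fin_cases j <;> rfl) _ ?_
  change IsPPT (fun z : Fin 10 → BitStr => PMF.pure ![code (K.readA (pad.act K.na
    (pad.readKey K.na (z 8))⁻¹ (firstBits K.na (z 5))), pad.readKey n (z 9)) ++ z 4, z 7])
  refine IsPPT.lookup 8 _ (pad.readKey K.na) (readKey_take pad K.na)
    (fun k z => PMF.pure ![code (K.readA (pad.act K.na k⁻¹ (firstBits K.na (z 5))),
      pad.readKey n (z 9)) ++ z 4, z 7]) fun k => ?_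
  refine IsPPT.lookup 5 _ (firstBits K.na) (firstBits_take le_rfl)
    (fun y z => PMF.pure ![code (K.readA (pad.act K.na k⁻¹ y), pad.readKey n (z 9)) ++ z 4, z 7])
    fun y => ?_
  refine IsPPT.lookup 9 _ (pad.readKey n) (readKey_take pad n)
    (fun k' z => PMF.pure ![code (K.readA (pad.act K.na k⁻¹ y), k') ++ z 4, z 7]) fun k' => ?_
  exact IsPPT.write ![code (K.readA (pad.act K.na k⁻¹ y), k'), []] ![4, 7] ![0, 0] _
    (fun x j => by fin_cases j <;> rfl)

theorem padAttack₂_ppt (hA : A.PPT) (C : Finset Q) (q' q : Q) (L : ℕ)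
    (read : BitStr → Option G.Ans × pad.Key n) : IsPPT (padAttack₂ K A C q' q L read) := by
  refine IsPPT.lookup 0 L (fun s => read (s.take L)) (fun s => by rw [List.take_take, min_self])
    (fun y x => (A.second ![(x 0).drop L, List.ofFn (K.codeQ q),
      pad.keyStr (pad.readKey n (x 1) * y.2)]).bind fun t =>
      PMF.pure ![[K.accepts C q' q y.1 (t 0)]]) fun y => ?_
  refine IsPPT.lookup 1 _ (pad.readKey n) (readKey_take pad n)
    (fun k x => (A.second ![(x 0).drop L, List.ofFn (K.codeQ q), pad.keyStr (k * y.2)]).bind fun t =>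
      PMF.pure ![[K.accepts C q' q y.1 (t 0)]]) fun k => ?_
  refine IsPPT.run hA.2 ![[], List.ofFn (K.codeQ q), pad.keyStr (k * y.2)] ![0, 2, 2] ![L, 0, 0] _
    (fun x j => by fin_cases j <;> simp [startBits]) _ ?_
  refine IsPPT.lookup 2 _ (K.accepts C q' q y.1) (K.accepts_take C q' q y.1)
    (fun b _ => PMF.pure ![[b]]) fun b => ?_
  exact IsPPT.const _

theorem hide_key (hP : P.Secure) (hA : A.PPT) (C : Finset Q) (q' q : Q) (m : BitStr) :
    ∃ ν : ℕ → ℝ, Negligible ν ∧ ∀ l,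
      (firstRound E P A m l fun sk g r =>
        secondRound K E A C q' q sk r (finalKey E P sk (g 1) (r 2) (r 3))) ≤
      (firstRound E P A m l fun sk _ r => mean (PMF.uniformOfFintype (pad.Key n)) fun k =>
        secondRound K E A C q' q sk r k) + ENNReal.ofReal (ν l) := by
  obtain ⟨L, code, read, hL, hread⟩ := exists_code (Option G.Ans × pad.Key n)
  obtain ⟨ν, hν, h⟩ := hP _ _ (padAttack₁_ppt K E hA m code) (padAttack₂_ppt K hA C q' q L read)
  refine ⟨fun l => 2 * |ν l|, hν.abs.const_mul 2, fun l => ?_⟩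
  let R : BitStr → (Fin 2 → BitStr) → (Fin 4 → BitStr) → ℝ≥0∞ := fun sk g r =>
    secondRound K E A C q' q sk r (finalKey E P sk (g 1) (r 2) (r 3))
  let U : BitStr → (Fin 2 → BitStr) → (Fin 4 → BitStr) → ℝ≥0∞ := fun sk _ r =>
    mean (PMF.uniformOfFintype (pad.Key n)) fun k => secondRound K E A C q' q sk r k
  let W : BitStr → (Fin 2 → BitStr) → (Fin 4 → BitStr) → Bool → pad.Key n → ℝ≥0∞ :=
    fun sk g r b k => mean (A.second ![r 0, List.ofFn (K.codeQ q),
      pad.keyStr ((if b = true then P.dec (g 1) (r 3) else k) * pad.readKey n (E.dec sk (r 2)))])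
      fun t => if K.accepts C q' q (K.readA (decStr pad E.toFHE K.na sk (r 1))) (t 0) = b
        then 1 else 0
  have hgame : P.game (padAttack₁ K E A m code) (padAttack₂ K A C q' q L read) l true =
      firstRound E P A m l fun sk g r => mean (PMF.uniformOfFintype Bool) fun b =>
        mean (PMF.uniformOfFintype (pad.Key n)) fun k => W sk g r b k := by
    have hA₁ : ∀ x Φ, mean (padAttack₁ K E A m code x) Φ = mean (E.gen ![x 0]) fun sk =>
        mean (encStr pad E.toFHE (sk 0) m) fun c => mean (A.first ![x 0, c, x 1]) fun r =>
          Φ ![code (K.readA (decStr pad E.toFHE K.na (sk 0) (r 1)),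
            pad.readKey n (E.dec (sk 0) (r 2))) ++ r 0, r 3] := by
      intro x Φ
      simp only [padAttack₁, mean_bind, mean_pure, mean_map]
      rfl
    have hA₂ : ∀ y st k b, (mean (padAttack₂ K A C q' q L read ![code y ++ st, pad.keyStr k])
        fun b' => (PMF.pure (decide (b' 0 = [b])) : PMF Bool) true) =
        mean (A.second ![st, List.ofFn (K.codeQ q), pad.keyStr (k * y.2)]) fun t =>
          if K.accepts C q' q y.1 (t 0) = b then 1 else 0 := by
      intro y st k b
      simp only [padAttack₂, mean_bind, mean_pure, PMF.pure_apply, Matrix.cons_val_zero,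
        Matrix.cons_val_one, List.take_left' (hL y), List.drop_left' (hL y), hread, readKey_keyStr]
      congr 1; funext t
      by_cases hb : K.accepts C q' q y.1 (t 0) = b <;> simp [hb]
    change mean (P.gen ![unary l]) (fun g => mean (padAttack₁ K E A m code ![unary l, g 0]) fun r =>
      mean (PMF.uniformOfFintype Bool) fun b => mean (PMF.uniformOfFintype (pad.Key n)) fun k =>
        mean (padAttack₂ K A C q' q L read
            ![r 0, pad.keyStr (if b = true then P.dec (g 1) (r 1) else k)]) fun b' =>
          (PMF.pure (decide (b' 0 = [b])) : PMF Bool) true) = _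
    simp only [hA₁, Matrix.cons_val_zero, Matrix.cons_val_one, hA₂, firstRound]
    rw [mean_comm]
    congr 1; funext sk
    rw [mean_comm]
  have hinner : ∀ sk g r, (mean (PMF.uniformOfFintype Bool) fun b =>
        mean (PMF.uniformOfFintype (pad.Key n)) fun k => W sk g r b k) + 2⁻¹ * U sk g r =
        2⁻¹ * R sk g r + 2⁻¹ := by
    intro sk g r
    have h1 : ∀ k, W sk g r true k = R sk g r := fun k => rfl
    have h3 : (mean (PMF.uniformOfFintype (pad.Key n)) fun k => W sk g r false k) + U sk g r = 1 := by
      have hU : U sk g r = mean (PMF.uniformOfFintype (pad.Key n)) fun k =>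
          secondRound K E A C q' q sk r (k * pad.readKey n (E.dec sk (r 2))) :=
        (mean_mul_right_group _ _).symm
      rw [hU, ← mean_add]
      refine (congrArg (mean _) (funext fun k => ?_)).trans (mean_const _ 1)
      simp only [W, secondRound, if_false, Bool.false_eq_true]
      rw [← mean_add]
      refine (congrArg (mean _) (funext fun t => ?_)).trans (mean_const _ 1)
      cases K.accepts C q' q (K.readA (decStr pad E.toFHE K.na sk (r 1))) (t 0) <;> simp
    rw [mean_uniform, Fintype.sum_bool, Fintype.card_bool]
    simp only [h1, mean_const]
    rw [add_assoc, Nat.cast_ofNat, ← mul_add, h3, mul_one]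
  have htot : P.game (padAttack₁ K E A m code) (padAttack₂ K A C q' q L read) l true +
      2⁻¹ * firstRound E P A m l U = 2⁻¹ * firstRound E P A m l R + 2⁻¹ := by
    rw [hgame, ← firstRound_mul_left, ← firstRound_add]
    simp only [hinner]
    rw [firstRound_add, firstRound_mul_left, firstRound_const]
  have hle : P.game (padAttack₁ K E A m code) (padAttack₂ K A C q' q L read) l true ≤
      2⁻¹ + ENNReal.ofReal |ν l| := by
    rw [← ENNReal.ofReal_toReal (PMF.apply_ne_top (P.game (padAttack₁ K E A m code)
      (padAttack₂ K A C q' q L read) l) true)]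
    refine (ENNReal.ofReal_le_ofReal ((h l).trans (add_le_add_right (le_abs_self _) _))).trans ?_
    rw [ENNReal.ofReal_add (by norm_num) (abs_nonneg _), one_div,
      ENNReal.ofReal_inv_of_pos two_pos, ENNReal.ofReal_ofNat]
  have h4 : 2⁻¹ * firstRound E P A m l R + 2⁻¹ ≤
      2⁻¹ * (firstRound E P A m l U + ENNReal.ofReal (2 * |ν l|)) + 2⁻¹ := by
    rw [← htot, mul_add, ENNReal.ofReal_mul two_pos.le, ENNReal.ofReal_ofNat, ← mul_assoc,
      ENNReal.inv_mul_cancel two_ne_zero ENNReal.ofNat_ne_top, one_mul]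
    refine (add_le_add_left hle _).trans (le_of_eq ?_)
    ring
  have h5 := (ENNReal.add_le_add_iff_right (by simp)).1 h4
  exact (ENNReal.mul_le_mul_iff_right (by simp) (by simp)).1 h5

end

/-! ### Product distributions -/

theorem sum_prod_pair {ι X R : Type*} [Fintype ι] [Fintype X] [CommSemiring R] (w : ι → X → R)
    (hw : ∀ i, ∑ x, w i x = 1) {i j : ι} (hne : j ≠ i) (F : X → X → R) :
    ∑ τ : ι → X, (∏ k, w k (τ k)) * F (τ i) (τ j) = ∑ x, ∑ y, w i x * w j y * F x y := by
  have key : ∀ x y, w i x * w j y =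
      ∑ τ : ι → X, (∏ k, w k (τ k)) * if τ i = x ∧ τ j = y then 1 else 0 := by
    intro x y
    let g : ι → X → R := fun k z => w k z * if k = i then (if z = x then 1 else 0) else
      if k = j then (if z = y then 1 else 0) else 1
    have h1 : ∏ k, ∑ z, g k z = w i x * w j y := by
      rw [Finset.prod_eq_mul i j hne.symm]
      · simp [g, hne]
      · intro k _ hk
        simp only [g, if_neg hk.1, if_neg hk.2, mul_one, hw]
      · simp
      · simp
    rw [← h1, Finset.prod_univ_sum, Fintype.piFinset_univ]
    refine Finset.sum_congr rfl fun τ _ => ?_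
    rw [Finset.prod_mul_distrib]
    congr 1
    rw [Finset.prod_eq_mul i j hne.symm]
    · simp only [if_true, if_neg hne]
      by_cases h : τ i = x <;> by_cases h' : τ j = y <;> simp [h, h']
    · intro k _ hk
      rw [if_neg hk.1, if_neg hk.2]
    · simp
    · simp
  simp only [key, Finset.sum_mul]
  symm
  calc _ = ∑ τ : ι → X, ∑ x, ∑ y, ((∏ k, w k (τ k)) * if τ i = x ∧ τ j = y then 1 else 0) * F x y := by
        exact (Finset.sum_congr rfl fun x _ => Finset.sum_comm).trans Finset.sum_comm
    _ = _ := by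
        refine Finset.sum_congr rfl fun τ _ => ?_
        rw [Finset.sum_eq_single (τ i), Finset.sum_eq_single (τ j)]
        · simp
        · intro y _ hy; simp [Ne.symm hy]
        · simp
        · intro x _ hx
          exact Finset.sum_eq_zero fun y _ => by simp [Ne.symm hx]
        · simp

theorem PMF.sum_fintype {X : Type*} [Fintype X] (p : PMF X) : ∑ x, p x = 1 := by
  have := p.tsum_coe
  rwa [tsum_fintype] at this

/-- The product of distributions. -/
def PMF.prodFamily {ι X : Type*} [Fintype ι] [Fintype X] (B : ι → PMF X) : PMF (ι → X) :=
  PMF.ofFintype (fun τ => ∏ i, B i (τ i)) (by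
    rw [← Fintype.piFinset_univ, ← Finset.prod_univ_sum]
    exact Finset.prod_eq_one fun i _ => PMF.sum_fintype _)

theorem mean_fintype {X : Type*} [Fintype X] (p : PMF X) (Φ : X → ℝ≥0∞) :
    mean p Φ = ∑ x, p x * Φ x := tsum_fintype _

theorem mean_prodFamily {ι X : Type*} [Fintype ι] [Fintype X] (B : ι → PMF X) {i j : ι}
    (hne : j ≠ i) (F : X → X → ℝ≥0∞) : mean (PMF.prodFamily B) (fun τ => F (τ i) (τ j)) =
      mean (B i) fun x => mean (B j) fun y => F x y := by
  simp only [mean_fintype, Finset.mul_sum, ← mul_assoc]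
  exact sum_prod_pair (fun k x => B k x) (fun k => PMF.sum_fintype _) hne F

/-! ### Noncontextual values -/

section
variable {Q : Type} [Fintype Q] {G : ContextualityGame Q}

/-- The probability to win for a context with answers from a joint distribution. -/
def ncWin (J : PMF (Q → G.Ans)) (C : Finset Q) : ℝ≥0∞ :=
  mean J fun τ => if G.pred C (fun x => τ x.1) = true then 1 else 0

theorem bddAbove_val : BddAbove (G.val '' G.NCStrategies) := by
  refine ⟨∑ C : {C // C ∈ G.contexts}, ∑ a : {q // q ∈ C.1} → G.Ans, 1, ?_⟩
  rintro _ ⟨R, ⟨J, hJ⟩, rfl⟩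
  refine Finset.sum_le_sum fun C _ => Finset.sum_le_sum fun a _ => ?_
  have h1 : R C a ≤ 1 := by
    rw [hJ, ← sum_toReal J]
    refine Finset.sum_le_sum fun α _ => ?_
    split
    · exact le_rfl
    · exact ENNReal.toReal_nonneg
  have h0 : 0 ≤ R C a := by
    rw [hJ]
    refine Finset.sum_nonneg fun α _ => ?_
    split
    · exact ENNReal.toReal_nonneg
    · exact le_rfl
  have h3 : (G.D C).toReal ≤ 1 := ENNReal.toReal_le_of_le_ofReal zero_le_one
    (by rw [ENNReal.ofReal_one]; exact PMF.coe_le_one _ _)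
  refine mul_le_one₀ (mul_le_one₀ ?_ h0 h1) ENNReal.toReal_nonneg h3
  split <;> norm_num

theorem valNC_nonneg : 0 ≤ G.valNC := by
  refine Real.sSup_nonneg ?_
  rintro _ ⟨R, ⟨J, hJ⟩, rfl⟩
  refine Finset.sum_nonneg fun C _ => Finset.sum_nonneg fun a _ => mul_nonneg (mul_nonneg ?_ ?_)
    ENNReal.toReal_nonneg
  · split <;> norm_num
  · rw [hJ]
    refine Finset.sum_nonneg fun α _ => ?_
    split
    · exact ENNReal.toReal_nonneg
    · exact le_rfl

theorem mean_ncWin_le (J : PMF (Q → G.Ans)) :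
    (mean G.D fun C => ncWin J C.1) ≤ ENNReal.ofReal G.valNC := by
  let R : G.Strategy := fun C a =>
    ∑ α : Q → G.Ans, if (fun q : {q // q ∈ C.1} => α q.1) = a then (J α).toReal else 0
  have h1 : ∀ C : {C // C ∈ G.contexts}, ncWin J C.1 =
      ENNReal.ofReal (∑ α : Q → G.Ans, (J α).toReal *
        if G.pred C.1 (fun x => α x.1) = true then 1 else 0) := by
    intro C
    rw [← mean_ofReal_fintype]
    · refine congrArg (mean J) (funext fun τ => ?_)
      split <;> simp
    · intro τ; split <;> norm_num
  simp only [h1]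
  rw [mean_ofReal_fintype]
  · refine ENNReal.ofReal_le_ofReal (le_trans (le_of_eq ?_)
      (le_csSup bddAbove_val ⟨R, ⟨J, fun _ _ => rfl⟩, rfl⟩))
    refine Finset.sum_congr rfl fun C _ => ?_
    simp only [R]
    rw [mul_comm, ← Finset.sum_mul]
    congr 1
    simp only [Finset.mul_sum]
    rw [Finset.sum_comm]
    refine Finset.sum_congr rfl fun α _ => ?_
    rw [Finset.sum_eq_single (fun q : {q // q ∈ C.1} => α q.1)]
    · rw [if_pos rfl, mul_comm]
    · intro a _ ha; rw [if_neg (Ne.symm ha), mul_zero]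
    · simp
  · intro C
    refine Finset.sum_nonneg fun α _ => mul_nonneg ENNReal.toReal_nonneg ?_
    split <;> norm_num

end

section
variable {Q : Type} [Fintype Q] {G : ContextualityGame Q} (K : Encoding G)
  {pad : PadFamily} (E : QFHE pad) {n : ℕ} (P : OPad pad n) (A : CProver 2 3 2 1) (a₀ : G.Ans)

/-- The answer given in the clear, with a default value. -/
def Encoding.readD (w : BitStr) : G.Ans := (K.readAStr w).getD a₀

/-- The distribution of the second message of the prover for a uniform key. -/
def answerDist (r : Fin 4 → BitStr) (q : Q) : PMF G.Ans :=
  (PMF.uniformOfFintype (pad.Key n)).bind fun k =>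
    (A.second ![r 0, List.ofFn (K.codeQ q), pad.keyStr k]).map fun t => K.readD a₀ (t 0)

theorem mean_answerDist (r : Fin 4 → BitStr) (q : Q) (Φ : G.Ans → ℝ≥0∞) :
    mean (answerDist K (pad := pad) (n := n) A a₀ r q) Φ =
      mean (PMF.uniformOfFintype (pad.Key n)) fun k =>
        mean (A.second ![r 0, List.ofFn (K.codeQ q), pad.keyStr k]) fun t =>
          Φ (K.readD a₀ (t 0)) := by
  simp only [answerDist, mean_bind, mean_map]

theorem ncWin_prodFamily {C : Finset Q} {q' q : Q} (hC : C = {q', q}) (hne : q ≠ q')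
    (B : Q → PMF G.Ans) : ncWin (PMF.prodFamily B) C = mean (B q') fun a₁ => mean (B q) fun a =>
        if G.pred C (fun x => if x.1 = q then a else a₁) = true then 1 else 0 := by
  rw [← mean_prodFamily B hne (fun a₁ a =>
    if G.pred C (fun x => if x.1 = q then a else a₁) = true then 1 else 0), ncWin]
  refine congrArg (mean _) (funext fun τ => ?_)
  have : (fun x : {x // x ∈ C} => if x.1 = q then τ q else τ q') = fun x => τ x.1 := by
    funext ⟨x, hx⟩
    have : x = q' ∨ x = q := by simpa [hC] using hx
    rcases this with rfl | rfl
    · simp [hne.symm]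
    · simp
  rw [this]

theorem secondRound_add_le {C : Finset Q} {q' q : Q} (hC : C = {q', q}) (hne : q ≠ q')
    (sk : BitStr) (r : Fin 4 → BitStr) :
    (mean (PMF.uniformOfFintype (pad.Key n)) fun k => secondRound K E A C q' q' sk r k) +
      (mean (PMF.uniformOfFintype (pad.Key n)) fun k => secondRound K E A C q' q sk r k) ≤
    1 + ncWin (PMF.prodFamily (answerDist K (pad := pad) (n := n) A a₀ r)) C := by
  let B := answerDist K (pad := pad) (n := n) A a₀ r
  cases ha : K.readA (decStr pad E.toFHE K.na sk (r 1)) with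
  | none =>
    have h0 : ∀ (q₀ : Q) (k : pad.Key n), secondRound K E A C q' q₀ sk r k = 0 := by
      intro q₀ k
      rw [secondRound, ha]
      simp only [Encoding.accepts]
      simp [mean]
    simp only [h0, mean_const, add_zero]
    exact zero_le
  | some a' =>
    have hle : ∀ q₀, (mean (PMF.uniformOfFintype (pad.Key n)) fun k =>
        secondRound K E A C q' q₀ sk r k) ≤
        mean (B q₀) fun a => if wins C q' q₀ a' a = true then 1 else 0 := by
      intro q₀
      rw [mean_answerDist]
      refine mean_mono fun k _ => mean_mono fun t _ => ?_
      rw [ha]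
      cases h : K.readAStr (t 0) with
      | none => simp [Encoding.accepts, h]
      | some a => simp [Encoding.accepts, Encoding.readD, h]
    refine (add_le_add (hle q') (hle q)).trans ?_
    rw [ncWin_prodFamily hC hne]
    calc _ = mean (B q') fun a₁ => (if wins C q' q' a' a₁ = true then 1 else 0) +
            mean (B q) fun a => if wins C q' q a' a = true then 1 else 0 := by
          rw [mean_add, mean_const]
      _ ≤ mean (B q') fun a₁ => 1 + mean (B q) fun a =>
            if G.pred C (fun x => if x.1 = q then a else a₁) = true then 1 else 0 := ?_
      _ = _ := by rw [mean_add, mean_const]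
    refine mean_mono fun a₁ _ => ?_
    rw [wins, if_pos rfl]
    by_cases h1 : a₁ = a'
    · subst h1
      simp only [decide_true, if_true]
      refine add_le_add le_rfl (mean_mono fun a _ => ?_)
      rw [wins, if_neg hne]
    · simp only [h1, decide_false, Bool.false_eq_true, if_false, zero_add]
      refine le_trans (mean_le_one fun a => ?_) le_self_add
      split
      · exact le_rfl
      · exact zero_le

end

section
variable {Q : Type} [Fintype Q] {G : ContextualityGame Q} (K : Encoding G)
  {pad : PadFamily} (E : QFHE pad) {n : ℕ} (P : OPad pad n) (A : CProver 2 3 2 1) (a₀ : G.Ans)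

/-- A distinguisher of ciphertexts that asks the prover two questions. -/
def cipherAttack (C : Finset Q) (q' q : Q) : Alg 2 1 := fun x =>
  (P.gen ![x 0]).bind fun g => (A.first ![x 0, x 1, g 0]).bind fun r =>
  (PMF.uniformOfFintype (pad.Key n)).bind fun k =>
  (A.second ![r 0, List.ofFn (K.codeQ q'), pad.keyStr k]).bind fun t =>
  (PMF.uniformOfFintype (pad.Key n)).bind fun k' =>
  (A.second ![r 0, List.ofFn (K.codeQ q), pad.keyStr k']).bind fun t' =>
  PMF.pure ![[G.pred C fun x => if x.1 = q then K.readD a₀ (t' 0) else K.readD a₀ (t 0)]]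

variable {A}

theorem Encoding.readD_take (w : BitStr) : K.readD a₀ (w.take (K.na + 1)) = K.readD a₀ w := by
  rw [readD, readD, readAStr_take]

theorem cipherAttack_ppt (hA : A.PPT) (C : Finset Q) (q' q : Q) :
    IsPPT (cipherAttack K P A a₀ C q' q) := by
  refine IsPPT.run P.gen_ppt ![[]] ![0] ![0] _ (fun x j => by fin_cases j; rfl) _ ?_
  refine IsPPT.run hA.1 ![[], [], []] ![0, 1, 2] ![0, 0, 0] _
    (fun x j => by fin_cases j <;> rfl) _ ?_
  refine IsPPT.uniform (fun k z => (A.second ![z 4, List.ofFn (K.codeQ q'), pad.keyStr k]).bind _)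
    fun k => ?_
  refine IsPPT.run hA.2 ![[], List.ofFn (K.codeQ q'), pad.keyStr k] ![4, 8, 8] ![0, 0, 0] _
    (fun x j => by fin_cases j <;> simp [startBits]) _ ?_
  refine IsPPT.uniform (fun k z => (A.second ![z 4, List.ofFn (K.codeQ q), pad.keyStr k]).bind _)
    fun k => ?_
  refine IsPPT.run hA.2 ![[], List.ofFn (K.codeQ q), pad.keyStr k] ![4, 9, 9] ![0, 0, 0] _
    (fun x j => by fin_cases j <;> simp [startBits]) _ ?_
  change IsPPT (fun z : Fin 10 → BitStr => PMF.pure ![[G.pred C fun x =>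
    if x.1 = q then K.readD a₀ (z 9) else K.readD a₀ (z 8)]])
  refine IsPPT.lookup 8 _ (K.readD a₀) (K.readD_take a₀) (fun a' z => PMF.pure ![[G.pred C fun x =>
    if x.1 = q then K.readD a₀ (z 9) else a']]) fun a' => ?_
  refine IsPPT.lookup 9 _ (K.readD a₀) (K.readD_take a₀) (fun a _ => PMF.pure ![[G.pred C fun x =>
    if x.1 = q then a else a']]) fun a => ?_
  exact IsPPT.const _

theorem change_message (hE : E.Secure) (hA : A.PPT) {C : Finset Q} {q' q : Q} (hC : C = {q', q})
    (hne : q ≠ q') (m m' : Bits K.nq) : ∃ ν : ℕ → ℝ, Negligible ν ∧ ∀ l,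
    (firstRound E P A (List.ofFn m) l fun _ _ r => ncWin (PMF.prodFamily
        (answerDist K (pad := pad) (n := n) A a₀ r)) C) ≤
      (firstRound E P A (List.ofFn m') l fun _ _ r => ncWin (PMF.prodFamily
        (answerDist K (pad := pad) (n := n) A a₀ r)) C) + ENNReal.ofReal (ν l) := by
  obtain ⟨ν, hν, h⟩ := hE _ (cipherAttack_ppt K P a₀ hA C q' q) (Polynomial.C K.nq)
  refine ⟨fun l => |ν l|, hν.abs, fun l => ?_⟩
  have h1 : ∀ m : BitStr, probOne (do
      let sk ← E.gen ![unary l]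
      let c ← encStr pad E.toFHE (sk 0) m
      cipherAttack K P A a₀ C q' q ![unary l, c]) =
      (firstRound E P A m l fun _ _ r => ncWin (PMF.prodFamily
        (answerDist K (pad := pad) (n := n) A a₀ r)) C).toReal := by
    intro m
    rw [probOne]
    congr 1
    simp only [ncWin_prodFamily hC hne, mean_answerDist, firstRound]
    change mean _ (fun sk => mean _ fun c => mean (P.gen ![unary l]) fun g =>
      mean (A.first ![unary l, c, g 0]) fun r => mean (PMF.uniformOfFintype (pad.Key n)) fun k =>
      mean (A.second ![r 0, List.ofFn (K.codeQ q'), pad.keyStr k]) fun t =>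
      mean (PMF.uniformOfFintype (pad.Key n)) fun k' =>
      mean (A.second ![r 0, List.ofFn (K.codeQ q), pad.keyStr k']) fun t' =>
      (PMF.pure ![[G.pred C fun x => if x.1 = q then K.readD a₀ (t' 0) else K.readD a₀ (t 0)]] :
        PMF (Fin 1 → BitStr)) ![[true]]) = _
    have h3 : ∀ b : Bool, (PMF.pure ![[b]] : PMF (Fin 1 → BitStr)) ![[true]] =
        if b = true then 1 else 0 := by
      intro b
      rw [PMF.pure_apply]
      cases b <;> simp
    simp only [h3]
  have h3 := h l (List.ofFn m) (List.ofFn m') (by simp) (by simp)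
  rw [h1, h1] at h3
  have h4 : ∀ m : BitStr, (firstRound E P A m l fun _ _ r => ncWin (PMF.prodFamily
        (answerDist K (pad := pad) (n := n) A a₀ r)) C) ≠ ⊤ := fun m => by
    refine ne_top_of_le_ne_top ENNReal.one_ne_top (le_trans (firstRound_mono (Ψ := fun _ _ _ => 1)
      fun _ _ r => mean_le_one fun τ => ?_) (firstRound_const 1).le)
    split
    · exact le_rfl
    · exact zero_le
  rw [← ENNReal.ofReal_toReal (h4 (List.ofFn m)), ← ENNReal.ofReal_toReal (h4 (List.ofFn m')),
    ← ENNReal.ofReal_add ENNReal.toReal_nonneg (abs_nonneg _)]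
  refine ENNReal.ofReal_le_ofReal ?_
  linarith [(abs_le.1 h3).2, le_abs_self (ν l)]

/-- The contribution of a context and the first question `q'`. -/
theorem sum_second_le (hE : E.Secure) (hP : P.Secure) (hA : A.PPT) {C : Finset Q} {q' q : Q}
    (hC : C = {q', q}) (hne : q ≠ q') (m : Bits K.nq) : ∃ ν : ℕ → ℝ, Negligible ν ∧ ∀ l,
    (firstRound E P A (List.ofFn (K.codeQ q')) l fun sk g r =>
        secondRound K E A C q' q' sk r (finalKey E P sk (g 1) (r 2) (r 3))) +
      (firstRound E P A (List.ofFn (K.codeQ q')) l fun sk g r =>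
        secondRound K E A C q' q sk r (finalKey E P sk (g 1) (r 2) (r 3))) ≤
      1 + (firstRound E P A (List.ofFn m) l fun _ _ r => ncWin (PMF.prodFamily
        (answerDist K (pad := pad) (n := n) A a₀ r)) C) + ENNReal.ofReal |ν l| := by
  obtain ⟨ν₁, hν₁, h₁⟩ := hide_key K E P hP hA C q' q' (List.ofFn (K.codeQ q'))
  obtain ⟨ν₂, hν₂, h₂⟩ := hide_key K E P hP hA C q' q (List.ofFn (K.codeQ q'))
  obtain ⟨ν₃, hν₃, h₃⟩ := change_message K E P a₀ hE hA hC hne (K.codeQ q') m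
  refine ⟨fun l => |ν₁ l| + |ν₂ l| + |ν₃ l|, (hν₁.abs.add hν₂.abs).add hν₃.abs, fun l => ?_⟩
  rw [abs_of_nonneg (by positivity), ENNReal.ofReal_add (by positivity) (abs_nonneg _),
    ENNReal.ofReal_add (abs_nonneg _) (abs_nonneg _)]
  refine (add_le_add ((h₁ l).trans (add_le_add le_rfl (ENNReal.ofReal_le_ofReal (le_abs_self _))))
    ((h₂ l).trans (add_le_add le_rfl (ENNReal.ofReal_le_ofReal (le_abs_self _))))).trans ?_
  rw [add_add_add_comm, ← firstRound_add]
  refine (add_le_add_left (firstRound_mono fun sk g r =>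
    secondRound_add_le K E A a₀ hC hne sk r) _).trans ?_
  rw [firstRound_add, firstRound_const]
  refine (add_le_add_left (add_le_add le_rfl ((h₃ l).trans (add_le_add le_rfl
    (ENNReal.ofReal_le_ofReal (le_abs_self _))))) _).trans (le_of_eq ?_)
  ring

theorem soundness_compiled [Nonempty Q] (a₀ : G.Ans) (h2 : ∀ C ∈ G.contexts, C.card = 2) (hE : E.Secure)
    (hP : P.Secure) (hA : A.PPT) : ∃ ν : ℕ → ℝ, Negligible ν ∧ ∀ l,
    (compiled K E P h2).accept (fun _ => A.behaviour) l ≤ 1 / 2 * (1 + G.valNC) + ν l := by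
  let q₀ : Q := Classical.arbitrary Q
  choose! ν hν h using fun (C : Finset Q) (q' q : Q) (hh : C = {q', q} ∧ q ≠ q') =>
    sum_second_le K E P a₀ hE hP hA hh.1 hh.2 (K.codeQ q₀)
  let μ : ℕ → ℝ := fun l => ∑ x : Finset Q × Q × Q,
    if x.1 = {x.2.1, x.2.2} ∧ x.2.2 ≠ x.2.1 then |ν x.1 x.2.1 x.2.2 l| else 0
  have hμ0 : ∀ l, 0 ≤ μ l := fun l => Finset.sum_nonneg fun x _ => by
    split
    · exact abs_nonneg _
    · exact le_rfl
  have hμ : Negligible μ := by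
    refine Negligible.sum _ fun x _ => ?_
    by_cases hx : x.1 = {x.2.1, x.2.2} ∧ x.2.2 ≠ x.2.1
    · simpa only [if_pos hx] using (hν _ _ _ hx).abs
    · simp only [if_neg hx]
      exact Negligible.zero
  have hνμ : ∀ C q' q l, C = {q', q} ∧ q ≠ q' → |ν C q' q l| ≤ μ l := by
    intro C q' q l hh
    refine le_trans (le_of_eq ?_) (Finset.single_le_sum (f := fun x : Finset Q × Q × Q =>
      if x.1 = {x.2.1, x.2.2} ∧ x.2.2 ≠ x.2.1 then |ν x.1 x.2.1 x.2.2 l| else 0) (fun x _ => ?_)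
      (Finset.mem_univ (C, q', q)))
    · exact (if_pos hh).symm
    · split
      · exact abs_nonneg _
      · exact le_rfl
  refine ⟨μ, hμ, fun l => ?_⟩
  have hv := valNC_nonneg (G := G)
  rw [Protocol.accept_eq]
  refine ENNReal.toReal_le_of_le_ofReal (add_nonneg (by positivity) (hμ0 l)) ?_
  rw [acceptWeight_classical]
  let Φ : Finset Q → ℝ≥0∞ := fun C => firstRound E P A (List.ofFn (K.codeQ q₀)) l fun _ _ r =>
    ncWin (PMF.prodFamily (answerDist K (pad := pad) (n := n) A a₀ r)) C
  have hctx : ∀ C : {C // C ∈ G.contexts}, (mean (uniformQuestion h2 C) fun q' =>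
      mean (uniformQuestion h2 C) fun q => firstRound E P A (List.ofFn (K.codeQ q')) l fun sk g r =>
        secondRound K E A C.1 q' q sk r (finalKey E P sk (g 1) (r 2) (r 3))) ≤
      2⁻¹ * (1 + Φ C.1 + ENNReal.ofReal (μ l)) := by
    intro C
    obtain ⟨x, y, hxy, hC⟩ := Finset.card_eq_two.1 (h2 C.1 C.2)
    have hC' : C.1 = {y, x} := by rw [hC, Finset.pair_comm]
    simp only [mean_uniformQuestion]
    rw [← Finset.mul_sum]
    refine mul_le_mul_right ?_ _
    have hone : ∀ q' q, C.1 = {q', q} → q ≠ q' → ∑ q₁ ∈ C.1, 2⁻¹ *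
        (firstRound E P A (List.ofFn (K.codeQ q')) l fun sk g r =>
        secondRound K E A C.1 q' q₁ sk r (finalKey E P sk (g 1) (r 2) (r 3))) ≤
        2⁻¹ * (1 + Φ C.1 + ENNReal.ofReal (μ l)) := by
      intro q' q hq hne
      rw [← Finset.mul_sum]
      refine mul_le_mul_right ?_ _
      have hs : ∀ Ψ : Q → ℝ≥0∞, ∑ q₁ ∈ C.1, Ψ q₁ = Ψ q' + Ψ q := fun Ψ => by
        rw [hq, Finset.sum_pair hne.symm]
      rw [hs]
      exact (h C.1 q' q ⟨hq, hne⟩ l).trans (add_le_add le_rfl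
        (ENNReal.ofReal_le_ofReal (hνμ _ _ _ l ⟨hq, hne⟩)))
    have hs : ∀ Ψ : Q → ℝ≥0∞, ∑ q₁ ∈ C.1, Ψ q₁ = Ψ x + Ψ y := fun Ψ => by
      rw [hC, Finset.sum_pair hxy]
    rw [hs]
    refine (add_le_add (hone x y hC hxy.symm) (hone y x hC' hxy)).trans (le_of_eq ?_)
    rw [← add_mul, ENNReal.inv_two_add_inv_two, one_mul]
  have hΦ : (mean G.D fun C => Φ C.1) ≤ ENNReal.ofReal G.valNC := by
    have h1 : (mean G.D fun C => Φ C.1) = firstRound E P A (List.ofFn (K.codeQ q₀)) l fun _ _ r =>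
        mean G.D fun C => ncWin (PMF.prodFamily (answerDist K (pad := pad) (n := n) A a₀ r)) C.1 := by
      simp only [Φ, firstRound, mean_comm G.D]
    rw [h1]
    exact (firstRound_mono fun _ _ r => mean_ncWin_le _).trans (firstRound_const _).le
  refine (mean_mono fun C _ => hctx C).trans ?_
  rw [mean_mul_left, mean_add, mean_add, mean_const, mean_const]
  refine (mul_le_mul_right (add_le_add_left (add_le_add le_rfl hΦ) _) _).trans ?_
  have h3 : (2⁻¹ : ℝ≥0∞) = ENNReal.ofReal (1 / 2) := by
    rw [one_div, ENNReal.ofReal_inv_of_pos two_pos, ENNReal.ofReal_ofNat]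
  rw [h3, ← ENNReal.ofReal_one, ← ENNReal.ofReal_add zero_le_one hv,
    ← ENNReal.ofReal_add (by positivity) (hμ0 l), ← ENNReal.ofReal_mul (by norm_num)]
  exact ENNReal.ofReal_le_ofReal (by have := hμ0 l; linarith)

end

section
variable {Q : Type} [Fintype Q] {G : ContextualityGame Q} (K : Encoding G) [Nonempty Q]
  {pad : PadFamily} (E : QFHE pad) {n : ℕ} (P : OPad pad n)
  (h2 : ∀ C ∈ G.contexts, C.card = 2) (S : G.QStrat (Qubits n))

/-- The probability of the ciphertexts of the answer `a'` and of a uniform key, if all ciphertexts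
are fresh, and of the answer `a`. -/
def freshWeight (sk : BitStr) (q' q : Q) (a : G.Ans) (ca kh : BitStr) : ℝ≥0∞ :=
  (∑ a', encStr pad E.toFHE sk (List.ofFn (K.codeA a')) ca * ENNReal.ofReal (S.joint q' a' q a)) *
    mean (PMF.uniformOfFintype (pad.Key n)) fun k => E.enc ![sk, pad.keyStr k] ![kh]

/-- The behaviour of the honest prover with an ideal pad and fresh ciphertexts. -/
def freshBehaviour (vs : Coins G) : Behaviour 2 3 2 1 := fun _ t₁ t₂ t₃ t₄ =>
  K.onAnswer (fun a => P.samp ![t₁ 1] ![t₂ 2] *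
    freshWeight K E S vs.sk vs.q' (K.readQ (firstBits K.nq (t₃ 0))) a (t₂ 0) (t₂ 1)) (t₄ 0)

variable {E S} in
theorem tsum_gap_freshWeight_le (hE : E.EvaluatedForm) (hS : S.Described) :
    ∃ ν : ℕ → ℝ, Negligible ν ∧
    ∀ (l : ℕ), ∀ sk ∈ (E.gen ![unary l]).support, ∀ q' : Q,
    ∀ c ∈ (encStr pad E.toFHE (sk 0) (List.ofFn (K.codeQ q'))).support, ∀ (q : Q) (a : G.Ans),
      ∑' (ca) (kh), gap (ENNReal.ofReal ((paddedProj S q a (pad.readKey n (E.dec (sk 0) kh)) *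
          evaluated K E S c ca kh).trace).re) (freshWeight K E S (sk 0) q' q a ca kh) ≤
        ENNReal.ofReal (ν l) := by
  obtain ⟨ν, hν, h⟩ := hE.2 (h := n) (n := K.nq) (measurementCircuit K S)
    (measurementCircuit_admissible K S hS)
  refine ⟨fun l => 2 * ν l, hν.const_mul 2, fun l sk hsk q' c hc q a => ?_⟩
  obtain ⟨k, kh, hkh, rfl⟩ := mem_support_encStr_ofFn hc
  have hcl := (h _ _ S.isUnit2_psi (isUnit2_single (K.codeQ q')) l sk hsk k kh hkh).tsum_le
    (fun o => paddedProj S q a (pad.readKey n (E.dec (sk 0) (o 1))))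
    fun o => effect_paddedProj S q a _
  refine le_trans (le_of_eq_of_le (tsum_fin_two (fun o : Fin 2 → BitStr => gap
    (ENNReal.ofReal ((paddedProj S q a (pad.readKey n (E.dec (sk 0) (o 1))) *
      evaluated K E S (List.ofFn (pad.act K.nq k (K.codeQ q')) ++ kh 0) (o 0) (o 1)).trace).re)
    (freshWeight K E S (sk 0) q' q a (o 0) (o 1)))).symm (ENNReal.tsum_le_tsum fun o => ?_)) hcl
  have hw : freshWeight K E S (sk 0) q' q a (o 0) (o 1) = ENNReal.ofReal
      ((paddedProj S q a (pad.readKey n (E.dec (sk 0) (o 1))) *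
        ∑ y : Bits K.na, ∑ k'' : pad.Key n,
          (((encStr pad E.toFHE (sk 0) (List.ofFn y) (o 0)).toReal *
            (E.enc ![sk 0, pad.keyStr k''] ![o 1]).toReal / Fintype.card (pad.Key n) : ℝ) : ℂ) •
          (pad.U n k'' * (measurementCircuit K S).output (tens (fun u => S.psi u)
            (Pi.single (K.codeQ q') 1)) y * (pad.U n k'')ᴴ)).trace).re := by
    have hterm : ∀ (y : Bits K.na) (k'' : pad.Key n),
        ((paddedProj S q a (pad.readKey n (E.dec (sk 0) (o 1))) *
          ((((encStr pad E.toFHE (sk 0) (List.ofFn y) (o 0)).toReal *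
            (E.enc ![sk 0, pad.keyStr k''] ![o 1]).toReal / Fintype.card (pad.Key n) : ℝ) : ℂ) •
          (pad.U n k'' * (measurementCircuit K S).output (tens (fun u => S.psi u)
            (Pi.single (K.codeQ q') 1)) y * (pad.U n k'')ᴴ))).trace).re =
        K.byCode (fun a' => (encStr pad E.toFHE (sk 0) (List.ofFn (K.codeA a')) (o 0)).toReal *
          S.joint q' a' q a) y *
          ((Fintype.card (pad.Key n) : ℝ)⁻¹ * (E.enc ![sk 0, pad.keyStr k''] ![o 1]).toReal) := by
      intro y k''
      rw [mul_smul_comm, Matrix.trace_smul, smul_eq_mul, Complex.re_ofReal_mul]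
      by_cases hz : E.enc ![sk 0, pad.keyStr k''] ![o 1] = 0
      · simp [hz]
      · have hd := E.dec_enc l sk hsk (pad.keyStr k'') ![o 1] ((PMF.mem_support_iff _ _).2 hz)
        rw [Matrix.cons_val_zero] at hd
        rw [hd, readKey_keyStr, paddedProj, PadFamily.trace_conj, output_measurementCircuit,
          readQ_codeQ]
        by_cases hy : ∃ a', K.codeA a' = y
        · obtain ⟨a', rfl⟩ := hy
          rw [K.byCode_codeA, K.byCode_codeA]
          have := S.trace_projMat_mul_post q' a' q a
          rw [QStrat.post] at this
          rw [this, Complex.ofReal_re]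
          ring
        · rw [K.byCode_of_ne _ y (by simpa using hy), K.byCode_of_ne _ y (by simpa using hy)]
          simp
    simp only [Finset.mul_sum, Matrix.trace_sum, Complex.re_sum, hterm]
    simp only [← Finset.mul_sum, ← Finset.sum_mul]
    rw [K.sum_byCode, ENNReal.ofReal_mul, ENNReal.ofReal_sum_of_nonneg, ENNReal.ofReal_mul,
      ENNReal.ofReal_sum_of_nonneg, freshWeight, mean_uniform, ← Finset.mul_sum,
      ENNReal.ofReal_inv_of_pos, ENNReal.ofReal_natCast]
    · congr 2
      · funext a'
        rw [ENNReal.ofReal_mul ENNReal.toReal_nonneg, ENNReal.ofReal_toReal (PMF.apply_ne_top _ _)]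
      · exact Finset.sum_congr rfl fun k'' _ => (ENNReal.ofReal_toReal (PMF.apply_ne_top _ _)).symm
    · exact Nat.cast_pos.2 Fintype.card_pos
    · exact fun _ _ => ENNReal.toReal_nonneg
    · positivity
    · exact fun a' _ => mul_nonneg ENNReal.toReal_nonneg (S.joint_nonneg _ _ _ _)
    · exact Finset.sum_nonneg fun a' _ => mul_nonneg ENNReal.toReal_nonneg (S.joint_nonneg _ _ _ _)
  rw [hw, mul_sub, Matrix.trace_sub, Complex.sub_re, qeval_eq_evaluated]
  exact gap_ofReal _ _

theorem ideal_close_fresh (hE : E.EvaluatedForm) {S : G.QStrat (Qubits n)} (hS : S.Described) :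
    ∃ ν : ℕ → ℝ, Negligible ν ∧ ∀ l,
    (compiled K E P h2).distance l (idealBehaviour K E P S) (freshBehaviour K E P S) ≤
      ENNReal.ofReal (ν l) := by
  obtain ⟨ν, hν, h⟩ := tsum_gap_freshWeight_le K hE hS
  refine ⟨fun l => Fintype.card G.Ans * |ν l|, hν.abs.const_mul _, fun l => ?_⟩
  refine (le_of_eq (total_compiled K E P h2 l _)).trans ?_
  refine mean_le fun sk hsk => mean_le fun C _ => mean_le fun q' hq' => mean_le fun c hc => ?_
  simp only [freshBehaviour, idealBehaviour, Matrix.cons_val_zero, Matrix.cons_val_one,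
    firstBits_ofFn', readQ_codeQ, K.tsum_gap_onAnswer, gap_mul _ _ _ (PMF.apply_ne_top _ _),
    ← Finset.mul_sum, tsum_fin_three, Matrix.cons_val_two, Matrix.tail_cons, Matrix.head_cons,
    mean_mul_left]
  have hsamp : ∀ Z : ℝ≥0∞, ∑' s, mean (P.gen ![unary l]) (fun g => P.samp ![g 0] ![s] * Z) = Z :=
    fun Z => by rw [← mean_tsum, samp_total]
  simp only [mean_tsum (P.gen ![unary l]), hsamp]
  simp only [← mean_tsum (uniformQuestion h2 C)]
  refine mean_le fun q _ => ?_
  simp only [Summable.tsum_finsetSum fun _ _ => ENNReal.summable]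
  rw [ENNReal.ofReal_mul (by positivity), ENNReal.ofReal_natCast]
  refine (Finset.sum_le_card_nsmul Finset.univ _ (ENNReal.ofReal |ν l|) fun a _ => ?_).trans
    (le_of_eq (by rw [nsmul_eq_mul, Finset.card_univ]))
  exact (h l sk hsk q' c hc q a).trans (ENNReal.ofReal_le_ofReal (le_abs_self _))

end

section
variable {Q : Type} [Fintype Q] {G : ContextualityGame Q} (K : Encoding G) [Nonempty Q]
  {pad : PadFamily} (E : QFHE pad) {n : ℕ} (P : OPad pad n)
  (h2 : ∀ C ∈ G.contexts, C.card = 2)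

theorem compiledMaps_paired : Paired (compiledMaps K E P h2).q₁ (compiledMaps K E P h2).a₁ ∧
    Paired (compiledMaps K E P h2).q₂ (compiledMaps K E P h2).a₂ := by
  refine ⟨⟨?_, ?_⟩, ⟨?_, ?_⟩⟩
  · intro j p h
    fin_cases j
    · obtain rfl : _ = p := Option.some.inj h
      rfl
    · exact absurd h (by simp [compiledMaps])
    · exact absurd h (by simp [compiledMaps])
  · intro i hi
    fin_cases i
    · refine ⟨0, ⟨_, rfl⟩, ?_⟩
      rintro j ⟨f, hf⟩
      fin_cases j
      · rfl
      · exact absurd hf (by simp [compiledMaps])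
      · exact absurd hf (by simp [compiledMaps])
    · exact absurd hi (by simp [compiledMaps])
  · intro j p h
    fin_cases j
    obtain rfl : _ = p := Option.some.inj h
    rfl
  · intro i hi
    fin_cases i
    · exact ⟨0, ⟨_, rfl⟩, fun j _ => Subsingleton.elim _ _⟩
    · exact absurd hi (by simp [compiledMaps])

variable {K E P h2}

theorem start_ne_zero {l : ℕ} {vs : Coins G} {t₁ : Fin 2 → BitStr}
    (h : (compiled K E P h2).start l (vs, t₁) ≠ 0) :
    ∃ sk ∈ (E.gen ![unary l]).support, vs.sk = sk 0 ∧ vs.q' ∈ vs.C.1 ∧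
      t₁ 0 ∈ (encStr pad E.toFHE (sk 0) (List.ofFn (K.codeQ vs.q'))).support := by
  have h1 : (vs, t₁) ∈ ((E.gen ![unary l]).bind fun sk => G.D.bind fun C =>
      (uniformQuestion h2 C).bind fun q' =>
      (encStr pad E.toFHE (sk 0) (List.ofFn (K.codeQ q'))).bind fun c =>
      (P.gen ![unary l]).bind fun g =>
      PMF.pure ((⟨sk 0, C, q', g 1⟩ : Coins G), ![c, g 0])).support := (PMF.mem_support_iff _ _).2 h
  simp only [PMF.mem_support_bind_iff, PMF.support_pure, Set.mem_singleton_iff] at h1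
  obtain ⟨sk, hsk, C, -, q', hq', c, hc, g, -, he⟩ := h1
  obtain ⟨rfl, rfl⟩ := Prod.mk.inj he
  exact ⟨sk, hsk, rfl, (mem_support_uniformQuestion h2 C q').1 hq', hc⟩

theorem next_ne_zero {vs : Coins G} {t₁ : Fin 2 → BitStr} {t₂ : Fin 3 → BitStr}
    {t₃ : Fin 2 → BitStr} (h : (compiled K E P h2).next vs t₁ t₂ t₃ ≠ 0) :
    ∃ q ∈ vs.C.1, t₃ 0 = List.ofFn (K.codeQ q) := by
  have h1 : t₃ ∈ ((uniformQuestion h2 vs.C).bind fun q => PMF.pure ![List.ofFn (K.codeQ q),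
      pad.keyStr (finalKey E P vs.sk vs.opSk (t₂ 1) (t₂ 2))]).support := (PMF.mem_support_iff _ _).2 h
  simp only [PMF.mem_support_bind_iff, PMF.support_pure, Set.mem_singleton_iff] at h1
  obtain ⟨q, hq, rfl⟩ := h1
  exact ⟨q, (mem_support_uniformQuestion h2 vs.C q).1 hq, rfl⟩

theorem readQ_question {l : ℕ} {sk : Fin 1 → BitStr} (hsk : sk ∈ (E.gen ![unary l]).support) {q : Q}
    {c : BitStr} (hc : c ∈ (encStr pad E.toFHE (sk 0) (List.ofFn (K.codeQ q))).support) :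
    K.readQ (decStr pad E.toFHE K.nq (sk 0) c) = q := by
  rw [decStr_encStr hsk hc, readQ_codeQ]

/-- The questions asked in an execution. -/
theorem asked_compiled {l : ℕ} {e : (compiled K E P h2).Exec}
    (h : (compiled K E P h2).start l (e.vs, e.t₁) ≠ 0)
    (h' : (compiled K E P h2).next e.vs e.t₁ e.t₂ e.t₃ ≠ 0) :
    ∃ sk ∈ (E.gen ![unary l]).support, e.vs.sk = sk 0 ∧
      K.readQ (decStr pad E.toFHE K.nq (sk 0) (e.t₁ 0)) = e.vs.q' ∧ e.vs.q' ∈ e.vs.C.1 ∧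
      ∃ q ∈ e.vs.C.1, K.readQ (firstBits K.nq (e.t₃ 0)) = q ∧
        (compiledMaps K E P h2).asked e = {e.vs.q', q} := by
  obtain ⟨sk, hsk, h1, h3, h4⟩ := start_ne_zero h
  obtain ⟨q, hq, h5⟩ := next_ne_zero h'
  have h6 := readQ_question hsk h4
  have h7 : K.readQ (firstBits K.nq (e.t₃ 0)) = q := by rw [h5, firstBits_ofFn', readQ_codeQ]
  refine ⟨sk, hsk, h1, h6, h3, q, hq, h7, ?_⟩
  ext x
  have e1 : ∀ i, decodeQuestions (compiledMaps K E P h2).q₁ e.vs e.t₁ i = some x ↔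
      i = 0 ∧ x = e.vs.q' := by
    intro i
    fin_cases i
    · change some (K.readQ (decStr pad E.toFHE K.nq e.vs.sk (e.t₁ 0))) = some x ↔ _
      rw [h1, h6]
      simp [eq_comm]
    · change (none : Option Q) = some x ↔ _
      simp
  have e2 : ∀ i, decodeQuestions (compiledMaps K E P h2).q₂ e.vs e.t₃ i = some x ↔
      i = 0 ∧ x = q := by
    intro i
    fin_cases i
    · change some (K.readQ (firstBits K.nq (e.t₃ 0))) = some x ↔ _
      rw [h7]
      simp [eq_comm]
    · change (none : Option Q) = some x ↔ _
      simp
  simp [QAMaps.asked, e1, e2]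

variable (K E P h2)

theorem sum_first_answer {X M : Type*} [Fintype X] [AddCommMonoid M]
    (F : (Fin 2 → Option X) → M) (h : ∀ a, F a ≠ 0 → (∃ x, a 0 = some x) ∧ a 1 = none) :
    ∑ a, F a = ∑ x, F ![some x, none] := by
  symm
  refine Finset.sum_of_injOn (fun x => ![some x, none]) ?_ (fun _ _ => Finset.mem_coe.2
    (Finset.mem_univ _)) ?_ fun _ _ => rfl
  · intro x _ y _ hxy
    exact Option.some.inj (congrFun hxy 0)
  · intro a _ ha
    by_contra h0
    obtain ⟨⟨x, hx⟩, h1⟩ := h a h0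
    refine ha ⟨x, by simp, ?_⟩
    funext i
    fin_cases i
    · exact hx.symm
    · exact h1.symm

theorem PMF.apply_of_subsingleton {X : Type*} [Subsingleton X] (p : PMF X) (x : X) : p x = 1 := by
  rw [← p.tsum_coe, tsum_eq_single x fun y hy => absurd (Subsingleton.elim y x) hy]

/-- The behaviour of a simulator in the compiled game. -/
theorem simulator_compiled (W : Answering 2 2 G)
    (hW : ∀ d₁ a₁ d₂ a₂, d₁ 1 = none → d₂ 1 = none → W d₁ a₁ d₂ a₂ ≠ 0 → a₁ 1 = none ∧ a₂ 1 = none)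
    (aux : Aux (compiledMaps K E P h2)) (vs : Coins G) (l : ℕ) (t₁ : Fin 2 → BitStr)
    (t₂ : Fin 3 → BitStr) (t₃ : Fin 2 → BitStr) (t₄ : Fin 1 → BitStr) :
    simulator (compiledMaps K E P h2) W aux vs l t₁ t₂ t₃ t₄ =
      K.onAnswer (fun a => ∑ a' : G.Ans,
        W ![some (K.readQ (decStr pad E.toFHE K.nq vs.sk (t₁ 0))), none] ![some a', none]
          ![some (K.readQ (firstBits K.nq (t₃ 0))), none] ![some a, none] *
        encStr pad E.toFHE vs.sk (List.ofFn (K.codeA a')) (t₂ 0) *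
        aux.first l t₁ ![some (K.readQ (decStr pad E.toFHE K.nq vs.sk (t₁ 0))), none]
          ![some a', none] (fun j => t₂ j.1) (fun j => t₂ j.1)) (t₄ 0) := by
  have hd₁ : decodeQuestions (compiledMaps K E P h2).q₁ vs t₁ =
      ![some (K.readQ (decStr pad E.toFHE K.nq vs.sk (t₁ 0))), none] := by
    funext i; fin_cases i <;> rfl
  have hd₂ : decodeQuestions (compiledMaps K E P h2).q₂ vs t₃ =
      ![some (K.readQ (firstBits K.nq (t₃ 0))), none] := by
    funext i; fin_cases i <;> rfl
  have he₁ : ∀ a₁ : Fin 2 → Option G.Ans, encodeProb (compiledMaps K E P h2).a₁ vs a₁ t₂ =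
      match a₁ 0 with
      | some a => encStr pad E.toFHE vs.sk (List.ofFn (K.codeA a)) (t₂ 0)
      | none => 0 := by
    intro a₁
    refine (Fin.prod_univ_three _).trans ?_
    exact (mul_one _).trans (mul_one _)
  have he₂ : ∀ a₂ : Fin 2 → Option G.Ans, encodeProb (compiledMaps K E P h2).a₂ vs a₂ t₄ =
      match a₂ 0 with
      | some a => (PMF.pure (List.ofFn (K.codeA a)) : PMF BitStr) (t₄ 0)
      | none => 0 := by
    intro a₂
    exact Fin.prod_univ_one _
  have hemp : IsEmpty {j // ¬ ((compiledMaps K E P h2).a₂ j).isSome = true} :=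
    ⟨fun j => j.2 (by obtain ⟨j, hj⟩ := j; fin_cases j; rfl)⟩
  dsimp only [simulator]
  simp only [hd₁, hd₂, he₁, he₂, PMF.apply_of_subsingleton, mul_one]
  rw [sum_first_answer]
  · have hinner : ∀ a', (∑ a₂ : Fin 2 → Option G.Ans,
        W ![some (K.readQ (decStr pad E.toFHE K.nq vs.sk (t₁ 0))), none] ![some a', none]
          ![some (K.readQ (firstBits K.nq (t₃ 0))), none] a₂ *
        encStr pad E.toFHE vs.sk (List.ofFn (K.codeA a')) (t₂ 0) *
        aux.first l t₁ ![some (K.readQ (decStr pad E.toFHE K.nq vs.sk (t₁ 0))), none]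
          ![some a', none] (fun j => t₂ j.1) (fun j => t₂ j.1) *
        match a₂ 0 with
        | some a => (PMF.pure (List.ofFn (K.codeA a)) : PMF BitStr) (t₄ 0)
        | none => 0) = K.onAnswer (fun a =>
        W ![some (K.readQ (decStr pad E.toFHE K.nq vs.sk (t₁ 0))), none] ![some a', none]
          ![some (K.readQ (firstBits K.nq (t₃ 0))), none] ![some a, none] *
        encStr pad E.toFHE vs.sk (List.ofFn (K.codeA a')) (t₂ 0) *
        aux.first l t₁ ![some (K.readQ (decStr pad E.toFHE K.nq vs.sk (t₁ 0))), none]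
          ![some a', none] (fun j => t₂ j.1) (fun j => t₂ j.1)) (t₄ 0) := by
      intro a'
      rw [sum_first_answer]
      · simp only [Matrix.cons_val_zero, PMF.pure_apply, Encoding.onAnswer]
        cases ha : K.readAStr (t₄ 0) with
        | none =>
          refine Finset.sum_eq_zero fun a _ => ?_
          rw [if_neg, mul_zero]
          intro h
          rw [h, readAStr_ofFn] at ha
          cases ha
        | some a =>
          rw [Finset.sum_eq_single a]
          · rw [if_pos (readAStr_eq_some K ha), mul_one]
          · intro b _ hb
            rw [if_neg, mul_zero]
            intro h
            rw [h, readAStr_ofFn] at ha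
            exact hb (Option.some.inj ha)
          · simp
      · intro a₂ h0
        refine ⟨Option.ne_none_iff_exists'.1 fun h => h0 ?_, (hW ![some (K.readQ (decStr pad E.toFHE K.nq vs.sk (t₁ 0))), none]
          ![some a', none] ![some (K.readQ (firstBits K.nq (t₃ 0))), none] a₂ rfl rfl
          fun h => h0 ?_).2⟩
        · simp [h]
        · simp [h]
    refine (Finset.sum_congr rfl fun a' _ => hinner a').trans ?_
    simp only [Encoding.onAnswer]
    cases K.readAStr (t₄ 0) with
    | none => simp
    | some a => rfl
  · intro a₁ h0
    obtain ⟨a₂, -, h1⟩ := Finset.exists_ne_zero_of_sum_ne_zero h0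
    refine ⟨Option.ne_none_iff_exists'.1 fun h => h1 ?_, (hW ![some (K.readQ (decStr pad E.toFHE K.nq vs.sk (t₁ 0))), none]
      a₁ ![some (K.readQ (firstBits K.nq (t₃ 0))), none] a₂ rfl rfl fun h => h1 ?_).1⟩
    · simp [h]
    · simp [h]

end

theorem wins_assignment {Q : Type} [Fintype Q] {G : ContextualityGame Q} {C : Finset Q} {q' q : Q} (hC : C = {q', q}) (hne : q ≠ q')
    (τ : Q → G.Ans) : wins C q' q (τ q') (τ q) = G.pred C (fun x => τ x.1) := by
  rw [wins, if_neg hne]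
  congr 1
  funext ⟨x, hx⟩
  have : x = q' ∨ x = q := by simpa [hC] using hx
  rcases this with rfl | rfl
  · simp [hne.symm]
  · simp

theorem context_eq_pair {Q : Type} {C : Finset Q} (h : C.card = 2) {q' q : Q} (hq' : q' ∈ C) (hq : q ∈ C)
    (hne : q ≠ q') : C = {q', q} := by
  refine (Finset.eq_of_subset_of_card_le (fun x hx => ?_) ?_).symm
  · simp only [Finset.mem_insert, Finset.mem_singleton] at hx
    rcases hx with rfl | rfl <;> assumption
  · rw [h, Finset.card_pair hne.symm]

section
variable {Q : Type} [Fintype Q] {G : ContextualityGame Q} {K : Encoding G} [Nonempty Q]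
  {pad : PadFamily} {E : QFHE pad} {n : ℕ} {P : OPad pad n}
  {h2 : ∀ C ∈ G.contexts, C.card = 2}

theorem simulator_answerNC (τ : Q → G.Ans)
    (aux : Aux (compiledMaps K E P h2)) (vs : Coins G) (l : ℕ) (t₁ : Fin 2 → BitStr)
    (t₂ : Fin 3 → BitStr) (t₃ : Fin 2 → BitStr) (t₄ : Fin 1 → BitStr) {q' q : Q}
    (hq' : K.readQ (decStr pad E.toFHE K.nq vs.sk (t₁ 0)) = q')
    (hq : K.readQ (firstBits K.nq (t₃ 0)) = q) :
    simulator (compiledMaps K E P h2) (answerNC τ) aux vs l t₁ t₂ t₃ t₄ =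
      K.onAnswer (fun a => if a = τ q then
        encStr pad E.toFHE vs.sk (List.ofFn (K.codeA (τ q'))) (t₂ 0) *
        aux.first l t₁ ![some q', none] ![some (τ q'), none] (fun j => t₂ j.1) (fun j => t₂ j.1)
        else 0) (t₄ 0) := by
  rw [simulator_compiled, hq', hq]
  · congr 1
    funext a
    rw [Finset.sum_eq_single (τ q')]
    · by_cases ha : a = τ q
      · simp [answerNC, ha, Fin.forall_fin_two]
      · simp [answerNC, ha, Fin.forall_fin_two]
    · intro a' _ ha'
      simp [answerNC, ha', Fin.forall_fin_two]
    · simp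
  · intro d₁ a₁ d₂ a₂ h1 h3 h
    have := (ite_ne_right_iff.1 h).1
    exact ⟨by rw [this.1 1, h1]; rfl, by rw [this.2 1, h3]; rfl⟩

theorem verdict_answerNC (τ : Q → G.Ans) (aux : Aux (compiledMaps K E P h2)) (l : ℕ)
    (vs : Coins G) (t₁ : Fin 2 → BitStr) (t₂ : Fin 3 → BitStr) (t₃ : Fin 2 → BitStr)
    (t₄ : Fin 1 → BitStr) {q : Q} {sk : Fin 1 → BitStr}
    (hsk : sk ∈ (E.gen ![unary l]).support) (h1 : vs.sk = sk 0)
    (hq' : K.readQ (decStr pad E.toFHE K.nq vs.sk (t₁ 0)) = vs.q')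
    (hq : K.readQ (firstBits K.nq (t₃ 0)) = q)
    (h : simulator (compiledMaps K E P h2) (answerNC τ) aux vs l t₁ t₂ t₃ t₄ ≠ 0) :
    Protocol.Exec.verdict (V := compiled K E P h2) ⟨vs, t₁, t₂, t₃, t₄⟩ =
      wins vs.C.1 vs.q' q (τ vs.q') (τ q) := by
  rw [simulator_answerNC τ aux vs l t₁ t₂ t₃ t₄ hq' hq, Encoding.onAnswer] at h
  rw [verdict_eq_accepts, hq]
  cases ha : K.readAStr (t₄ 0) with
  | none => rw [ha] at h; exact absurd rfl h
  | some a =>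
    rw [ha] at h
    obtain ⟨h3, h4⟩ := ite_ne_right_iff.1 h
    rw [h1] at h4 ⊢
    rw [decStr_encStr hsk ((PMF.mem_support_iff _ _).2 (left_ne_zero_of_mul h4)), readA_codeA]
    simp only [Encoding.accepts, ha, h3]

theorem decision_compiled (τ : Q → G.Ans) (aux : Aux (compiledMaps K E P h2)) (l : ℕ)
    (e : (compiled K E P h2).Exec)
    (h : (compiled K E P h2).mass (simulator (compiledMaps K E P h2) (answerNC τ) aux) l e ≠ 0) :
    (∀ C ∈ G.contexts, (compiledMaps K E P h2).asked e = C →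
      e.verdict = G.pred C (fun q => τ q.1)) ∧
    ((compiledMaps K E P h2).asked e ∉ G.contexts → e.verdict = true) := by
  have h3 := left_ne_zero_of_mul h
  obtain ⟨sk, hsk, h1, hq', hm', q, hm, hq, hask⟩ :=
    asked_compiled (left_ne_zero_of_mul h3) (right_ne_zero_of_mul h3)
  have hver : e.verdict = _ := verdict_answerNC τ aux l e.vs e.t₁ e.t₂ e.t₃ e.t₄ hsk h1
    (by rw [h1]; exact hq') hq (right_ne_zero_of_mul h)
  rw [hver, hask]
  refine ⟨fun C hC hCe => ?_, fun hC => ?_⟩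
  · have hne : q ≠ e.vs.q' := by
      rintro rfl
      have := h2 C hC
      rw [← hCe] at this
      simp at this
    have hvs := context_eq_pair (h2 _ e.vs.C.2) hm' hm hne
    rw [wins_assignment hvs hne, hvs, hCe]
  · have : q = e.vs.q' := by
      by_contra hne
      exact hC (context_eq_pair (h2 _ e.vs.C.2) hm' hm hne ▸ e.vs.C.2)
    subst this
    simp [wins]

theorem tsum_restrict_le_one {M : QAMaps (compiled K E P h2) G} (h0 : ∀ j, (M.a₁ j).isSome = true → j = 0)
    (p : PMF BitStr) (r : ({j // (M.a₁ j).isSome = true} → BitStr) →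
      PMF ({j // ¬ (M.a₁ j).isSome = true} → BitStr)) :
    ∑' t₂ : Fin 3 → BitStr, p (t₂ 0) * r (fun j => t₂ j.1) (fun j => t₂ j.1) ≤ 1 := by
  have hj : ∀ t₂ : Fin 3 → BitStr, (fun j : {j // (M.a₁ j).isSome = true} => t₂ j.1) =
      fun _ => t₂ 0 := fun t₂ => funext fun j => by rw [h0 j.1 j.2]
  simp only [hj]
  have hinj : Function.Injective (fun t₂ : Fin 3 → BitStr =>
      (t₂ 0, fun j : {j // ¬ (M.a₁ j).isSome = true} => t₂ j.1)) := by
    intro t t' h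
    funext i
    by_cases hi : (M.a₁ i).isSome = true
    · rw [h0 i hi]; exact (Prod.mk.inj h).1
    · exact congrFun (Prod.mk.inj h).2 ⟨i, hi⟩
  refine (ENNReal.tsum_comp_le_tsum_of_injective hinj (fun x : BitStr ×
    ({j // ¬ (M.a₁ j).isSome = true} → BitStr) => p x.1 * r (fun _ => x.1) x.2)).trans (le_of_eq ?_)
  rw [ENNReal.tsum_prod (f := fun x y => p x * r (fun _ => x) y)]
  simp only [ENNReal.tsum_mul_left, PMF.tsum_coe, mul_one]

theorem soundness_answerNC (τ : Q → G.Ans) (aux : Aux (compiledMaps K E P h2)) (l : ℕ) :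
    (compiled K E P h2).accept (simulator (compiledMaps K E P h2) (answerNC τ) aux) l ≤
      1 / 2 * (1 + G.valNC) := by
  have hv := valNC_nonneg (G := G)
  rw [Protocol.accept_eq]
  refine ENNReal.toReal_le_of_le_ofReal (by positivity) ?_
  let v : {C // C ∈ G.contexts} → ℝ := fun C => if G.pred C.1 (fun x => τ x.1) = true then 1 else 0
  let w : {C // C ∈ G.contexts} → Q → Q → ℝ := fun C q' q =>
    if wins C.1 q' q (τ q') (τ q) = true then 1 else 0
  have hv0 : ∀ C, 0 ≤ v C := fun C => by dsimp only [v]; split <;> norm_num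
  have hval : ∑ C, v C * (G.D C).toReal ≤ G.valNC := by
    have h1 := mean_ncWin_le (G := G) (PMF.pure τ)
    have h3 : ∀ C : {C // C ∈ G.contexts}, ncWin (PMF.pure τ) C.1 = ENNReal.ofReal (v C) := by
      intro C
      rw [ncWin, mean_pure]
      dsimp only [v]
      split <;> simp
    simp only [h3] at h1
    rw [mean_ofReal_fintype _ _ hv0] at h1
    simp only [mul_comm (v _)]
    exact (ENNReal.ofReal_le_ofReal_iff hv).1 h1
  have hmean := mean_questions h2 w v hv0 (fun C q _ => by simp [w, wins])
    (fun C q' q hC hne => by simp only [w, v, wins_assignment hC hne τ])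
  refine le_trans ?_ (hmean.le.trans (ENNReal.ofReal_le_ofReal (by linarith)))
  refine (le_of_eq (total_compiled K E P h2 l _)).trans ?_
  refine mean_le fun sk hsk => mean_mono fun C _ => mean_mono fun q' _ => mean_le fun c hc =>
    mean_le fun g _ => ?_
  let X : (Fin 3 → BitStr) → ℝ≥0∞ := fun t₂ =>
    encStr pad E.toFHE (sk 0) (List.ofFn (K.codeA (τ q'))) (t₂ 0) *
        aux.first l ![c, g 0] ![some q', none] ![some (τ q'), none] (fun j => t₂ j.1)
          (fun j => t₂ j.1)
  have hX : ∑' t₂, X t₂ ≤ 1 := by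
    refine tsum_restrict_le_one (fun j hj => ?_) _
      (aux.first l ![c, g 0] ![some q', none] ![some (τ q'), none])
    fin_cases j
    · rfl
    · exact absurd hj (by simp [compiledMaps])
    · exact absurd hj (by simp [compiledMaps])
  have hq' := readQ_question hsk hc
  calc _ ≤ ∑' t₂, mean (uniformQuestion h2 C) fun q => X t₂ * ENNReal.ofReal (w C q' q) := by
        refine ENNReal.tsum_le_tsum fun t₂ => mean_mono fun q _ => ?_
        have hq : ∀ s : BitStr, K.readQ (firstBits K.nq ((![List.ofFn (K.codeQ q), s] :
            Fin 2 → BitStr) 0)) = q := fun s => by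
          rw [Matrix.cons_val_zero, firstBits_ofFn', readQ_codeQ]
        have hR := fun (s : BitStr) (t : Fin 1 → BitStr) => simulator_answerNC τ aux
          (⟨sk 0, C, q', g 1⟩ : Coins G) l ![c, g 0] t₂ ![List.ofFn (K.codeQ q), s] t hq' (hq s)
        rw [K.tsum_answer]
        · refine (Finset.sum_le_sum fun a _ => ?_ : _ ≤ ∑ a : G.Ans, if a = τ q then
            X t₂ * ENNReal.ofReal (w C q' q) else 0).trans (by simp)
          by_cases h0 : simulator (compiledMaps K E P h2) (answerNC τ) aux
              (⟨sk 0, C, q', g 1⟩ : Coins G) l ![c, g 0] t₂ ![List.ofFn (K.codeQ q),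
                pad.keyStr (finalKey E P (sk 0) (g 1) (t₂ 1) (t₂ 2))] ![List.ofFn (K.codeA a)] = 0
          · rw [h0, ite_self]
            exact zero_le
          · have hver := verdict_answerNC τ aux l ⟨sk 0, C, q', g 1⟩ ![c, g 0] t₂
              ![List.ofFn (K.codeQ q), pad.keyStr (finalKey E P (sk 0) (g 1) (t₂ 1) (t₂ 2))]
              ![List.ofFn (K.codeA a)] hsk rfl hq' (hq _) h0
            rw [hver, hR]
            dsimp only [w]
            rw [Matrix.cons_val_zero, K.onAnswer_ofFn]
            split <;> simp [X]
        · intro t ht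
          rw [hR]
          simp [Encoding.onAnswer, ht]
    _ = (∑' t₂, X t₂) * mean (uniformQuestion h2 C) fun q => ENNReal.ofReal (w C q' q) := by
        simp only [mean_mul_left, ENNReal.tsum_mul_right]
    _ ≤ _ := (mul_le_mul_left hX _).trans (one_mul _).le

end

theorem answerOps_two {Q : Type} [Fintype Q] {G : ContextualityGame Q} {H : Type}
    [NormedAddCommGroup H] [InnerProductSpace ℂ H] [CompleteSpace H] (S : G.QStrat H)
    (q : Fin 2 → Option Q) (a : Fin 2 → Option G.Ans) :
    answerOps S q a = answerOp S (q 1) (a 1) * answerOp S (q 0) (a 0) := by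
  simp [answerOps, List.ofFn_succ]

theorem mean_ite_eq {X : Type*} (p : PMF X) (x : X) :
    mean p (fun y => if y = x then 1 else 0) = p x := by
  rw [mean, tsum_eq_single x]
  · simp
  · intro y hy; simp [hy]

/-- The quality of ciphertexts of a uniform key that are obtained by evaluation. -/
theorem eval_key_close {Q : Type} [Fintype Q] {G : ContextualityGame Q} (K : Encoding G)
    {pad : PadFamily} (E : QFHE pad) {n : ℕ} (hE : E.EvaluatedForm) : ∃ ν : ℕ → ℝ, Negligible ν ∧
    ∀ (l : ℕ), ∀ sk ∈ (E.gen ![unary l]).support, ∀ q' : Q,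
    ∀ c ∈ (encStr pad E.toFHE (sk 0) (List.ofFn (K.codeQ q'))).support,
      ∑' kh, gap (mean (PMF.uniformOfFintype (pad.Key n)) fun k =>
          E.eval (fun _ : Bits (pad.len K.nq) => pad.code n k) ![c.drop K.nq] ![kh])
        (mean (PMF.uniformOfFintype (pad.Key n)) fun k => E.enc ![sk 0, pad.keyStr k] ![kh]) ≤
        ENNReal.ofReal (ν l) := by
  choose ν hν h using fun k : pad.Key n => hE.1 (fun _ : Bits (pad.len K.nq) => pad.code n k)
  refine ⟨fun l => ∑ k, |ν k l|, Negligible.sum _ fun k _ => (hν k).abs,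
    fun l sk hsk q' c hc => ?_⟩
  obtain ⟨k', kh', hkh, rfl⟩ := mem_support_encStr_ofFn hc
  have hd : ![(List.ofFn (pad.act K.nq k' (K.codeQ q')) ++ kh' 0).drop K.nq] = kh' := by
    rw [List.drop_left' (by simp)]
    funext i; fin_cases i; rfl
  rw [hd]
  refine (ENNReal.tsum_le_tsum fun kh => gap_mean_le _ _ _).trans ?_
  rw [← mean_tsum]
  refine mean_le fun k _ => ?_
  have h1 := h k l sk hsk (pad.code K.nq k') kh' hkh
  rw [l1Dist_eq, tsum_fin_one] at h1
  exact h1.trans (ENNReal.ofReal_le_ofReal ((le_abs_self _).trans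
    (Finset.single_le_sum (f := fun k => |ν k l|) (fun k _ => abs_nonneg _) (Finset.mem_univ k))))

section
variable {Q : Type} [Fintype Q] {G : ContextualityGame Q} {K : Encoding G} [Nonempty Q]
  {pad : PadFamily} {E : QFHE pad} {n : ℕ} {P : OPad pad n}
  {h2 : ∀ C ∈ G.contexts, C.card = 2} {S : G.QStrat (Qubits n)}

theorem honest_close_fresh (hE : E.EvaluatedForm) (hS : S.Described) :
    ∃ ν : ℕ → ℝ, Negligible ν ∧ ∀ l,
    (compiled K E P h2).distance l (fun _ => (honest K E P S).behaviour) (freshBehaviour K E P S) ≤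
      ENNReal.ofReal (ν l) := by
  obtain ⟨ν, hν, h⟩ := honest_close_ideal K E P h2 hS
  obtain ⟨μ, hμ, h'⟩ := ideal_close_fresh K E P h2 hE hS
  refine ⟨fun l => |ν l| + |μ l|, hν.abs.add hμ.abs, fun l => ?_⟩
  rw [ENNReal.ofReal_add (abs_nonneg _) (abs_nonneg _)]
  exact (Protocol.distance_triangle _ l _ _ _).trans (add_le_add
    ((h l).trans (ENNReal.ofReal_le_ofReal (le_abs_self _)))
    ((h' l).trans (ENNReal.ofReal_le_ofReal (le_abs_self _))))

theorem marginal_compiled (hE : E.EvaluatedForm) {S S' : G.QStrat (Qubits n)} (hS : S.Described)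
    (hS' : S'.Described) (C : Finset Q) (hpsi : S.psi = S'.psi) (hO : ∀ q ∈ C, S.O q = S'.O q) :
    ∃ ν : ℕ → ℝ, Negligible ν ∧ ∀ l,
      l1Dist
        (fun e : {e : (compiled K E P h2).Exec // (compiledMaps K E P h2).asked e ⊆ C} =>
          (compiled K E P h2).mass (fun _ => (honest K E P S).behaviour) l e.1)
        (fun e : {e : (compiled K E P h2).Exec // (compiledMaps K E P h2).asked e ⊆ C} =>
          (compiled K E P h2).mass (fun _ => (honest K E P S').behaviour) l e.1) ≤
        ENNReal.ofReal (ν l) := by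
  obtain ⟨ν, hν, h⟩ := honest_close_fresh (K := K) (P := P) (h2 := h2) hE hS
  obtain ⟨μ, hμ, h'⟩ := honest_close_fresh (K := K) (P := P) (h2 := h2) hE hS'
  refine ⟨fun l => |ν l| + |μ l|, hν.abs.add hμ.abs, fun l => ?_⟩
  rw [ENNReal.ofReal_add (abs_nonneg _) (abs_nonneg _)]
  refine (Protocol.l1Dist_subtype_le _ (fun e => (compiledMaps K E P h2).asked e ⊆ C) _
    (freshBehaviour K E P S) (freshBehaviour K E P S') _ l fun e he => ?_).trans (add_le_add
    ((h l).trans (ENNReal.ofReal_le_ofReal (le_abs_self _)))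
    ((Protocol.distance_comm _ l _ _).trans_le
      ((h' l).trans (ENNReal.ofReal_le_ofReal (le_abs_self _)))))
  change _ * _ * _ = _ * _ * _
  by_cases h0 : (compiled K E P h2).start l (e.vs, e.t₁) = 0
  · rw [h0, zero_mul, zero_mul, zero_mul]
  by_cases h1 : (compiled K E P h2).next e.vs e.t₁ e.t₂ e.t₃ = 0
  · rw [h1, mul_zero, zero_mul, zero_mul]
  congr 1
  obtain ⟨sk, -, -, -, -, q, -, hq, hask⟩ := asked_compiled h0 h1
  have hqC : q ∈ C := he (by rw [hask]; simp)
  have hq'C : e.vs.q' ∈ C := he (by rw [hask]; simp)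
  have hj : ∀ a' a, S.joint e.vs.q' a' q a = S'.joint e.vs.q' a' q a := fun a' a => by
    rw [QStrat.joint, QStrat.joint, QStrat.proj, QStrat.proj, QStrat.proj, QStrat.proj, hO q hqC,
      hO _ hq'C, hpsi]
  simp only [freshBehaviour, freshWeight, hq, hj]

variable (K E P h2)

/-- The strings of a simulator that are not answers: a ciphertext of a uniform key obtained by
evaluation of a constant, and a sample of the oblivious pad. -/
def simulatedStrings (t₁ : Fin 2 → BitStr) :
    PMF ({j // ¬ ((compiledMaps K E P h2).a₁ j).isSome = true} → BitStr) :=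
  (PMF.uniformOfFintype (pad.Key n)).bind fun k =>
    (E.eval (fun _ : Bits (pad.len K.nq) => pad.code n k) ![(t₁ 0).drop K.nq]).bind fun r =>
    (P.samp ![t₁ 1]).bind fun s => PMF.pure fun j => if j.1 = 1 then r 0 else s 0

theorem simulatedStrings_apply (t₁ : Fin 2 → BitStr) (t₂ : Fin 3 → BitStr) :
    simulatedStrings K E P h2 t₁ (fun j => t₂ j.1) =
      (mean (PMF.uniformOfFintype (pad.Key n)) fun k =>
        E.eval (fun _ : Bits (pad.len K.nq) => pad.code n k) ![(t₁ 0).drop K.nq] ![t₂ 1]) *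
      P.samp ![t₁ 1] ![t₂ 2] := by
  have h1 : ¬ ((compiledMaps K E P h2).a₁ 1).isSome = true := by simp [compiledMaps]
  have h3 : ¬ ((compiledMaps K E P h2).a₁ 2).isSome = true := by simp [compiledMaps]
  have hite : ∀ r s : Fin 1 → BitStr,
      ((PMF.pure fun j => if j.1 = 1 then r 0 else s 0 :
        PMF ({j // ¬ ((compiledMaps K E P h2).a₁ j).isSome = true} → BitStr)) fun j => t₂ j.1) =
      (if r = ![t₂ 1] then 1 else 0) * if s = ![t₂ 2] then 1 else 0 := by
    intro r s
    rw [PMF.pure_apply]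
    have : ((fun j : {j // ¬ ((compiledMaps K E P h2).a₁ j).isSome = true} => t₂ j.1) =
        fun j => if j.1 = 1 then r 0 else s 0) ↔ r = ![t₂ 1] ∧ s = ![t₂ 2] := by
      constructor
      · intro h
        refine ⟨?_, ?_⟩
        · funext i; fin_cases i
          exact (congrFun h ⟨1, h1⟩).symm
        · funext i; fin_cases i
          exact (congrFun h ⟨2, h3⟩).symm
      · rintro ⟨rfl, rfl⟩
        funext ⟨j, hj⟩
        fin_cases j
        · exact absurd rfl hj
        · rfl
        · rfl
    by_cases hr : r = ![t₂ 1]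
    · by_cases hs : s = ![t₂ 2]
      · rw [if_pos (this.2 ⟨hr, hs⟩), if_pos hr, if_pos hs, mul_one]
      · rw [if_neg fun h => hs (this.1 h).2, if_neg hs, mul_zero]
    · rw [if_neg fun h => hr (this.1 h).1, if_neg hr, zero_mul]
  rw [simulatedStrings, bind_apply_mean, ← mean_mul_right]
  congr 1; funext k
  rw [bind_apply_mean, ← mean_ite_eq (E.eval _ _), ← mean_mul_right]
  congr 1; funext r
  rw [bind_apply_mean, ← mean_ite_eq (P.samp _), ← mean_mul_left]
  congr 1; funext s
  convert hite r s

variable (S)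

theorem simulator_answerQu (vs : Coins G) (l : ℕ) (t₁ : Fin 2 → BitStr)
    (t₂ : Fin 3 → BitStr) (t₃ : Fin 2 → BitStr) (t₄ : Fin 1 → BitStr)
    (aux : Aux (compiledMaps K E P h2))
    (haux : ∀ l t₁ d₁ a₁ x, aux.first l t₁ d₁ a₁ x = simulatedStrings K E P h2 t₁)
    (hq' : K.readQ (decStr pad E.toFHE K.nq vs.sk (t₁ 0)) = vs.q') :
    simulator (compiledMaps K E P h2) (answerQu S) aux vs l t₁ t₂ t₃ t₄ =
      K.onAnswer (fun a => P.samp ![t₁ 1] ![t₂ 2] *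
        ((∑ a', encStr pad E.toFHE vs.sk (List.ofFn (K.codeA a')) (t₂ 0) *
          ENNReal.ofReal (S.joint vs.q' a' (K.readQ (firstBits K.nq (t₃ 0))) a)) *
        mean (PMF.uniformOfFintype (pad.Key n)) fun k =>
          E.eval (fun _ : Bits (pad.len K.nq) => pad.code n k) ![(t₁ 0).drop K.nq] ![t₂ 1]))
        (t₄ 0) := by
  rw [simulator_compiled, hq']
  · congr 1
    funext a
    rw [Finset.sum_mul, Finset.mul_sum]
    refine Finset.sum_congr rfl fun a' _ => ?_
    rw [haux, simulatedStrings_apply]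
    have : answerQu S ![some vs.q', none] ![some a', none]
        ![some (K.readQ (firstBits K.nq (t₃ 0))), none] ![some a, none] =
        ENNReal.ofReal (S.joint vs.q' a' (K.readQ (firstBits K.nq (t₃ 0))) a) := by
      rw [answerQu, answerOps_two, answerOps_two]
      simp [answerOp, QStrat.joint]
    rw [this]
    ring
  · intro d₁ a₁ d₂ a₂ h1 h3 h
    rw [answerQu, answerOps_two, answerOps_two, h1, h3] at h
    refine ⟨?_, ?_⟩
    · by_contra h0
      obtain ⟨x, hx⟩ := Option.ne_none_iff_exists'.1 h0
      exact h (by simp [hx, answerOp])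
    · by_contra h0
      obtain ⟨x, hx⟩ := Option.ne_none_iff_exists'.1 h0
      exact h (by simp [hx, answerOp])

variable {S}

theorem quantumCompleteness_compiled (hE : E.EvaluatedForm) (hS : S.Described) :
    ∃ (aux : Aux (compiledMaps K E P h2)) (ν : ℕ → ℝ), Negligible ν ∧ ∀ l,
      l1Dist ((compiled K E P h2).transcript (simulator (compiledMaps K E P h2) (answerQu S) aux) l)
        ((compiled K E P h2).transcript (fun _ => (honest K E P S).behaviour) l) ≤
        ENNReal.ofReal (ν l) := by
  obtain ⟨ν, hν, h⟩ := honest_close_fresh (K := K) (P := P) (h2 := h2) hE hS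
  obtain ⟨μ, hμ, h'⟩ := eval_key_close K E (n := n) hE
  refine ⟨⟨fun _ t₁ _ _ _ => simulatedStrings K E P h2 t₁,
    fun _ _ _ _ _ _ _ _ _ => PMF.pure fun _ => []⟩, fun l => |μ l| + |ν l|, hμ.abs.add hν.abs,
    fun l => ?_⟩
  refine (Protocol.l1Dist_transcript_le _ _ _ l).trans
    ((Protocol.distance_triangle _ l _ (freshBehaviour K E P S) _).trans ?_)
  rw [ENNReal.ofReal_add (abs_nonneg _) (abs_nonneg _)]
  refine add_le_add ?_ ((Protocol.distance_comm _ l _ _).trans_le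
    ((h l).trans (ENNReal.ofReal_le_ofReal (le_abs_self _))))
  refine le_trans ?_ (ENNReal.ofReal_le_ofReal (le_abs_self (μ l)))
  refine (le_of_eq (total_compiled K E P h2 l _)).trans ?_
  refine mean_le fun sk hsk => mean_le fun C _ => mean_le fun q' hq' => mean_le fun c hc => ?_
  let B : Q → G.Ans → BitStr → ℝ≥0∞ := fun q a ca =>
    ∑ a', encStr pad E.toFHE (sk 0) (List.ofFn (K.codeA a')) ca * ENNReal.ofReal (S.joint q' a' q a)
  let D : BitStr → ℝ≥0∞ := fun kh => gap (mean (PMF.uniformOfFintype (pad.Key n)) fun k =>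
          E.eval (fun _ : Bits (pad.len K.nq) => pad.code n k) ![c.drop K.nq] ![kh])
        (mean (PMF.uniformOfFintype (pad.Key n)) fun k => E.enc ![sk 0, pad.keyStr k] ![kh])
  have hB : ∀ q a ca, B q a ca ≠ ⊤ := fun q a ca => ENNReal.sum_ne_top.2 fun a' _ =>
    ENNReal.mul_ne_top (PMF.apply_ne_top _ _) ENNReal.ofReal_ne_top
  have hBsum : ∀ q, ∑' ca, ∑ a, B q a ca = 1 := by
    intro q
    rw [Summable.tsum_finsetSum fun _ _ => ENNReal.summable]
    simp only [B, Summable.tsum_finsetSum fun _ _ => ENNReal.summable, ENNReal.tsum_mul_right,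
      PMF.tsum_coe, one_mul]
    rw [Finset.sum_comm]
    simp only [← ENNReal.ofReal_sum_of_nonneg fun a _ => S.joint_nonneg _ _ _ _]
    rw [← ENNReal.ofReal_sum_of_nonneg fun a _ => Finset.sum_nonneg fun _ _ => S.joint_nonneg _ _ _ _,
      S.sum_joint, ENNReal.ofReal_one]
  have hinner : ∀ (g : Fin 2 → BitStr) (ca kh s : BitStr) (q : Q) (x : BitStr),
      (∑' t₄ : Fin 1 → BitStr, gap (simulator (compiledMaps K E P h2) (answerQu S)
        ⟨fun _ t₁ _ _ _ => simulatedStrings K E P h2 t₁,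
          fun _ _ _ _ _ _ _ _ _ => PMF.pure fun _ => []⟩ (⟨sk 0, C, q', g 1⟩ : Coins G) l ![c, g 0]
          ![ca, kh, s] ![List.ofFn (K.codeQ q), x] t₄)
        (freshBehaviour K E P S (⟨sk 0, C, q', g 1⟩ : Coins G) l ![c, g 0] ![ca, kh, s]
          ![List.ofFn (K.codeQ q), x] t₄)) = P.samp ![g 0] ![s] * ((∑ a, B q a ca) * D kh) := by
    intro g ca kh s q x
    have hsim := fun t₄ => simulator_answerQu K E P h2 S (⟨sk 0, C, q', g 1⟩ : Coins G) l
      ![c, g 0] ![ca, kh, s] ![List.ofFn (K.codeQ q), x] t₄ ⟨fun _ t₁ _ _ _ =>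
        simulatedStrings K E P h2 t₁, fun _ _ _ _ _ _ _ _ _ => PMF.pure fun _ => []⟩
      (fun _ _ _ _ _ => rfl) (readQ_question hsk hc)
    simp only [hsim, freshBehaviour, K.tsum_gap_onAnswer, gap_mul _ _ _ (PMF.apply_ne_top _ _), freshWeight]
    rw [Finset.sum_mul, Finset.mul_sum]
    refine Finset.sum_congr rfl fun a _ => ?_
    congr 1
    simp only [Matrix.cons_val_zero, firstBits_ofFn', readQ_codeQ]
    exact gap_mul _ _ _ (hB q a ca)
  have hsamp : ∀ Z : ℝ≥0∞, ∑' s, mean (P.gen ![unary l]) (fun g => P.samp ![g 0] ![s] * Z) = Z :=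
    fun Z => by rw [← mean_tsum, samp_total]
  simp only [tsum_fin_three, hinner, mean_mul_left, mean_tsum (P.gen ![unary l]), hsamp]
  simp only [← mean_tsum (uniformQuestion h2 C)]
  refine mean_le fun q _ => ?_
  simp only [ENNReal.tsum_mul_left, ENNReal.tsum_mul_right, hBsum, one_mul]
  exact h' l sk hsk q' c hc

end

/-! ### The joint distribution of commuting observables -/

theorem sum_prod_idempotent {ι X R : Type*} [Fintype ι] [Fintype X] [CommRing R] {e : ι → X → R}
    (hm : ∀ i x y, e i x * e i y = if x = y then e i x else 0) (hs : ∀ i, ∑ x, e i x = 1)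
    (i j : ι) (x y : X) :
    ∑ τ : ι → X, (if τ i = x ∧ τ j = y then ∏ k, e k (τ k) else 0) = e i x * e j y := by
  have h1 : ∀ (τ : ι → X) i x, e i x * ∏ k, e k (τ k) = if τ i = x then ∏ k, e k (τ k) else 0 := by
    intro τ i x
    rw [← Finset.mul_prod_erase Finset.univ _ (Finset.mem_univ i), ← mul_assoc, hm]
    by_cases h : τ i = x
    · rw [if_pos h.symm, if_pos h, h]
    · rw [if_neg (Ne.symm h), if_neg h, zero_mul]
  have h2 : ∑ τ : ι → X, ∏ k, e k (τ k) = 1 := by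
    rw [← Fintype.piFinset_univ, ← Finset.prod_univ_sum]
    simp only [hs, Finset.prod_const_one]
  rw [← mul_one (e i x * e j y), ← h2, Finset.mul_sum]
  refine Finset.sum_congr rfl fun τ _ => ?_
  rw [mul_assoc, h1, mul_ite, mul_zero, h1, ite_and]
  by_cases h : τ i = x <;> by_cases h' : τ j = y <;> simp only [h, h', if_true, if_false]

open scoped IsMulCommutative in
/-- The products of the projections of commuting measurements. -/
theorem exists_joint_projections {ι X : Type*} [Fintype ι] [Fintype X] {n : ℕ} {M : ι → X → QOp n}
    (hM : ∀ i, IsPVM (M i)) (hc : ∀ i j x y, M i x * M j y = M j y * M i x)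
    (ha : ∀ i x u v, IsAlgebraic ℚ (M i x u v)) : ∃ N : (ι → X) → QOp n,
      (∀ τ, (N τ).PosSemidef) ∧ (∀ τ u v, IsAlgebraic ℚ (N τ u v)) ∧
      ∀ i j x y, ∑ τ, (if τ i = x ∧ τ j = y then N τ else 0) = M i x * M j y := by
  let s : Set (QOp n) := Set.range fun p : ι × X => M p.1 p.2
  have : IsMulCommutative (Subring.closure s) := Subring.isMulCommutative_closure (by
    rintro _ ⟨p, rfl⟩ _ ⟨p', rfl⟩
    exact hc _ _ _ _)
  let e : ι → X → Subring.closure s := fun i x =>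
    ⟨M i x, Subring.subset_closure ⟨(i, x), rfl⟩⟩
  have hm : ∀ i x y, e i x * e i y = if x = y then e i x else 0 := by
    intro i x y
    refine Subtype.ext (((hM i).mul x y).trans ?_)
    split <;> rfl
  have hs : ∀ i, ∑ x, e i x = 1 := by
    intro i
    refine Subtype.ext ((map_sum (Subring.closure s).subtype _ _).trans (hM i).sum)
  have hstar : ∀ (τ : ι → X) (t : Finset ι),
      ((∏ k ∈ t, e k (τ k) : Subring.closure s) : QOp n)ᴴ = (∏ k ∈ t, e k (τ k) : Subring.closure s) := by
    intro τ t
    induction t using Finset.cons_induction with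
    | empty => exact Matrix.conjTranspose_one
    | cons i t hi ih =>
      rw [Finset.prod_cons]
      refine (Matrix.conjTranspose_mul _ _).trans ?_
      rw [ih]
      refine Eq.trans ?_ (congrArg Subtype.val (mul_comm (∏ k ∈ t, e k (τ k)) (e i (τ i))))
      exact congrArg _ ((hM i).herm _)
  have halg : ∀ (τ : ι → X) (t : Finset ι) u v,
      IsAlgebraic ℚ (((∏ k ∈ t, e k (τ k) : Subring.closure s) : QOp n) u v) := by
    intro τ t
    induction t using Finset.cons_induction with
    | empty =>
      intro u v
      change IsAlgebraic ℚ ((1 : QOp n) u v)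
      rw [Matrix.one_apply]
      split
      · exact isAlgebraic_one
      · exact isAlgebraic_zero
    | cons i t hi ih =>
      rw [Finset.prod_cons]
      exact isAlgebraic_matrix_mul (ha i _) ih
  refine ⟨fun τ => (∏ k, e k (τ k) : Subring.closure s), fun τ => ?_,
    fun τ => halg τ Finset.univ, fun i j x y => ?_⟩
  · have h : (∏ k, e k (τ k)) * (∏ k, e k (τ k)) = ∏ k, e k (τ k) := by
      rw [← Finset.prod_mul_distrib]
      exact Finset.prod_congr rfl fun k _ => by rw [hm, if_pos rfl]
    have h1 := Matrix.posSemidef_conjTranspose_mul_self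
      ((∏ k, e k (τ k) : Subring.closure s) : QOp n)
    rw [hstar] at h1
    rwa [show ((∏ k, e k (τ k) : Subring.closure s) : QOp n) * (∏ k, e k (τ k) : Subring.closure s) =
      (∏ k, e k (τ k) : Subring.closure s) from congrArg Subtype.val h] at h1
  · refine Eq.trans ?_ (congrArg Subtype.val (sum_prod_idempotent hm hs i j x y))
    refine Eq.trans ?_ (map_sum (Subring.closure s).subtype _ _).symm
    refine Finset.sum_congr rfl fun τ _ => ?_
    split <;> rfl

theorem exists_jointDistribution {Q : Type} [Fintype Q] {G : ContextualityGame Q} {n : ℕ}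
    [Nonempty Q] {S : G.QStrat (Qubits n)} (hS : S.Described)
    (hc : ∀ q q', Commute (S.O q) (S.O q')) : ∃ J : PMF (Q → G.Ans),
      (∀ τ, IsAlgebraic ℚ (J τ).toReal) ∧ ∀ q' a' q a,
        ∑ τ, (if τ q' = a' ∧ τ q = a then J τ else 0) = ENNReal.ofReal (S.joint q' a' q a) := by
  obtain ⟨N, hN, halg, hsum⟩ := exists_joint_projections (M := fun q (a : G.Ans) => S.projMat q a.1)
    S.isPVM_projMat (fun q q' a a' => S.commute_projMat (hc q q') _ _) fun q a => hS.2 q a.1 a.2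
  let p : (Q → G.Ans) → ℝ := fun τ => ((N τ * ketbra S.psi.ofLp).trace).re
  have hp : ∀ τ, 0 ≤ p τ := fun τ => re_trace_mul_nonneg (hN τ) (posSemidef_ketbra _)
  have hj : ∀ q' a' q a, ∑ τ, (if τ q' = a' ∧ τ q = a then p τ else 0) = S.joint q' a' q a := by
    intro q' a' q a
    have h1 : ∑ τ, (if τ q' = a' ∧ τ q = a then p τ else 0) =
        ((S.projMat q' a'.1 * S.projMat q a.1 * ketbra S.psi.ofLp).trace).re := by
      rw [← hsum, Finset.sum_mul, Matrix.trace_sum, Complex.re_sum]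
      refine Finset.sum_congr rfl fun τ _ => ?_
      split
      · rfl
      · simp
    have h2 := S.trace_projMat_mul_post q' a' q a
    have h3 : S.post q' a' = S.projMat q' a'.1 * ketbra S.psi.ofLp * S.projMat q' a'.1 := by
      rw [QStrat.post, ketbra_mulVec, (S.isPVM_projMat q').herm]
    rw [h1, ← Complex.ofReal_re (S.joint q' a' q a), ← h2, h3]
    have h4 : S.projMat q' a'.1 * S.projMat q' a'.1 = S.projMat q' a'.1 :=
      ((S.isPVM_projMat q').mul a' a').trans (if_pos rfl)
    congr 1
    calc (S.projMat q' a'.1 * S.projMat q a.1 * ketbra S.psi.ofLp).trace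
        = (S.projMat q' a'.1 * (S.projMat q' a'.1 * S.projMat q a.1 * ketbra S.psi.ofLp)).trace := by
          rw [← Matrix.mul_assoc, ← Matrix.mul_assoc, h4]
      _ = _ := by
          rw [Matrix.trace_mul_comm, ← S.commute_projMat (hc q q')]
          simp only [Matrix.mul_assoc]
  have h1 : ∑ τ, ENNReal.ofReal (p τ) = 1 := by
    rw [← ENNReal.ofReal_sum_of_nonneg fun τ _ => hp τ, ← ENNReal.ofReal_one]
    congr 1
    let q : Q := Classical.arbitrary Q
    rw [← S.sum_joint q q]
    simp only [← hj]
    rw [Finset.sum_congr rfl fun a' _ => Finset.sum_comm, Finset.sum_comm]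
    refine Finset.sum_congr rfl fun τ _ => ?_
    simp [ite_and]
  refine ⟨PMF.ofFintype (fun τ => ENNReal.ofReal (p τ)) h1, fun τ => ?_, fun q' a' q a => ?_⟩
  · rw [PMF.ofFintype_apply, ENNReal.toReal_ofReal (hp τ)]
    refine (isAlgebraic_algHom_iff (Complex.ofRealAm.restrictScalars ℚ)
      Complex.ofReal_injective).1 ?_
    change IsAlgebraic ℚ ((p τ : ℝ) : ℂ)
    have h2 : ((p τ : ℝ) : ℂ) = (N τ * ketbra S.psi.ofLp).trace :=
      (Complex.eq_re_of_ofReal_le (trace_mul_nonneg (hN τ) (posSemidef_ketbra _))).symm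
    rw [h2]
    exact isAlgebraic_sum _ fun u _ => isAlgebraic_matrix_mul (halg τ)
      (fun u v => (hS.1 u).mul (isAlgebraic_star (hS.1 v))) _ _
  · simp only [PMF.ofFintype_apply]
    rw [← hj, ENNReal.ofReal_sum_of_nonneg]
    · refine Finset.sum_congr rfl fun τ _ => ?_
      split
      · rfl
      · simp
    · intro τ _
      split
      · exact hp τ
      · exact le_rfl

/-! ### Secure encryption of strings -/

theorem encStr_ofFn {pad : PadFamily} {E : FHE} {sk : BitStr} {N : ℕ} (b : Bits N) :
    encStr pad E sk (List.ofFn b) = (PMF.uniformOfFintype (pad.Key N)).bind fun k =>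
      (E.enc ![sk, pad.keyStr k]).bind fun kh => PMF.pure (List.ofFn (pad.act N k b) ++ kh 0) := by
  have h : ∀ (M : ℕ) (hM : M = N) (b' : Bits M), (∀ i, b' i = b (Fin.cast hM i)) →
      ((PMF.uniformOfFintype (pad.Key M)).bind fun k =>
        (E.enc ![sk, pad.keyStr k]).bind fun kh => PMF.pure (List.ofFn (pad.act M k b') ++ kh 0)) =
      (PMF.uniformOfFintype (pad.Key N)).bind fun k =>
        (E.enc ![sk, pad.keyStr k]).bind fun kh => PMF.pure (List.ofFn (pad.act N k b) ++ kh 0) := by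
    rintro M rfl b' hb
    rw [show b' = b from funext hb]
  exact h _ List.length_ofFn _ fun i => by simp; rfl

/-- The pads of a secure scheme hide strings completely. -/
theorem QFHE.Secure.exists_act_eq {pad : PadFamily} {E : QFHE pad} (hE : E.Secure) {N : ℕ}
    (x y : Bits N) : ∃ k, pad.act N k x = y := by
  by_contra h0
  let φ : BitStr → Bool := fun s => decide (∃ k, pad.act N k x = firstBits N s)
  have hφ : ∀ s : BitStr, φ (s.take N) = φ s := by
    intro s
    simp only [φ, firstBits_take le_rfl]
  obtain ⟨ν, hν, h⟩ := hE (fun z => PMF.pure ![[φ (z 1)]])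
    (IsPPT.lookup 1 N φ hφ (fun b _ => PMF.pure ![[b]]) fun b => IsPPT.const _) (Polynomial.C N)
  have h1 : ∀ (b : Bits N) (v : Bool), (∀ k, decide (∃ k', pad.act N k' x = pad.act N k b) = v) →
      ∀ l, probOne (do
        let sk ← E.gen ![unary l]
        let c ← encStr pad E.toFHE (sk 0) (List.ofFn b)
        PMF.pure ![[φ ((![unary l, c] : Fin 2 → BitStr) 1)]]) = if v = true then 1 else 0 := by
    intro b v hv l
    change (mean (E.gen ![unary l]) fun sk => mean (encStr pad E.toFHE (sk 0) (List.ofFn b)) fun c =>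
      (PMF.pure ![[φ c]] : PMF (Fin 1 → BitStr)) ![[true]]).toReal = _
    have h2 : ∀ sk : Fin 1 → BitStr, (mean (encStr pad E.toFHE (sk 0) (List.ofFn b)) fun c =>
        (PMF.pure ![[φ c]] : PMF (Fin 1 → BitStr)) ![[true]]) = if v = true then 1 else 0 := by
      intro sk
      rw [← mean_const (encStr pad E.toFHE (sk 0) (List.ofFn b)) (if v = true then 1 else 0)]
      refine mean_congr fun c hc => ?_
      obtain ⟨k, kh, -, rfl⟩ := mem_support_encStr_ofFn hc
      have h3 : φ (List.ofFn (pad.act N k b) ++ kh 0) = v := by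
        simp only [φ, firstBits_ofFn, hv]
      rw [h3, PMF.pure_apply]
      cases v <;> simp
    simp only [h2, mean_const]
    cases v <;> simp
  have h2 := fun l => h l (List.ofFn x) (List.ofFn y) (by simp) (by simp)
  have hy : ∀ k, ¬ ∃ k', pad.act N k' x = pad.act N k y := fun k ⟨k', hk⟩ =>
    h0 ⟨k⁻¹ * k', by rw [PadFamily.act_mul, hk, PadFamily.act_inv_act]⟩
  have h3 : ∀ l, 1 ≤ ν l := fun l => by
    have := h2 l
    rw [h1 x true fun k => decide_eq_true ⟨k, rfl⟩, h1 y false fun k => decide_eq_false (hy k)] at this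
    simpa using this
  have h4 : Filter.Tendsto ν Filter.atTop (nhds 0) := by simpa using hν 0
  exact absurd (ge_of_tendsto' h4 h3) (by norm_num)

theorem tsum_gap_bind_le {α β : Type*} (p q : PMF α) (f : α → PMF β) :
    ∑' b, gap ((p.bind f) b) ((q.bind f) b) ≤ l1Dist p q := by
  have h : ∀ b, gap ((p.bind f) b) ((q.bind f) b) ≤ ∑' a, f a b * gap (p a) (q a) := fun b => by
    rw [PMF.bind_apply, PMF.bind_apply]
    refine (gap_tsum_le _ _).trans (ENNReal.tsum_le_tsum fun a => ?_)
    rw [mul_comm (p a), mul_comm (q a), gap_mul _ _ _ ((f a).apply_ne_top b)]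
  refine (ENNReal.tsum_le_tsum h).trans ?_
  rw [ENNReal.tsum_comm, l1Dist_eq]
  simp only [ENNReal.tsum_mul_right, PMF.tsum_coe, one_mul, le_refl]

theorem gap_mul_mul_le {a b c d : ℝ≥0∞} (hb : b ≠ ⊤) (hc : c ≠ ⊤) :
    gap (a * c) (b * d) ≤ gap a b * c + b * gap c d := by
  refine (gap_triangle _ (b * c) _).trans (add_le_add (le_of_eq ?_) (gap_mul _ _ _ hb).le)
  rw [mul_comm a, mul_comm b, gap_mul _ _ _ hc, mul_comm]

theorem bind_three_apply (f : PMF BitStr) (g h : PMF (Fin 1 → BitStr)) (m st ca kh s : BitStr) :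
    (f.bind fun x => g.bind fun y => h.bind fun z =>
      PMF.pure (![m, x, y 0, z 0] : Fin 4 → BitStr)) ![st, ca, kh, s] =
      (if st = m then 1 else 0) * (f ca * (g ![kh] * h ![s])) := by
  rw [bind_apply_mean, ← mean_ite_eq f, ← mean_mul_right, ← mean_mul_left]
  congr 1; funext x
  rw [bind_apply_mean, ← mean_ite_eq g, ← mean_mul_right, ← mean_mul_left, ← mean_mul_left]
  congr 1; funext y
  rw [bind_apply_mean, ← mean_ite_eq h, ← mean_mul_left, ← mean_mul_left, ← mean_mul_left]
  congr 1; funext z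
  have h1 : (![st, ca, kh, s] : Fin 4 → BitStr) = ![m, x, y 0, z 0] ↔
      st = m ∧ x = ca ∧ y = ![kh] ∧ z = ![s] := by
    constructor
    · intro h
      refine ⟨congrFun h 0, (congrFun h 1).symm, ?_, ?_⟩
      · funext i; fin_cases i
        exact (congrFun h 2).symm
      · funext i; fin_cases i
        exact (congrFun h 3).symm
    · rintro ⟨rfl, rfl, rfl, rfl⟩
      rfl
  rw [PMF.pure_apply]
  by_cases h2 : st = m ∧ x = ca ∧ y = ![kh] ∧ z = ![s]
  · rw [if_pos (h1.2 h2), if_pos h2.1, if_pos h2.2.1, if_pos h2.2.2.1, if_pos h2.2.2.2]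
    simp
  · rw [if_neg (mt h1.1 h2)]
    by_contra h3
    refine h2 ⟨?_, ?_, ?_, ?_⟩ <;> by_contra h4 <;> exact h3 (by rw [if_neg h4]; simp)

section
variable {Q : Type} [Fintype Q] {G : ContextualityGame Q} (K : Encoding G) [Nonempty Q]
  {pad : PadFamily} (E : QFHE pad) {n : ℕ} (P : OPad pad n)
  (h2 : ∀ C ∈ G.contexts, C.card = 2) {S : G.QStrat (Qubits n)}
  (t : G.Ans → pad.Key K.na) (b₀ : Bits K.na) (J : PMF (Q → G.Ans))
  (L : ℕ) (code : (Q → G.Ans) → BitStr) (read : BitStr → Q → G.Ans)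

/-- The function that maps the key of the ciphertext of a question, with padded question `w`, to the
key of the ciphertext of the answer according to `τ`. -/
def answerKey (τ : Q → G.Ans) (k₀ : pad.Key K.na) (w : Bits K.nq) :
    Bits (pad.len K.nq) → Bits (pad.len K.na) := fun z =>
  pad.code K.na (k₀ * t (τ (K.readQ (pad.act K.nq (pad.readKey K.nq (List.ofFn z))⁻¹ w))))

/-- The ciphertext of the answer according to `τ` to an encrypted question. -/
def answerCipher (τ : Q → G.Ans) (c : BitStr) : PMF BitStr :=
  (PMF.uniformOfFintype (pad.Key K.na)).bind fun k₀ =>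
    (E.eval (answerKey K t τ k₀ (firstBits K.nq c)) ![c.drop K.nq]).bind fun h =>
    PMF.pure (List.ofFn (pad.act K.na k₀ b₀) ++ h 0)

/-- A ciphertext of a uniform key, obtained by evaluation of a constant function. -/
def keyCipher (n : ℕ) (c : BitStr) : PMF (Fin 1 → BitStr) :=
  (PMF.uniformOfFintype (pad.Key n)).bind fun k =>
    E.eval (fun _ : Bits (pad.len K.nq) => pad.code n k) ![c.drop K.nq]

/-- A classical prover that answers according to an assignment with distribution `J`. -/
def classicalProver : CProver 2 3 2 1 where
  first x := J.bind fun τ => (answerCipher K E t b₀ τ (x 1)).bind fun ca =>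
    (keyCipher K E n (x 1)).bind fun r => (P.samp ![x 2]).bind fun s =>
    PMF.pure ![code τ, ca, r 0, s 0]
  second x := PMF.pure ![List.ofFn (K.codeA (read ((x 0).take L) (K.readQ (firstBits K.nq (x 1)))))]

theorem classicalProver_ppt (hJ : ∀ τ, IsAlgebraic ℚ (J τ).toReal) :
    (classicalProver K E P t b₀ J L code read).PPT := by
  constructor
  · refine IsPPT.sample J hJ (fun τ (x : Fin 3 → BitStr) => (answerCipher K E t b₀ τ (x 1)).bind fun ca =>
      (keyCipher K E n (x 1)).bind fun r => (P.samp ![x 2]).bind fun s =>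
      PMF.pure ![code τ, ca, r 0, s 0]) fun τ => ?_
    simp only [answerCipher, keyCipher, PMF.bind_bind, PMF.pure_bind]
    refine IsPPT.uniform (fun k₀ (x : Fin 3 → BitStr) => (E.eval (answerKey K t τ k₀ (firstBits K.nq (x 1)))
      ![(x 1).drop K.nq]).bind _) fun k₀ => ?_
    refine IsPPT.lookup 1 _ (firstBits K.nq) (firstBits_take le_rfl)
      (fun w (x : Fin 3 → BitStr) => (E.eval (answerKey K t τ k₀ w) ![(x 1).drop K.nq]).bind
        fun h => (PMF.uniformOfFintype (pad.Key n)).bind fun k =>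
        (E.eval (fun _ : Bits (pad.len K.nq) => pad.code n k) ![(x 1).drop K.nq]).bind fun r =>
        (P.samp ![x 2]).bind fun s =>
        PMF.pure ![code τ, List.ofFn (pad.act K.na k₀ b₀) ++ h 0, r 0, s 0]) fun w => ?_
    refine IsPPT.run (E.eval_ppt _) ![[]] ![1] ![K.nq] _ (fun x j => by fin_cases j; rfl) _ ?_
    refine IsPPT.uniform (fun k z => (E.eval (fun _ : Bits (pad.len K.nq) => pad.code n k)
      ![(z 1).drop K.nq]).bind _) fun k => ?_
    refine IsPPT.run (E.eval_ppt _) ![[]] ![1] ![K.nq] _ (fun x j => by fin_cases j; rfl) _ ?_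
    refine IsPPT.run P.samp_ppt ![[]] ![2] ![0] _ (fun x j => by fin_cases j; rfl) _ ?_
    exact IsPPT.write ![code τ, List.ofFn (pad.act K.na k₀ b₀), [], []] ![6, 3, 4, 5] ![0, 0, 0, 0] _
      (fun x j => by fin_cases j <;> simp [startBits])
  · refine IsPPT.lookup 0 L (fun s => read (s.take L)) (fun s => by rw [List.take_take, min_self])
      (fun τ (x : Fin 3 → BitStr) => PMF.pure ![List.ofFn (K.codeA (τ (K.readQ (firstBits K.nq (x 1)))))]) fun τ => ?_
    refine IsPPT.lookup 1 _ (firstBits K.nq) (firstBits_take le_rfl)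
      (fun w (x : Fin 3 → BitStr) => PMF.pure ![List.ofFn (K.codeA (τ (K.readQ w)))]) fun w => ?_
    exact IsPPT.const _

variable {K E P t b₀ J L code read}

theorem behaviour_classicalProver (hL : ∀ τ, (code τ).length = L) (hread : ∀ τ, read (code τ) = τ)
    (l : ℕ) (c p ca kh s : BitStr) (t₃ : Fin 2 → BitStr) (t₄ : Fin 1 → BitStr) :
    (classicalProver K E P t b₀ J L code read).behaviour l ![c, p] ![ca, kh, s] t₃ t₄ =
      K.onAnswer (fun a => P.samp ![p] ![s] *
        ((mean J fun τ => (if τ (K.readQ (firstBits K.nq (t₃ 0))) = a then 1 else 0) *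
          answerCipher K E t b₀ τ c ca) * keyCipher K E n c ![kh])) (t₄ 0) := by
  have h1 : ∀ st : BitStr, (classicalProver K E P t b₀ J L code read).first
      (Fin.cons (unary l) ![c, p]) (Fin.cons st ![ca, kh, s]) =
      mean J fun τ => (if st = code τ then 1 else 0) * (answerCipher K E t b₀ τ c ca *
        (keyCipher K E n c ![kh] * P.samp ![p] ![s])) := fun st =>
    (bind_apply_mean _ _ _).trans (congrArg (mean J) (funext fun τ => bind_three_apply _ _ _ _ _ _ _ _))
  have h3 : ∀ τ : Q → G.Ans, (classicalProver K E P t b₀ J L code read).second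
      (Fin.cons (code τ) t₃) t₄ = K.onAnswer (fun a =>
        if τ (K.readQ (firstBits K.nq (t₃ 0))) = a then 1 else 0) (t₄ 0) := by
    intro τ
    change (PMF.pure ![List.ofFn (K.codeA (read ((code τ).take L)
      (K.readQ (firstBits K.nq (t₃ 0)))))] : PMF (Fin 1 → BitStr)) t₄ = _
    rw [List.take_of_length_le (hL τ).le, hread, PMF.pure_apply, Encoding.onAnswer]
    have h0 : ∀ w : BitStr, t₄ = ![w] ↔ t₄ 0 = w := fun w => ⟨fun h => congrFun h 0, fun h => by
      funext i; fin_cases i; exact h⟩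
    cases hr : K.readAStr (t₄ 0) with
    | none =>
      rw [if_neg]
      intro h
      rw [(h0 _).1 h, readAStr_ofFn] at hr
      exact Option.some_ne_none _ hr
    | some a =>
      by_cases h : τ (K.readQ (firstBits K.nq (t₃ 0))) = a
      · rw [h, if_pos ((h0 _).2 (readAStr_eq_some K hr))]
        exact (if_pos rfl).symm
      · refine (if_neg fun h' => h ?_).trans (if_neg h).symm
        exact (K.codeA.injective (List.ofFn_injective
          (((h0 _).1 h').symm.trans (readAStr_eq_some K hr))))
  have h4 : ∀ τ, ∑' st : BitStr, (if st = code τ then 1 else 0) *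
      (classicalProver K E P t b₀ J L code read).second (Fin.cons st t₃) t₄ =
      K.onAnswer (fun a =>
        if τ (K.readQ (firstBits K.nq (t₃ 0))) = a then 1 else 0) (t₄ 0) := by
    intro τ
    rw [tsum_eq_single (code τ) fun st hst => by rw [if_neg hst, zero_mul], if_pos rfl, one_mul, h3]
  simp only [CProver.behaviour, h1, ← mean_mul_right, ← mean_tsum]
  have h5 : ∀ τ, ∑' st : BitStr, (if st = code τ then 1 else 0) * (answerCipher K E t b₀ τ c ca *
        (keyCipher K E n c ![kh] * P.samp ![p] ![s])) *
      (classicalProver K E P t b₀ J L code read).second (Fin.cons st t₃) t₄ =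
      K.onAnswer (fun a =>
        if τ (K.readQ (firstBits K.nq (t₃ 0))) = a then 1 else 0) (t₄ 0) *
      (answerCipher K E t b₀ τ c ca * (keyCipher K E n c ![kh] * P.samp ![p] ![s])) := by
    intro τ
    rw [← h4, ← ENNReal.tsum_mul_right]
    exact tsum_congr fun st => by ring
  simp only [h5, Encoding.onAnswer]
  split
  · rw [← mean_mul_left]
    congr 1; funext τ
    ring
  · simp [mean]

theorem answerCipher_close (hE : E.EvaluatedForm) (ht : ∀ a, pad.act K.na (t a) (K.codeA a) = b₀) :
    ∃ ν : ℕ → ℝ, Negligible ν ∧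
    ∀ (l : ℕ), ∀ sk ∈ (E.gen ![unary l]).support, ∀ q' : Q,
    ∀ c ∈ (encStr pad E.toFHE (sk 0) (List.ofFn (K.codeQ q'))).support, ∀ τ : Q → G.Ans,
      ∑' ca, gap (answerCipher K E t b₀ τ c ca)
        (encStr pad E.toFHE (sk 0) (List.ofFn (K.codeA (τ q'))) ca) ≤ ENNReal.ofReal (ν l) := by
  choose ν hν h using fun x : (Q → G.Ans) × pad.Key K.na × Bits K.nq =>
    hE.1 (answerKey K t x.1 x.2.1 x.2.2)
  refine ⟨fun l => ∑ x, |ν x l|, Negligible.sum _ fun x _ => (hν x).abs,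
    fun l sk hsk q' c hc τ => ?_⟩
  obtain ⟨k', kh', hkh, rfl⟩ := mem_support_encStr_ofFn hc
  have hd : ![(List.ofFn (pad.act K.nq k' (K.codeQ q')) ++ kh' 0).drop K.nq] = kh' := by
    rw [List.drop_left' (by simp)]
    funext i; fin_cases i; rfl
  have henc : ∀ ca, encStr pad E.toFHE (sk 0) (List.ofFn (K.codeA (τ q'))) ca =
      mean (PMF.uniformOfFintype (pad.Key K.na)) fun k₀ =>
        ((E.enc ![sk 0, pad.keyStr (k₀ * t (τ q'))]).bind fun h =>
          PMF.pure (List.ofFn (pad.act K.na k₀ b₀) ++ h 0)) ca := by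
    intro ca
    rw [encStr_ofFn, bind_apply_mean, ← mean_mul_right_group (t (τ q'))]
    simp only [PadFamily.act_mul, ht]
  simp only [henc]
  rw [answerCipher, hd, firstBits_ofFn]
  simp only [bind_apply_mean (PMF.uniformOfFintype (pad.Key K.na))]
  refine (ENNReal.tsum_le_tsum fun ca => gap_mean_le _ _ _).trans ?_
  rw [← mean_tsum]
  refine mean_le fun k₀ _ => (tsum_gap_bind_le _ _ _).trans ?_
  have h1 := h (τ, k₀, pad.act K.nq k' (K.codeQ q')) l sk hsk (pad.code K.nq k') kh' hkh
  have h3 : answerKey K t τ k₀ (pad.act K.nq k' (K.codeQ q')) (pad.code K.nq k') =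
      pad.code K.na (k₀ * t (τ q')) := by
    rw [answerKey, show List.ofFn (pad.code K.nq k') = pad.keyStr k' from rfl, readKey_keyStr,
      PadFamily.act_inv_act, readQ_codeQ]
  rw [h3] at h1
  exact h1.trans (ENNReal.ofReal_le_ofReal ((le_abs_self _).trans
    (Finset.single_le_sum (f := fun x => |ν x l|) (fun x _ => abs_nonneg _) (Finset.mem_univ
      (τ, k₀, pad.act K.nq k' (K.codeQ q'))))))

end

theorem sum_answer_joint {Q : Type} [Fintype Q] {G : ContextualityGame Q} {n : ℕ}
    {S : G.QStrat (Qubits n)} {J : PMF (Q → G.Ans)} (hJ : ∀ q' a' q a,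
      ∑ τ, (if τ q' = a' ∧ τ q = a then J τ else 0) = ENNReal.ofReal (S.joint q' a' q a))
    (Φ : G.Ans → ℝ≥0∞) (q' q : Q) (a : G.Ans) :
    ∑ a', Φ a' * ENNReal.ofReal (S.joint q' a' q a) =
      mean J fun τ => (if τ q = a then 1 else 0) * Φ (τ q') := by
  simp only [← hJ, mean_fintype, Finset.mul_sum]
  rw [Finset.sum_comm]
  refine Finset.sum_congr rfl fun τ _ => ?_
  rw [Finset.sum_eq_single (τ q')]
  · by_cases h : τ q = a
    · rw [if_pos ⟨rfl, h⟩, if_pos h, one_mul, mul_comm]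
    · rw [if_neg fun h' => h h'.2, if_neg h, zero_mul, mul_zero, mul_zero]
  · intro b _ hb
    rw [if_neg fun h => hb h.1.symm, mul_zero]
  · simp

theorem sum_mean_answer {Q X : Type*} [Fintype X] [DecidableEq X] (J : PMF (Q → X)) (q : Q) (Φ : (Q → X) → ℝ≥0∞) :
    ∑ a, mean J (fun τ => (if τ q = a then 1 else 0) * Φ τ) = mean J Φ := by
  rw [← mean_sum]
  congr 1; funext τ
  simp

section
variable {Q : Type} [Fintype Q] {G : ContextualityGame Q} (K : Encoding G) [Nonempty Q]
  {pad : PadFamily} (E : QFHE pad) {n : ℕ} (P : OPad pad n)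
  (h2 : ∀ C ∈ G.contexts, C.card = 2) {S : G.QStrat (Qubits n)}

theorem asked_subset_context {l : ℕ} {e : (compiled K E P h2).Exec}
    (h : (compiled K E P h2).start l (e.vs, e.t₁) ≠ 0)
    (h' : (compiled K E P h2).next e.vs e.t₁ e.t₂ e.t₃ ≠ 0) :
    ∃ C ∈ G.contexts, (compiledMaps K E P h2).asked e ⊆ C := by
  obtain ⟨sk, -, -, -, hq', q, hq, -, hask⟩ := asked_compiled h h'
  refine ⟨e.vs.C.1, e.vs.C.2, ?_⟩
  rw [hask]
  intro x hx
  rcases Finset.mem_insert.1 hx with rfl | hx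
  · exact hq'
  · rw [Finset.mem_singleton.1 hx]
    exact hq

theorem classicalCompleteness_compiled (hE : E.Secure) (hE' : E.EvaluatedForm) (hS : S.Described)
    (hc : ∀ q q', Commute (S.O q) (S.O q')) :
    ∃ A : CProver 2 3 2 1, A.PPT ∧ ∃ ν : ℕ → ℝ, Negligible ν ∧ ∀ l,
      l1Dist ((compiled K E P h2).transcript (fun _ => A.behaviour) l)
        ((compiled K E P h2).transcript (fun _ => (honest K E P S).behaviour) l) ≤
        ENNReal.ofReal (ν l) := by
  obtain ⟨J, hJalg, hJ⟩ := exists_jointDistribution hS hc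
  have : Nonempty G.Ans := S.nonempty_ans
  obtain ⟨L, code, read, hL, hread⟩ := exists_code (Q → G.Ans)
  let b₀ : Bits K.na := fun _ => false
  choose t ht using fun a => hE.exists_act_eq (K.codeA a) b₀
  obtain ⟨ν, hν, h⟩ := honest_close_fresh (K := K) (P := P) (h2 := h2) hE' hS
  obtain ⟨μ, hμ, h'⟩ := eval_key_close K E (n := n) hE'
  obtain ⟨κ, hκ, h''⟩ := answerCipher_close (E := E) hE' ht
  refine ⟨classicalProver K E P t b₀ J L code read, classicalProver_ppt K E P t b₀ J L code read hJalg,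
    fun l => (|κ l| + |μ l|) + |ν l|, (hκ.abs.add hμ.abs).add hν.abs, fun l => ?_⟩
  refine (Protocol.l1Dist_transcript_le _ _ _ l).trans
    ((Protocol.distance_triangle _ l _ (freshBehaviour K E P S) _).trans ?_)
  rw [ENNReal.ofReal_add (by positivity) (abs_nonneg _)]
  refine add_le_add ?_ ((Protocol.distance_comm _ l _ _).trans_le
    ((h l).trans (ENNReal.ofReal_le_ofReal (le_abs_self _))))
  refine (le_of_eq (total_compiled K E P h2 l _)).trans ?_
  refine mean_le fun sk hsk => mean_le fun C _ => mean_le fun q' hq' => mean_le fun c hc => ?_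
  let X : BitStr → ℝ≥0∞ := fun ca => mean J fun τ => gap (answerCipher K E t b₀ τ c ca)
    (encStr pad E.toFHE (sk 0) (List.ofFn (K.codeA (τ q'))) ca)
  let Y : BitStr → ℝ≥0∞ := fun ca => mean J fun τ =>
    encStr pad E.toFHE (sk 0) (List.ofFn (K.codeA (τ q'))) ca
  let D : BitStr → ℝ≥0∞ := fun kh => gap (keyCipher K E n c ![kh])
    (mean (PMF.uniformOfFintype (pad.Key n)) fun k => E.enc ![sk 0, pad.keyStr k] ![kh])
  have hX : ∑' ca, X ca ≤ ENNReal.ofReal |κ l| := by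
    rw [← mean_tsum]
    exact mean_le fun τ _ => (h'' l sk hsk q' c hc τ).trans
      (ENNReal.ofReal_le_ofReal (le_abs_self _))
  have hY : ∑' ca, Y ca = 1 := by
    rw [← mean_tsum]
    simp only [PMF.tsum_coe, mean_const]
  have hD : ∑' kh, D kh ≤ ENNReal.ofReal |μ l| := by
    refine le_trans (le_of_eq (tsum_congr fun kh => ?_)) ((h' l sk hsk q' c hc).trans
      (ENNReal.ofReal_le_ofReal (le_abs_self _)))
    rw [← bind_apply_mean]
    rfl
  have hK : ∑' kh, keyCipher K E n c ![kh] = 1 := by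
    rw [← tsum_fin_one fun s => keyCipher K E n c s, PMF.tsum_coe]
  have hinner : ∀ (g : Fin 2 → BitStr) (ca kh s : BitStr) (q : Q) (x : BitStr),
      (∑' t₄ : Fin 1 → BitStr, gap ((classicalProver K E P t b₀ J L code read).behaviour l ![c, g 0]
          ![ca, kh, s] ![List.ofFn (K.codeQ q), x] t₄)
        (freshBehaviour K E P S (⟨sk 0, C, q', g 1⟩ : Coins G) l ![c, g 0] ![ca, kh, s]
          ![List.ofFn (K.codeQ q), x] t₄)) ≤
        P.samp ![g 0] ![s] * (X ca * keyCipher K E n c ![kh] + Y ca * D kh) := by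
    intro g ca kh s q x
    simp only [behaviour_classicalProver hL hread, freshBehaviour, K.tsum_gap_onAnswer,
      gap_mul _ _ _ (PMF.apply_ne_top _ _), freshWeight, Matrix.cons_val_zero, Matrix.cons_val_one,
      Matrix.cons_val_two, Matrix.tail_cons, Matrix.head_cons, firstBits_ofFn', readQ_codeQ,
      sum_answer_joint hJ]
    rw [← Finset.mul_sum]
    refine mul_le_mul_right ?_ _
    have hfin : ∀ (Φ : (Q → G.Ans) → ℝ≥0∞), (∀ τ, Φ τ ≤ 1) → ∀ a,
        mean J (fun τ => (if τ q = a then 1 else 0) * Φ τ) ≠ ⊤ := fun Φ hΦ a =>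
      ne_top_of_le_ne_top ENNReal.one_ne_top (mean_le_one fun τ => mul_le_one' (by split <;> simp) (hΦ τ))
    refine (Finset.sum_le_sum fun a _ => gap_mul_mul_le (hfin _ (fun τ => PMF.coe_le_one _ _) a)
      (PMF.apply_ne_top _ _)).trans ?_
    rw [Finset.sum_add_distrib, ← Finset.sum_mul, ← Finset.sum_mul, sum_mean_answer]
    refine add_le_add_left (mul_le_mul_left ?_ _) _
    refine (Finset.sum_le_sum fun a _ => gap_mean_le _ _ _).trans ?_
    have hite : ∀ (p : Prop) [Decidable p], (if p then (1 : ℝ≥0∞) else 0) ≠ ⊤ := fun p _ => by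
      split <;> simp
    simp only [gap_mul _ _ _ (hite _)]
    rw [sum_mean_answer]
  have hsamp : ∀ Z : ℝ≥0∞, ∑' s, mean (P.gen ![unary l]) (fun g => P.samp ![g 0] ![s] * Z) = Z :=
    fun Z => by rw [← mean_tsum, samp_total]
  simp only [tsum_fin_three]
  refine (mean_mono fun g _ => ENNReal.tsum_le_tsum fun ca => ENNReal.tsum_le_tsum fun kh =>
    ENNReal.tsum_le_tsum fun s => mean_mono fun q _ => hinner g ca kh s q _).trans ?_
  simp only [mean_const, mean_tsum (P.gen ![unary l]), hsamp]
  simp only [ENNReal.tsum_add, ENNReal.tsum_mul_left, ENNReal.tsum_mul_right, hK, hY, mul_one, one_mul]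
  rw [ENNReal.ofReal_add (abs_nonneg _) (abs_nonneg _)]
  exact add_le_add hX hD

end

end

end Contextuality

theorem mainTheorem1 {Q : Type} [Fintype Q] [Nonempty Q] (G : ContextualityGame Q)
    (h2 : ∀ C ∈ G.contexts, C.card = 2) (hNC : G.valNC < 1)
    (K : Encoding G) {pad : PadFamily} (E : QFHE pad) (hE : E.Secure)
    {n : ℕ} (P : OPad pad n) (hP : P.Secure)
    (S : G.QStrat (Qubits n)) (hS : S.Described) (hopt : G.val S.strategy = G.valQu) :
    ((honest K E P S).QPT ∧ ∃ ν : ℕ → ℝ, Negligible ν ∧ ∀ l : ℕ,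
      1 / 2 * (1 + G.valQu) - ν l ≤
        (compiled K E P h2).accept (fun _ => (honest K E P S).behaviour) l) ∧
    (∀ A : CProver 2 3 2 1, A.PPT → ∃ ν : ℕ → ℝ, Negligible ν ∧ ∀ l : ℕ,
      (compiled K E P h2).accept (fun _ => A.behaviour) l ≤
        1 / 2 * (1 + G.valNC) + ν l) ∧
    (E.EvaluatedForm →
      Faithful (compiled K E P h2) G (compiledMaps K E P h2) (honest K E P)
        (1 / 2 * (1 + G.valNC)) (1 / 2 * (1 + G.valQu))) := by
  obtain ⟨ν, hν, hacc⟩ := accept_honest K E P h2 hS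
  rw [hopt] at hacc
  obtain ⟨a₀⟩ := S.nonempty_ans
  refine ⟨⟨⟨honest_first_qpt K E P S hS, honest_second_qpt K E P S hS⟩, ν, hν, fun l => ?_⟩,
    fun A hA => soundness_compiled K E P a₀ h2 hE hP hA, fun hE' =>
      { paired := compiledMaps_paired K E P h2
        qpt := fun T hT => ⟨honest_first_qpt K E P T hT, honest_second_qpt K E P T hT⟩
        marginal := fun T T' hT hT' C _ hpsi hO => marginal_compiled hE' hT hT' C hpsi hO
        wellFormed := fun l e h h' => asked_subset_context K E P h2 h h'
        soundness := ⟨0, Negligible.zero, fun τ aux l =>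
          (soundness_answerNC τ aux l).trans (le_of_eq (add_zero _).symm)⟩
        decision := fun τ aux l e => decision_compiled τ aux l e
        completeness := ⟨S, hS, ν, hν, hacc⟩
        quantumCompleteness := fun T hT => quantumCompleteness_compiled K E P h2 hE' hT
        classicalCompleteness := fun T hT hc =>
          classicalCompleteness_compiled K E P h2 hE hE' hT hc }⟩
  have := (abs_le.1 (hacc l)).1
  linarith
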